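/- **Setting.** Let $\Omega\subset\mathbb R^3$ be a conforming multi-patch NURBS domain of degree $p\ge 1$ (a single patch is allowed): $\Omega$ is the interior of the union of finitely many closed patches $\overline\Omega_i=\mathbf F_i([0,1]^3)$, where * $\mathbf F_i$ is a trivariate NURBS map of degree $p$ in each direction, with positive weights, open knot vectors $\Xi^i_1,\Xi^i_2,\Xi^i_3$ on $[0,1]$ with interior multiplicities at most $p$, and $\mathbf F_i$ is bi-Lipschitz on $[0,1]^3$; * two different closed patches are disjoint, or meet exactly in a common full side, edge or vertex, on which the knot vectors, the control points and (up to a common factor) the weights from both sides match; * any two patches through a point are linked by a chain of patches through that point, consecutive ones sharing a full side (no contact of $\Omega$ with itself only along an edge or at a vertex). Let $\Gamma_D\subseteq\partial\Omega$ be the union of an arbitrary (possibly empty) set of patch sides that are not interfaces. With $B$ the univariate B-splines of degree $p$ and $D$ the Curry–Schoenberg splines of degree $p-1$ (so that $B_i'=D_i-D_{i+1}$), let $S_p^0(\Omega;\Gamma_D)\subset H^1(\Omega)$, $S_p^1(\Omega;\Gamma_D)\subset H(\mathrm{curl};\Omega)$, $S_p^2(\Omega;\Gamma_D)\subset H(\mathrm{div};\Omega)$,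 $S_p^3(\Omega)\subset L^2(\Omega)$ be the spaces of fields with vanishing (full, tangential, normal, no) trace on $\Gamma_D$ whose pull-backs $u\circ\mathbf F_i$, $D\mathbf F_i^{\top}(u\circ\mathbf F_i)$, $\det(D\mathbf F_i)\,D\mathbf F_i^{-1}(u\circ\mathbf F_i)$, $\det(D\mathbf F_i)(u\circ\mathbf F_i)$ are, for each $i$, combinations of the tensor products with $D$ in the directions in which an entity (vertex, edge, facet, cell) of the grid of control points extends and $B$ in the other directions. Thus on each patch the basis functions are indexed by the vertices, edges, facets and cells of the control grid; the *control mesh* is obtained by identifying the coincident entities of different patches. Its edges and vertices on $\Gamma_D$ are called Dirichlet edges and vertices. Let $K=\{u\in S_p^1(\Omega;\Gamma_D):\nabla\times u=0\}$ be the discrete kernel. For a set $T$ of edges of the control mesh let $N(T)\subset S^1_p(\Omega;\Gamma_D)$ be the space of fields whose degrees of freedom on $T$ vanish; we say that $T$ removes exactly a subspace $W$ if $S_p^1(\Omega;\Gamma_D)=N(T)\oplus W$. **Claim.** 1. Suppose that the control mesh is a valid mesh, i.e. that the piecewise trilinear maps of the grids onto the control points again define a conforming multi-patch domain, with the same identifications.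 Let $Z^0,Z^1,Z^2,Z^3$ be the lowest-order spaces on it (continuous trilinear, Nédélec edge, Raviart–Thomas face, piecewise constant elements), with the same boundary conditions. There are linear isomorphisms $I^k:S_p^k\to Z^k$, $k=0,\dots,3$, that preserve the degrees of freedom (each spline basis function goes to the lowest-order basis function of the same vertex, edge, facet or cell), and $\nabla I^0u=I^1\nabla u$, $\nabla\times I^1u=I^2\nabla\times u$, $\nabla\cdot I^2u=I^3\nabla\cdot u$. Hence $u\in S_p^1(\Omega;\Gamma_D)$ lies in $K$ if and only if $I^1u$ lies in the discrete kernel $K_Z=\{z\in Z^1:\nabla\times z=0\}$; and a set of edges $T$ removes exactly $K$ from $S_p^1(\Omega;\Gamma_D)$ if and only if it removes exactly $K_Z$ from $Z^1$. 2. Without any assumption on the positions of the control points: the families of degrees of freedom of the fields in $S_p^1(\Omega;\Gamma_D)$ are exactly the $1$-cochains of the control mesh that vanish on the Dirichlet edges, and such a field lies in $K$ if and only if its cochain has zero circulation around each facet of the control mesh. 3. Let $\Omega$ be connected, and let $b_1$ be the rank of the first real cellular cohomology group of the control mesh relative to $\Gamma_D$. Call $T$ a gauge tree if it is obtained by the tree–cotree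 algorithm: it has no cycle, it contains a spanning tree of each component of the Dirichlet subgraph, and it is grown from the Dirichlet vertices, without connecting different components of the Dirichlet subgraph, until all vertices are reached (a spanning tree of the control mesh, if $\Gamma_D=\emptyset$). Gauge trees exist, and for each gauge tree $T$: (a) $T$ removes exactly the gradients $\nabla S_p^0(\Omega;\Gamma_D)$; (b) $T$ removes exactly the discrete kernel $K$ if and only if $b_1=0$; (c) in general there is a set $H$ of exactly $b_1$ further edges, neither in $T$ nor Dirichlet, such that $T\cup H$ removes exactly the discrete kernel $K$. -/

import Mathlib

open MeasureTheory Set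
open scoped ENNReal ContDiff InnerProductSpace

noncomputable section

/-- Three-dimensional Euclidean space; used for the reference and for the physical domain. -/
abbrev E3 : Type := EuclideanSpace ℝ (Fin 3)

/-! ### Univariate B-splines -/

/-- `Ξ 0, …, Ξ (n + p)` is an open knot vector on `[0,1]` for `n` B-splines of degree `p`: it is
nondecreasing, starts with `p + 1` zeros, ends with `p + 1` ones, and no interior knot has
multiplicity larger than `p` (the last condition also says that `0` and `1` occur exactly
`p + 1` times). -/
structure IsOpenKnotVector (p n : ℕ) (Ξ : ℕ → ℝ) : Prop where
  card : p + 1 ≤ n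
  mono : ∀ m, m < n + p → Ξ m ≤ Ξ (m + 1)
  left : ∀ m, m ≤ p → Ξ m = 0
  right : ∀ m, n ≤ m → m ≤ n + p → Ξ m = 1
  mult : ∀ m, 1 ≤ m → m < n → Ξ m < Ξ (m + p)

/-- B-spline number `i` of degree `p` on the knots `Ξ`, by the Cox–de Boor recursion with the usual
convention `0 / 0 = 0`. The last nonempty knot interval is closed at the end point `1`. -/
def bspline (Ξ : ℕ → ℝ) : ℕ → ℕ → ℝ → ℝ
  | 0, i, x =>
      open Classical in
      if (Ξ i ≤ x ∧ x < Ξ (i + 1)) ∨ (x = 1 ∧ Ξ i < Ξ (i + 1) ∧ Ξ (i + 1) = 1) then 1 else 0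
  | p + 1, i, x =>
      (x - Ξ i) / (Ξ (i + p + 1) - Ξ i) * bspline Ξ p i x +
        (Ξ (i + p + 2) - x) / (Ξ (i + p + 2) - Ξ (i + 1)) * bspline Ξ p (i + 1) x

/-- Curry–Schoenberg spline number `i` of degree `p - 1`, on the knot vector obtained from `Ξ` by
removing the first and the last knot (whence the index shift `i + 1`). -/
def curryBspline (Ξ : ℕ → ℝ) (p i : ℕ) (x : ℝ) : ℝ :=
  (p : ℝ) / (Ξ (i + 1 + p) - Ξ (i + 1)) * bspline Ξ (p - 1) (i + 1) x

/-! ### The reference cube, its sides, edges and vertices -/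

/-- The open reference cube `(0,1)³`. -/
def openCube : Set E3 := {ξ | ∀ e, ξ e ∈ Ioo (0 : ℝ) 1}

/-- The closed reference cube `[0,1]³`. -/
def closedCube : Set E3 := {ξ | ∀ e, ξ e ∈ Icc (0 : ℝ) 1}

/-- A closed side, edge or vertex of the cube is described by `f : Fin 3 → Option Bool`: coordinate
`e` is free if `f e = none`, is `0` if `f e = some false`, and is `1` if `f e = some true`. -/
def cubeFace (f : Fin 3 → Option Bool) : Set E3 :=
  {ξ ∈ closedCube | ∀ e s, f e = some s → ξ e = if s then 1 else 0}

/-- The two-dimensional side of the cube on which coordinate `e` is `0` or `1`. -/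
def sideOf (e : Fin 3) (s : Bool) : Fin 3 → Option Bool :=
  Function.update (fun _ => none) e (some s)

/-! ### Structured control grids, and how the grids of several patches are glued -/

/-- The identification of a side, edge or vertex `face` of a first patch with one of a second patch:
coordinate `e` of the first patch becomes coordinate `perm e` of the second one, with the reversed
direction if `flip e`. -/
structure Gluing where
  face : Fin 3 → Option Bool
  perm : Equiv.Perm (Fin 3)
  flip : Fin 3 → Bool

/-- The combinatorial control mesh of a family of patches: patch `i` has a structured grid of
`n i 0 × n i 1 × n i 2` control points, and `glue i j` says along which common side, edge or vertex
(if any) the grids of the patches `i` and `j` are identified. -/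
structure ControlGrid (ι : Type*) where
  n : ι → Fin 3 → ℕ
  glue : ι → ι → Option Gluing

namespace ControlGrid

variable {ι : Type*} (M : ControlGrid ι)

/-- Number of grid entities in direction `e`, for the entities that extend in the directions `D`. -/
def ext (i : ι) (D : Finset (Fin 3)) (e : Fin 3) : ℕ := M.n i e - if e ∈ D then 1 else 0

/-- The entities of the grid of patch `i` that extend in the directions `D`, each given by its
vertex with the smallest indices: vertices for `D = ∅`, edges in direction `d` for `D = {d}`,
facets with normal direction `d` for `D = {d}ᶜ`, and cells for `D = univ`. -/
abbrev Idx (i : ι) (D : Finset (Fin 3)) : Type := ∀ e : Fin 3, Fin (M.ext i D e)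

/-- The vertices of the grids of all the patches, before gluing. -/
abbrev LocalVertex : Type _ := Σ i : ι, M.Idx i ∅

/-- The edges before gluing: patch, direction, index. -/
abbrev LocalEdge : Type _ := Σ i : ι, Σ d : Fin 3, M.Idx i {d}

/-- The facets before gluing: patch, normal direction, index. -/
abbrev LocalFacet : Type _ := Σ i : ι, Σ d : Fin 3, M.Idx i {d}ᶜ

/-- The cells before gluing. -/
abbrev LocalCell : Type _ := Σ i : ι, M.Idx i Finset.univ

variable {M}

/-- The entity `a` lies in the side of its patch on which coordinate `e` is `0` or `1`. -/
def OnSide {i : ι} {D : Finset (Fin 3)} (a : M.Idx i D) (e : Fin 3) (s : Bool) : Prop :=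
  e ∉ D ∧ if s then (a e : ℕ) + 1 = M.n i e else (a e : ℕ) = 0

/-- The entity `a` of patch `i` lies in `g.face`, and `g` identifies it with the entity `b` of
patch `j`. -/
def Matches (g : Gluing) {i j : ι} {D D' : Finset (Fin 3)} (a : M.Idx i D) (b : M.Idx j D') :
    Prop :=
  D' = D.image g.perm ∧ ∀ e : Fin 3,
    match g.face e with
    | none =>
        if g.flip e then (a e : ℕ) + (b (g.perm e) : ℕ) + 1 = M.ext i D e
        else (b (g.perm e) : ℕ) = (a e : ℕ)
    | some s => OnSide a e s ∧ OnSide b (g.perm e) (xor s (g.flip e))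

/-- First end point of an edge. -/
def tail (x : M.LocalEdge) : M.LocalVertex :=
  ⟨x.1, fun e => ⟨(x.2.2 e : ℕ), by
    have h := (x.2.2 e).isLt
    simp only [ext, Finset.notMem_empty, if_false] at h ⊢
    omega⟩⟩

/-- Second end point of an edge. -/
def head (x : M.LocalEdge) : M.LocalVertex :=
  ⟨x.1, fun e => ⟨(x.2.2 e : ℕ) + (if e = x.2.1 then 1 else 0), by
    have h := (x.2.2 e).isLt
    simp only [ext, Finset.notMem_empty, if_false, Finset.mem_singleton] at h ⊢
    split_ifs at h ⊢ <;> omega⟩⟩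

/-- The edge in direction `c ≠ d` of a facet with normal direction `d`, which starts at the first
vertex of the facet (`up = false`), or the opposite edge of the facet (`up = true`). -/
def facetEdge (q : M.LocalFacet) (c : Fin 3) (hc : c ≠ q.2.1) (up : Bool) : M.LocalEdge :=
  ⟨q.1, c, fun e => ⟨(q.2.2 e : ℕ) + (if e ≠ q.2.1 ∧ e ≠ c ∧ up = true then 1 else 0), by
    have h := (q.2.2 e).isLt
    generalize (q.2.2 e : ℕ) = k at h ⊢
    simp only [ext, Finset.mem_singleton, Finset.mem_compl] at h ⊢
    by_cases h1 : e = q.2.1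
    · have h2 : e ≠ c := fun h2 => hc (h2.symm.trans h1)
      simp only [h1, not_true_eq_false, ne_eq, false_and, if_false] at h ⊢
      rw [if_neg (fun h3 => hc h3.symm)]
      omega
    · by_cases h2 : e = c
      · simp only [h2, not_true_eq_false, ne_eq, false_and, and_false, if_false, if_true] at h ⊢
        rw [if_pos (fun h3 => hc h3)] at h
        omega
      · simp only [h1, h2, not_false_eq_true, ne_eq, true_and, if_false, if_true] at h ⊢
        split_ifs <;> omega⟩⟩

variable (M)

/-- Vertices of the glued control mesh. -/
def Vertex : Type _ :=
  Quot fun v w : M.LocalVertex => ∃ g, M.glue v.1 w.1 = some g ∧ Matches g v.2 w.2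

/-- (Unoriented) edges of the glued control mesh. -/
def Edge : Type _ :=
  Quot fun x y : M.LocalEdge => ∃ g, M.glue x.1 y.1 = some g ∧ Matches g x.2.2 y.2.2

variable {M}

/-- The vertex of the glued mesh given by a vertex of a patch. -/
def toVertex (v : M.LocalVertex) : M.Vertex := Quot.mk _ v

/-- The edge of the glued mesh given by an edge of a patch. -/
def toEdge (x : M.LocalEdge) : M.Edge := Quot.mk _ x

variable (M)

/-- The side `(i, e, s)` of patch `i` is not identified with a side of another patch. -/
def IsBoundarySide (b : ι × Fin 3 × Bool) : Prop :=
  ∀ j g, M.glue b.1 j = some g → g.face ≠ sideOf b.2.1 b.2.2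

variable (S : Set (ι × Fin 3 × Bool))

/-- The entity `a` lies in one of the sides in `S`. -/
def OnDirichlet {i : ι} {D : Finset (Fin 3)} (a : M.Idx i D) : Prop :=
  ∃ e s, (i, e, s) ∈ S ∧ OnSide a e s

/-- Vertices of the control mesh on the Dirichlet boundary. -/
def dirichletVertices : Set M.Vertex := {v | ∃ x, toVertex x = v ∧ M.OnDirichlet S x.2}

/-- Edges of the control mesh on the Dirichlet boundary. -/
def dirichletEdges : Set M.Edge := {E | ∃ x, toEdge x = E ∧ M.OnDirichlet S x.2.2}

/-! ### Tree and cotree in the control-mesh graph -/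

/-- The vertices `v` and `w` are joined by a path of edges in `A`. -/
def Joined (A : Set M.Edge) : M.Vertex → M.Vertex → Prop :=
  Relation.EqvGen fun v w =>
    ∃ x : M.LocalEdge, toEdge x ∈ A ∧ v = toVertex (tail x) ∧ w = toVertex (head x)

/-- `T` is a tree as produced by the tree–cotree algorithm: it contains no cycle, it contains a
spanning tree of (each connected component of) the Dirichlet subgraph, and it is grown from there
until it reaches every vertex; a growth step joins a new vertex to the old ones, so it never
connects two components of the Dirichlet subgraph. If there is no Dirichlet boundary, `T` is a
spanning tree. -/
structure IsGaugeTree (T : Set M.Edge) : Prop where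
  acyclic : ∀ x : M.LocalEdge, toEdge x ∈ T →
    ¬ M.Joined (T \ {toEdge x}) (toVertex (tail x)) (toVertex (head x))
  dirichlet : ∀ x : M.LocalEdge, toEdge x ∈ M.dirichletEdges S →
    M.Joined (T ∩ M.dirichletEdges S) (toVertex (tail x)) (toVertex (head x))
  spans : M.dirichletVertices S = ∅ → ∀ v w, M.Joined T v w
  reaches : (M.dirichletVertices S).Nonempty → ∀ v, ∃ w ∈ M.dirichletVertices S, M.Joined T w v
  separates : ∀ v ∈ M.dirichletVertices S, ∀ w ∈ M.dirichletVertices S,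
    M.Joined T v w → M.Joined (M.dirichletEdges S) v w

/-! ### First cellular cohomology of the control mesh relative to the Dirichlet boundary -/

/-- The coboundary of a `0`-cochain. -/
def coboundary : (M.Vertex → ℝ) →ₗ[ℝ] (M.LocalEdge → ℝ) where
  toFun f := fun x => f (toVertex (head x)) - f (toVertex (tail x))
  map_add' f g := by
    funext x
    simp only [Pi.add_apply]
    ring
  map_smul' c f := by
    funext x
    simp only [Pi.smul_apply, smul_eq_mul, RingHom.id_apply]
    ring

/-- Relative `0`-cochains: they vanish on the Dirichlet boundary. -/
def cochains0 : Submodule ℝ (M.Vertex → ℝ) where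
  carrier := {f | ∀ v ∈ M.dirichletVertices S, f v = 0}
  zero_mem' := fun _ _ => rfl
  add_mem' := fun ha hb v hv => by simp [ha v hv, hb v hv]
  smul_mem' := fun c f hf v hv => by simp [hf v hv]

/-- Relative `1`-cochains of the glued mesh: identified edges carry the same value up to the sign
given by their orientations, and edges on the Dirichlet boundary carry the value `0`. -/
def cochains1 : Submodule ℝ (M.LocalEdge → ℝ) where
  carrier := {f | (∀ x y g, M.glue x.1 y.1 = some g → Matches g x.2.2 y.2.2 →
      f y = (if g.flip x.2.1 then -1 else 1) * f x) ∧
    ∀ x : M.LocalEdge, M.OnDirichlet S x.2.2 → f x = 0}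
  zero_mem' := ⟨fun _ _ _ _ _ => by simp, fun _ _ => rfl⟩
  add_mem' := fun ha hb =>
    ⟨fun x y g h1 h2 => by
      simp only [Pi.add_apply]
      rw [ha.1 x y g h1 h2, hb.1 x y g h1 h2]
      ring,
     fun x hx => by simp [ha.2 x hx, hb.2 x hx]⟩
  smul_mem' := fun c f hf =>
    ⟨fun x y g h1 h2 => by
      simp only [Pi.smul_apply, smul_eq_mul]
      rw [hf.1 x y g h1 h2]
      ring,
     fun x hx => by simp [hf.2 x hx]⟩

/-- Circulation of a `1`-cochain around a facet with normal direction `d`. -/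
def circulation (f : M.LocalEdge → ℝ) (q : M.LocalFacet) : ℝ :=
  f (facetEdge q (q.2.1 + 1) (by intro h; revert h; generalize q.2.1 = d; revert d; decide) false)
  + f (facetEdge q (q.2.1 + 2) (by intro h; revert h; generalize q.2.1 = d; revert d; decide) true)
  - f (facetEdge q (q.2.1 + 1) (by intro h; revert h; generalize q.2.1 = d; revert d; decide) true)
  - f (facetEdge q (q.2.1 + 2) (by intro h; revert h; generalize q.2.1 = d; revert d; decide) false)

/-- Relative `1`-cocycles. -/
def cocycles1 : Submodule ℝ (M.LocalEdge → ℝ) where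
  carrier := {f | f ∈ M.cochains1 S ∧ ∀ q, M.circulation f q = 0}
  zero_mem' := ⟨zero_mem _, fun q => by simp [circulation]⟩
  add_mem' := fun ha hb => ⟨add_mem ha.1 hb.1, fun q => by
    have h1 := ha.2 q
    have h2 := hb.2 q
    simp only [circulation, Pi.add_apply] at h1 h2 ⊢
    linarith⟩
  smul_mem' := fun c f hf => ⟨Submodule.smul_mem _ c hf.1, fun q => by
    have h1 := hf.2 q
    simp only [circulation, Pi.smul_apply, smul_eq_mul] at h1 ⊢
    linear_combination c * h1⟩

/-- Relative `1`-coboundaries. -/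
def coboundaries1 : Submodule ℝ (M.LocalEdge → ℝ) := (M.cochains0 S).map M.coboundary

/-- Rank of the first real cohomology group of the control mesh relative to the Dirichlet
boundary. -/
def relativeBetti1 : ℕ :=
  Module.finrank ℝ (M.cocycles1 S ⧸ (M.coboundaries1 S).submoduleOf (M.cocycles1 S))

end ControlGrid

/-! ### Weak differential operators, with boundary conditions -/

/-- Jacobian matrix: the entry `(m, e)` is the `e`-th partial derivative of component `m`. -/
def jacobian (F : E3 → E3) (x : E3) : Matrix (Fin 3) (Fin 3) ℝ :=
  Matrix.of fun m e => fderiv ℝ F x (EuclideanSpace.single e 1) m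

/-- Classical divergence. -/
def divergence (φ : E3 → E3) (x : E3) : ℝ := (jacobian φ x).trace

/-- Classical curl. -/
def curl (φ : E3 → E3) (x : E3) : E3 :=
  !₂[jacobian φ x 2 1 - jacobian φ x 1 2, jacobian φ x 0 2 - jacobian φ x 2 0,
    jacobian φ x 1 0 - jacobian φ x 0 1]

/-- `L²(Ω)`. -/
abbrev L2Scalar (Ω : Set E3) : Type := Lp ℝ 2 (volume.restrict Ω)

/-- `L²(Ω)³`. -/
abbrev L2Vector (Ω : Set E3) : Type := Lp E3 2 (volume.restrict Ω)

/-- Smooth compactly supported functions on the whole space that vanish in a neighbourhood of each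
point of `Γ`. -/
structure IsTest {V : Type*} [NormedAddCommGroup V] [NormedSpace ℝ V] (Γ : Set E3) (φ : E3 → V) :
    Prop where
  smooth : ContDiff ℝ ∞ φ
  compact : HasCompactSupport φ
  avoids : Disjoint (tsupport φ) Γ

/-- `g` is the weak gradient of `u` in `Ω`, tested with fields that vanish near `Γ ⊆ ∂Ω`. For
`Γ = ∂Ω` this is the usual weak gradient; for `Γ = ∂Ω \ Σ` it says in addition that the trace of `u`
on `Σ` is zero (in the sense of Green's formula). -/
def WeakGrad (Ω Γ : Set E3) (u : L2Scalar Ω) (g : L2Vector Ω) : Prop :=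
  ∀ φ : E3 → E3, IsTest Γ φ →
    ∫ x in Ω, u x * divergence φ x = -∫ x in Ω, ⟪g x, φ x⟫_ℝ

/-- `w` is the weak curl of `u` in `Ω`, tested with fields that vanish near `Γ ⊆ ∂Ω`. For `Γ = ∂Ω`
this is the usual weak curl; for `Γ = ∂Ω \ Σ` it says in addition that the tangential trace of `u`
on `Σ` is zero (in the sense of Green's formula). -/
def WeakCurl (Ω Γ : Set E3) (u w : L2Vector Ω) : Prop :=
  ∀ φ : E3 → E3, IsTest Γ φ →
    ∫ x in Ω, ⟪u x, curl φ x⟫_ℝ = ∫ x in Ω, ⟪w x, φ x⟫_ℝ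

/-- `w` is the weak divergence of `u` in `Ω`, tested with functions that vanish near `Γ ⊆ ∂Ω`. For
`Γ = ∂Ω` this is the usual weak divergence; for `Γ = ∂Ω \ Σ` it says in addition that the normal
trace of `u` on `Σ` is zero (in the sense of Green's formula). -/
def WeakDiv (Ω Γ : Set E3) (u : L2Vector Ω) (w : L2Scalar Ω) : Prop :=
  ∀ φ : E3 → ℝ, IsTest Γ φ →
    ∫ x in Ω, ⟪u x, gradient φ x⟫_ℝ = -∫ x in Ω, w x * φ x


section Linearity

variable {Ω Γ : Set E3}

theorem IsTest.memLp_two {V : Type*} [NormedAddCommGroup V] [NormedSpace ℝ V] {ψ : E3 → V}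
    (h1 : Continuous ψ) (h2 : HasCompactSupport ψ) : MemLp ψ 2 (volume.restrict Ω) :=
  (h1.memLp_of_hasCompactSupport h2).restrict Ω

theorem IsTest.continuous_jacobian {φ : E3 → E3} (h : IsTest Γ φ) (m e : Fin 3) :
    Continuous fun x => jacobian φ x m e := by
  have h1 : Continuous (fderiv ℝ φ) := h.smooth.continuous_fderiv (by decide)
  simp only [jacobian, Matrix.of_apply]
  fun_prop

theorem IsTest.jacobian_eq_zero {φ : E3 → E3} {x : E3} (hx : x ∉ tsupport φ) :
    jacobian φ x = 0 := by
  have h0 : fderiv ℝ φ x = 0 := by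
    by_contra h
    exact hx (support_fderiv_subset ℝ h)
  ext m e
  simp [jacobian, h0]

theorem IsTest.memLp_divergence {φ : E3 → E3} (h : IsTest Γ φ) :
    MemLp (divergence φ) 2 (volume.restrict Ω) := by
  refine IsTest.memLp_two ?_ (HasCompactSupport.intro h.compact fun x hx => ?_)
  · change Continuous fun x => ∑ i, jacobian φ x i i
    exact continuous_finsetSum _ fun i _ => h.continuous_jacobian i i
  · simp [divergence, IsTest.jacobian_eq_zero hx]

theorem IsTest.memLp_curl {φ : E3 → E3} (h : IsTest Γ φ) :
    MemLp (curl φ) 2 (volume.restrict Ω) := by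
  refine IsTest.memLp_two ?_ (HasCompactSupport.intro h.compact fun x hx => ?_)
  · have hc := h.continuous_jacobian
    refine (PiLp.continuous_toLp 2 _).comp (continuous_pi fun k => ?_)
    fin_cases k
    · exact (hc 2 1).sub (hc 1 2)
    · exact (hc 0 2).sub (hc 2 0)
    · exact (hc 1 0).sub (hc 0 1)
  · ext k
    fin_cases k <;> simp [curl, IsTest.jacobian_eq_zero hx]

theorem IsTest.memLp_gradient {φ : E3 → ℝ} (h : IsTest Γ φ) :
    MemLp (gradient φ) 2 (volume.restrict Ω) := by
  have h1 : Continuous (fderiv ℝ φ) := h.smooth.continuous_fderiv (by simp)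
  refine IsTest.memLp_two ?_ (HasCompactSupport.intro h.compact fun x hx => ?_)
  · exact (LinearIsometryEquiv.continuous _).comp h1
  · have h0 : fderiv ℝ φ x = 0 := by
      by_contra h
      exact hx (support_fderiv_subset ℝ h)
    simp [gradient, h0]

theorem L2Scalar.integral_add (u v : L2Scalar Ω) {ψ : E3 → ℝ}
    (hψ : MemLp ψ 2 (volume.restrict Ω)) :
    ∫ x in Ω, (u + v) x * ψ x = (∫ x in Ω, u x * ψ x) + ∫ x in Ω, v x * ψ x := by
  have hu : Integrable (fun x => u x * ψ x) (volume.restrict Ω) :=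
    (Lp.memLp u).integrable_mul hψ
  have hv : Integrable (fun x => v x * ψ x) (volume.restrict Ω) :=
    (Lp.memLp v).integrable_mul hψ
  rw [← MeasureTheory.integral_add hu hv]
  refine integral_congr_ae ?_
  filter_upwards [Lp.coeFn_add u v] with x hx
  simp only [hx, Pi.add_apply, add_mul]

theorem L2Scalar.integral_smul (c : ℝ) (u : L2Scalar Ω) (ψ : E3 → ℝ) :
    ∫ x in Ω, (c • u) x * ψ x = c * ∫ x in Ω, u x * ψ x := by
  rw [← integral_const_mul]
  refine integral_congr_ae ?_
  filter_upwards [Lp.coeFn_smul c u] with x hx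
  simp [hx, mul_assoc]

theorem L2Vector.integrable (u : L2Vector Ω) {ψ : E3 → E3}
    (hψ : MemLp ψ 2 (volume.restrict Ω)) :
    Integrable (fun x => ⟪u x, ψ x⟫_ℝ) (volume.restrict Ω) := by
  refine (L2.integrable_inner (𝕜 := ℝ) u (hψ.toLp ψ)).congr ?_
  filter_upwards [hψ.coeFn_toLp] with x hx
  rw [hx]

theorem L2Vector.integral_add (u v : L2Vector Ω) {ψ : E3 → E3}
    (hψ : MemLp ψ 2 (volume.restrict Ω)) :
    ∫ x in Ω, ⟪(u + v) x, ψ x⟫_ℝ = (∫ x in Ω, ⟪u x, ψ x⟫_ℝ) + ∫ x in Ω, ⟪v x, ψ x⟫_ℝ := by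
  have hu : Integrable (fun x => ⟪u x, ψ x⟫_ℝ) (volume.restrict Ω) :=
    L2Vector.integrable u hψ
  have hv : Integrable (fun x => ⟪v x, ψ x⟫_ℝ) (volume.restrict Ω) :=
    L2Vector.integrable v hψ
  rw [← MeasureTheory.integral_add hu hv]
  refine integral_congr_ae ?_
  filter_upwards [Lp.coeFn_add u v] with x hx
  simp only [hx, Pi.add_apply, inner_add_left]

theorem L2Vector.integral_smul (c : ℝ) (u : L2Vector Ω) (ψ : E3 → E3) :
    ∫ x in Ω, ⟪(c • u) x, ψ x⟫_ℝ = c * ∫ x in Ω, ⟪u x, ψ x⟫_ℝ := by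
  rw [← integral_const_mul]
  refine integral_congr_ae ?_
  filter_upwards [Lp.coeFn_smul c u] with x hx
  simp [hx, inner_smul_left]

theorem IsTest.memLp {V : Type*} [NormedAddCommGroup V] [NormedSpace ℝ V] {φ : E3 → V}
    (h : IsTest Γ φ) : MemLp φ 2 (volume.restrict Ω) :=
  IsTest.memLp_two h.smooth.continuous h.compact

theorem WeakGrad.add {u v : L2Scalar Ω} {g h : L2Vector Ω} (h1 : WeakGrad Ω Γ u g)
    (h2 : WeakGrad Ω Γ v h) : WeakGrad Ω Γ (u + v) (g + h) := fun φ hφ => by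
  rw [L2Scalar.integral_add u v hφ.memLp_divergence, L2Vector.integral_add g h hφ.memLp,
    h1 φ hφ, h2 φ hφ]
  ring

theorem WeakGrad.smul (c : ℝ) {u : L2Scalar Ω} {g : L2Vector Ω} (h1 : WeakGrad Ω Γ u g) :
    WeakGrad Ω Γ (c • u) (c • g) := fun φ hφ => by
  rw [L2Scalar.integral_smul, L2Vector.integral_smul, h1 φ hφ]
  ring

theorem WeakGrad.zero : WeakGrad Ω Γ 0 0 := by
  intro φ hφ
  have h1 := L2Scalar.integral_smul (Ω := Ω) 0 0 (divergence φ)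
  have h2 := L2Vector.integral_smul (Ω := Ω) 0 0 φ
  rw [zero_smul, zero_mul] at h1 h2
  rw [h1, h2, neg_zero]

theorem WeakCurl.add {u v w z : L2Vector Ω} (h1 : WeakCurl Ω Γ u w) (h2 : WeakCurl Ω Γ v z) :
    WeakCurl Ω Γ (u + v) (w + z) := fun φ hφ => by
  rw [L2Vector.integral_add u v hφ.memLp_curl, L2Vector.integral_add w z hφ.memLp,
    h1 φ hφ, h2 φ hφ]

theorem WeakCurl.smul (c : ℝ) {u w : L2Vector Ω} (h1 : WeakCurl Ω Γ u w) :
    WeakCurl Ω Γ (c • u) (c • w) := fun φ hφ => by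
  rw [L2Vector.integral_smul, L2Vector.integral_smul, h1 φ hφ]

theorem WeakCurl.zero : WeakCurl Ω Γ 0 0 := by
  intro φ hφ
  have h1 := L2Vector.integral_smul (Ω := Ω) 0 0 (curl φ)
  have h2 := L2Vector.integral_smul (Ω := Ω) 0 0 φ
  rw [zero_smul, zero_mul] at h1 h2
  rw [h1, h2]

theorem WeakDiv.add {u v : L2Vector Ω} {w z : L2Scalar Ω} (h1 : WeakDiv Ω Γ u w)
    (h2 : WeakDiv Ω Γ v z) : WeakDiv Ω Γ (u + v) (w + z) := fun φ hφ => by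
  rw [L2Vector.integral_add u v hφ.memLp_gradient, L2Scalar.integral_add w z hφ.memLp,
    h1 φ hφ, h2 φ hφ]
  ring

theorem WeakDiv.smul (c : ℝ) {u : L2Vector Ω} {w : L2Scalar Ω} (h1 : WeakDiv Ω Γ u w) :
    WeakDiv Ω Γ (c • u) (c • w) := fun φ hφ => by
  rw [L2Vector.integral_smul, L2Scalar.integral_smul, h1 φ hφ]
  ring

theorem WeakDiv.zero : WeakDiv Ω Γ 0 0 := by
  intro φ hφ
  have h1 := L2Vector.integral_smul (Ω := Ω) 0 0 (gradient φ)
  have h2 := L2Scalar.integral_smul (Ω := Ω) 0 0 φ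
  rw [zero_smul, zero_mul] at h1 h2
  rw [h1, h2, neg_zero]

end Linearity

/-! ### Multi-patch NURBS geometries -/

/-- Data of a multi-patch NURBS geometry with control grid `M`: the degree (the same in all
directions), the knot vectors, the weights and the control points of each patch. Only the values at
indices in the range of the grid matter. -/
structure MultiPatch {ι : Type*} (M : ControlGrid ι) where
  degree : ℕ
  knot : ι → Fin 3 → ℕ → ℝ
  weight : ι → (Fin 3 → ℕ) → ℝ
  ctrl : ι → (Fin 3 → ℕ) → E3

namespace MultiPatch

variable {ι : Type*} {M : ControlGrid ι} (P : MultiPatch M)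

/-- The tensor-product spline associated to an entity of the control grid of patch `i`: a
Curry–Schoenberg spline of degree `p - 1` in the directions `D` in which the entity extends, and a
B-spline of degree `p` in the other directions. -/
def basisFun (i : ι) (D : Finset (Fin 3)) (a : M.Idx i D) (ξ : E3) : ℝ :=
  ∏ e, if e ∈ D then curryBspline (P.knot i e) P.degree (a e) (ξ e)
    else bspline (P.knot i e) P.degree (a e) (ξ e)

/-- The NURBS parametrisation of patch `i`. -/
def param (i : ι) (ξ : E3) : E3 :=
  (∑ a : M.Idx i ∅, P.weight i (fun e => a e) * P.basisFun i ∅ a ξ)⁻¹ •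
    ∑ a : M.Idx i ∅, (P.weight i (fun e => a e) * P.basisFun i ∅ a ξ) • P.ctrl i (fun e => a e)

/-- The closed patch `i`. -/
def patch (i : ι) : Set E3 := P.param i '' closedCube

/-- The domain: the interior of the union of the closed patches. -/
def domain : Set E3 := interior (⋃ i, P.patch i)

/-- The part of the boundary formed by the patch sides in `S`. -/
def dirichletPart (S : Set (ι × Fin 3 × Bool)) : Set E3 :=
  ⋃ b ∈ S, P.param b.1 '' cubeFace (sideOf b.2.1 b.2.2)

/-- `P` is a conforming multi-patch domain. Each parametrisation is a NURBS of degree `p ≥ 1` with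
open knot vectors and positive weights, and is bi-Lipschitz. Two different closed patches are
disjoint or meet exactly in a common side, edge or vertex (the one given by `M.glue`), on which the
knot vectors, the control points and (up to a common factor) the weights from both sides match.
Patches that meet in a point are linked by patches through that point that meet in full sides:
no two parts of the domain are in contact only along edges or at vertices. -/
structure IsConforming : Prop where
  degree_pos : 1 ≤ P.degree
  knots : ∀ i e, IsOpenKnotVector P.degree (M.n i e) (P.knot i e)
  weight_pos : ∀ i (a : M.Idx i ∅), 0 < P.weight i (fun e => a e)
  biLipschitz : ∀ i, ∃ c C : ℝ, 0 < c ∧ ∀ ξ ∈ closedCube, ∀ η ∈ closedCube,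
    c * dist ξ η ≤ dist (P.param i ξ) (P.param i η) ∧
      dist (P.param i ξ) (P.param i η) ≤ C * dist ξ η
  glue_self : ∀ i, M.glue i i = none
  glue_none : ∀ i j, i ≠ j → M.glue i j = none → Disjoint (P.patch i) (P.patch j)
  glue_proper : ∀ i j g, M.glue i j = some g → ∃ e, g.face e ≠ none
  glue_inter : ∀ i j g, M.glue i j = some g →
    P.patch i ∩ P.patch j = P.param i '' cubeFace g.face
  glue_knots : ∀ i j g, M.glue i j = some g → ∀ e, g.face e = none →
    M.n j (g.perm e) = M.n i e ∧ ∀ m, m ≤ M.n i e + P.degree →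
      P.knot j (g.perm e) m =
        if g.flip e then 1 - P.knot i e (M.n i e + P.degree - m) else P.knot i e m
  glue_control : ∀ i j g, M.glue i j = some g → ∃ c : ℝ, 0 < c ∧
    ∀ (a : M.Idx i ∅) (b : M.Idx j ∅), ControlGrid.Matches g a b →
      P.ctrl j (fun e => b e) = P.ctrl i (fun e => a e) ∧
      P.weight j (fun e => b e) = c * P.weight i (fun e => a e)
  sideLinked : ∀ x i j, x ∈ P.patch i → x ∈ P.patch j →
    Relation.ReflTransGen (fun k l => x ∈ P.patch k ∧ x ∈ P.patch l ∧
      ∃ g e s, M.glue k l = some g ∧ g.face = sideOf e s) i j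

/-- The control mesh of `P`, as a mesh of hexahedra that are images of cubes under trilinear maps:
its parametrisation is the spline of degree one, on uniform knots and without weights, that has the
same control points. For this geometry the spaces defined below are the lowest-order finite element
spaces: continuous trilinear elements, lowest-order edge elements of Nédélec, lowest-order face
elements of Raviart–Thomas, and piecewise constants, each with the usual transformation from the
reference cubes. -/
def controlMesh : MultiPatch M where
  degree := 1
  knot i e m := ((min (m - 1) (M.n i e - 1) : ℕ) : ℝ) / ((M.n i e - 1 : ℕ) : ℝ)
  weight _ _ := 1
  ctrl := P.ctrl

/-! ### The spline spaces

The predicates `HasCoeffs0`, …, `HasCoeffs3` say that on each patch the pull-back of a field is the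
combination of the tensor-product splines with the given coefficients. The pull-backs are
`û = u ∘ F`, `û = DFᵀ (u ∘ F)`, `û = det(DF) DF⁻¹ (u ∘ F) = adj(DF) (u ∘ F)`, `û = det(DF) (u ∘ F)`.
-/

/-- The scalar field `u` has the coefficients `c` with respect to the control points. -/
def HasCoeffs0 (u : L2Scalar P.domain) (c : M.LocalVertex → ℝ) : Prop :=
  ∀ᵐ x ∂(volume.restrict P.domain), ∀ i, ∀ ξ ∈ openCube, P.param i ξ = x →
    u x = ∑ a : M.Idx i ∅, c ⟨i, a⟩ * P.basisFun i ∅ a ξ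

/-- The field `u` has the coefficients `c` with respect to the control edges. -/
def HasCoeffs1 (u : L2Vector P.domain) (c : M.LocalEdge → ℝ) : Prop :=
  ∀ᵐ x ∂(volume.restrict P.domain), ∀ i, ∀ ξ ∈ openCube, P.param i ξ = x →
    ∀ d, ((jacobian (P.param i) ξ).transpose.mulVec (u x)) d =
      ∑ a : M.Idx i {d}, c ⟨i, d, a⟩ * P.basisFun i {d} a ξ

/-- The field `u` has the coefficients `c` with respect to the facets of the control mesh. -/
def HasCoeffs2 (u : L2Vector P.domain) (c : M.LocalFacet → ℝ) : Prop :=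
  ∀ᵐ x ∂(volume.restrict P.domain), ∀ i, ∀ ξ ∈ openCube, P.param i ξ = x →
    ∀ d, ((jacobian (P.param i) ξ).adjugate.mulVec (u x)) d =
      ∑ a : M.Idx i {d}ᶜ, c ⟨i, d, a⟩ * P.basisFun i {d}ᶜ a ξ

/-- The scalar field `u` has the coefficients `c` with respect to the cells of the control mesh. -/
def HasCoeffs3 (u : L2Scalar P.domain) (c : M.LocalCell → ℝ) : Prop :=
  ∀ᵐ x ∂(volume.restrict P.domain), ∀ i, ∀ ξ ∈ openCube, P.param i ξ = x →
    (jacobian (P.param i) ξ).det * u x =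
      ∑ a : M.Idx i Finset.univ, c ⟨i, a⟩ * P.basisFun i Finset.univ a ξ

variable {P}

theorem HasCoeffs0.add {u v : L2Scalar P.domain} {c b : M.LocalVertex → ℝ}
    (h1 : P.HasCoeffs0 u c) (h2 : P.HasCoeffs0 v b) : P.HasCoeffs0 (u + v) (c + b) := by
  filter_upwards [h1, h2, Lp.coeFn_add u v] with x h1 h2 h3 i ξ hξ hx
  simp only [h3, Pi.add_apply, h1 i ξ hξ hx, h2 i ξ hξ hx, add_mul, Finset.sum_add_distrib]

theorem HasCoeffs0.smul (r : ℝ) {u : L2Scalar P.domain} {c : M.LocalVertex → ℝ}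
    (h1 : P.HasCoeffs0 u c) : P.HasCoeffs0 (r • u) (r • c) := by
  filter_upwards [h1, Lp.coeFn_smul r u] with x h1 h3 i ξ hξ hx
  simp only [h3, Pi.smul_apply, smul_eq_mul, h1 i ξ hξ hx, mul_assoc, Finset.mul_sum]

theorem HasCoeffs0.zero : P.HasCoeffs0 0 0 := by
  filter_upwards [Lp.coeFn_zero ℝ 2 (volume.restrict P.domain)] with x h3 i ξ hξ hx
  have h4 : (0 : L2Scalar P.domain) x = 0 := h3
  rw [h4]
  simp

theorem HasCoeffs1.add {u v : L2Vector P.domain} {c b : M.LocalEdge → ℝ}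
    (h1 : P.HasCoeffs1 u c) (h2 : P.HasCoeffs1 v b) : P.HasCoeffs1 (u + v) (c + b) := by
  filter_upwards [h1, h2, Lp.coeFn_add u v] with x h1 h2 h3 i ξ hξ hx d
  simp only [h3, Pi.add_apply, WithLp.ofLp_add, Matrix.mulVec_add, h1 i ξ hξ hx, h2 i ξ hξ hx,
    add_mul, Finset.sum_add_distrib]

theorem HasCoeffs1.smul (r : ℝ) {u : L2Vector P.domain} {c : M.LocalEdge → ℝ}
    (h1 : P.HasCoeffs1 u c) : P.HasCoeffs1 (r • u) (r • c) := by
  filter_upwards [h1, Lp.coeFn_smul r u] with x h1 h3 i ξ hξ hx d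
  simp only [h3, Pi.smul_apply, WithLp.ofLp_smul, Matrix.mulVec_smul, smul_eq_mul, h1 i ξ hξ hx,
    mul_assoc, Finset.mul_sum]

theorem HasCoeffs1.zero : P.HasCoeffs1 0 0 := by
  filter_upwards [Lp.coeFn_zero E3 2 (volume.restrict P.domain)] with x h3 i ξ hξ hx d
  have h4 : (0 : L2Vector P.domain) x = 0 := h3
  rw [h4]
  simp

theorem HasCoeffs2.add {u v : L2Vector P.domain} {c b : M.LocalFacet → ℝ}
    (h1 : P.HasCoeffs2 u c) (h2 : P.HasCoeffs2 v b) : P.HasCoeffs2 (u + v) (c + b) := by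
  filter_upwards [h1, h2, Lp.coeFn_add u v] with x h1 h2 h3 i ξ hξ hx d
  simp only [h3, Pi.add_apply, WithLp.ofLp_add, Matrix.mulVec_add, h1 i ξ hξ hx, h2 i ξ hξ hx,
    add_mul, Finset.sum_add_distrib]

theorem HasCoeffs2.smul (r : ℝ) {u : L2Vector P.domain} {c : M.LocalFacet → ℝ}
    (h1 : P.HasCoeffs2 u c) : P.HasCoeffs2 (r • u) (r • c) := by
  filter_upwards [h1, Lp.coeFn_smul r u] with x h1 h3 i ξ hξ hx d
  simp only [h3, Pi.smul_apply, WithLp.ofLp_smul, Matrix.mulVec_smul, smul_eq_mul, h1 i ξ hξ hx,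
    mul_assoc, Finset.mul_sum]

theorem HasCoeffs2.zero : P.HasCoeffs2 0 0 := by
  filter_upwards [Lp.coeFn_zero E3 2 (volume.restrict P.domain)] with x h3 i ξ hξ hx d
  have h4 : (0 : L2Vector P.domain) x = 0 := h3
  rw [h4]
  simp

theorem HasCoeffs3.add {u v : L2Scalar P.domain} {c b : M.LocalCell → ℝ}
    (h1 : P.HasCoeffs3 u c) (h2 : P.HasCoeffs3 v b) : P.HasCoeffs3 (u + v) (c + b) := by
  filter_upwards [h1, h2, Lp.coeFn_add u v] with x h1 h2 h3 i ξ hξ hx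
  simp only [h3, Pi.add_apply, mul_add, h1 i ξ hξ hx, h2 i ξ hξ hx, add_mul,
    Finset.sum_add_distrib]

theorem HasCoeffs3.smul (r : ℝ) {u : L2Scalar P.domain} {c : M.LocalCell → ℝ}
    (h1 : P.HasCoeffs3 u c) : P.HasCoeffs3 (r • u) (r • c) := by
  filter_upwards [h1, Lp.coeFn_smul r u] with x h1 h3 i ξ hξ hx
  simp only [h3, Pi.smul_apply, smul_eq_mul, mul_left_comm _ r, h1 i ξ hξ hx, mul_assoc,
    Finset.mul_sum]

theorem HasCoeffs3.zero : P.HasCoeffs3 0 0 := by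
  filter_upwards [Lp.coeFn_zero ℝ 2 (volume.restrict P.domain)] with x h3 i ξ hξ hx
  have h4 : (0 : L2Scalar P.domain) x = 0 := h3
  rw [h4]
  simp

variable (P) (S : Set (ι × Fin 3 × Bool))

/-- `S_p⁰(Ω; Σ)`: the functions in `H¹(Ω)` that vanish on the sides in `S` and are splines on each
patch. -/
def S0 : Submodule ℝ (L2Scalar P.domain) where
  carrier := {u | (∃ c, P.HasCoeffs0 u c) ∧
    ∃ g, WeakGrad P.domain (frontier P.domain \ P.dirichletPart S) u g}
  zero_mem' := ⟨⟨0, HasCoeffs0.zero⟩, ⟨0, WeakGrad.zero⟩⟩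
  add_mem' := fun ⟨⟨_, h1⟩, ⟨_, h2⟩⟩ ⟨⟨_, h3⟩, ⟨_, h4⟩⟩ => ⟨⟨_, h1.add h3⟩, ⟨_, h2.add h4⟩⟩
  smul_mem' := fun r _ ⟨⟨_, h1⟩, ⟨_, h2⟩⟩ => ⟨⟨_, h1.smul r⟩, ⟨_, h2.smul r⟩⟩

/-- `S_p¹(Ω; Σ)`: the fields in `H(curl; Ω)` whose tangential trace vanishes on the sides in `S` and
that are splines on each patch. -/
def S1 : Submodule ℝ (L2Vector P.domain) where
  carrier := {u | (∃ c, P.HasCoeffs1 u c) ∧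
    ∃ w, WeakCurl P.domain (frontier P.domain \ P.dirichletPart S) u w}
  zero_mem' := ⟨⟨0, HasCoeffs1.zero⟩, ⟨0, WeakCurl.zero⟩⟩
  add_mem' := fun ⟨⟨_, h1⟩, ⟨_, h2⟩⟩ ⟨⟨_, h3⟩, ⟨_, h4⟩⟩ => ⟨⟨_, h1.add h3⟩, ⟨_, h2.add h4⟩⟩
  smul_mem' := fun r _ ⟨⟨_, h1⟩, ⟨_, h2⟩⟩ => ⟨⟨_, h1.smul r⟩, ⟨_, h2.smul r⟩⟩

/-- `S_p²(Ω; Σ)`: the fields in `H(div; Ω)` whose normal trace vanishes on the sides in `S` and that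
are splines on each patch. -/
def S2 : Submodule ℝ (L2Vector P.domain) where
  carrier := {u | (∃ c, P.HasCoeffs2 u c) ∧
    ∃ w, WeakDiv P.domain (frontier P.domain \ P.dirichletPart S) u w}
  zero_mem' := ⟨⟨0, HasCoeffs2.zero⟩, ⟨0, WeakDiv.zero⟩⟩
  add_mem' := fun ⟨⟨_, h1⟩, ⟨_, h2⟩⟩ ⟨⟨_, h3⟩, ⟨_, h4⟩⟩ => ⟨⟨_, h1.add h3⟩, ⟨_, h2.add h4⟩⟩
  smul_mem' := fun r _ ⟨⟨_, h1⟩, ⟨_, h2⟩⟩ => ⟨⟨_, h1.smul r⟩, ⟨_, h2.smul r⟩⟩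

/-- `S_p³(Ω)`: the functions in `L²(Ω)` that are splines on each patch; boundary conditions do not
affect this space. -/
def S3 : Submodule ℝ (L2Scalar P.domain) where
  carrier := {u | ∃ c, P.HasCoeffs3 u c}
  zero_mem' := ⟨0, HasCoeffs3.zero⟩
  add_mem' := fun ⟨_, h1⟩ ⟨_, h3⟩ => ⟨_, h1.add h3⟩
  smul_mem' := fun r _ ⟨_, h1⟩ => ⟨_, h1.smul r⟩

/-- `g = grad u` in `Ω`. -/
def IsGrad (u : L2Scalar P.domain) (g : L2Vector P.domain) : Prop :=
  WeakGrad P.domain (frontier P.domain) u g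

/-- `w = curl u` in `Ω`. -/
def IsCurl (u w : L2Vector P.domain) : Prop :=
  WeakCurl P.domain (frontier P.domain) u w

/-- `w = div u` in `Ω`. -/
def IsDiv (u : L2Vector P.domain) (w : L2Scalar P.domain) : Prop :=
  WeakDiv P.domain (frontier P.domain) u w

/-! ### The discrete kernel of the curl, and tree–cotree gauging -/

/-- The discrete kernel: the fields in `S_p¹(Ω; Σ)` with vanishing curl. -/
def curlKernel : Submodule ℝ (L2Vector P.domain) where
  carrier := {u | u ∈ P.S1 S ∧ P.IsCurl u 0}
  zero_mem' := ⟨zero_mem _, WeakCurl.zero⟩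
  add_mem' := fun h1 h2 => ⟨add_mem h1.1 h2.1, by
    have h := h1.2.add h2.2
    rwa [add_zero] at h⟩
  smul_mem' := fun r _ h1 => ⟨Submodule.smul_mem _ r h1.1, by
    have h := h1.2.smul r
    rwa [smul_zero] at h⟩

/-- The gradients of the functions in `S_p⁰(Ω; Σ)`. -/
def gradients : Submodule ℝ (L2Vector P.domain) where
  carrier := {g | ∃ u ∈ P.S0 S, P.IsGrad u g}
  zero_mem' := ⟨0, zero_mem _, WeakGrad.zero⟩
  add_mem' := fun ⟨_, h1, h2⟩ ⟨_, h3, h4⟩ => ⟨_, add_mem h1 h3, h2.add h4⟩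
  smul_mem' := fun r _ ⟨_, h1, h2⟩ => ⟨_, Submodule.smul_mem _ r h1, h2.smul r⟩

/-- The gauged space: the fields in `S_p¹(Ω; Σ)` whose degrees of freedom on the edges in `T` are set
to zero. -/
def gauged (T : Set M.Edge) : Submodule ℝ (L2Vector P.domain) where
  carrier := {u | u ∈ P.S1 S ∧ ∃ c, P.HasCoeffs1 u c ∧
    ∀ x : M.LocalEdge, ControlGrid.toEdge x ∈ T → c x = 0}
  zero_mem' := ⟨zero_mem _, 0, HasCoeffs1.zero, fun _ _ => rfl⟩
  add_mem' := fun ⟨h1, _, h2, h3⟩ ⟨h4, _, h5, h6⟩ => ⟨add_mem h1 h4, _, h2.add h5, fun x hx => by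
    simp [h3 x hx, h6 x hx]⟩
  smul_mem' := fun r _ ⟨h1, _, h2, h3⟩ => ⟨Submodule.smul_mem _ r h1, _, h2.smul r, fun x hx => by
    simp [h3 x hx]⟩

/-- Setting the degrees of freedom on the edges in `T` to zero removes exactly the subspace `K` of
`S_p¹(Ω; Σ)`: nothing of `K` remains, and each field in `S_p¹(Ω; Σ)` can be brought into the gauged
space by adding an element of `K`. -/
def RemovesExactly (T : Set M.Edge) (K : Submodule ℝ (L2Vector P.domain)) : Prop :=
  P.gauged S T ⊓ K = ⊥ ∧ P.gauged S T ⊔ K = P.S1 S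

end MultiPatch

end

/-!
The whole statement is a consequence of one fact: the spline spaces with boundary conditions and the
operators grad, curl and div are described by the coefficients alone, in terms of the combinatorial
control mesh. The degree, the knots and the positions of the control points do not enter this
description, so that it is the same for the splines and for the lowest-order spaces on the control
mesh.

On a patch, the derivative of a B-spline is a difference of Curry–Schoenberg splines, hence the
operators act on the pull-backs as the incidence matrices of the control grid
(`MultiPatch.lineDiff_field`). A field that is a spline on each patch has a weak derivative with the
boundary condition if and only if its traces (all, tangential, normal) agree from the two sides of
each interface and vanish on the Dirichlet sides. This is shown with Green's formulas on the
reference cubes, `green_grad`, `green_curl` and `green_div`: they turn the defect of a weak derivative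
into a sum of fluxes through the sides of the patches, and no regularity of the mapped patches beyond
the bi-Lipschitz NURBS maps is needed. If the traces match, the fluxes cancel in pairs
(`flux_eq_zero`), since the two patches of an interface lie on opposite sides of it, with
corresponding orientations (`OneSided.opposite`, `inward_mul_orient`). Conversely, test functions
concentrated near a generic point of a side show that the traces match there (`tracesMatch_of_flux`);
this uses that generic points of interfaces are interior points of the domain, and generic points of
the other sides are boundary points (`interface_mem_domain`, `boundary_mem_frontier`).

As the splines restricted to a side are linearly independent and correspond to each other under the
gluing, matching traces mean matching coefficients (`mem_S0_iff`, `mem_S1_iff`, `mem_S2_iff`,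
`isGrad_iff`, `isCurl_iff`). Matching across full sides extends to entities that are identified along
an edge or at a vertex, because patches through a point are linked by full sides
(`of_matches_of_side`). The coefficients of `S_p¹` are thus the relative `1`-cochains, those of its
curl-free fields the cocycles, and those of the gradients the coboundaries.

What remains is linear algebra on a graph. On a forest each cochain is a coboundary
(`Acyclic.exists_potential`), and the properties of a gauge tree make the potential unique and let it
vanish on the Dirichlet vertices: the relative cochains are the direct sum of those that vanish on
the tree and of the coboundaries (`gauged_inf_coboundaries`, `gauged_sup_coboundaries`). The cocycles
that vanish on the tree therefore represent the cohomology, and they are parametrised by their values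
on as many edges as their dimension (`exists_interpolation_set`, `exists_harmonic_edges`).
-/


noncomputable section

/-! ### Univariate B-splines -/

/-- A B-spline of degree `q` depends only on its own `q + 2` knots. -/
theorem bspline_congr {Ξ Ξ' : ℕ → ℝ} (q i : ℕ) (x : ℝ)
    (h : ∀ k, i ≤ k → k ≤ i + q + 1 → Ξ k = Ξ' k) : bspline Ξ q i x = bspline Ξ' q i x := by
  induction q generalizing i with
  | zero => simp only [bspline, h i le_rfl (by omega), h (i + 1) (by omega) (by omega)]
  | succ q ih =>
    simp only [bspline]
    rw [ih i (fun k h1 h2 => h k h1 (by omega)), ih (i + 1) (fun k h1 h2 => h k (by omega) (by omega)),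
      h i le_rfl (by omega), h (i + q + 1) (by omega) (by omega),
      h (i + q + 2) (by omega) (by omega), h (i + 1) (by omega) (by omega)]

/-- The polynomial that the B-spline of degree `q` and number `i` equals on the knot span number
`m`. -/
def bpiece (Ξ : ℕ → ℝ) (m : ℕ) : ℕ → ℕ → ℝ → ℝ
  | 0, i, _ => if i = m then 1 else 0
  | q + 1, i, x =>
      (x - Ξ i) / (Ξ (i + q + 1) - Ξ i) * bpiece Ξ m q i x +
        (Ξ (i + q + 2) - x) / (Ξ (i + q + 2) - Ξ (i + 1)) * bpiece Ξ m q (i + 1) x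

/-- The polynomial piece divided by the length of the support of the spline. -/
def nbpiece (Ξ : ℕ → ℝ) (m q i : ℕ) (x : ℝ) : ℝ := bpiece Ξ m q i x / (Ξ (i + q + 1) - Ξ i)

/-- The point `x` belongs to knot span number `m`; the last nonempty span contains `1`. -/
def InSpan (Ξ : ℕ → ℝ) (m : ℕ) (x : ℝ) : Prop :=
  (Ξ m ≤ x ∧ x < Ξ (m + 1)) ∨ (x = 1 ∧ Ξ m < Ξ (m + 1) ∧ Ξ (m + 1) = 1)

section Pieces

variable {Ξ : ℕ → ℝ} {m : ℕ}

theorem bpiece_succ (q i : ℕ) (x : ℝ) : bpiece Ξ m (q + 1) i x =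
    (x - Ξ i) * nbpiece Ξ m q i x + (Ξ (i + q + 2) - x) * nbpiece Ξ m q (i + 1) x := by
  simp only [bpiece, nbpiece]
  rw [show i + 1 + q + 1 = i + q + 2 by ring]
  ring

theorem bspline_eq_bpiece (hΞ : Monotone Ξ) (h1 : ∀ k, Ξ k ≤ 1) {x : ℝ} (hx : InSpan Ξ m x)
    (q i : ℕ) : bspline Ξ q i x = bpiece Ξ m q i x := by
  induction q generalizing i with
  | zero =>
    simp only [bspline, bpiece]
    have key : ((Ξ i ≤ x ∧ x < Ξ (i + 1)) ∨ (x = 1 ∧ Ξ i < Ξ (i + 1) ∧ Ξ (i + 1) = 1)) ↔ i = m := by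
      refine ⟨fun h => ?_, fun h => h ▸ hx⟩
      have h3 := h1 (i + 1)
      have h4 := h1 (m + 1)
      rcases lt_trichotomy i m with h2 | h2 | h2
      · have := hΞ (show i + 1 ≤ m from h2)
        rcases h with ⟨a, b⟩ | ⟨a, b, c⟩ <;> rcases hx with ⟨d, e⟩ | ⟨d, e, f⟩ <;> linarith
      · exact h2
      · have := hΞ (show m + 1 ≤ i from h2)
        rcases h with ⟨a, b⟩ | ⟨a, b, c⟩ <;> rcases hx with ⟨d, e⟩ | ⟨d, e, f⟩ <;> linarith
    simp only [key]
  | succ q ih => simp only [bspline, bpiece, ih]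

theorem bpiece_eq_zero (q i : ℕ) (x : ℝ) (h : m < i ∨ i + q < m) : bpiece Ξ m q i x = 0 := by
  induction q generalizing i with
  | zero => rw [bpiece, if_neg (by omega)]
  | succ q ih => rw [bpiece, ih i (by omega), ih (i + 1) (by omega)]; ring

theorem nbpiece_eq_zero (q i : ℕ) (x : ℝ) (h : m < i ∨ i + q < m) : nbpiece Ξ m q i x = 0 := by
  rw [nbpiece, bpiece_eq_zero q i x h, zero_div]

theorem sub_mul_nbpiece (hΞ : Monotone Ξ) (hm : Ξ m < Ξ (m + 1)) (q i : ℕ) (x : ℝ) :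
    (Ξ (i + q + 1) - Ξ i) * nbpiece Ξ m q i x = bpiece Ξ m q i x := by
  by_cases h : m < i ∨ i + q < m
  · rw [nbpiece_eq_zero q i x h, bpiece_eq_zero q i x h, mul_zero]
  · have h1 : Ξ i ≤ Ξ m := hΞ (by omega)
    have h2 : Ξ (m + 1) ≤ Ξ (i + q + 1) := hΞ (by omega)
    rw [nbpiece, mul_div_cancel₀]
    linarith

theorem nbpiece_eq_zero_of_eq (q i : ℕ) (x : ℝ) (h : Ξ (i + q + 1) - Ξ i = 0) :
    nbpiece Ξ m q i x = 0 := by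
  rw [nbpiece, h, div_zero]

theorem hasDerivAt_bpiece (hΞ : Monotone Ξ) (q i : ℕ) (x : ℝ) :
    HasDerivAt (bpiece Ξ m (q + 1) i)
      ((q + 1) * (nbpiece Ξ m q i x - nbpiece Ξ m q (i + 1) x)) x := by
  induction q generalizing i with
  | zero =>
    have h : bpiece Ξ m (0 + 1) i = fun x => (x - Ξ i) * nbpiece Ξ m 0 i 0 +
        (Ξ (i + 0 + 2) - x) * nbpiece Ξ m 0 (i + 1) 0 := by
      funext x
      rw [bpiece_succ]
      simp [nbpiece, bpiece]
    rw [h]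
    have e1 : ∀ k, nbpiece Ξ m 0 k x = nbpiece Ξ m 0 k 0 := fun k => by simp [nbpiece, bpiece]
    rw [e1, e1]
    refine ((((hasDerivAt_id x).sub_const (Ξ i)).mul_const (nbpiece Ξ m 0 i 0)).add
      (((hasDerivAt_id x).const_sub (Ξ (i + 0 + 2))).mul_const
        (nbpiece Ξ m 0 (i + 1) 0))).congr_deriv ?_
    push_cast
    ring
  | succ q ih =>
    have hn : ∀ k, HasDerivAt (nbpiece Ξ m (q + 1) k)
        ((q + 1) * (nbpiece Ξ m q k x - nbpiece Ξ m q (k + 1) x) /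
          (Ξ (k + (q + 1) + 1) - Ξ k)) x := fun k => (ih k).div_const _
    have h : bpiece Ξ m (q + 1 + 1) i = fun x => (x - Ξ i) * nbpiece Ξ m (q + 1) i x +
        (Ξ (i + (q + 1) + 2) - x) * nbpiece Ξ m (q + 1) (i + 1) x := funext (bpiece_succ _ _)
    rw [h]
    refine ((((hasDerivAt_id x).sub_const (Ξ i)).mul (hn i)).add
      (((hasDerivAt_id x).const_sub (Ξ (i + (q + 1) + 2))).mul (hn (i + 1)))).congr_deriv ?_
    -- each of the two terms reproduces the middle spline of lower degree, with opposite signs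
    have hA : (x - Ξ i) * ((q + 1) * (nbpiece Ξ m q i x - nbpiece Ξ m q (i + 1) x) /
          (Ξ (i + (q + 1) + 1) - Ξ i)) - (q + 1) * nbpiece Ξ m (q + 1) i x =
        -((q + 1) * nbpiece Ξ m q (i + 1) x) := by
      by_cases h0 : Ξ (i + (q + 1) + 1) - Ξ i = 0
      · have h2 : Ξ (i + 1 + q + 1) - Ξ (i + 1) = 0 := by
          have a1 := hΞ (show i ≤ i + 1 by omega)
          have a2 := hΞ (show i + 1 ≤ i + 1 + q + 1 by omega)
          rw [show i + 1 + q + 1 = i + (q + 1) + 1 by ring] at a2 ⊢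
          linarith
        rw [nbpiece_eq_zero_of_eq _ _ _ h0, nbpiece_eq_zero_of_eq q (i + 1) x h2, h0]
        simp
      · have h3 : nbpiece Ξ m (q + 1) i x = _ / _ := rfl
        rw [h3, bpiece_succ]
        field_simp
        rw [show i + (q + 1) + 1 = i + q + 2 by ring]
        ring
    have hB : (Ξ (i + (q + 1) + 2) - x) *
          ((q + 1) * (nbpiece Ξ m q (i + 1) x - nbpiece Ξ m q (i + 1 + 1) x) /
          (Ξ (i + 1 + (q + 1) + 1) - Ξ (i + 1))) + (q + 1) * nbpiece Ξ m (q + 1) (i + 1) x =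
        (q + 1) * nbpiece Ξ m q (i + 1) x := by
      by_cases h0 : Ξ (i + 1 + (q + 1) + 1) - Ξ (i + 1) = 0
      · have h2 : Ξ (i + 1 + q + 1) - Ξ (i + 1) = 0 := by
          have a1 := hΞ (show i + 1 ≤ i + 1 + q + 1 by omega)
          have a2 := hΞ (show i + 1 + q + 1 ≤ i + 1 + (q + 1) + 1 by omega)
          linarith
        rw [nbpiece_eq_zero_of_eq _ _ _ h0, nbpiece_eq_zero_of_eq q (i + 1) x h2, h0]
        simp
      · have h3 : nbpiece Ξ m (q + 1) (i + 1) x = _ / _ := rfl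
        rw [h3, bpiece_succ]
        field_simp
        rw [show i + 1 + (q + 1) + 1 = i + q + 3 by ring, show i + (q + 1) + 2 = i + q + 3 by ring,
          show i + 1 + q + 2 = i + q + 3 by ring]
        ring
    simp only [id_eq, one_mul, neg_mul]
    push_cast
    linear_combination hA + hB

theorem contDiff_bpiece (q i : ℕ) : ContDiff ℝ ∞ (bpiece Ξ m q i) := by
  induction q generalizing i with
  | zero => exact contDiff_const
  | succ q ih =>
    have h : bpiece Ξ m (q + 1) i = fun x => (x - Ξ i) / (Ξ (i + q + 1) - Ξ i) * bpiece Ξ m q i x +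
        (Ξ (i + q + 2) - x) / (Ξ (i + q + 2) - Ξ (i + 1)) * bpiece Ξ m q (i + 1) x := rfl
    rw [h]
    exact (((contDiff_id.sub contDiff_const).div_const _).mul (ih i)).add
      (((contDiff_const.sub contDiff_id).div_const _).mul (ih (i + 1)))

theorem sum_bpiece (hΞ : Monotone Ξ) (hm : Ξ m < Ξ (m + 1)) {n : ℕ} (hn : m < n) (q : ℕ)
    (hq : q ≤ m) (x : ℝ) : ∑ i ∈ Finset.range n, bpiece Ξ m q i x = 1 := by
  induction q with
  | zero => simp [bpiece, hn]
  | succ q ih =>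
    rw [← ih (by omega)]
    obtain ⟨k, rfl⟩ : ∃ k, n = k + 1 := ⟨n - 1, by omega⟩
    have hz : nbpiece Ξ m q (k + 1) x = 0 := nbpiece_eq_zero _ _ _ (by omega)
    have h0 : nbpiece Ξ m q 0 x = 0 := nbpiece_eq_zero _ _ _ (by omega)
    simp only [bpiece_succ, Finset.sum_add_distrib]
    rw [Finset.sum_range_succ' (fun i => (x - Ξ i) * nbpiece Ξ m q i x),
      Finset.sum_range_succ (fun i => (Ξ (i + q + 2) - x) * nbpiece Ξ m q (i + 1) x),
      Finset.sum_range_succ' (fun i => bpiece Ξ m q i x), hz, h0,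
      bpiece_eq_zero q 0 x (by omega)]
    simp only [mul_zero, add_zero, ← Finset.sum_add_distrib]
    refine Finset.sum_congr rfl fun i _ => ?_
    rw [← sub_mul_nbpiece hΞ hm q (i + 1) x, show i + 1 + q + 1 = i + q + 2 by ring]
    ring

theorem bpiece_nonneg (hΞ : Monotone Ξ) (q i : ℕ) {x : ℝ} (h1 : Ξ m ≤ x) (h2 : x ≤ Ξ (m + 1)) :
    0 ≤ bpiece Ξ m q i x := by
  have hs : ∀ a b, a ≤ b → 0 ≤ Ξ b - Ξ a := fun a b h => sub_nonneg.2 (hΞ h)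
  induction q generalizing i with
  | zero => rw [bpiece]; split_ifs <;> norm_num
  | succ q ih =>
    rw [bpiece]
    refine add_nonneg ?_ ?_
    · by_cases h : m < i
      · rw [bpiece_eq_zero _ _ _ (Or.inl h), mul_zero]
      · have := hΞ (not_lt.1 h)
        exact mul_nonneg (div_nonneg (by linarith) (hs _ _ (by omega))) (ih i)
    · by_cases h : i + 1 + q < m
      · rw [bpiece_eq_zero _ _ _ (Or.inr h), mul_zero]
      · have := hΞ (show m + 1 ≤ i + q + 2 by omega)
        exact mul_nonneg (div_nonneg (by linarith) (hs _ _ (by omega))) (ih (i + 1))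

/-- Values at the right end of a span, for degrees up to the multiplicity of the end point. -/
theorem bpiece_right_end {μ : ℕ} {t : ℝ} (hμ : ∀ k, m < k → k ≤ m + μ → Ξ k = t) (ht : Ξ m < t)
    (q i : ℕ) (hq : q ≤ μ) :
    bpiece Ξ m q i t = if i = m then 1 else 0 := by
  induction q generalizing i with
  | zero => rfl
  | succ q ih =>
    rw [bpiece, ih i (by omega), ih (i + 1) (by omega)]
    by_cases h1 : i = m
    · subst h1
      rw [if_pos rfl, if_neg (by omega), hμ (i + q + 1) (by omega) (by omega), div_self (by linarith)]
      ring
    · by_cases h2 : i + 1 = m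
      · rw [if_neg h1, if_pos h2, hμ (i + q + 2) (by omega) (by omega)]
        ring
      · rw [if_neg h1, if_neg h2]; ring

/-- Values at the left end of a span, for degrees up to the multiplicity of the end point. -/
theorem bpiece_left_end {μ : ℕ} {t : ℝ} (hμ : ∀ k, k ≤ m → m < k + μ → Ξ k = t)
    (ht : t < Ξ (m + 1)) (q i : ℕ) (hq : q < μ + 1) :
    bpiece Ξ m q i t = if i + q = m then 1 else 0 := by
  induction q generalizing i with
  | zero => rfl
  | succ q ih =>
    rw [bpiece, ih i (by omega), ih (i + 1) (by omega)]
    by_cases h1 : i + q = m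
    · rw [if_pos h1, if_neg (by omega), if_neg (by omega), hμ i (by omega) (by omega)]
      ring
    · by_cases h2 : i + (q + 1) = m
      · rw [if_neg h1, if_pos (by omega), if_pos h2, hμ (i + 1) (by omega) (by omega),
          show i + q + 2 = m + 1 by omega, div_self (by linarith)]
        ring
      · rw [if_neg h1, if_neg (by omega), if_neg h2]; ring

/-- Continuity across a knot whose multiplicity is at most the degree. -/
theorem bpiece_eq_bpiece {m' : ℕ} {t : ℝ} {q : ℕ} (hmm : m ≤ m') (hq : m' ≤ m + q)
    (hk : ∀ k, m < k → k ≤ m' → Ξ k = t) (hm : Ξ m < t) (hm' : t < Ξ (m' + 1)) (h : m < m') (i : ℕ) :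
    bpiece Ξ m q i t = bpiece Ξ m' q i t := by
  obtain ⟨μ, rfl⟩ := Nat.exists_eq_add_of_le hmm
  have hq' : μ ≤ q := by omega
  clear hq
  induction q, hq' using Nat.le_induction generalizing i with
  | base =>
    rw [bpiece_right_end hk hm μ i le_rfl,
      bpiece_left_end (μ := μ) (fun k h1 h2 => hk k (by omega) h1) hm' μ i (by omega)]
    simp
  | succ q _ ih => rw [bpiece, bpiece, ih, ih]

/-- Local linear independence: on a nonempty span the `q + 1` splines that do not vanish there are
linearly independent. -/
theorem bpiece_linearIndep (hΞ : Monotone Ξ) (hm : Ξ m < Ξ (m + 1)) {n : ℕ} (hn : m < n) (q : ℕ)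
    (hq : q ≤ m) (c : ℕ → ℝ)
    (h : ∀ t ∈ Ioo (Ξ m) (Ξ (m + 1)), ∑ i ∈ Finset.range n, c i * bpiece Ξ m q i t = 0)
    (i : ℕ) (hi : i ≤ m) (hi' : m ≤ i + q) : c i = 0 := by
  have hne : (Ioo (Ξ m) (Ξ (m + 1))).Nonempty := nonempty_Ioo.2 hm
  induction q generalizing c i with
  | zero =>
    obtain ⟨t, ht⟩ := hne
    obtain rfl : i = m := by omega
    have := h t ht
    simpa [bpiece, hn] using this
  | succ q ih =>
    -- the derivative is a combination of splines of degree `q` with the differences as coefficients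
    have hd : ∀ t ∈ Ioo (Ξ m) (Ξ (m + 1)), ∑ i ∈ Finset.range n,
        (if i = 0 then 0 else (c i - c (i - 1)) / (Ξ (i + q + 1) - Ξ i)) * bpiece Ξ m q i t = 0 := by
      intro t ht
      have h1 : HasDerivAt (fun t => ∑ i ∈ Finset.range n, c i * bpiece Ξ m (q + 1) i t)
          (∑ i ∈ Finset.range n, c i *
            ((q + 1) * (nbpiece Ξ m q i t - nbpiece Ξ m q (i + 1) t))) t :=
        HasDerivAt.fun_sum fun i _ => (hasDerivAt_bpiece hΞ q i t).const_mul (c i)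
      have h2 : HasDerivAt (fun t => ∑ i ∈ Finset.range n, c i * bpiece Ξ m (q + 1) i t) 0 t :=
        (hasDerivAt_const t (0 : ℝ)).congr_of_eventuallyEq
          (Filter.eventually_of_mem (isOpen_Ioo.mem_nhds ht) h)
      have h3 := h1.unique h2
      obtain ⟨k, rfl⟩ : ∃ k, n = k + 1 := ⟨n - 1, by omega⟩
      have hz : nbpiece Ξ m q (k + 1) t = 0 := nbpiece_eq_zero _ _ _ (by omega)
      have h0 : nbpiece Ξ m q 0 t = 0 := nbpiece_eq_zero _ _ _ (by omega)
      have h4 : ∑ i ∈ Finset.range (k + 1), c i * (nbpiece Ξ m q i t - nbpiece Ξ m q (i + 1) t)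
          = 0 := by
        have hq0 : ((q : ℝ) + 1) ≠ 0 := by positivity
        refine (mul_eq_zero.1 ?_).resolve_left hq0
        rw [Finset.mul_sum, ← h3]
        exact Finset.sum_congr rfl fun i _ => by ring
      simp only [mul_sub, Finset.sum_sub_distrib] at h4
      rw [Finset.sum_range_succ' (fun i => c i * nbpiece Ξ m q i t),
        Finset.sum_range_succ (fun i => c i * nbpiece Ξ m q (i + 1) t), hz, h0, mul_zero, mul_zero,
        add_zero, add_zero, ← Finset.sum_sub_distrib] at h4
      rw [Finset.sum_range_succ', if_pos rfl, zero_mul, add_zero, ← h4]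
      refine Finset.sum_congr rfl fun i _ => ?_
      rw [if_neg (Nat.succ_ne_zero i), nbpiece, Nat.add_sub_cancel]
      ring
    have hc : ∀ i, i ≤ m → m ≤ i + q → c i = c (i - 1) := by
      intro i h1 h2
      have h3 := ih (by omega) _ hd i h1 h2
      rw [if_neg (by omega)] at h3
      have h4 : Ξ i ≤ Ξ m := hΞ h1
      have h5 : Ξ (m + 1) ≤ Ξ (i + q + 1) := hΞ (by omega)
      rcases div_eq_zero_iff.1 h3 with h6 | h6 <;> linarith
    have hc' : ∀ k, k ≤ q + 1 → c (m - k) = c m := by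
      intro k hk
      induction k with
      | zero => rfl
      | succ k ihk => rw [← ihk (by omega), hc (m - k) (by omega) (by omega), Nat.sub_sub]
    have hcm : ∀ i, i ≤ m → m ≤ i + (q + 1) → c i = c m := fun i h1 h2 => by
      rw [← hc' (m - i) (by omega), show m - (m - i) = i by omega]
    obtain ⟨t, ht⟩ := hne
    have h6 := h t ht
    have h7 : ∑ i ∈ Finset.range n, c i * bpiece Ξ m (q + 1) i t
        = c m * ∑ i ∈ Finset.range n, bpiece Ξ m (q + 1) i t := by
      rw [Finset.mul_sum]
      refine Finset.sum_congr rfl fun i _ => ?_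
      by_cases h8 : m < i ∨ i + (q + 1) < m
      · rw [bpiece_eq_zero _ _ _ h8]; ring
      · rw [hcm i (by omega) (by omega)]
    rw [h7, sum_bpiece hΞ hm hn (q + 1) hq, mul_one] at h6
    rw [hcm i hi hi', h6]

end Pieces
end

noncomputable section

/-! ### Splines on an open knot vector -/

/-- The points of the open unit interval that are not knots. -/
def genericSet (p n : ℕ) (Ξ : ℕ → ℝ) : Set ℝ := {t | t ∈ Ioo (0 : ℝ) 1 ∧ ∀ m, m ≤ n + p → Ξ m ≠ t}

/-- The derivative of a B-spline of degree `p`, as a difference of Curry–Schoenberg splines. -/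
def bsplineDeriv (Ξ : ℕ → ℝ) (p : ℕ) : ℕ → ℝ → ℝ
  | 0, t => -curryBspline Ξ p 0 t
  | k + 1, t => curryBspline Ξ p k t - curryBspline Ξ p (k + 1) t

theorem measurable_bspline (Ξ : ℕ → ℝ) (q i : ℕ) : Measurable (bspline Ξ q i) := by
  induction q generalizing i with
  | zero =>
    refine Measurable.ite ?_ measurable_const measurable_const
    exact (measurableSet_Ico (a := Ξ i) (b := Ξ (i + 1))).union
      ((measurableSet_singleton (1 : ℝ)).inter (MeasurableSet.const _))
  | succ q ih =>
    exact (((measurable_id.sub_const _).div_const _).mul (ih i)).add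
      (((measurable_id.const_sub _).div_const _).mul (ih (i + 1)))

theorem measurable_curryBspline (Ξ : ℕ → ℝ) (p i : ℕ) : Measurable (curryBspline Ξ p i) :=
  (measurable_bspline Ξ (p - 1) (i + 1)).const_mul _

theorem measurable_bsplineDeriv (Ξ : ℕ → ℝ) (p i : ℕ) : Measurable (bsplineDeriv Ξ p i) := by
  cases i with
  | zero => exact (measurable_curryBspline Ξ p 0).neg
  | succ k => exact (measurable_curryBspline Ξ p k).sub (measurable_curryBspline Ξ p (k + 1))

theorem bspline_bounded (Ξ : ℕ → ℝ) (q i : ℕ) : ∃ C, ∀ t ∈ Icc (0 : ℝ) 1, |bspline Ξ q i t| ≤ C := by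
  have hlin : ∀ a b c : ℝ, ∃ C, ∀ t ∈ Icc (0 : ℝ) 1, |(a * t + b) / c| ≤ C := fun a b c => by
    obtain ⟨C, hC⟩ := isCompact_Icc.exists_bound_of_continuousOn
      (f := fun t : ℝ => (a * t + b) / c) (s := Icc (0 : ℝ) 1) (by fun_prop)
    exact ⟨C, hC⟩
  induction q generalizing i with
  | zero =>
    refine ⟨1, fun t _ => ?_⟩
    rw [bspline]
    split_ifs <;> norm_num
  | succ q ih =>
    obtain ⟨C1, h1⟩ := ih i
    obtain ⟨C2, h2⟩ := ih (i + 1)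
    obtain ⟨C3, h3⟩ := hlin 1 (-Ξ i) (Ξ (i + q + 1) - Ξ i)
    obtain ⟨C4, h4⟩ := hlin (-1) (Ξ (i + q + 2)) (Ξ (i + q + 2) - Ξ (i + 1))
    refine ⟨C3 * C1 + C4 * C2, fun t ht => ?_⟩
    rw [bspline]
    refine (abs_add_le _ _).trans (add_le_add ?_ ?_) <;> rw [abs_mul]
    · have := h3 t ht
      rw [show 1 * t + -Ξ i = t - Ξ i by ring] at this
      exact mul_le_mul this (h1 t ht) (abs_nonneg _) ((abs_nonneg _).trans this)
    · have := h4 t ht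
      rw [show -1 * t + Ξ (i + q + 2) = Ξ (i + q + 2) - t by ring] at this
      exact mul_le_mul this (h2 t ht) (abs_nonneg _) ((abs_nonneg _).trans this)

theorem curryBspline_bounded (Ξ : ℕ → ℝ) (p i : ℕ) :
    ∃ C, ∀ t ∈ Icc (0 : ℝ) 1, |curryBspline Ξ p i t| ≤ C := by
  obtain ⟨C, hC⟩ := bspline_bounded Ξ (p - 1) (i + 1)
  refine ⟨|(p : ℝ) / (Ξ (i + 1 + p) - Ξ (i + 1))| * C, fun t ht => ?_⟩
  rw [curryBspline, abs_mul]
  exact mul_le_mul_of_nonneg_left (hC t ht) (abs_nonneg _)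

theorem bsplineDeriv_bounded (Ξ : ℕ → ℝ) (p i : ℕ) :
    ∃ C, ∀ t ∈ Icc (0 : ℝ) 1, |bsplineDeriv Ξ p i t| ≤ C := by
  cases i with
  | zero =>
    obtain ⟨C, hC⟩ := curryBspline_bounded Ξ p 0
    exact ⟨C, fun t ht => by rw [bsplineDeriv, abs_neg]; exact hC t ht⟩
  | succ k =>
    obtain ⟨C, hC⟩ := curryBspline_bounded Ξ p k
    obtain ⟨C', hC'⟩ := curryBspline_bounded Ξ p (k + 1)
    exact ⟨C + C', fun t ht => (abs_sub _ _).trans (add_le_add (hC t ht) (hC' t ht))⟩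

/-- The knots continued by the constant `1` (the value of the last knot). -/
def clampKnots (N : ℕ) (Ξ : ℕ → ℝ) (k : ℕ) : ℝ := Ξ (min k N)

namespace IsOpenKnotVector

variable {p n : ℕ} {Ξ : ℕ → ℝ}

theorem clamp_of_le {N k : ℕ} (h : k ≤ N) : clampKnots N Ξ k = Ξ k := by
  rw [clampKnots, min_eq_left h]

theorem monotone_clamp (h : IsOpenKnotVector p n Ξ) : Monotone (clampKnots (n + p) Ξ) := by
  refine monotone_nat_of_le_succ fun k => ?_
  by_cases hk : k < n + p
  · rw [clamp_of_le hk.le, clamp_of_le hk]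
    exact h.mono k hk
  · rw [clampKnots, clampKnots, min_eq_right (by omega), min_eq_right (by omega)]

theorem clamp_le_one (h : IsOpenKnotVector p n Ξ) (k : ℕ) : clampKnots (n + p) Ξ k ≤ 1 := by
  have h1 := h.monotone_clamp (le_max_left k (n + p))
  refine h1.trans_eq ?_
  rw [clampKnots, min_eq_right (le_max_right _ _)]
  exact h.right _ (by omega) le_rfl

theorem clamp (h : IsOpenKnotVector p n Ξ) : IsOpenKnotVector p n (clampKnots (n + p) Ξ) where
  card := h.card
  mono m hm := h.monotone_clamp (Nat.le_succ m)
  left m hm := by rw [clamp_of_le (by omega)]; exact h.left m hm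
  right m hm hm' := by rw [clamp_of_le hm']; exact h.right m hm hm'
  mult m hm hm' := by rw [clamp_of_le (by omega), clamp_of_le (by omega)]; exact h.mult m hm hm'

theorem bspline_clamp {k : ℕ} (hk : k < n) (t : ℝ) :
    bspline (clampKnots (n + p) Ξ) p k t = bspline Ξ p k t :=
  bspline_congr _ _ _ fun j _ hj => clamp_of_le (by omega)

theorem span_right (h : IsOpenKnotVector p n Ξ) {t : ℝ} (h0 : 0 ≤ t) (h1 : t < 1) :
    ∃ m, p ≤ m ∧ m < n ∧ Ξ m ≤ t ∧ t < Ξ (m + 1) := by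
  classical
  have hex : ∃ k, p < k ∧ t < Ξ k := ⟨n, h.card, by rw [h.right n le_rfl (by omega)]; exact h1⟩
  have hs := Nat.find_spec hex
  have hmin : ∀ j, j < Nat.find hex → ¬(p < j ∧ t < Ξ j) := fun j hj => Nat.find_min hex hj
  have hle : Nat.find hex ≤ n :=
    Nat.find_min' hex ⟨h.card, by rw [h.right n le_rfl (by omega)]; exact h1⟩
  generalize Nat.find hex = k at hs hle hmin
  refine ⟨k - 1, by omega, by omega, ?_, by rw [Nat.sub_add_cancel (by omega)]; exact hs.2⟩
  by_cases hk : k - 1 = p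
  · rw [hk, h.left p le_rfl]; exact h0
  · by_contra hc
    exact hmin (k - 1) (by omega) ⟨by omega, not_le.1 hc⟩

theorem span_left (h : IsOpenKnotVector p n Ξ) {t : ℝ} (h0 : 0 < t) (h1 : t ≤ 1) :
    ∃ m, p ≤ m ∧ m < n ∧ Ξ m < t ∧ t ≤ Ξ (m + 1) := by
  classical
  have hn : t ≤ Ξ n := by rw [h.right n le_rfl (by omega)]; exact h1
  have hex : ∃ k, p < k ∧ t ≤ Ξ k := ⟨n, h.card, hn⟩
  have hs := Nat.find_spec hex
  have hmin : ∀ j, j < Nat.find hex → ¬(p < j ∧ t ≤ Ξ j) := fun j hj => Nat.find_min hex hj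
  have hle : Nat.find hex ≤ n := Nat.find_min' hex ⟨h.card, hn⟩
  generalize Nat.find hex = k at hs hle hmin
  refine ⟨k - 1, by omega, by omega, ?_, by rw [Nat.sub_add_cancel (by omega)]; exact hs.2⟩
  by_cases hk : k - 1 = p
  · rw [hk, h.left p le_rfl]; exact h0
  · by_contra hc
    exact hmin (k - 1) (by omega) ⟨by omega, not_lt.1 hc⟩

/-- Near a point of `[0,1)`, to the right of it, the B-splines are polynomials. -/
theorem eq_bpiece_right (h : IsOpenKnotVector p n Ξ) {t : ℝ} (h0 : 0 ≤ t) (h1 : t < 1) :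
    ∃ m, p ≤ m ∧ m < n ∧ Ξ m < Ξ (m + 1) ∧ Ξ m ≤ t ∧ t < Ξ (m + 1) ∧
      ∀ x ∈ Ico t (Ξ (m + 1)), ∀ q i, i + q + 1 ≤ n + p →
        bspline Ξ q i x = bpiece (clampKnots (n + p) Ξ) m q i x := by
  obtain ⟨m, h2, h3, h4, h5⟩ := h.span_right h0 h1
  refine ⟨m, h2, h3, h4.trans_lt h5, h4, h5, fun x hx q i hi => ?_⟩
  rw [← bspline_eq_bpiece h.monotone_clamp h.clamp_le_one, bspline_congr _ _ _ fun j _ hj => ?_]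
  · exact (clamp_of_le (by omega)).symm
  · left
    rw [clamp_of_le (by omega), clamp_of_le (by omega)]
    exact ⟨h4.trans hx.1, hx.2⟩

/-- Near a point of `(0,1]`, to the left of it and at the point itself, the B-splines of degree `p`
are polynomials. -/
theorem eq_bpiece_left (h : IsOpenKnotVector p n Ξ) {t : ℝ} (h0 : 0 < t) (h1 : t ≤ 1) :
    ∃ m, p ≤ m ∧ m < n ∧ Ξ m < Ξ (m + 1) ∧ Ξ m < t ∧ t ≤ Ξ (m + 1) ∧
      ∀ x ∈ Ioc (Ξ m) t, ∀ i, i < n → bspline Ξ p i x = bpiece (clampKnots (n + p) Ξ) m p i x := by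
  obtain ⟨m, h2, h3, h4, h5⟩ := h.span_left h0 h1
  have hm1 : clampKnots (n + p) Ξ m = Ξ m := clamp_of_le (by omega)
  have hm2 : clampKnots (n + p) Ξ (m + 1) = Ξ (m + 1) := clamp_of_le (by omega)
  have hle := h.clamp_le_one (m + 1)
  refine ⟨m, h2, h3, h4.trans_le h5, h4, h5, fun x hx i hi => ?_⟩
  rw [← bspline_clamp hi]
  rcases lt_or_eq_of_le (hx.2.trans h5) with h6 | h6
  · exact bspline_eq_bpiece h.monotone_clamp h.clamp_le_one
      (Or.inl ⟨by rw [hm1]; exact hx.1.le, by rw [hm2]; exact h6⟩) _ _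
  rcases lt_or_eq_of_le (hx.2.trans h1) with h7 | h7
  · obtain ⟨m', a1, a2, a3, a4⟩ := h.span_right (h0.le.trans (by rw [h6]; exact h5)) h7
    have hm1' : clampKnots (n + p) Ξ m' = Ξ m' := clamp_of_le (by omega)
    have hm2' : clampKnots (n + p) Ξ (m' + 1) = Ξ (m' + 1) := clamp_of_le (by omega)
    rw [bspline_eq_bpiece (m := m') h.monotone_clamp h.clamp_le_one
      (Or.inl ⟨by rw [hm1']; exact a3, by rw [hm2']; exact a4⟩)]
    have hmm : m < m' := by
      by_contra hc
      have := h.monotone_clamp (show m' + 1 ≤ m + 1 by omega)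
      rw [hm2, hm2'] at this
      linarith
    have hk : ∀ k, m < k → k ≤ m' → clampKnots (n + p) Ξ k = x := fun k b1 b2 => by
      have c1 := h.monotone_clamp (show m + 1 ≤ k by omega)
      have c2 := h.monotone_clamp b2
      rw [hm2] at c1
      rw [hm1'] at c2
      linarith
    have hmul : m' ≤ m + p := by
      by_contra hc
      have d0 : m + 1 < n := by omega
      have d1 := h.mult (m + 1) (by omega) d0
      have d2 := hk (m + 1 + p) (by omega) (by omega)
      rw [clamp_of_le (by omega)] at d2
      linarith
    exact (bpiece_eq_bpiece hmm.le hmul hk (by rw [hm1]; exact hx.1) (by rw [hm2']; exact a4)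
      hmm i).symm
  · exact bspline_eq_bpiece h.monotone_clamp h.clamp_le_one
      (Or.inr ⟨h7, by rw [hm1, hm2]; linarith [hx.1], by rw [hm2]; linarith⟩) _ _

/-- Smooth extension of the B-splines from a right neighbourhood of a point. -/
theorem exists_extension_right (h : IsOpenKnotVector p n Ξ) {t : ℝ} (h0 : 0 ≤ t) (h1 : t < 1) :
    ∃ q : ℕ → ℝ → ℝ, (∀ k, ContDiff ℝ ∞ (q k)) ∧
      ∀ᶠ x in nhds t, t ≤ x → x ∈ Icc (0 : ℝ) 1 ∧ ∀ k < n, bspline Ξ p k x = q k x := by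
  obtain ⟨m, -, h3, -, h5, h6, h7⟩ := h.eq_bpiece_right h0 h1
  refine ⟨fun k => bpiece (clampKnots (n + p) Ξ) m p k, fun k => contDiff_bpiece _ _, ?_⟩
  filter_upwards [Iio_mem_nhds h6] with x hx htx
  have := h.clamp_le_one (m + 1)
  rw [clamp_of_le (by omega)] at this
  exact ⟨⟨h0.trans htx, hx.le.trans this⟩, fun k hk => h7 x ⟨htx, hx⟩ p k (by omega)⟩

/-- Smooth extension of the B-splines from a left neighbourhood of a point. -/
theorem exists_extension_left (h : IsOpenKnotVector p n Ξ) {t : ℝ} (h0 : 0 < t) (h1 : t ≤ 1) :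
    ∃ q : ℕ → ℝ → ℝ, (∀ k, ContDiff ℝ ∞ (q k)) ∧
      ∀ᶠ x in nhds t, x ≤ t → x ∈ Icc (0 : ℝ) 1 ∧ ∀ k < n, bspline Ξ p k x = q k x := by
  obtain ⟨m, -, h3, -, h5, h6, h7⟩ := h.eq_bpiece_left h0 h1
  refine ⟨fun k => bpiece (clampKnots (n + p) Ξ) m p k, fun k => contDiff_bpiece _ _, ?_⟩
  filter_upwards [Ioi_mem_nhds h5] with x hx htx
  have := h.monotone_clamp (Nat.zero_le m)
  rw [clamp_of_le (by omega), clamp_of_le (by omega), h.left 0 (by omega)] at this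
  exact ⟨⟨this.trans hx.le, htx.trans h1⟩, fun k hk => h7 x ⟨hx, htx⟩ k hk⟩

/-- The multiplicity of the interior knots is at most the degree, and the last knot span is closed
at `1`, so that the splines are continuous. -/
theorem continuousOn_bspline (h : IsOpenKnotVector p n Ξ) {k : ℕ} (hk : k < n) :
    ContinuousOn (bspline Ξ p k) (Icc 0 1) := by
  intro t ht
  have hR : ContinuousWithinAt (bspline Ξ p k) (Icc 0 1 ∩ Ici t) t := by
    rcases lt_or_eq_of_le ht.2 with h1 | h1
    · obtain ⟨q, hq, he⟩ := h.exists_extension_right ht.1 h1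
      have he' : ∀ᶠ x in nhdsWithin t (Icc 0 1 ∩ Ici t), bspline Ξ p k x = q k x := by
        filter_upwards [nhdsWithin_le_nhds he, self_mem_nhdsWithin] with x hx hx'
        exact (hx hx'.2).2 k hk
      exact ((hq k).continuous.continuousWithinAt).congr_of_eventuallyEq he'
        ((he.self_of_nhds le_rfl).2 k hk)
    · refine (continuousWithinAt_singleton (f := bspline Ξ p k) (x := t)).mono fun x hx => ?_
      exact le_antisymm (hx.1.2.trans_eq h1.symm) hx.2
  have hL : ContinuousWithinAt (bspline Ξ p k) (Icc 0 1 ∩ Iic t) t := by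
    rcases lt_or_eq_of_le ht.1 with h1 | h1
    · obtain ⟨q, hq, he⟩ := h.exists_extension_left h1 ht.2
      have he' : ∀ᶠ x in nhdsWithin t (Icc 0 1 ∩ Iic t), bspline Ξ p k x = q k x := by
        filter_upwards [nhdsWithin_le_nhds he, self_mem_nhdsWithin] with x hx hx'
        exact (hx hx'.2).2 k hk
      exact ((hq k).continuous.continuousWithinAt).congr_of_eventuallyEq he'
        ((he.self_of_nhds le_rfl).2 k hk)
    · refine (continuousWithinAt_singleton (f := bspline Ξ p k) (x := t)).mono fun x hx => ?_
      exact le_antisymm hx.2 (h1.symm.trans_le hx.1.1)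
  refine (hR.union hL).mono fun x hx => ?_
  rcases le_total t x with h1 | h1
  · exact Or.inl ⟨hx, h1⟩
  · exact Or.inr ⟨hx, h1⟩

/-- Near a generic point all the splines are polynomials. -/
theorem eq_bpiece_generic (h : IsOpenKnotVector p n Ξ) {t : ℝ} (ht : t ∈ genericSet p n Ξ) :
    ∃ m, p ≤ m ∧ m < n ∧ Ξ m < Ξ (m + 1) ∧
      ∀ᶠ x in nhds t, ∀ q i, i + q + 1 ≤ n + p →
        bspline Ξ q i x = bpiece (clampKnots (n + p) Ξ) m q i x := by
  obtain ⟨m, h2, h3, h4, h5, h6, -⟩ := h.eq_bpiece_right ht.1.1.le ht.1.2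
  refine ⟨m, h2, h3, h4, ?_⟩
  have h7 : Ξ m < t := lt_of_le_of_ne h5 (ht.2 m (by omega))
  filter_upwards [Ioo_mem_nhds h7 h6] with x hx q i hi
  rw [← bspline_eq_bpiece h.monotone_clamp h.clamp_le_one, bspline_congr _ _ _ fun j _ hj => ?_]
  · exact (clamp_of_le (by omega)).symm
  · left
    rw [clamp_of_le (by omega), clamp_of_le (by omega)]
    exact ⟨hx.1.le, hx.2⟩

theorem contDiffAt_bspline (h : IsOpenKnotVector p n Ξ) {t : ℝ} (ht : t ∈ genericSet p n Ξ)
    {q i : ℕ} (hi : i + q + 1 ≤ n + p) : ContDiffAt ℝ ∞ (bspline Ξ q i) t := by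
  obtain ⟨m, -, -, -, he⟩ := h.eq_bpiece_generic ht
  exact (contDiff_bpiece q i).contDiffAt.congr_of_eventuallyEq
    (he.mono fun x hx => hx q i hi)

theorem continuousAt_curryBspline (h : IsOpenKnotVector p n Ξ) (hp : 1 ≤ p) {t : ℝ}
    (ht : t ∈ genericSet p n Ξ) {i : ℕ} (hi : i < n) : ContinuousAt (curryBspline Ξ p i) t :=
  (h.contDiffAt_bspline ht (q := p - 1) (i := i + 1) (by omega)).continuousAt.const_mul _

theorem continuousAt_bsplineDeriv (h : IsOpenKnotVector p n Ξ) (hp : 1 ≤ p) {t : ℝ}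
    (ht : t ∈ genericSet p n Ξ) {i : ℕ} (hi : i < n) : ContinuousAt (bsplineDeriv Ξ p i) t := by
  cases i with
  | zero => exact (h.continuousAt_curryBspline hp ht hi).neg
  | succ k =>
    exact (h.continuousAt_curryBspline hp ht (by omega)).sub (h.continuousAt_curryBspline hp ht hi)

theorem curryBspline_last (h : IsOpenKnotVector p n Ξ) {k : ℕ} (hk : k + 1 = n) (t : ℝ) :
    curryBspline Ξ p k t = 0 := by
  rw [curryBspline, h.right (k + 1 + p) (by omega) (by omega), h.right (k + 1) (by omega) (by omega)]
  simp

theorem curryBspline_eq_nbpiece (hp : 1 ≤ p) {m k : ℕ} (hk : k < n) {x : ℝ}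
    (hx : ∀ q i, i + q + 1 ≤ n + p → bspline Ξ q i x = bpiece (clampKnots (n + p) Ξ) m q i x) :
    curryBspline Ξ p k x = p * nbpiece (clampKnots (n + p) Ξ) m (p - 1) (k + 1) x := by
  rw [curryBspline, nbpiece, hx (p - 1) (k + 1) (by omega), clamp_of_le (by omega),
    clamp_of_le (by omega), show k + 1 + (p - 1) + 1 = k + 1 + p by omega]
  ring

theorem hasDerivAt_bspline (h : IsOpenKnotVector p n Ξ) (hp : 1 ≤ p) {t : ℝ}
    (ht : t ∈ genericSet p n Ξ) {k : ℕ} (hk : k < n) :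
    HasDerivAt (bspline Ξ p k) (bsplineDeriv Ξ p k t) t := by
  obtain ⟨m, h1, h2, h3, he⟩ := h.eq_bpiece_generic ht
  have hm : clampKnots (n + p) Ξ m < clampKnots (n + p) Ξ (m + 1) := by
    rw [clamp_of_le (by omega), clamp_of_le (by omega)]; exact h3
  obtain ⟨q, rfl⟩ : ∃ q, p = q + 1 := ⟨p - 1, by omega⟩
  have h4 := (hasDerivAt_bpiece h.monotone_clamp q k t).congr_of_eventuallyEq
    (he.mono fun x hx => hx (q + 1) k (by omega))
  refine h4.congr_deriv ?_
  have hc : ∀ j, j < n → curryBspline Ξ (q + 1) j t =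
      (q + 1) * nbpiece (clampKnots (n + (q + 1)) Ξ) m q (j + 1) t := fun j hj => by
    rw [curryBspline_eq_nbpiece hp hj he.self_of_nhds]
    push_cast
    rfl
  cases k with
  | zero => rw [bsplineDeriv, hc 0 hk, nbpiece_eq_zero q 0 t (by omega)]; ring
  | succ k => rw [bsplineDeriv, hc k (by omega), hc (k + 1) hk]; ring

theorem bspline_zero (h : IsOpenKnotVector p n Ξ) {k : ℕ} (hk : k < n) :
    bspline Ξ p k 0 = if k = 0 then 1 else 0 := by
  have hc := h.card
  have h1 : (0 : ℝ) < 1 := one_pos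
  obtain ⟨m, a1, a2, a3, a4, a5, a6⟩ := h.eq_bpiece_right le_rfl h1
  have hm : m = p := by
    by_contra hne
    have b0 := h.mult (m - p) (by omega) (by omega)
    rw [Nat.sub_add_cancel a1] at b0
    have b1 := h.clamp.monotone_clamp (Nat.zero_le (m - p))
    rw [clamp_of_le (by omega), clamp_of_le (by omega), clamp_of_le (by omega),
      clamp_of_le (by omega), h.left 0 (by omega)] at b1
    linarith
  subst hm
  rw [a6 0 ⟨le_rfl, a5⟩ m k (by omega), bpiece_left_end (μ := m + 1) (fun j b1 b2 => ?_) ?_ m k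
    (by omega)]
  · simp
  · rw [clamp_of_le (by omega)]; exact a5
  · rw [clamp_of_le (by omega)]; exact h.left _ ‹_›

theorem bspline_one (h : IsOpenKnotVector p n Ξ) {k : ℕ} (hk : k < n) :
    bspline Ξ p k 1 = if k + 1 = n then 1 else 0 := by
  have hc := h.card
  obtain ⟨m, a1, a2, a3, a4, a5, a6⟩ := h.eq_bpiece_left one_pos le_rfl
  have hm : m + 1 = n := by
    by_contra hne
    have b0 := h.mult (m + 1) (by omega) (by omega)
    have b1 := h.clamp_le_one (m + 1 + p)
    rw [clamp_of_le (by omega)] at b1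
    linarith
  have hm1 : clampKnots (n + p) Ξ m = Ξ m := clamp_of_le (by omega)
  have hm2 : clampKnots (n + p) Ξ (m + 1) = Ξ (m + 1) := clamp_of_le (by omega)
  rw [a6 1 ⟨a4, le_rfl⟩ k hk, bpiece_right_end (μ := p) (fun j b1 b2 => ?_) (by rw [hm1]; exact a4) p k le_rfl]
  · simp only [← hm, Nat.add_right_cancel_iff]
  · rw [clamp_of_le (by omega)]; exact h.right j (by omega) (by omega)

theorem exists_span (h : IsOpenKnotVector p n Ξ) {t : ℝ} (ht : t ∈ Icc (0 : ℝ) 1) :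
    ∃ m, p ≤ m ∧ m < n ∧ Ξ m < Ξ (m + 1) ∧ Ξ m ≤ t ∧ t ≤ Ξ (m + 1) ∧
      ∀ i < n, bspline Ξ p i t = bpiece (clampKnots (n + p) Ξ) m p i t := by
  rcases lt_or_eq_of_le ht.2 with h1 | h1
  · obtain ⟨m, a1, a2, a3, a4, a5, a6⟩ := h.eq_bpiece_right ht.1 h1
    exact ⟨m, a1, a2, a3, a4, a5.le, fun i hi => a6 t ⟨le_rfl, a5⟩ p i (by omega)⟩
  · obtain ⟨m, a1, a2, a3, a4, a5, a6⟩ := h.eq_bpiece_left (h1 ▸ one_pos) ht.2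
    exact ⟨m, a1, a2, a3, a4.le, a5, fun i hi => a6 t ⟨a4, le_rfl⟩ i hi⟩

theorem bspline_nonneg (h : IsOpenKnotVector p n Ξ) {t : ℝ} (ht : t ∈ Icc (0 : ℝ) 1) {k : ℕ}
    (hk : k < n) : 0 ≤ bspline Ξ p k t := by
  obtain ⟨m, a1, a2, a3, a4, a5, a6⟩ := h.exists_span ht
  rw [a6 k hk]
  exact bpiece_nonneg h.monotone_clamp _ _ (by rwa [clamp_of_le (by omega)])
    (by rwa [clamp_of_le (by omega)])

theorem sum_bspline (h : IsOpenKnotVector p n Ξ) {t : ℝ} (ht : t ∈ Icc (0 : ℝ) 1) :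
    ∑ k ∈ Finset.range n, bspline Ξ p k t = 1 := by
  obtain ⟨m, a1, a2, a3, a4, a5, a6⟩ := h.exists_span ht
  rw [← sum_bpiece (m := m) h.monotone_clamp
    (by rwa [clamp_of_le (by omega), clamp_of_le (by omega)]) a2 p a1 t]
  exact Finset.sum_congr rfl fun i hi => a6 i (Finset.mem_range.1 hi)

theorem exists_span_support {a b : ℕ} (hab : a ≤ b) (hlt : Ξ a < Ξ b) :
    ∃ m, a ≤ m ∧ m < b ∧ Ξ m < Ξ (m + 1) := by
  by_contra hc
  push Not at hc
  have : ∀ k, a + k ≤ b → Ξ (a + k) ≤ Ξ a := by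
    intro k
    induction k with
    | zero => intro _; exact le_rfl
    | succ k ih => intro hk; exact (hc (a + k) (by omega) (by omega)).trans (ih (by omega))
  have := this (b - a) (by omega)
  rw [Nat.add_sub_cancel' hab] at this
  linarith

/-- The interior of a nonempty knot span consists of generic points. -/
theorem span_generic (h : IsOpenKnotVector p n Ξ) {m : ℕ} (hm : m < n + p) {t : ℝ}
    (ht : t ∈ Ioo (Ξ m) (Ξ (m + 1))) : t ∈ genericSet p n Ξ := by
  have hle : ∀ a b, a ≤ b → b ≤ n + p → Ξ a ≤ Ξ b := fun a b h1 h2 => by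
    have := h.monotone_clamp h1
    rwa [clamp_of_le (by omega), clamp_of_le h2] at this
  have h0 := hle 0 m (by omega) hm.le
  have h1 := hle (m + 1) (n + p) hm le_rfl
  rw [h.left 0 (by omega)] at h0
  rw [h.right (n + p) (by omega) le_rfl] at h1
  refine ⟨⟨h0.trans_lt ht.1, ht.2.trans_le h1⟩, fun k hk he => ?_⟩
  rcases Nat.lt_or_ge m k with h2 | h2
  · have := hle (m + 1) k h2 hk
    linarith [ht.2]
  · have := hle k m h2 hm.le
    linarith [ht.1]

theorem bspline_linearIndep (h : IsOpenKnotVector p n Ξ) (hp : 1 ≤ p) (c : ℕ → ℝ)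
    (hc : ∀ t ∈ genericSet p n Ξ, ∑ k ∈ Finset.range n, c k * bspline Ξ p k t = 0)
    (k : ℕ) (hk : k < n) : c k = 0 := by
  have hcd := h.card
  have hlt : Ξ k < Ξ (k + p + 1) := by
    have h1 := h.mult (max k 1) (by omega) (by omega)
    have h2 := h.monotone_clamp (show k ≤ max k 1 by omega)
    have h3 := h.monotone_clamp (show max k 1 + p ≤ k + p + 1 by omega)
    rw [clamp_of_le (by omega), clamp_of_le (by omega)] at h2 h3
    linarith
  obtain ⟨m, h1, h2, h3⟩ := exists_span_support (by omega) hlt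
  have hpm : p ≤ m := by
    by_contra hcon
    rw [h.left m (by omega), h.left (m + 1) (by omega)] at h3
    exact lt_irrefl _ h3
  have hmn : m < n := by
    by_contra hcon
    rw [h.right m (by omega) (by omega), h.right (m + 1) (by omega) (by omega)] at h3
    exact lt_irrefl _ h3
  have hm1 : clampKnots (n + p) Ξ m = Ξ m := clamp_of_le (by omega)
  have hm2 : clampKnots (n + p) Ξ (m + 1) = Ξ (m + 1) := clamp_of_le (by omega)
  refine bpiece_linearIndep h.monotone_clamp (by rwa [hm1, hm2]) hmn p hpm c (fun t ht => ?_) k h1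
    (by omega)
  refine Eq.trans ?_ (hc t (h.span_generic (m := m) (by omega) (by rwa [hm1, hm2] at ht)))
  refine Finset.sum_congr rfl fun i hi => ?_
  rw [← bspline_clamp (p := p) (Finset.mem_range.1 hi),
    bspline_eq_bpiece h.monotone_clamp h.clamp_le_one (Or.inl ⟨ht.1.le, ht.2⟩)]

/-- The Curry–Schoenberg splines are linearly independent on the generic points, even locally: the
knot span that carries a given one determines its coefficient. -/
theorem curryBspline_linearIndep (h : IsOpenKnotVector p n Ξ) (hp : 1 ≤ p) (c : ℕ → ℝ)
    (hc : ∀ t ∈ genericSet p n Ξ, ∑ k ∈ Finset.range (n - 1), c k * curryBspline Ξ p k t = 0)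
    (k : ℕ) (hk : k < n - 1) : c k = 0 := by
  have hcd := h.card
  have hlt := h.mult (k + 1) (by omega) (by omega)
  obtain ⟨m, h1, h2, h3⟩ := exists_span_support (by omega) hlt
  have hpm : p ≤ m := by
    by_contra hcon
    rw [h.left m (by omega), h.left (m + 1) (by omega)] at h3
    exact lt_irrefl _ h3
  have hmn : m < n := by
    by_contra hcon
    rw [h.right m (by omega) (by omega), h.right (m + 1) (by omega) (by omega)] at h3
    exact lt_irrefl _ h3
  have hm1 : clampKnots (n + p) Ξ m = Ξ m := clamp_of_le (by omega)
  have hm2 : clampKnots (n + p) Ξ (m + 1) = Ξ (m + 1) := clamp_of_le (by omega)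
  have key := bpiece_linearIndep h.monotone_clamp (by rwa [hm1, hm2]) hmn (p - 1) (by omega)
    (fun i => if i = 0 then 0 else c (i - 1) * (p / (Ξ (i + p) - Ξ i)))
    (fun t ht => ?_) (k + 1) h1 (by omega)
  · simp only [Nat.add_eq_zero_iff, one_ne_zero, and_false, if_false, Nat.add_sub_cancel] at key
    have hp' : (p : ℝ) ≠ 0 := by positivity
    refine (mul_eq_zero.1 key).resolve_right (div_ne_zero hp' ?_)
    linarith
  · refine Eq.trans ?_ (hc t (h.span_generic (m := m) (by omega) (by rwa [hm1, hm2] at ht)))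
    obtain ⟨N, rfl⟩ : ∃ N, n = N + 1 := ⟨n - 1, by omega⟩
    rw [Finset.sum_range_succ', if_pos rfl, zero_mul, add_zero, Nat.add_sub_cancel]
    refine Finset.sum_congr rfl fun i hi => ?_
    have hi' := Finset.mem_range.1 hi
    rw [if_neg (Nat.succ_ne_zero i), Nat.add_sub_cancel, curryBspline,
      ← bspline_eq_bpiece h.monotone_clamp h.clamp_le_one (Or.inl ⟨ht.1.le, ht.2⟩),
      bspline_congr _ _ _ fun j _ hj => clamp_of_le (by omega), mul_assoc]

theorem genericSet_compl_finite : (Ioo (0 : ℝ) 1 \ genericSet p n Ξ).Finite := by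
  refine ((Set.finite_Iic (n + p)).image Ξ).subset fun t ht => ?_
  by_contra hc
  exact ht.2 ⟨ht.1, fun m hm he => hc ⟨m, hm, he⟩⟩

theorem genericSet_isOpen : IsOpen (genericSet p n Ξ) := by
  have : genericSet p n Ξ = Ioo 0 1 \ (Ξ '' Iic (n + p)) := by
    ext t
    refine and_congr Iff.rfl ⟨fun h ⟨m, hm, he⟩ => h m hm he, fun h m hm he => h ⟨m, hm, he⟩⟩
  rw [this]
  exact isOpen_Ioo.sdiff ((Set.finite_Iic (n + p)).image Ξ).isClosed

theorem Icc_subset_closure_genericSet : Icc (0 : ℝ) 1 ⊆ closure (genericSet p n Ξ) := by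
  have hd : Dense ((Ξ '' Iic (n + p))ᶜ : Set ℝ) :=
    ((Set.finite_Iic (n + p)).image Ξ).countable.dense_compl ℝ
  have h1 : Ioo (0 : ℝ) 1 ⊆ closure (genericSet p n Ξ) := by
    refine (hd.open_subset_closure_inter isOpen_Ioo).trans (closure_mono ?_)
    exact fun t ht => ⟨ht.1, fun m hm he => ht.2 ⟨m, hm, he⟩⟩
  rw [← closure_Ioo (zero_ne_one (α := ℝ))]
  exact closure_minimal h1 isClosed_closure

/-- Reflection of the knots reflects the splines. -/
theorem bspline_reflect {Ξ' : ℕ → ℝ} (hr : ∀ m, m ≤ n + p → Ξ' m = 1 - Ξ (n + p - m)) {t : ℝ}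
    (ht : t ∈ genericSet p n Ξ) (q i k : ℕ) (hik : i + k + q + 1 = n + p) :
    bspline Ξ' q k (1 - t) = bspline Ξ q i t := by
  have hr' : ∀ a b, a + b = n + p → Ξ' a = 1 - Ξ b := fun a b hab => by
    rw [hr a (by omega), show n + p - a = b by omega]
  induction q generalizing i k with
  | zero =>
    have h1 := ht.1.1
    have h2 := ht.1.2
    have h3 := ht.2 i (by omega)
    have h4 := ht.2 (i + 1) (by omega)
    simp only [bspline, hr' k (i + 1) (by omega), hr' (k + 1) i (by omega)]
    refine if_congr ⟨?_, ?_⟩ rfl rfl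
    · rintro (⟨a, b⟩ | ⟨a, -, -⟩)
      · exact Or.inl ⟨by linarith, lt_of_le_of_ne (by linarith) h4.symm⟩
      · linarith
    · rintro (⟨a, b⟩ | ⟨a, -, -⟩)
      · exact Or.inl ⟨by linarith, by linarith [lt_of_le_of_ne a h3]⟩
      · linarith
  | succ q ih =>
    rw [bspline, bspline, ih (i + 1) k (by omega), ih i (k + 1) (by omega),
      hr' k (i + q + 2) (by omega), hr' (k + q + 1) (i + 1) (by omega),
      hr' (k + q + 2) i (by omega), hr' (k + 1) (i + q + 1) (by omega)]
    rw [show (1 - Ξ (i + 1) - (1 - Ξ (i + q + 2))) = Ξ (i + q + 2) - Ξ (i + 1) by ring,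
      show 1 - Ξ i - (1 - Ξ (i + q + 1)) = Ξ (i + q + 1) - Ξ i by ring]
    ring

theorem curryBspline_reflect (hp : 1 ≤ p) {Ξ' : ℕ → ℝ}
    (hr : ∀ m, m ≤ n + p → Ξ' m = 1 - Ξ (n + p - m)) {t : ℝ}
    (ht : t ∈ genericSet p n Ξ) (i k : ℕ) (hik : i + k + 2 = n) :
    curryBspline Ξ' p k (1 - t) = curryBspline Ξ p i t := by
  rw [curryBspline, curryBspline, bspline_reflect hr ht (p - 1) (i + 1) (k + 1) (by omega),
    hr (k + 1 + p) (by omega), hr (k + 1) (by omega),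
    show n + p - (k + 1 + p) = i + 1 by omega, show n + p - (k + 1) = i + 1 + p by omega]
  congr 2
  ring

theorem bspline_reflect_Icc (h : IsOpenKnotVector p n Ξ) {Ξ' : ℕ → ℝ}
    (h' : IsOpenKnotVector p n Ξ') (hr : ∀ m, m ≤ n + p → Ξ' m = 1 - Ξ (n + p - m)) {t : ℝ}
    (ht : t ∈ Icc (0 : ℝ) 1) (i k : ℕ) (hik : i + k + 1 = n) :
    bspline Ξ' p k (1 - t) = bspline Ξ p i t := by
  have hcont : ContinuousOn (fun t => bspline Ξ' p k (1 - t)) (Icc 0 1) :=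
    (h'.continuousOn_bspline (by omega)).comp (by fun_prop) fun x hx =>
      ⟨by linarith [hx.2], by linarith [hx.1]⟩
  have hsub : genericSet p n Ξ ⊆ Icc 0 1 := fun t ht => ⟨ht.1.1.le, ht.1.2.le⟩
  have heq : EqOn (fun t => bspline Ξ' p k (1 - t)) (bspline Ξ p i) (genericSet p n Ξ) :=
    fun t ht => bspline_reflect hr ht p i k (by omega)
  exact heq.of_subset_closure hcont (h.continuousOn_bspline (by omega)) hsub
    Icc_subset_closure_genericSet ht

end IsOpenKnotVector
end

noncomputable section

/-! ### Integration along a coordinate direction of the cube -/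

/-- The point `ξ` with coordinate `e` replaced by `t`. -/
def upd (ξ : E3) (e : Fin 3) (t : ℝ) : E3 := WithLp.toLp 2 (Function.update ξ e t)

@[simp] theorem upd_same (ξ : E3) (e : Fin 3) (t : ℝ) : upd ξ e t e = t := by simp [upd]

theorem upd_ne (ξ : E3) {e f : Fin 3} (h : f ≠ e) (t : ℝ) : upd ξ e t f = ξ f := by simp [upd, h]

theorem upd_apply (ξ : E3) (e f : Fin 3) (t : ℝ) : upd ξ e t f = if f = e then t else ξ f := by
  by_cases h : f = e
  · subst h; simp
  · rw [upd_ne ξ h, if_neg h]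

@[simp] theorem upd_eq_self (ξ : E3) (e : Fin 3) : upd ξ e (ξ e) = ξ := by
  ext f; rw [upd_apply]; split_ifs with h <;> simp [*]

@[simp] theorem upd_upd (ξ : E3) (e : Fin 3) (s t : ℝ) : upd (upd ξ e s) e t = upd ξ e t := by
  ext f; simp only [upd_apply]; split_ifs <;> rfl

theorem upd_eq_add (ξ : E3) (e : Fin 3) (t : ℝ) :
    upd ξ e t = ξ + (t - ξ e) • EuclideanSpace.single e (1 : ℝ) := by
  ext f
  rw [upd_apply]
  by_cases h : f = e
  · subst h; simp
  · simp [h]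

theorem continuous_upd_right (ξ : E3) (e : Fin 3) : Continuous (upd ξ e) := by
  have : upd ξ e = fun t => ξ + (t - ξ e) • EuclideanSpace.single e (1 : ℝ) :=
    funext (upd_eq_add ξ e)
  rw [this]; fun_prop

theorem continuous_upd_left (e : Fin 3) (t : ℝ) : Continuous fun ξ => upd ξ e t := by
  have : (fun ξ => upd ξ e t) = fun ξ : E3 => ξ + (t - ξ e) • EuclideanSpace.single e (1 : ℝ) :=
    funext fun ξ => upd_eq_add ξ e t
  rw [this]; fun_prop

theorem hasDerivAt_upd (ξ : E3) (e : Fin 3) (t : ℝ) :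
    HasDerivAt (upd ξ e) (EuclideanSpace.single e (1 : ℝ)) t := by
  have : upd ξ e = fun t => ξ + (t - ξ e) • EuclideanSpace.single e (1 : ℝ) :=
    funext (upd_eq_add ξ e)
  rw [this]
  simpa using (((hasDerivAt_id t).sub_const (ξ e)).smul_const
    (EuclideanSpace.single e (1 : ℝ))).const_add ξ

theorem upd_mem_closedCube {ξ : E3} (hξ : ξ ∈ closedCube) {e : Fin 3} {t : ℝ}
    (ht : t ∈ Icc (0 : ℝ) 1) : upd ξ e t ∈ closedCube := by
  intro f
  rw [upd_apply]
  split_ifs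
  · exact ht
  · exact hξ f

theorem closedCube_eq_preimage :
    closedCube = WithLp.ofLp ⁻¹' (Icc (0 : Fin 3 → ℝ) 1) := by
  ext ξ
  exact ⟨fun h => ⟨fun e => (h e).1, fun e => (h e).2⟩, fun h e => ⟨h.1 e, h.2 e⟩⟩

theorem isCompact_closedCube : IsCompact closedCube := by
  have h : closedCube = (WithLp.toLp 2) '' (Icc (0 : Fin 3 → ℝ) 1) := by
    rw [closedCube_eq_preimage]
    ext ξ
    exact ⟨fun h => ⟨ξ.ofLp, h, rfl⟩, fun ⟨y, h1, h2⟩ => h2 ▸ h1⟩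
  rw [h]
  exact isCompact_Icc.image (PiLp.continuous_toLp 2 _)

theorem measurableSet_closedCube : MeasurableSet closedCube :=
  isCompact_closedCube.isClosed.measurableSet

theorem volume_closedCube_lt_top : volume closedCube < ⊤ := isCompact_closedCube.measure_lt_top

theorem integrableOn_closedCube_of_bounded {E : Type*} [NormedAddCommGroup E] {h : E3 → E}
    (hm : AEStronglyMeasurable h (volume.restrict closedCube)) (C : ℝ)
    (hC : ∀ ξ ∈ closedCube, ‖h ξ‖ ≤ C) : IntegrableOn h closedCube := by
  have : IsFiniteMeasure (volume.restrict closedCube) :=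
    ⟨by rw [Measure.restrict_apply_univ]; exact volume_closedCube_lt_top⟩
  exact Integrable.of_bound hm C
    ((ae_restrict_iff' measurableSet_closedCube).2 (Filter.Eventually.of_forall hC))

theorem hasDerivAt_E3 {f : ℝ → E3} {f' : E3} {t : ℝ}
    (h : ∀ b, HasDerivAt (fun t => f t b) (f' b) t) : HasDerivAt f f' t :=
  (PiLp.continuousLinearEquiv 2 ℝ (fun _ : Fin 3 => ℝ)).symm.toContinuousLinearMap.hasFDerivAt.comp_hasDerivAt
    t (hasDerivAt_pi.2 h)

/-- `h` is continuous along direction `e` on the closed cube, and has the partial derivative `h'` in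
this direction wherever coordinate `e` lies in the set `G e`; both functions are measurable and
bounded on the cube. -/
structure LineDiff (G : Fin 3 → Set ℝ) (e : Fin 3) (h h' : E3 → ℝ) : Prop where
  meas : Measurable h
  meas' : Measurable h'
  bdd : ∃ C, ∀ ξ ∈ closedCube, |h ξ| ≤ C
  bdd' : ∃ C, ∀ ξ ∈ closedCube, |h' ξ| ≤ C
  cont : ∀ ξ ∈ closedCube, ContinuousOn (fun t => h (upd ξ e t)) (Icc 0 1)
  deriv : ∀ ξ ∈ closedCube, ξ e ∈ G e → HasDerivAt (fun t => h (upd ξ e t)) (h' ξ) (ξ e)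

namespace LineDiff

variable {G : Fin 3 → Set ℝ} {e : Fin 3} {h h' k k' : E3 → ℝ}

theorem congr (H : LineDiff G e h h') (h1 : h' = k') : LineDiff G e h k' := h1 ▸ H

theorem const (c : ℝ) : LineDiff G e (fun _ => c) (fun _ => 0) where
  meas := measurable_const
  meas' := measurable_const
  bdd := ⟨|c|, fun _ _ => le_rfl⟩
  bdd' := ⟨|0|, fun _ _ => le_rfl⟩
  cont _ _ := continuousOn_const
  deriv _ _ _ := hasDerivAt_const _ _

theorem bdd_mul (h1 : ∃ C, ∀ ξ ∈ closedCube, |h ξ| ≤ C) (h2 : ∃ C, ∀ ξ ∈ closedCube, |k ξ| ≤ C) :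
    ∃ C, ∀ ξ ∈ closedCube, |h ξ * k ξ| ≤ C := by
  obtain ⟨C, hC⟩ := h1
  obtain ⟨C', hC'⟩ := h2
  refine ⟨C * C', fun ξ hξ => ?_⟩
  rw [abs_mul]
  exact mul_le_mul (hC ξ hξ) (hC' ξ hξ) (abs_nonneg _) ((abs_nonneg _).trans (hC ξ hξ))

theorem bdd_add (h1 : ∃ C, ∀ ξ ∈ closedCube, |h ξ| ≤ C) (h2 : ∃ C, ∀ ξ ∈ closedCube, |k ξ| ≤ C) :
    ∃ C, ∀ ξ ∈ closedCube, |h ξ + k ξ| ≤ C := by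
  obtain ⟨C, hC⟩ := h1
  obtain ⟨C', hC'⟩ := h2
  exact ⟨C + C', fun ξ hξ => (abs_add_le _ _).trans (add_le_add (hC ξ hξ) (hC' ξ hξ))⟩

theorem add (H : LineDiff G e h h') (K : LineDiff G e k k') :
    LineDiff G e (fun ξ => h ξ + k ξ) (fun ξ => h' ξ + k' ξ) where
  meas := H.meas.add K.meas
  meas' := H.meas'.add K.meas'
  bdd := bdd_add H.bdd K.bdd
  bdd' := bdd_add H.bdd' K.bdd'
  cont ξ hξ := (H.cont ξ hξ).add (K.cont ξ hξ)
  deriv ξ hξ h1 := (H.deriv ξ hξ h1).add (K.deriv ξ hξ h1)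

theorem mul (H : LineDiff G e h h') (K : LineDiff G e k k') :
    LineDiff G e (fun ξ => h ξ * k ξ) (fun ξ => h' ξ * k ξ + h ξ * k' ξ) where
  meas := H.meas.mul K.meas
  meas' := (H.meas'.mul K.meas).add (H.meas.mul K.meas')
  bdd := bdd_mul H.bdd K.bdd
  bdd' := bdd_add (bdd_mul H.bdd' K.bdd) (bdd_mul H.bdd K.bdd')
  cont ξ hξ := (H.cont ξ hξ).mul (K.cont ξ hξ)
  deriv ξ hξ h1 := by
    have := (H.deriv ξ hξ h1).mul (K.deriv ξ hξ h1)
    rwa [upd_eq_self] at this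

theorem const_mul (c : ℝ) (H : LineDiff G e h h') :
    LineDiff G e (fun ξ => c * h ξ) (fun ξ => c * h' ξ) :=
  ((const c).mul H).congr (by funext ξ; ring)

theorem sub (H : LineDiff G e h h') (K : LineDiff G e k k') :
    LineDiff G e (fun ξ => h ξ - k ξ) (fun ξ => h' ξ - k' ξ) := by
  have := H.add (K.const_mul (-1))
  simpa only [neg_one_mul, ← sub_eq_add_neg] using this

theorem sum {I : Type*} (s : Finset I) {h h' : I → E3 → ℝ}
    (H : ∀ i ∈ s, LineDiff G e (h i) (h' i)) :
    LineDiff G e (fun ξ => ∑ i ∈ s, h i ξ) (fun ξ => ∑ i ∈ s, h' i ξ) := by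
  classical
  induction s using Finset.induction_on with
  | empty => simpa using const (G := G) (e := e) 0
  | insert a s ha ih =>
    simp only [Finset.sum_insert ha]
    exact (H a (Finset.mem_insert_self _ _)).add
      (ih fun i hi => H i (Finset.mem_insert_of_mem hi))

theorem inv (H : LineDiff G e h h') {δ : ℝ} (hδ : 0 < δ) (hl : ∀ ξ ∈ closedCube, δ ≤ h ξ) :
    LineDiff G e (fun ξ => (h ξ)⁻¹) (fun ξ => -h' ξ * ((h ξ)⁻¹ * (h ξ)⁻¹)) where
  meas := H.meas.inv
  meas' := H.meas'.neg.mul (H.meas.inv.mul H.meas.inv)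
  bdd := ⟨δ⁻¹, fun ξ hξ => by
    rw [abs_of_pos (inv_pos.2 (hδ.trans_le (hl ξ hξ)))]
    exact inv_anti₀ hδ (hl ξ hξ)⟩
  bdd' := by
    have h1 : ∃ C, ∀ ξ ∈ closedCube, |(h ξ)⁻¹| ≤ C := ⟨δ⁻¹, fun ξ hξ => by
      rw [abs_of_pos (inv_pos.2 (hδ.trans_le (hl ξ hξ)))]
      exact inv_anti₀ hδ (hl ξ hξ)⟩
    refine bdd_mul ?_ (bdd_mul h1 h1)
    simpa only [abs_neg] using H.bdd'
  cont ξ hξ := (H.cont ξ hξ).inv₀ fun t ht =>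
    (hδ.trans_le (hl _ (upd_mem_closedCube hξ ht))).ne'
  deriv ξ hξ h1 := by
    have h2 : h ξ ≠ 0 := (hδ.trans_le (hl ξ hξ)).ne'
    refine ((H.deriv ξ hξ h1).fun_inv (by rwa [upd_eq_self])).congr_deriv ?_
    rw [upd_eq_self]
    field_simp

/-- Chain rule for the composition of a test function with a map whose components are
differentiable along direction `e`. -/
theorem comp_test {φ : E3 → ℝ} (hφ : ContDiff ℝ ∞ φ) (hc : HasCompactSupport φ) {F F' : E3 → E3}
    (H : ∀ b, LineDiff G e (fun ξ => F ξ b) (fun ξ => F' ξ b)) :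
    LineDiff G e (fun ξ => φ (F ξ)) (fun ξ => fderiv ℝ φ (F ξ) (F' ξ)) := by
  have hF : Measurable F := by
    have : Measurable fun ξ => WithLp.toLp 2 (fun b => F ξ b) :=
      (PiLp.continuous_toLp 2 _).measurable.comp (measurable_pi_lambda _ fun b => (H b).meas)
    exact this
  have hF' : Measurable F' := by
    have : Measurable fun ξ => WithLp.toLp 2 (fun b => F' ξ b) :=
      (PiLp.continuous_toLp 2 _).measurable.comp (measurable_pi_lambda _ fun b => (H b).meas')
    exact this
  have hcd : Continuous (fderiv ℝ φ) := hφ.continuous_fderiv (by simp)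
  refine ⟨hφ.continuous.measurable.comp hF, ?_, ?_, ?_, fun ξ hξ => ?_, fun ξ hξ h1 => ?_⟩
  · have h3 : Continuous fun x : E3 × E3 => fderiv ℝ φ x.1 x.2 := by fun_prop
    exact h3.measurable.comp (hF.prodMk hF')
  · obtain ⟨C, hC⟩ := hφ.continuous.bounded_above_of_compact_support hc
    exact ⟨C, fun ξ _ => hC _⟩
  · obtain ⟨C, hC⟩ := hcd.bounded_above_of_compact_support (hc.fderiv (𝕜 := ℝ))
    choose B hB using fun b => (H b).bdd'
    have hC0 : 0 ≤ C := (norm_nonneg _).trans (hC 0)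
    refine ⟨C * √(∑ b, B b ^ 2), fun ξ hξ => ?_⟩
    refine ((fderiv ℝ φ (F ξ)).le_opNorm _).trans ?_
    refine mul_le_mul (hC _) ?_ (norm_nonneg _) hC0
    rw [EuclideanSpace.norm_eq]
    refine Real.sqrt_le_sqrt (Finset.sum_le_sum fun b _ => ?_)
    rw [Real.norm_eq_abs]
    exact pow_le_pow_left₀ (abs_nonneg _) (hB b ξ hξ) 2
  · refine hφ.continuous.comp_continuousOn ?_
    have : ContinuousOn (fun t => WithLp.toLp 2 (fun b => F (upd ξ e t) b)) (Icc (0 : ℝ) 1) :=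
      (PiLp.continuous_toLp 2 _).comp_continuousOn
        (continuousOn_pi.2 fun b => (H b).cont ξ hξ)
    exact this
  · have h2 : HasDerivAt (fun t => F (upd ξ e t)) (F' ξ) (ξ e) :=
      hasDerivAt_E3 fun b => (H b).deriv ξ hξ h1
    have h3 : HasFDerivAt φ (fderiv ℝ φ (F (upd ξ e (ξ e)))) (F (upd ξ e (ξ e))) :=
      ((hφ.differentiable (by simp)) _).hasFDerivAt
    have h4 := h3.comp_hasDerivAt (ξ e) h2
    rwa [upd_eq_self] at h4

end LineDiff

/-- The coordinates of a point, with coordinate `e` singled out. -/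
def splitCoord (e : Fin 3) : E3 ≃ᵐ ℝ × (Fin 2 → ℝ) :=
  (MeasurableEquiv.toLp 2 (Fin 3 → ℝ)).symm.trans (MeasurableEquiv.piFinSuccAbove (fun _ => ℝ) e)

theorem splitCoord_symm_apply (e : Fin 3) (t : ℝ) (z : Fin 2 → ℝ) :
    (splitCoord e).symm (t, z) = WithLp.toLp 2 (Fin.insertNth e t z : Fin 3 → ℝ) := rfl

theorem measurePreserving_splitCoord (e : Fin 3) :
    MeasurePreserving (splitCoord e).symm volume volume :=
  MeasurePreserving.symm (splitCoord e)
    ((volume_preserving_piFinSuccAbove (fun _ => ℝ) e).comp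
      (EuclideanSpace.volume_preserving_symm_measurableEquiv_toLp (Fin 3)))

theorem upd_splitCoord_symm (e : Fin 3) (s t : ℝ) (z : Fin 2 → ℝ) :
    upd ((splitCoord e).symm (s, z)) e t = (splitCoord e).symm (t, z) := by
  rw [splitCoord_symm_apply, splitCoord_symm_apply, upd]
  congr 1
  exact Fin.update_insertNth (α := fun _ => ℝ) e s t z

theorem splitCoord_symm_preimage_closedCube (e : Fin 3) :
    (splitCoord e).symm ⁻¹' closedCube = Icc (0 : ℝ) 1 ×ˢ Icc (0 : Fin 2 → ℝ) 1 := by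
  ext ⟨t, z⟩
  simp only [mem_preimage, splitCoord_symm_apply, closedCube, mem_ofPred_eq, mem_prod,
    Fin.forall_iff_succAbove e, Fin.insertNth_apply_same, Fin.insertNth_apply_succAbove]
  refine and_congr Iff.rfl ⟨fun h => ⟨fun j => (h j).1, fun j => (h j).2⟩, fun h j => ⟨h.1 j, h.2 j⟩⟩

theorem setIntegral_closedCube_split (e : Fin 3) {g : E3 → ℝ} (hm : Measurable g)
    (hb : ∃ C, ∀ ξ ∈ closedCube, |g ξ| ≤ C) :
    ∫ ξ in closedCube, g ξ =
      ∫ z in Icc (0 : Fin 2 → ℝ) 1, ∫ t in Icc (0 : ℝ) 1, g ((splitCoord e).symm (t, z)) := by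
  obtain ⟨C, hC⟩ := hb
  have hint : IntegrableOn (fun x => g ((splitCoord e).symm x))
      (Icc (0 : ℝ) 1 ×ˢ Icc (0 : Fin 2 → ℝ) 1) (volume.prod volume) := by
    rw [← splitCoord_symm_preimage_closedCube e]
    exact ((measurePreserving_splitCoord e).integrableOn_comp_preimage
      (splitCoord e).symm.measurableEmbedding).2
      (integrableOn_closedCube_of_bounded hm.aestronglyMeasurable C hC)
  rw [← (measurePreserving_splitCoord e).setIntegral_preimage_emb
    (splitCoord e).symm.measurableEmbedding, splitCoord_symm_preimage_closedCube]
  change ∫ x in Icc (0 : ℝ) 1 ×ˢ Icc (0 : Fin 2 → ℝ) 1, g ((splitCoord e).symm x)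
    ∂(volume.prod volume) = _
  rw [← setIntegral_prod_swap]
  exact setIntegral_prod _ hint.swap

/-- The fundamental theorem of calculus along direction `e`, integrated over the other directions.
The integral over the two sides of the cube is written as an integral over the cube itself. -/
theorem LineDiff.integral_eq {G : Fin 3 → Set ℝ} {e : Fin 3} {h h' : E3 → ℝ}
    (H : LineDiff G e h h') (hG : (Ioo 0 1 \ G e).Countable) :
    ∫ ξ in closedCube, h' ξ = ∫ ξ in closedCube, (h (upd ξ e 1) - h (upd ξ e 0)) := by
  have hu : ∀ t : ℝ, Measurable fun ξ => h (upd ξ e t) := fun t =>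
    H.meas.comp (continuous_upd_left e t).measurable
  have hb : ∃ C, ∀ ξ ∈ closedCube, |h (upd ξ e 1) - h (upd ξ e 0)| ≤ C := by
    obtain ⟨C, hC⟩ := H.bdd
    refine ⟨C + C, fun ξ hξ => (abs_sub _ _).trans (add_le_add ?_ ?_)⟩ <;>
    exact hC _ (upd_mem_closedCube hξ (by simp))
  rw [setIntegral_closedCube_split e H.meas' H.bdd',
    setIntegral_closedCube_split e (g := fun ξ => h (upd ξ e 1) - h (upd ξ e 0))
      ((hu 1).sub (hu 0)) hb]
  refine setIntegral_congr_fun measurableSet_Icc fun z hz => ?_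
  have hz' : ∀ t ∈ Icc (0 : ℝ) 1, (splitCoord e).symm (t, z) ∈ closedCube := fun t ht => by
    have : (t, z) ∈ (splitCoord e).symm ⁻¹' closedCube := by
      rw [splitCoord_symm_preimage_closedCube]; exact ⟨ht, hz⟩
    exact this
  have h0 := hz' 0 (by simp)
  simp only [upd_splitCoord_symm]
  rw [setIntegral_const]
  simp only [integral_Icc_eq_integral_Ioc]
  rw [← intervalIntegral.integral_of_le zero_le_one]
  have hc := H.cont _ h0
  simp only [upd_splitCoord_symm] at hc
  have hd : ∀ t ∈ Ioo (0 : ℝ) 1 \ (Ioo 0 1 \ G e),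
      HasDerivAt (fun t => h ((splitCoord e).symm (t, z))) (h' ((splitCoord e).symm (t, z))) t := by
    intro t ht
    have ht' : t ∈ G e := by
      by_contra hn
      exact ht.2 ⟨ht.1, hn⟩
    have h3 := H.deriv _ (hz' t ⟨ht.1.1.le, ht.1.2.le⟩)
      (by rw [splitCoord_symm_apply]; simpa using ht')
    simp only [upd_splitCoord_symm] at h3
    rw [splitCoord_symm_apply] at h3
    simpa [splitCoord_symm_apply] using h3
  have hi : IntervalIntegrable (fun t => h' ((splitCoord e).symm (t, z))) volume 0 1 := by
    obtain ⟨C, hC⟩ := H.bdd'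
    rw [intervalIntegrable_iff_integrableOn_Icc_of_le zero_le_one]
    refine Measure.integrableOn_of_bounded (M := C) (by simp) ?_ ?_
    · exact (H.meas'.comp ((splitCoord e).symm.measurable.comp
        (measurable_id.prodMk measurable_const))).aestronglyMeasurable
    · exact (ae_restrict_iff' measurableSet_Icc).2 (Filter.Eventually.of_forall fun t ht =>
        hC _ (hz' t ht))
  rw [integral_eq_of_hasDerivAt_off_countable_of_le (fun t => h ((splitCoord e).symm (t, z))) _
    zero_le_one hG hc hd hi]
  simp
end

noncomputable section

/-! ### Tensor-product splines and their partial derivatives -/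

/-- Tensor product of univariate functions, number `a e` from the family `β e` in direction `e`. -/
def tens (β : Fin 3 → ℕ → ℝ → ℝ) (a : Fin 3 → ℕ) (ξ : E3) : ℝ := ∏ e, β e (a e) (ξ e)

theorem tens_eq_mul (β : Fin 3 → ℕ → ℝ → ℝ) (a : Fin 3 → ℕ) (ξ : E3) (e : Fin 3) :
    tens β a ξ = β e (a e) (ξ e) * ∏ f ∈ Finset.univ.erase e, β f (a f) (ξ f) :=
  (Finset.mul_prod_erase _ _ (Finset.mem_univ e)).symm

theorem tens_upd (β : Fin 3 → ℕ → ℝ → ℝ) (a : Fin 3 → ℕ) (ξ : E3) (e : Fin 3) (t : ℝ) :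
    tens β a (upd ξ e t) = β e (a e) t * ∏ f ∈ Finset.univ.erase e, β f (a f) (ξ f) := by
  rw [tens_eq_mul β a _ e, upd_same]
  congr 1
  refine Finset.prod_congr rfl fun f hf => ?_
  rw [upd_ne ξ (Finset.ne_of_mem_erase hf)]

theorem tens_update (β : Fin 3 → ℕ → ℝ → ℝ) (β' : ℕ → ℝ → ℝ) (a : Fin 3 → ℕ) (ξ : E3) (e : Fin 3) :
    tens (Function.update β e β') a ξ =
      β' (a e) (ξ e) * ∏ f ∈ Finset.univ.erase e, β f (a f) (ξ f) := by
  rw [tens_eq_mul _ a _ e, Function.update_self]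
  congr 1
  refine Finset.prod_congr rfl fun f hf => ?_
  rw [Function.update_of_ne (Finset.ne_of_mem_erase hf)]

theorem measurable_tens {β : Fin 3 → ℕ → ℝ → ℝ} {a : Fin 3 → ℕ}
    (hm : ∀ f, Measurable (β f (a f))) : Measurable (tens β a) :=
  Finset.measurable_fun_prod _ fun f _ => (hm f).comp
    (by fun_prop : Continuous fun ξ : E3 => ξ f).measurable

theorem tens_bounded {β : Fin 3 → ℕ → ℝ → ℝ} {a : Fin 3 → ℕ}
    (hb : ∀ f, ∃ C, ∀ t ∈ Icc (0 : ℝ) 1, |β f (a f) t| ≤ C) :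
    ∃ C, ∀ ξ ∈ closedCube, |tens β a ξ| ≤ C := by
  choose C hC using hb
  refine ⟨∏ f, C f, fun ξ hξ => ?_⟩
  rw [tens, Finset.abs_prod]
  exact Finset.prod_le_prod (fun f _ => abs_nonneg _) fun f _ => hC f _ (hξ f)

theorem lineDiff_tens {G : Fin 3 → Set ℝ} {e : Fin 3} {β : Fin 3 → ℕ → ℝ → ℝ} {β' : ℕ → ℝ → ℝ}
    {a : Fin 3 → ℕ} (hm : ∀ f, Measurable (β f (a f)))
    (hb : ∀ f, ∃ C, ∀ t ∈ Icc (0 : ℝ) 1, |β f (a f) t| ≤ C) (hm' : Measurable (β' (a e)))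
    (hb' : ∃ C, ∀ t ∈ Icc (0 : ℝ) 1, |β' (a e) t| ≤ C)
    (hc : ContinuousOn (β e (a e)) (Icc 0 1))
    (hd : ∀ t ∈ G e, HasDerivAt (β e (a e)) (β' (a e) t) t) :
    LineDiff G e (tens β a) (tens (Function.update β e β') a) where
  meas := measurable_tens hm
  meas' := measurable_tens fun f => by
    by_cases h : f = e
    · subst h; rwa [Function.update_self]
    · rw [Function.update_of_ne h]; exact hm f
  bdd := tens_bounded hb
  bdd' := tens_bounded fun f => by
    by_cases h : f = e
    · subst h; rwa [Function.update_self]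
    · rw [Function.update_of_ne h]; exact hb f
  cont ξ _ := by
    simp only [tens_upd]
    exact hc.mul continuousOn_const
  deriv ξ _ h1 := by
    simp only [tens_upd, tens_update]
    exact (hd _ h1).mul_const _

theorem sum_ite_tens {N : Fin 3 → ℕ} (K : ∀ f, Fin (N f) → Prop) [∀ f k, Decidable (K f k)]
    (β : Fin 3 → ℕ → ℝ → ℝ) (ξ : E3) :
    ∑ a : ∀ f, Fin (N f), (if ∀ f, K f (a f) then tens β (fun f => a f) ξ else 0) =
      ∏ f, ∑ k : Fin (N f), if K f k then β f k (ξ f) else 0 := by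
  rw [Finset.prod_univ_sum]
  simp only [Fintype.piFinset_univ]
  refine Finset.sum_congr rfl fun a _ => ?_
  rw [Finset.prod_ite_zero]
  simp only [Finset.mem_univ, true_imp_iff]
  rfl

namespace MultiPatch

variable {ι : Type*} {M : ControlGrid ι} (P : MultiPatch M)

/-- The points of the unit interval that are not knots of patch `i` in direction `e`. -/
def gen (i : ι) (e : Fin 3) : Set ℝ := genericSet P.degree (M.n i e) (P.knot i e)

/-- The points of the cube none of whose coordinates is a knot. -/
def genericCube (i : ι) : Set E3 := {ξ | ∀ e, ξ e ∈ P.gen i e}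

/-- The univariate splines that make up the basis functions of type `D`. -/
def uni (i : ι) (D : Finset (Fin 3)) (e : Fin 3) : ℕ → ℝ → ℝ :=
  if e ∈ D then curryBspline (P.knot i e) P.degree else bspline (P.knot i e) P.degree

/-- The B-splines, differentiated in the directions in `S`. -/
def duni (i : ι) (S : Finset (Fin 3)) (e : Fin 3) : ℕ → ℝ → ℝ :=
  if e ∈ S then bsplineDeriv (P.knot i e) P.degree else bspline (P.knot i e) P.degree

theorem basisFun_eq_tens (i : ι) (D : Finset (Fin 3)) (a : M.Idx i D) (ξ : E3) :
    P.basisFun i D a ξ = tens (P.uni i D) (fun e => a e) ξ := by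
  refine Finset.prod_congr rfl fun e _ => ?_
  rw [uni]
  split_ifs <;> rfl

theorem measurable_uni (i : ι) (D : Finset (Fin 3)) (e : Fin 3) (k : ℕ) :
    Measurable (P.uni i D e k) := by
  rw [uni]; split_ifs
  exacts [measurable_curryBspline _ _ _, measurable_bspline _ _ _]

theorem uni_bounded (i : ι) (D : Finset (Fin 3)) (e : Fin 3) (k : ℕ) :
    ∃ C, ∀ t ∈ Icc (0 : ℝ) 1, |P.uni i D e k t| ≤ C := by
  rw [uni]; split_ifs
  exacts [curryBspline_bounded _ _ _, bspline_bounded _ _ _]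

theorem measurable_duni (i : ι) (S : Finset (Fin 3)) (e : Fin 3) (k : ℕ) :
    Measurable (P.duni i S e k) := by
  rw [duni]; split_ifs
  exacts [measurable_bsplineDeriv _ _ _, measurable_bspline _ _ _]

theorem duni_bounded (i : ι) (S : Finset (Fin 3)) (e : Fin 3) (k : ℕ) :
    ∃ C, ∀ t ∈ Icc (0 : ℝ) 1, |P.duni i S e k t| ≤ C := by
  rw [duni]; split_ifs
  exacts [bsplineDeriv_bounded _ _ _, bspline_bounded _ _ _]

theorem duni_insert (i : ι) (S : Finset (Fin 3)) (e : Fin 3) :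
    Function.update (P.duni i S) e (bsplineDeriv (P.knot i e) P.degree) =
      P.duni i (insert e S) := by
  funext f
  by_cases h : f = e
  · subst h; rw [Function.update_self, duni, if_pos (Finset.mem_insert_self _ _)]
  · rw [Function.update_of_ne h, duni, duni]
    simp [h]

theorem idx_lt {i : ι} {D : Finset (Fin 3)} (a : M.Idx i D) (e : Fin 3) : (a e : ℕ) < M.n i e :=
  (a e).isLt.trans_le (Nat.sub_le _ _)

/-- The weight function of patch `i`, differentiated in the directions in `S`. -/
def weightSum (i : ι) (S : Finset (Fin 3)) (ξ : E3) : ℝ :=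
  ∑ a : M.Idx i ∅, P.weight i (fun e => a e) * tens (P.duni i S) (fun e => a e) ξ

/-- The numerator of the NURBS map of patch `i`, differentiated in the directions in `S`. -/
def ctrlSum (i : ι) (S : Finset (Fin 3)) (b : Fin 3) (ξ : E3) : ℝ :=
  ∑ a : M.Idx i ∅, (P.weight i (fun e => a e) * P.ctrl i (fun e => a e) b) *
    tens (P.duni i S) (fun e => a e) ξ

/-- First partial derivatives of the NURBS map, by the quotient rule. They are defined up to the
boundary of the cube. -/
def pd (i : ι) (f : Fin 3) (ξ : E3) : E3 := WithLp.toLp 2 fun b =>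
  (P.weightSum i ∅ ξ)⁻¹ * P.ctrlSum i {f} b ξ -
    P.weightSum i {f} ξ * ((P.weightSum i ∅ ξ)⁻¹ * (P.weightSum i ∅ ξ)⁻¹) * P.ctrlSum i ∅ b ξ

/-- Mixed second partial derivatives of the NURBS map. -/
def pd2 (i : ι) (e f : Fin 3) (ξ : E3) : E3 := WithLp.toLp 2 fun b =>
  (P.weightSum i ∅ ξ)⁻¹ * P.ctrlSum i {e, f} b ξ -
    (P.weightSum i {e} ξ * P.ctrlSum i {f} b ξ + P.weightSum i {f} ξ * P.ctrlSum i {e} b ξ +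
      P.weightSum i {e, f} ξ * P.ctrlSum i ∅ b ξ) *
        ((P.weightSum i ∅ ξ)⁻¹ * (P.weightSum i ∅ ξ)⁻¹) +
    2 * (P.weightSum i {e} ξ * P.weightSum i {f} ξ * P.ctrlSum i ∅ b ξ) *
      ((P.weightSum i ∅ ξ)⁻¹ * (P.weightSum i ∅ ξ)⁻¹ * (P.weightSum i ∅ ξ)⁻¹)

theorem pd2_symm (i : ι) (e f : Fin 3) (ξ : E3) : P.pd2 i e f ξ = P.pd2 i f e ξ := by
  rw [pd2, pd2]
  congr 1
  funext b
  rw [Finset.pair_comm e f]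
  ring

theorem param_apply (i : ι) (ξ : E3) (b : Fin 3) :
    P.param i ξ b = (P.weightSum i ∅ ξ)⁻¹ * P.ctrlSum i ∅ b ξ := by
  have h : ∀ a : M.Idx i ∅, P.basisFun i ∅ a ξ = tens (P.duni i ∅) (fun e => a e) ξ := fun a => by
    rw [basisFun_eq_tens]
    refine Finset.prod_congr rfl fun e _ => ?_
    simp [uni, duni]
  simp only [param, h, weightSum, ctrlSum, PiLp.smul_apply, WithLp.ofLp_sum, WithLp.ofLp_smul,
    Finset.sum_apply, smul_eq_mul, Pi.smul_apply]
  congr 1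
  exact Finset.sum_congr rfl fun a _ => by ring

/-- The spline of type `D` with coefficients `c` on patch `i`. -/
def field (i : ι) (D : Finset (Fin 3)) (c : M.Idx i D → ℝ) (ξ : E3) : ℝ :=
  ∑ a, c a * P.basisFun i D a ξ

section

variable {P} (hP : P.IsConforming)
include hP

theorem IsConforming.two_le (i : ι) (e : Fin 3) : 2 ≤ M.n i e := by
  have := (hP.knots i e).card
  have := hP.degree_pos
  omega

theorem lineDiff_sum_duni (i : ι) (S : Finset (Fin 3)) {e : Fin 3} (he : e ∉ S)
    (γ : M.Idx i ∅ → ℝ) :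
    LineDiff (P.gen i) e (fun ξ => ∑ a, γ a * tens (P.duni i S) (fun e => a e) ξ)
      (fun ξ => ∑ a, γ a * tens (P.duni i (insert e S)) (fun e => a e) ξ) := by
  refine LineDiff.sum _ fun a _ => LineDiff.const_mul _ ?_
  rw [← P.duni_insert]
  have h : P.duni i S e = bspline (P.knot i e) P.degree := by rw [duni, if_neg he]
  refine lineDiff_tens (fun f => P.measurable_duni _ _ _ _) (fun f => P.duni_bounded _ _ _ _)
    (measurable_bsplineDeriv _ _ _) (bsplineDeriv_bounded _ _ _) ?_ fun t ht => ?_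
  · rw [h]; exact (hP.knots i e).continuousOn_bspline (idx_lt a e)
  · rw [h]; exact (hP.knots i e).hasDerivAt_bspline hP.degree_pos ht (idx_lt a e)

theorem lineDiff_weightSum (i : ι) (S : Finset (Fin 3)) {e : Fin 3} (he : e ∉ S) :
    LineDiff (P.gen i) e (P.weightSum i S) (P.weightSum i (insert e S)) :=
  lineDiff_sum_duni hP i S he _

theorem lineDiff_ctrlSum (i : ι) (S : Finset (Fin 3)) {e : Fin 3} (he : e ∉ S) (b : Fin 3) :
    LineDiff (P.gen i) e (P.ctrlSum i S b) (P.ctrlSum i (insert e S) b) :=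
  lineDiff_sum_duni hP i S he _

theorem sum_tens_duni_empty (i : ι) {ξ : E3} (hξ : ξ ∈ closedCube) :
    ∑ a : M.Idx i ∅, tens (P.duni i ∅) (fun e => a e) ξ = 1 := by
  have h := sum_ite_tens (N := M.ext i ∅) (fun _ _ => True) (P.duni i ∅) ξ
  simp only [implies_true, if_true] at h
  rw [h]
  refine Finset.prod_eq_one fun e _ => ?_
  have h1 : M.ext i ∅ e = M.n i e := by simp [ControlGrid.ext]
  rw [Fin.sum_univ_eq_sum_range (fun k => P.duni i ∅ e k (ξ e)), h1]
  simpa [duni] using (hP.knots i e).sum_bspline (hξ e)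

theorem exists_weightSum_lower (i : ι) :
    ∃ δ, 0 < δ ∧ ∀ ξ ∈ closedCube, δ ≤ P.weightSum i ∅ ξ := by
  have hne : (Finset.univ : Finset (M.Idx i ∅)).Nonempty := by
    refine ⟨fun e => ⟨0, ?_⟩, Finset.mem_univ _⟩
    have := hP.two_le i e
    simp [ControlGrid.ext]
    omega
  obtain ⟨a0, -, ha0⟩ := Finset.exists_min_image _
    (fun a : M.Idx i ∅ => P.weight i (fun e => a e)) hne
  refine ⟨_, hP.weight_pos i a0, fun ξ hξ => ?_⟩
  rw [← mul_one (P.weight i _), ← sum_tens_duni_empty hP i hξ, Finset.mul_sum]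
  refine Finset.sum_le_sum fun a _ => mul_le_mul_of_nonneg_right (ha0 a (Finset.mem_univ _)) ?_
  refine Finset.prod_nonneg fun e _ => ?_
  simpa [duni] using (hP.knots i e).bspline_nonneg (hξ e) (idx_lt a e)

theorem weightSum_pos (i : ι) {ξ : E3} (hξ : ξ ∈ closedCube) : 0 < P.weightSum i ∅ ξ := by
  obtain ⟨δ, h1, h2⟩ := exists_weightSum_lower hP i
  exact h1.trans_le (h2 ξ hξ)

theorem lineDiff_weightSum_inv (i : ι) (e : Fin 3) :
    LineDiff (P.gen i) e (fun ξ => (P.weightSum i ∅ ξ)⁻¹)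
      (fun ξ => -P.weightSum i {e} ξ * ((P.weightSum i ∅ ξ)⁻¹ * (P.weightSum i ∅ ξ)⁻¹)) := by
  obtain ⟨δ, h1, h2⟩ := exists_weightSum_lower hP i
  have := lineDiff_weightSum hP i ∅ (Finset.notMem_empty e)
  rw [insert_empty_eq] at this
  exact this.inv h1 h2

theorem lineDiff_param (i : ι) (e b : Fin 3) :
    LineDiff (P.gen i) e (fun ξ => P.param i ξ b) (fun ξ => P.pd i e ξ b) := by
  simp only [param_apply]
  have h := lineDiff_ctrlSum hP i ∅ (Finset.notMem_empty e) b
  rw [insert_empty_eq] at h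
  refine ((lineDiff_weightSum_inv hP i e).mul h).congr ?_
  funext ξ
  simp only [pd]
  ring

theorem lineDiff_pd (i : ι) {e f : Fin 3} (hef : e ≠ f) (b : Fin 3) :
    LineDiff (P.gen i) e (fun ξ => P.pd i f ξ b) (fun ξ => P.pd2 i e f ξ b) := by
  simp only [pd]
  have hi := lineDiff_weightSum_inv hP i e
  have hN := lineDiff_ctrlSum hP i ∅ (Finset.notMem_empty e) b
  have hN' := lineDiff_ctrlSum hP i {f} (e := e) (by simpa using hef) b
  have hW := lineDiff_weightSum hP i {f} (e := e) (by simpa using hef)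
  rw [insert_empty_eq] at hN
  refine ((hi.mul hN').sub ((hW.mul (hi.mul hi)).mul hN)).congr ?_
  funext ξ
  simp only [pd2]
  ring

omit hP in
theorem exists_idx_of_lt (i : ι) (D : Finset (Fin 3)) (k : Fin 3 → ℕ)
    (hk : ∀ e, k e < M.ext i D e) : ∃ a : M.Idx i D, ∀ e, (a e : ℕ) = k e :=
  ⟨fun e => ⟨k e, hk e⟩, fun _ => rfl⟩

omit hP in
theorem idx_ext {i : ι} {D : Finset (Fin 3)} {a b : M.Idx i D} (h : ∀ e, (a e : ℕ) = b e) :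
    a = b := funext fun e => Fin.ext (h e)

theorem bsplineDeriv_eq_sum (i : ι) (e : Fin 3) {k : ℕ} (hk : k < M.n i e) (t : ℝ) :
    bsplineDeriv (P.knot i e) P.degree k t =
      (∑ l : Fin (M.n i e - 1), if k = (l : ℕ) + 1 then curryBspline (P.knot i e) P.degree l t else 0)
      - ∑ l : Fin (M.n i e - 1), if k = (l : ℕ) then curryBspline (P.knot i e) P.degree l t else 0 := by
  have h2 : ∀ j : ℕ, j < M.n i e →
      (∑ l : Fin (M.n i e - 1), if j = (l : ℕ) then curryBspline (P.knot i e) P.degree l t else 0)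
        = curryBspline (P.knot i e) P.degree j t := fun j hj => by
    rw [Fin.sum_univ_eq_sum_range (fun l => if j = l then curryBspline (P.knot i e) P.degree l t
      else 0), Finset.sum_ite_eq]
    by_cases h3 : j < M.n i e - 1
    · rw [if_pos (Finset.mem_range.2 h3)]
    · rw [if_neg (by simpa using h3), (hP.knots i e).curryBspline_last (k := j) (by omega)]
  rw [h2 k hk]
  cases k with
  | zero => simp [bsplineDeriv]
  | succ k =>
    simp only [Nat.add_right_cancel_iff]
    rw [h2 k (by omega), bsplineDeriv]

/-- Partial derivatives of splines are splines whose coefficients are differences of the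
coefficients. -/
theorem lineDiff_field (i : ι) {D D' : Finset (Fin 3)} {e : Fin 3} (he : e ∉ D)
    (hD' : D' = insert e D) (c : M.Idx i D → ℝ) (d : M.Idx i D' → ℝ)
    (hd : ∀ (a' : M.Idx i D') (a₁ a₀ : M.Idx i D),
      (∀ f, (a₁ f : ℕ) = a' f + if f = e then 1 else 0) → (∀ f, (a₀ f : ℕ) = a' f) →
        d a' = c a₁ - c a₀) :
    LineDiff (P.gen i) e (P.field i D c) (P.field i D' d) := by
  have h : P.uni i D e = bspline (P.knot i e) P.degree := by rw [uni, if_neg he]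
  have hext : ∀ f, M.ext i D f = M.ext i D' f + if f = e then 1 else 0 := fun f => by
    have := hP.two_le i f
    subst hD'
    by_cases hf : f = e
    · subst hf; simp [ControlGrid.ext, he]; omega
    · simp [ControlGrid.ext, hf]
  have hL : LineDiff (P.gen i) e (P.field i D c) (fun ξ => ∑ a : M.Idx i D, c a *
      tens (Function.update (P.uni i D) e (bsplineDeriv (P.knot i e) P.degree))
        (fun f => a f) ξ) := by
    unfold field
    simp only [basisFun_eq_tens]
    refine LineDiff.sum _ fun a _ => LineDiff.const_mul _ ?_
    refine lineDiff_tens (fun f => P.measurable_uni _ _ _ _) (fun f => P.uni_bounded _ _ _ _)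
      (measurable_bsplineDeriv _ _ _) (bsplineDeriv_bounded _ _ _) ?_ fun t ht => ?_
    · rw [h]; exact (hP.knots i e).continuousOn_bspline (idx_lt a e)
    · rw [h]; exact (hP.knots i e).hasDerivAt_bspline hP.degree_pos ht (idx_lt a e)
  refine hL.congr ?_
  funext ξ
  -- the derivative of one basis function is the difference of two lower-order ones
  have hkey : ∀ a : M.Idx i D,
      tens (Function.update (P.uni i D) e (bsplineDeriv (P.knot i e) P.degree)) (fun f => a f) ξ =
      (∑ a' : M.Idx i D', if ∀ f, (a f : ℕ) = a' f + (if f = e then 1 else 0) then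
        tens (P.uni i D') (fun f => a' f) ξ else 0) -
      ∑ a' : M.Idx i D', if ∀ f, (a f : ℕ) = a' f then tens (P.uni i D') (fun f => a' f) ξ
        else 0 := by
    intro a
    have hne : ∀ f ∈ Finset.univ.erase e, ∑ l : Fin (M.ext i D' f),
        (if (a f : ℕ) = l then P.uni i D' f l (ξ f) else 0) = P.uni i D f (a f) (ξ f) := by
      intro f hf
      have hf' := Finset.ne_of_mem_erase hf
      have h1 : P.uni i D' f = P.uni i D f := by simp [uni, hD', hf']
      rw [Fin.sum_univ_eq_sum_range (fun l => if (a f : ℕ) = l then P.uni i D' f l (ξ f) else 0),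
        Finset.sum_ite_eq, if_pos, h1]
      have h2 := hext f
      rw [if_neg hf', add_zero] at h2
      rw [Finset.mem_range, ← h2]
      exact (a f).isLt
    have hu : P.uni i D' e = curryBspline (P.knot i e) P.degree := by
      rw [uni, if_pos (by simp [hD'])]
    have hee : M.ext i D' e = M.n i e - 1 := by simp [ControlGrid.ext, hD']
    rw [sum_ite_tens (fun f (l : Fin (M.ext i D' f)) => (a f : ℕ) = l + if f = e then 1 else 0),
      sum_ite_tens (fun f (l : Fin (M.ext i D' f)) => (a f : ℕ) = l),
      ← Finset.mul_prod_erase _ _ (Finset.mem_univ e),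
      ← Finset.mul_prod_erase (f := fun f => ∑ l : Fin (M.ext i D' f),
        if (a f : ℕ) = l then P.uni i D' f l (ξ f) else 0) _ (Finset.mem_univ e),
      Finset.prod_congr rfl hne,
      Finset.prod_congr (g := fun f => P.uni i D f (a f) (ξ f)) rfl (fun f hf => ?_),
      ← sub_mul, tens_update, bsplineDeriv_eq_sum hP i e (idx_lt a e)]
    · congr 1
      rw [if_pos rfl, hu, hee]
    · rw [← hne f hf]
      simp only [if_neg (Finset.ne_of_mem_erase hf), add_zero]
  simp only [hkey, field, basisFun_eq_tens, mul_sub, Finset.sum_sub_distrib, Finset.mul_sum]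
  rw [Finset.sum_comm, Finset.sum_comm (s := Finset.univ (α := M.Idx i D)),
    ← Finset.sum_sub_distrib]
  refine Finset.sum_congr rfl fun a' _ => ?_
  obtain ⟨a₁, h₁⟩ := exists_idx_of_lt (M := M) i D (fun f => a' f + if f = e then 1 else 0)
    (fun f => by rw [hext]; have := (a' f).isLt; omega)
  obtain ⟨a₀, h₀⟩ := exists_idx_of_lt (M := M) i D (fun f => a' f)
    (fun f => by rw [hext]; have := (a' f).isLt; omega)
  rw [hd a' a₁ a₀ h₁ h₀, Finset.sum_eq_single a₁, Finset.sum_eq_single a₀, if_pos h₁, if_pos h₀]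
  · ring
  · intro b _ hb
    rw [if_neg fun h3 => hb (idx_ext fun f => (h3 f).trans (h₀ f).symm), mul_zero]
  · simp
  · intro b _ hb
    rw [if_neg fun h3 => hb (idx_ext fun f => (h3 f).trans (h₁ f).symm), mul_zero]
  · simp

end

end MultiPatch
end

noncomputable section

namespace MultiPatch

variable {ι : Type*} {M : ControlGrid ι} (P : MultiPatch M)

/-! ### Smoothness of the parametrisations -/

/-- The NURBS map with the weights and control points of patch `i`, and with arbitrary univariate
functions in place of the B-splines. -/
def nurbsOf (i : ι) (β : Fin 3 → ℕ → ℝ → ℝ) (ξ : E3) : E3 :=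
  (∑ a : M.Idx i ∅, P.weight i (fun e => a e) * tens β (fun e => a e) ξ)⁻¹ •
    ∑ a : M.Idx i ∅, (P.weight i (fun e => a e) * tens β (fun e => a e) ξ) •
      P.ctrl i (fun e => a e)

theorem param_eq_nurbsOf (i : ι) : P.param i = P.nurbsOf i (P.uni i ∅) := by
  funext ξ
  simp only [param, nurbsOf, basisFun_eq_tens]

theorem nurbsOf_congr (i : ι) {β β' : Fin 3 → ℕ → ℝ → ℝ} {ξ : E3}
    (h : ∀ e, ∀ k < M.n i e, β e k (ξ e) = β' e k (ξ e)) : P.nurbsOf i β ξ = P.nurbsOf i β' ξ := by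
  have : ∀ a : M.Idx i ∅, tens β (fun e => a e) ξ = tens β' (fun e => a e) ξ := fun a =>
    Finset.prod_congr rfl fun e _ => h e _ (idx_lt a e)
  simp only [nurbsOf, this]

theorem contDiffAt_tens {β : Fin 3 → ℕ → ℝ → ℝ} {a : Fin 3 → ℕ} {ξ : E3}
    (h : ∀ e, ContDiffAt ℝ ∞ (β e (a e)) (ξ e)) : ContDiffAt ℝ ∞ (tens β a) ξ := by
  have h2 : ∀ e, ContDiffAt ℝ ∞ (fun η : E3 => β e (a e) (η e)) ξ := fun e =>
    ContDiffAt.comp (f := fun η : E3 => η e) ξ (h e) (by fun_prop)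
  exact contDiffAt_prod fun e _ => h2 e

theorem contDiffAt_nurbsOf (i : ι) {β : Fin 3 → ℕ → ℝ → ℝ} {ξ : E3}
    (h : ∀ e, ∀ k < M.n i e, ContDiffAt ℝ ∞ (β e k) (ξ e))
    (h0 : ∑ a : M.Idx i ∅, P.weight i (fun e => a e) * tens β (fun e => a e) ξ ≠ 0) :
    ContDiffAt ℝ ∞ (P.nurbsOf i β) ξ := by
  have ht : ∀ a : M.Idx i ∅, ContDiffAt ℝ ∞ (tens β fun e => a e) ξ := fun a =>
    contDiffAt_tens fun e => h e _ (idx_lt a e)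
  have hw : ContDiffAt ℝ ∞ (fun ξ => ∑ a : M.Idx i ∅,
      P.weight i (fun e => a e) * tens β (fun e => a e) ξ) ξ :=
    ContDiffAt.sum fun a _ => contDiffAt_const.mul (ht a)
  refine ContDiffAt.smul (hw.inv h0) ?_
  · exact ContDiffAt.sum fun a _ => (contDiffAt_const.mul (ht a)).smul contDiffAt_const

theorem sum_weight_uni (i : ι) (ξ : E3) :
    ∑ a : M.Idx i ∅, P.weight i (fun e => a e) * tens (P.uni i ∅) (fun e => a e) ξ =
      P.weightSum i ∅ ξ := by
  have : P.uni i ∅ = P.duni i ∅ := by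
    funext e; simp [uni, duni]
  rw [this]; rfl

theorem genericCube_subset_openCube (i : ι) : P.genericCube i ⊆ openCube :=
  fun _ h e => (h e).1

theorem openCube_subset_closedCube : openCube ⊆ closedCube :=
  fun _ h e => ⟨(h e).1.le, (h e).2.le⟩

theorem genericCube_subset (i : ι) : P.genericCube i ⊆ closedCube :=
  (P.genericCube_subset_openCube i).trans openCube_subset_closedCube

theorem isOpen_genericCube (i : ι) : IsOpen (P.genericCube i) := by
  have : P.genericCube i = ⋂ e, (fun ξ : E3 => ξ e) ⁻¹' P.gen i e := by
    ext ξ; simp [genericCube]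
  rw [this]
  exact isOpen_iInter_of_finite fun e =>
    IsOpen.preimage (by fun_prop) IsOpenKnotVector.genericSet_isOpen

/-- The map `F` is a smooth extension of the parametrisation of patch `i` from the half
neighbourhood `0 ≤ ε (η e - ξ e)` of the point `ξ`, with derivative `A` there. -/
structure OneSided (i : ι) (e : Fin 3) (ε : ℝ) (ξ : E3) (F : E3 → E3) (A : E3 →L[ℝ] E3) :
    Prop where
  sign : ε = 1 ∨ ε = -1
  mem : ξ ∈ closedCube
  smooth : ContDiffAt ℝ ∞ F ξ
  deriv : HasFDerivAt F A ξ
  agree : ∀ᶠ η in nhds ξ, 0 ≤ ε * (η e - ξ e) → η ∈ closedCube ∧ F η = P.param i η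

variable {P} (hP : P.IsConforming)
include hP

theorem contDiffAt_param {i : ι} {ξ : E3} (hξ : ξ ∈ P.genericCube i) :
    ContDiffAt ℝ ∞ (P.param i) ξ := by
  rw [param_eq_nurbsOf]
  refine P.contDiffAt_nurbsOf i (fun e k hk => ?_) ?_
  · simp only [uni, Finset.notMem_empty, if_false]
    exact (hP.knots i e).contDiffAt_bspline (hξ e) (by omega)
  · rw [P.sum_weight_uni]
    exact (weightSum_pos hP i (P.genericCube_subset i hξ)).ne'

/-- Where at most coordinate `e` is a knot, the parametrisation agrees on each side of the knot with
a smooth map: in direction `e` the splines are replaced there by one of their polynomial pieces. -/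
theorem exists_oneSided {i : ι} {e : Fin 3} {ε : ℝ} {ξ : E3} (hξ : ∀ f, f ≠ e → ξ f ∈ P.gen i f)
    (h01 : ξ e ∈ Icc (0 : ℝ) 1) (hε : (ε = 1 ∧ ξ e < 1) ∨ (ε = -1 ∧ 0 < ξ e)) :
    ∃ F A, P.OneSided i e ε ξ F A := by
  have hmem : ξ ∈ closedCube := fun f => by
    by_cases h : f = e
    · rw [h]; exact h01
    · exact ⟨(hξ f h).1.1.le, (hξ f h).1.2.le⟩
  have hext : ∃ q : ℕ → ℝ → ℝ, (∀ k, ContDiff ℝ ∞ (q k)) ∧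
      ∀ᶠ x in nhds (ξ e), 0 ≤ ε * (x - ξ e) → x ∈ Icc (0 : ℝ) 1 ∧
        ∀ k < M.n i e, bspline (P.knot i e) P.degree k x = q k x := by
    rcases hε with ⟨rfl, h1⟩ | ⟨rfl, h1⟩
    · obtain ⟨q, hq, he⟩ := (hP.knots i e).exists_extension_right h01.1 h1
      exact ⟨q, hq, he.mono fun x hx hx' => hx (by linarith)⟩
    · obtain ⟨q, hq, he⟩ := (hP.knots i e).exists_extension_left h1 h01.2
      exact ⟨q, hq, he.mono fun x hx hx' => hx (by linarith)⟩
  obtain ⟨q, hq, he⟩ := hext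
  have h0 : ∀ η : E3, (∀ k < M.n i e, bspline (P.knot i e) P.degree k (η e) = q k (η e)) →
      ∀ f, ∀ k < M.n i f, Function.update (P.uni i ∅) e q f k (η f) = P.uni i ∅ f k (η f) := by
    intro η h1 f k hk
    by_cases hf : f = e
    · subst hf
      rw [Function.update_self, ← h1 k hk]
      simp [uni]
    · rw [Function.update_of_ne hf]
  have hsm : ContDiffAt ℝ ∞ (P.nurbsOf i (Function.update (P.uni i ∅) e q)) ξ := by
    refine P.contDiffAt_nurbsOf i (fun f k hk => ?_) ?_
    · by_cases hf : f = e
      · subst hf; rw [Function.update_self]; exact (hq k).contDiffAt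
      · rw [Function.update_of_ne hf]
        simp only [uni, Finset.notMem_empty, if_false]
        exact (hP.knots i f).contDiffAt_bspline (hξ f hf) (by omega)
    · have h2 := h0 ξ (he.self_of_nhds (by simp)).2
      have h3 : ∀ a : M.Idx i ∅, tens (Function.update (P.uni i ∅) e q) (fun e => a e) ξ =
          tens (P.uni i ∅) (fun e => a e) ξ := fun a =>
        Finset.prod_congr rfl fun f _ => h2 f _ (idx_lt a f)
      simp only [h3]
      rw [P.sum_weight_uni]
      exact (weightSum_pos hP i hmem).ne'
  refine ⟨P.nurbsOf i (Function.update (P.uni i ∅) e q), _, ?_, hmem, hsm,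
    (hsm.differentiableAt (by simp)).hasFDerivAt, ?_⟩
  · rcases hε with h | h
    exacts [Or.inl h.1, Or.inr h.1]
  · have hce : Filter.Tendsto (fun η : E3 => η e) (nhds ξ) (nhds (ξ e)) :=
      (by fun_prop : Continuous fun η : E3 => η e).continuousAt
    have hcf : ∀ᶠ η : E3 in nhds ξ, ∀ f, f ≠ e → η f ∈ Icc (0 : ℝ) 1 := by
      refine Filter.eventually_all.2 fun f => ?_
      by_cases hf : f = e
      · exact Filter.Eventually.of_forall fun η h => absurd hf h
      · have hc : Filter.Tendsto (fun η : E3 => η f) (nhds ξ) (nhds (ξ f)) :=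
          (by fun_prop : Continuous fun η : E3 => η f).continuousAt
        exact (hc.eventually (Icc_mem_nhds (hξ f hf).1.1 (hξ f hf).1.2)).mono fun η h _ => h
    filter_upwards [hce.eventually he, hcf] with η h1 h2 h3
    obtain ⟨h4, h5⟩ := h1 h3
    refine ⟨fun f => ?_, ?_⟩
    · by_cases hf : f = e
      · rw [hf]; exact h4
      · exact h2 f hf
    · rw [param_eq_nurbsOf]
      exact P.nurbsOf_congr i (h0 η h5)

theorem oneSided_of_generic {i : ι} {ξ : E3} (hξ : ξ ∈ P.genericCube i) (e : Fin 3) :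
    P.OneSided i e 1 ξ (P.param i) (fderiv ℝ (P.param i) ξ) where
  sign := Or.inl rfl
  mem := P.genericCube_subset i hξ
  smooth := contDiffAt_param hP hξ
  deriv := ((contDiffAt_param hP hξ).differentiableAt (by simp)).hasFDerivAt
  agree := ((P.isOpen_genericCube i).mem_nhds hξ |> Filter.eventually_of_mem <| fun _ h _ =>
    ⟨P.genericCube_subset i h, rfl⟩)

theorem hasDerivAt_param {i : ι} {ξ : E3} (hξ : ξ ∈ closedCube) {f : Fin 3} (hf : ξ f ∈ P.gen i f) :
    HasDerivAt (fun t => P.param i (upd ξ f t)) (P.pd i f ξ) (ξ f) :=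
  hasDerivAt_E3 fun b => (lineDiff_param hP i f b).deriv ξ hξ hf

namespace OneSided

omit hP in
theorem strict {i : ι} {e : Fin 3} {ε : ℝ} {ξ : E3} {F : E3 → E3} {A : E3 →L[ℝ] E3}
    (H : P.OneSided i e ε ξ F A) : HasStrictFDerivAt F A ξ :=
  H.smooth.hasStrictFDerivAt' H.deriv (by simp)

omit hP in
theorem eq_param {i : ι} {e : Fin 3} {ε : ℝ} {ξ : E3} {F : E3 → E3} {A : E3 →L[ℝ] E3}
    (H : P.OneSided i e ε ξ F A) : F ξ = P.param i ξ :=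
  (H.agree.self_of_nhds (by simp)).2

theorem apply_single {i : ι} {e : Fin 3} {ε : ℝ} {ξ : E3} {F : E3 → E3} {A : E3 →L[ℝ] E3}
    (H : P.OneSided i e ε ξ F A) {f : Fin 3} (hfe : f ≠ e) (hf : ξ f ∈ P.gen i f) :
    A (EuclideanSpace.single f 1) = P.pd i f ξ := by
  have h1 : HasDerivAt (fun t => F (upd ξ f t)) (A (EuclideanSpace.single f 1)) (ξ f) := by
    have h2 : HasFDerivAt F A (upd ξ f (ξ f)) := by rw [upd_eq_self]; exact H.deriv
    exact h2.comp_hasDerivAt (ξ f) (hasDerivAt_upd ξ f (ξ f))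
  refine h1.unique ((hasDerivAt_param hP H.mem hf).congr_of_eventuallyEq ?_)
  have hc : Filter.Tendsto (upd ξ f) (nhds (ξ f)) (nhds ξ) := by
    have := (continuous_upd_right ξ f).tendsto (ξ f)
    rwa [upd_eq_self] at this
  filter_upwards [hc.eventually H.agree] with t ht
  exact (ht (by rw [upd_ne ξ hfe.symm]; simp)).2

omit hP in
/-- The bi-Lipschitz bounds hold for the one-sided derivative: up to sign, each vector points into
the half neighbourhood. -/
theorem bounds {i : ι} {e : Fin 3} {ε : ℝ} {ξ : E3} {F : E3 → E3} {A : E3 →L[ℝ] E3}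
    (H : P.OneSided i e ε ξ F A) {c C : ℝ} (hb : ∀ ξ ∈ closedCube, ∀ η ∈ closedCube,
      c * dist ξ η ≤ dist (P.param i ξ) (P.param i η) ∧
        dist (P.param i ξ) (P.param i η) ≤ C * dist ξ η) (v : E3) :
    c * ‖v‖ ≤ ‖A v‖ ∧ ‖A v‖ ≤ C * ‖v‖ := by
  wlog hv : 0 ≤ ε * v e generalizing v
  · have := this (-v) (by simp only [PiLp.neg_apply]; linarith)
    simpa using this
  have hline : HasDerivAt (fun t : ℝ => ξ + t • v) v 0 := by
    simpa using ((hasDerivAt_id (0 : ℝ)).smul_const v).const_add ξ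
  have h1 : HasDerivAt (fun t : ℝ => F (ξ + t • v)) (A v) 0 := by
    have h2 : HasFDerivAt F A (ξ + (0 : ℝ) • v) := by simpa using H.deriv
    exact h2.comp_hasDerivAt 0 hline
  have h3 := h1.tendsto_slope_zero_right.norm
  have hc : Filter.Tendsto (fun t : ℝ => ξ + t • v) (nhdsWithin 0 (Ioi 0)) (nhds ξ) := by
    have := hline.continuousAt.tendsto
    simp only [zero_smul, add_zero] at this
    exact this.mono_left nhdsWithin_le_nhds
  have h4 : ∀ᶠ t : ℝ in nhdsWithin 0 (Ioi 0),
      c * ‖v‖ ≤ ‖t⁻¹ • (F (ξ + (0 + t) • v) - F (ξ + (0 : ℝ) • v))‖ ∧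
        ‖t⁻¹ • (F (ξ + (0 + t) • v) - F (ξ + (0 : ℝ) • v))‖ ≤ C * ‖v‖ := by
    filter_upwards [hc.eventually H.agree, self_mem_nhdsWithin] with t ht ht0
    have ht0' : 0 < t := ht0
    obtain ⟨h5, h6⟩ := ht (by
      simp only [PiLp.add_apply, PiLp.smul_apply, smul_eq_mul]
      nlinarith)
    have h7 := hb _ h5 _ H.mem
    rw [dist_eq_norm, dist_eq_norm, add_sub_cancel_left, norm_smul, Real.norm_eq_abs,
      abs_of_pos ht0'] at h7
    rw [zero_add, zero_smul, add_zero, h6, H.eq_param, norm_smul, norm_inv, Real.norm_eq_abs,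
      abs_of_pos ht0', ← div_eq_inv_mul, le_div_iff₀ ht0', div_le_iff₀ ht0']
    exact ⟨by linarith [h7.1], by linarith [h7.2]⟩
  exact ⟨ge_of_tendsto h3 (h4.mono fun t ht => ht.1), le_of_tendsto h3 (h4.mono fun t ht => ht.2)⟩

theorem injective {i : ι} {e : Fin 3} {ε : ℝ} {ξ : E3} {F : E3 → E3} {A : E3 →L[ℝ] E3}
    (H : P.OneSided i e ε ξ F A) : Function.Injective A := by
  obtain ⟨c, C, hc, hb⟩ := hP.biLipschitz i
  refine (injective_iff_map_eq_zero A).2 fun v hv => ?_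
  have := (H.bounds hb v).1
  rw [hv, norm_zero] at this
  exact norm_le_zero_iff.1 (by nlinarith [norm_nonneg v])

theorem exists_equiv {i : ι} {e : Fin 3} {ε : ℝ} {ξ : E3} {F : E3 → E3} {A : E3 →L[ℝ] E3}
    (H : P.OneSided i e ε ξ F A) : ∃ A' : E3 ≃L[ℝ] E3, (A' : E3 →L[ℝ] E3) = A :=
  ⟨(LinearEquiv.ofInjectiveEndo (A : E3 →ₗ[ℝ] E3) (H.injective hP)).toContinuousLinearEquiv,
    by ext v; rfl⟩

end OneSided

theorem fderiv_param_single {i : ι} {ξ : E3} (hξ : ξ ∈ P.genericCube i) (f : Fin 3) :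
    fderiv ℝ (P.param i) ξ (EuclideanSpace.single f 1) = P.pd i f ξ := by
  obtain ⟨e, he⟩ : ∃ e : Fin 3, f ≠ e := ⟨f + 1, by revert f; decide⟩
  exact (oneSided_of_generic hP hξ e).apply_single hP he (hξ f)

theorem jacobian_param {i : ι} {ξ : E3} (hξ : ξ ∈ P.genericCube i) (m f : Fin 3) :
    jacobian (P.param i) ξ m f = P.pd i f ξ m := by
  rw [jacobian, Matrix.of_apply, fderiv_param_single hP hξ]

theorem injOn_param (i : ι) : InjOn (P.param i) closedCube := by
  obtain ⟨c, C, hc, hb⟩ := hP.biLipschitz i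
  intro ξ hξ η hη h
  have := (hb ξ hξ η hη).1
  rw [h, dist_self] at this
  exact dist_le_zero.1 (by nlinarith [dist_nonneg (x := ξ) (y := η)])

theorem exists_lipschitz_param (i : ι) : ∃ C, LipschitzOnWith C (P.param i) closedCube := by
  obtain ⟨c, C, hc, hb⟩ := hP.biLipschitz i
  refine ⟨Real.toNNReal C, LipschitzOnWith.of_dist_le_mul fun ξ hξ η hη => ?_⟩
  exact ((hb ξ hξ η hη).2).trans
    (mul_le_mul_of_nonneg_right (Real.le_coe_toNNReal C) dist_nonneg)

theorem continuousOn_param (i : ι) : ContinuousOn (P.param i) closedCube :=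
  let ⟨_, h⟩ := exists_lipschitz_param hP i
  h.continuousOn

theorem isCompact_patch (i : ι) : IsCompact (P.patch i) :=
  isCompact_closedCube.image_of_continuousOn (continuousOn_param hP i)

/-- Points of the patch near `F ξ` have parameters near `ξ`. -/
theorem eventually_param_near (i : ι) {ξ : E3} (hξ : ξ ∈ closedCube) {U : Set E3}
    (hU : U ∈ nhds ξ) : ∀ᶠ y in nhds (P.param i ξ), ∀ η ∈ closedCube, P.param i η = y → η ∈ U := by
  obtain ⟨c, C, hc, hb⟩ := hP.biLipschitz i
  obtain ⟨r, hr, hrU⟩ := Metric.mem_nhds_iff.1 hU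
  filter_upwards [Metric.ball_mem_nhds (P.param i ξ) (mul_pos hc hr)] with y hy η hη h
  apply hrU
  have h1 := (hb η hη ξ hξ).1
  rw [h] at h1
  exact lt_of_mul_lt_mul_left (h1.trans_lt hy) hc.le

end MultiPatch
end

noncomputable section

/-! ### Cross products -/

/-- The cross product in `E3`. -/
def cross3 (u v : E3) : E3 :=
  !₂[u 1 * v 2 - u 2 * v 1, u 2 * v 0 - u 0 * v 2, u 0 * v 1 - u 1 * v 0]

theorem inner_E3 (u v : E3) : ⟪u, v⟫_ℝ = u 0 * v 0 + u 1 * v 1 + u 2 * v 2 := by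
  simp [PiLp.inner_apply, Fin.sum_univ_three, mul_comm]

theorem clm_det_eq (A : E3 →L[ℝ] E3) :
    A.det = (Matrix.of fun m k => A (EuclideanSpace.single k 1) m).det := by
  rw [ContinuousLinearMap.det, ← LinearMap.det_toMatrix (EuclideanSpace.basisFun (Fin 3) ℝ).toBasis]
  congr 1

theorem clm_apply_eq_sum (A : E3 →L[ℝ] E3) (w : E3) :
    A w = w 0 • A (EuclideanSpace.single 0 1) + w 1 • A (EuclideanSpace.single 1 1) +
      w 2 • A (EuclideanSpace.single 2 1) := by
  have h : w = w 0 • EuclideanSpace.single 0 1 + w 1 • EuclideanSpace.single 1 1 +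
      w 2 • EuclideanSpace.single 2 1 := by
    ext k; fin_cases k <;> simp
  conv_lhs => rw [h]
  simp only [map_add, map_smul]

/-- The cross product of two columns is, up to the determinant, a row of the inverse. -/
theorem inner_cross3_apply (A : E3 →L[ℝ] E3) (e : Fin 3) (w : E3) :
    ⟪cross3 (A (EuclideanSpace.single (e + 1) 1)) (A (EuclideanSpace.single (e + 2) 1)), A w⟫_ℝ =
      w e * A.det := by
  rw [clm_det_eq, Matrix.det_fin_three, clm_apply_eq_sum A w, inner_E3]
  fin_cases e <;>
    simp [cross3, show (2 : Fin 3) + 1 = 0 from rfl, show (2 : Fin 3) + 2 = 1 from rfl,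
      show (1 : Fin 3) + 1 = 2 from rfl, show (1 : Fin 3) + 2 = 0 from rfl] <;> ring

/-! ### Half neighbourhoods with disjoint images lie on opposite sides -/

/-- Two nonzero functionals that are nowhere positive simultaneously are negative multiples of each
other. -/
theorem exists_neg_multiple {n n' : E3} (hn : n ≠ 0) (hn' : n' ≠ 0)
    (h : ∀ v : E3, 0 < ⟪n, v⟫_ℝ → ¬ 0 < ⟪n', v⟫_ℝ) : ∃ c : ℝ, 0 < c ∧ n' = -c • n := by
  have h1 : 0 < ‖n‖ := norm_pos_iff.2 hn
  have h2 : 0 < ‖n'‖ := norm_pos_iff.2 hn'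
  have hle : ⟪n, n'⟫_ℝ ≤ -(‖n‖ * ‖n'‖) := by
    by_contra hc
    push Not at hc
    refine h (‖n'‖ • n + ‖n‖ • n') ?_ ?_ <;>
      rw [inner_add_right, inner_smul_right, inner_smul_right, real_inner_self_eq_norm_sq]
    · nlinarith
    · rw [real_inner_comm]; nlinarith
  have h0 : ‖n‖ • n' + ‖n'‖ • n = 0 := by
    refine norm_eq_zero.1 (pow_eq_zero_iff two_ne_zero |>.1 (le_antisymm ?_ (sq_nonneg _)))
    rw [norm_add_sq_real, inner_smul_left, inner_smul_right, norm_smul, norm_smul, norm_norm,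
      norm_norm, real_inner_comm]
    simp only [conj_trivial]
    nlinarith [mul_pos h1 h2]
  refine ⟨‖n‖⁻¹ * ‖n'‖, by positivity, ?_⟩
  have h3 : n' = ‖n‖⁻¹ • (‖n‖ • n') := by rw [smul_smul, inv_mul_cancel₀ h1.ne', one_smul]
  refine h3.trans ?_
  rw [eq_neg_of_add_eq_zero_left h0, smul_neg, smul_smul, neg_smul]

theorem HasDerivAt.eventually_lt_right {f : ℝ → ℝ} {f' x : ℝ} (h : HasDerivAt f f' x)
    (hf : 0 < f') : ∀ᶠ t in nhdsWithin 0 (Ioi 0), f x < f (x + t) := by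
  filter_upwards [h.tendsto_slope_zero_right.eventually (lt_mem_nhds hf), self_mem_nhdsWithin]
    with t ht ht0
  have ht0' : 0 < t := ht0
  rw [smul_eq_mul] at ht
  have := pos_of_mul_pos_right ht (inv_pos.2 ht0').le
  linarith

/-- A diffeomorphism maps one side of a coordinate plane onto a set that contains a segment in each
direction pointing strictly to that side. -/
theorem eventually_half (A : E3 ≃L[ℝ] E3) {F : E3 → E3} {ξ : E3}
    (hF : HasStrictFDerivAt F (A : E3 →L[ℝ] E3) ξ) {e : Fin 3} {ε : ℝ} {w : E3} (hw : 0 < ε * w e)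
    {U : Set E3} (hU : U ∈ nhds ξ) : ∀ᶠ t : ℝ in nhdsWithin 0 (Ioi 0),
      ∃ η ∈ U, 0 < ε * (η e - ξ e) ∧ F η = F ξ + t • A w := by
  have hg := hF.to_localInverse
  have hline : HasDerivAt (fun t : ℝ => F ξ + t • A w) (A w) 0 := by
    simpa using ((hasDerivAt_id (0 : ℝ)).smul_const (A w)).const_add (F ξ)
  have hy0 : F ξ + (0 : ℝ) • A w = F ξ := by simp
  have h1 : HasDerivAt (fun t : ℝ => hF.localInverse F A ξ (F ξ + t • A w)) w 0 := by
    have h2 : HasFDerivAt (hF.localInverse F A ξ) (A.symm : E3 →L[ℝ] E3) (F ξ + (0 : ℝ) • A w) := by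
      rw [hy0]; exact hg.hasFDerivAt
    have h5 := h2.comp_hasDerivAt (0 : ℝ) hline
    have h6 : (A.symm : E3 →L[ℝ] E3) (A w) = w := A.symm_apply_apply w
    rwa [h6] at h5
  have h3 : HasDerivAt (fun t : ℝ => ε * (hF.localInverse F A ξ (F ξ + t • A w) e)) (ε * w e) 0 := by
    have h4 : HasFDerivAt (fun v : E3 => v e) (EuclideanSpace.proj e : E3 →L[ℝ] ℝ)
        (hF.localInverse F A ξ (F ξ + (0 : ℝ) • A w)) :=
      (EuclideanSpace.proj e : E3 →L[ℝ] ℝ).hasFDerivAt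
    exact (h4.comp_hasDerivAt 0 h1).const_mul ε
  have hyc : Filter.Tendsto (fun t : ℝ => F ξ + t • A w) (nhdsWithin 0 (Ioi 0)) (nhds (F ξ)) := by
    have := hline.continuousAt.tendsto
    rw [hy0] at this
    exact this.mono_left nhdsWithin_le_nhds
  have himg : hF.localInverse F A ξ (F ξ) = ξ := hF.localInverse_apply_image
  have hgc : Filter.Tendsto (hF.localInverse F A ξ) (nhds (F ξ)) (nhds ξ) := by
    have := hg.continuousAt.tendsto
    rwa [himg] at this
  filter_upwards [h3.eventually_lt_right hw, hyc.eventually hF.eventually_right_inverse,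
    hyc.eventually (hgc.eventually hU)] with t ht1 ht2 ht3
  refine ⟨_, ht3, ?_, ht2⟩
  rw [hy0, himg, zero_add] at ht1
  linarith

namespace MultiPatch

variable {ι : Type*} {M : ControlGrid ι} {P : MultiPatch M} (hP : P.IsConforming)
include hP

/-- If two half neighbourhoods of a common point have disjoint images, then their tangent half
spaces are opposite: otherwise some direction points into both of them, and the images would overlap
along it. -/
theorem OneSided.opposite {i j : ι} {e e' : Fin 3} {ε ε' : ℝ} {ξ ξ' : E3} {F F' : E3 → E3}
    {A A' : E3 →L[ℝ] E3} (H : P.OneSided i e ε ξ F A) (H' : P.OneSided j e' ε' ξ' F' A')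
    (hx : P.param i ξ = P.param j ξ')
    (hno : ∃ U ∈ nhds ξ, ∃ U' ∈ nhds ξ', ∀ η ∈ U, ∀ η' ∈ U', η ∈ closedCube → η' ∈ closedCube →
      0 < ε * (η e - ξ e) → 0 < ε' * (η' e' - ξ' e') → P.param i η ≠ P.param j η') :
    ∃ c : ℝ, 0 < c ∧ ∀ w w', A w = A' w' → ε' * w' e' = -c * (ε * w e) := by
  obtain ⟨B, rfl⟩ := H.exists_equiv hP
  obtain ⟨B', rfl⟩ := H'.exists_equiv hP
  obtain ⟨U, hU, U', hU', hno⟩ := hno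
  -- the covectors that measure the inward direction in the physical space
  set ν : E3 →L[ℝ] ℝ := ε • (EuclideanSpace.proj e : E3 →L[ℝ] ℝ).comp (B.symm : E3 →L[ℝ] E3) with hν
  set ν' : E3 →L[ℝ] ℝ :=
    ε' • (EuclideanSpace.proj e' : E3 →L[ℝ] ℝ).comp (B'.symm : E3 →L[ℝ] E3) with hν'
  have hn : ∀ w, ⟪(InnerProductSpace.toDual ℝ E3).symm ν, B w⟫_ℝ = ε * w e := fun w => by
    rw [InnerProductSpace.toDual_symm_apply, hν]; simp
  have hn' : ∀ w, ⟪(InnerProductSpace.toDual ℝ E3).symm ν', B' w⟫_ℝ = ε' * w e' := fun w => by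
    rw [InnerProductSpace.toDual_symm_apply, hν']; simp
  set n := (InnerProductSpace.toDual ℝ E3).symm ν
  set n' := (InnerProductSpace.toDual ℝ E3).symm ν'
  have hε : ε ≠ 0 := by rcases H.sign with h | h <;> rw [h] <;> norm_num
  have hε' : ε' ≠ 0 := by rcases H'.sign with h | h <;> rw [h] <;> norm_num
  have hn0 : n ≠ 0 := fun h => by
    have := hn (EuclideanSpace.single e 1)
    rw [h, inner_zero_left] at this
    simp at this
    exact hε this.symm
  have hn0' : n' ≠ 0 := fun h => by
    have := hn' (EuclideanSpace.single e' 1)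
    rw [h, inner_zero_left] at this
    simp at this
    exact hε' this.symm
  obtain ⟨c, hc, hcn⟩ := exists_neg_multiple hn0 hn0' fun v h1 h2 => by
    obtain ⟨w, rfl⟩ := B.surjective v
    obtain ⟨w', hw'⟩ := B'.surjective (B w)
    rw [hn] at h1
    rw [← hw', hn'] at h2
    have e1 := eventually_half B H.strict h1 (Filter.inter_mem hU H.agree)
    have e2 := eventually_half B' H'.strict h2 (Filter.inter_mem hU' H'.agree)
    obtain ⟨t, ⟨η, hη, h3, h4⟩, ⟨η', hη', h5, h6⟩⟩ := (e1.and e2).exists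
    obtain ⟨m1, q1⟩ := hη.2 h3.le
    obtain ⟨m2, q2⟩ := hη'.2 h5.le
    refine hno η hη.1 η' hη'.1 m1 m2 h3 h5 ?_
    rw [← q1, ← q2, h4, h6, H.eq_param, H'.eq_param, hx, hw']
  refine ⟨c, hc, fun w w' hww => ?_⟩
  have hww' : B w = B' w' := hww
  rw [← hn', ← hn, hcn, inner_smul_left, ← hww']
  simp

/-! ### Orientation of the patches -/

theorem OneSided.det_ne_zero {i : ι} {e : Fin 3} {ε : ℝ} {ξ : E3} {F : E3 → E3}
    {A : E3 →L[ℝ] E3} (H : P.OneSided i e ε ξ F A) : A.det ≠ 0 := by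
  obtain ⟨B, rfl⟩ := H.exists_equiv hP
  intro h
  have := LinearEquiv.isUnit_det' B.toLinearEquiv
  rw [ContinuousLinearMap.det] at h
  exact this.ne_zero h

theorem det_fderiv_ne_zero {i : ι} {ξ : E3} (hξ : ξ ∈ P.genericCube i) :
    (fderiv ℝ (P.param i) ξ).det ≠ 0 :=
  (oneSided_of_generic hP hξ 0).det_ne_zero hP

theorem OneSided.eventually_det {i : ι} {e : Fin 3} {ε : ℝ} {ξ : E3} {F : E3 → E3}
    {A : E3 →L[ℝ] E3} (H : P.OneSided i e ε ξ F A) :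
    ∀ᶠ η in nhds ξ, 0 < ε * (η e - ξ e) → 0 < (fderiv ℝ (P.param i) η).det * A.det := by
  have hA := H.det_ne_zero hP
  have hcont : Filter.Tendsto (fun η => (fderiv ℝ F η).det * A.det) (nhds ξ)
      (nhds (A.det * A.det)) := by
    have h1 : ContinuousAt (fderiv ℝ F) ξ := H.smooth.continuousAt_fderiv (by simp)
    have h2 := (ContinuousLinearMap.continuous_det (𝕜 := ℝ) (E := E3)).continuousAt.comp h1
    have h3 := h2.tendsto
    simp only [Function.comp_apply, H.deriv.fderiv] at h3
    exact h3.mul_const _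
  filter_upwards [hcont.eventually (lt_mem_nhds (mul_self_pos.2 hA)),
    H.agree.eventually_nhds] with η h1 h2 h3
  have h4 : P.param i =ᶠ[nhds η] F := by
    have hc : ∀ᶠ η' : E3 in nhds η, 0 < ε * (η' e - ξ e) :=
      (by fun_prop : Continuous fun η' : E3 => ε * (η' e - ξ e)).continuousAt.eventually
        (lt_mem_nhds h3)
    filter_upwards [h2, hc] with η' h5 h6
    exact (h5 h6.le).2.symm
  rwa [h4.fderiv_eq]

/-- The Jacobian determinant does not change its sign across a knot: by injectivity the images of
the two half neighbourhoods of the knot are disjoint, so that their tangent half spaces are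
opposite. -/
theorem line_det_sign {i : ι} {e : Fin 3} {ξ : E3} (hξ : ∀ f, f ≠ e → ξ f ∈ P.gen i f) {t : ℝ}
    (ht : t ∈ Ioo (0 : ℝ) 1) : ∃ s : ℝ, ∀ᶠ t' in nhds t, t' ∈ P.gen i e →
      0 < (fderiv ℝ (P.param i) (upd ξ e t')).det * s := by
  have hne : ∀ f, f ≠ e → upd ξ e t f ∈ P.gen i f := fun f hf => by
    rw [upd_ne ξ hf]; exact hξ f hf
  have hlim : Filter.Tendsto (upd ξ e) (nhds t) (nhds (upd ξ e t)) :=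
    (continuous_upd_right ξ e).continuousAt
  have hte : upd ξ e t e = t := upd_same ξ e t
  by_cases hg : t ∈ P.gen i e
  · have hgen : upd ξ e t ∈ P.genericCube i := fun f => by
      by_cases hf : f = e
      · subst hf; rwa [hte]
      · exact hne f hf
    have hs := det_fderiv_ne_zero hP hgen
    refine ⟨(fderiv ℝ (P.param i) (upd ξ e t)).det, ?_⟩
    have h1 : ContinuousAt (fderiv ℝ (P.param i)) (upd ξ e t) :=
      (contDiffAt_param hP hgen).continuousAt_fderiv (by simp)
    have h2 := (ContinuousLinearMap.continuous_det (𝕜 := ℝ) (E := E3)).continuousAt.comp h1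
    have h3 := (h2.tendsto.comp hlim).mul_const (fderiv ℝ (P.param i) (upd ξ e t)).det
    exact (h3.eventually (lt_mem_nhds (mul_self_pos.2 hs))).mono fun _ h _ => h
  · obtain ⟨F, A, H⟩ := exists_oneSided hP (ε := 1) hne (by rw [hte]; exact ⟨ht.1.le, ht.2.le⟩)
      (Or.inl ⟨rfl, by rw [hte]; exact ht.2⟩)
    obtain ⟨F', A', H'⟩ := exists_oneSided hP (ε := -1) hne (by rw [hte]; exact ⟨ht.1.le, ht.2.le⟩)
      (Or.inr ⟨rfl, by rw [hte]; exact ht.1⟩)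
    obtain ⟨c, hc, hcw⟩ := H.opposite hP H' rfl ⟨univ, Filter.univ_mem, univ, Filter.univ_mem,
      fun η _ η' _ h1 h2 h3 h4 h5 => by
        have := injOn_param hP i h1 h2 h5
        rw [this] at h3
        linarith⟩
    have hAA : 0 < A.det * A'.det := by
      obtain ⟨B', hB'⟩ := H'.exists_equiv hP
      obtain ⟨w', hw'⟩ := B'.surjective (A (EuclideanSpace.single e 1))
      have hw2 : A (EuclideanSpace.single e 1) = A' w' := by rw [← hw', ← hB']; rfl
      have h1 := hcw _ _ hw2
      have a1 : e + 1 ≠ e := (by decide : ∀ e : Fin 3, e + 1 ≠ e) e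
      have a2 : e + 2 ≠ e := (by decide : ∀ e : Fin 3, e + 2 ≠ e) e
      have h2 := inner_cross3_apply A e (EuclideanSpace.single e 1)
      have h3 := inner_cross3_apply A' e w'
      rw [H.apply_single hP a1 (hne _ a1), H.apply_single hP a2 (hne _ a2)] at h2
      rw [H'.apply_single hP a1 (hne _ a1), H'.apply_single hP a2 (hne _ a2), ← hw2, h2] at h3
      simp only [PiLp.single_apply, if_true, one_mul, mul_one] at h1 h3
      have h4 : w' e = c := by linarith
      rw [h3, h4]
      have := mul_pos hc (mul_self_pos.2 (H'.det_ne_zero hP))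
      linarith
    refine ⟨A.det, ?_⟩
    filter_upwards [hlim.eventually (H.eventually_det hP), hlim.eventually (H'.eventually_det hP)]
      with t' h1 h2 h3
    simp only [upd_same] at h1 h2
    rcases lt_trichotomy t' t with h4 | h4 | h4
    · have := h2 (by linarith)
      by_contra h5
      nlinarith [mul_pos this hAA, mul_self_nonneg A'.det]
    · exact absurd (h4 ▸ h3) hg
    · exact h1 (by linarith)

theorem line_det_mul_pos {i : ι} {e : Fin 3} {ξ : E3} (hξ : ∀ f, f ≠ e → ξ f ∈ P.gen i f) {t t' : ℝ}
    (ht : t ∈ P.gen i e) (ht' : t' ∈ P.gen i e) :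
    0 < (fderiv ℝ (P.param i) (upd ξ e t)).det * (fderiv ℝ (P.param i) (upd ξ e t')).det := by
  choose! s hs using fun t (h : t ∈ Ioo (0 : ℝ) 1) => line_det_sign hP hξ h
  have key : 0 < s t * s t' := by
    refine isPreconnected_Ioo.induction₂ (fun x y => 0 < s x * s y) (fun x hx => ?_)
      (fun x y z _ _ _ h1 h2 => ?_) (fun x y _ _ h => by rwa [mul_comm]) ht.1 ht'.1
    · filter_upwards [nhdsWithin_le_nhds (hs x hx).eventually_nhds, self_mem_nhdsWithin]
        with y h1 hy
      have hcl : y ∈ closure (P.gen i e) :=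
        IsOpenKnotVector.Icc_subset_closure_genericSet ⟨hy.1.le, hy.2.le⟩
      obtain ⟨u, ⟨h2, h3⟩, h4⟩ := mem_closure_iff_nhds.1 hcl _ (Filter.inter_mem h1 (hs y hy))
      have h5 := h2 h4
      have h6 := h3 h4
      by_contra h7
      nlinarith [mul_pos h5 h6, mul_self_nonneg (fderiv ℝ (P.param i) (upd ξ e u)).det]
    · by_contra h3
      nlinarith [mul_pos h1 h2, mul_self_nonneg (s y)]
  have h1 := (hs t ht.1).self_of_nhds ht
  have h2 := (hs t' ht'.1).self_of_nhds ht'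
  by_contra h3
  nlinarith [mul_pos h1 h2]

theorem det_mul_pos {i : ι} {ξ η : E3} (hξ : ξ ∈ P.genericCube i) (hη : η ∈ P.genericCube i) :
    0 < (fderiv ℝ (P.param i) ξ).det * (fderiv ℝ (P.param i) η).det := by
  have hu : ∀ {ξ : E3} (e : Fin 3), ξ ∈ P.genericCube i → upd ξ e (η e) ∈ P.genericCube i :=
    fun {ξ} e h f => by
      rw [upd_apply]
      split_ifs with hf
      · subst hf; exact hη f
      · exact h f
  have hstep : ∀ {ξ : E3} (e : Fin 3), ξ ∈ P.genericCube i →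
      0 < (fderiv ℝ (P.param i) ξ).det * (fderiv ℝ (P.param i) (upd ξ e (η e))).det :=
    fun {ξ} e h => by
      have := line_det_mul_pos hP (ξ := ξ) (e := e) (fun f _ => h f) (h e) (hη e)
      rwa [upd_eq_self] at this
  have h1 := hstep 0 hξ
  have h2 := hstep 1 (hu 0 hξ)
  have h3 := hstep 2 (hu 1 (hu 0 hξ))
  have h4 : upd (upd (upd ξ 0 (η 0)) 1 (η 1)) 2 (η 2) = η := by
    ext k; fin_cases k <;> simp [upd_apply]
  rw [h4] at h3
  have := mul_pos (mul_pos h1 h2) h3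
  by_contra h5
  nlinarith [mul_self_nonneg ((fderiv ℝ (P.param i) (upd ξ 0 (η 0))).det *
    (fderiv ℝ (P.param i) (upd (upd ξ 0 (η 0)) 1 (η 1))).det)]

omit hP in
variable (P) in
open Classical in
/-- The orientation of patch `i`: the sign of the Jacobian determinant. -/
def orient (i : ι) : ℝ :=
  if ∃ ξ ∈ P.genericCube i, 0 < (fderiv ℝ (P.param i) ξ).det then 1 else -1

omit hP in
theorem orient_mul_self (i : ι) : P.orient i * P.orient i = 1 := by
  rw [orient]; split_ifs <;> norm_num

theorem orient_mul_det_pos {i : ι} {ξ : E3} (hξ : ξ ∈ P.genericCube i) :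
    0 < P.orient i * (fderiv ℝ (P.param i) ξ).det := by
  rw [orient]
  split_ifs with h
  · obtain ⟨η, hη, h1⟩ := h
    rw [one_mul]
    exact pos_of_mul_pos_right (det_mul_pos hP hη hξ) h1.le
  · push Not at h
    have := lt_of_le_of_ne (h ξ hξ) (det_fderiv_ne_zero hP hξ)
    linarith

theorem abs_det_eq {i : ι} {ξ : E3} (hξ : ξ ∈ P.genericCube i) :
    |(fderiv ℝ (P.param i) ξ).det| = P.orient i * (fderiv ℝ (P.param i) ξ).det := by
  have h := orient_mul_det_pos hP hξ
  have h2 : |P.orient i| = 1 := by rw [orient]; split_ifs <;> simp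
  rw [← abs_of_pos h, abs_mul, h2, one_mul]

/-- One-sided derivatives have the orientation of the patch, as limits of derivatives at generic
points. -/
theorem OneSided.orient_mul_det_pos {i : ι} {e : Fin 3} {ε : ℝ} {ξ : E3} {F : E3 → E3}
    {A : E3 →L[ℝ] E3} (H : P.OneSided i e ε ξ F A) (hξ : ∀ f, f ≠ e → ξ f ∈ P.gen i f) :
    0 < P.orient i * A.det := by
  have hlim : Filter.Tendsto (upd ξ e) (nhds (ξ e)) (nhds ξ) := by
    have := (continuous_upd_right ξ e).tendsto (ξ e)
    rwa [upd_eq_self] at this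
  have hev := (hlim.eventually ((H.eventually_det hP).and H.agree))
  -- a generic parameter close to `ξ e`, on the right side of it
  have hex : ∃ t ∈ P.gen i e, 0 < ε * (t - ξ e) ∧
      0 < (fderiv ℝ (P.param i) (upd ξ e t)).det * A.det := by
    have hdense : Dense ((P.knot i e '' Iic (M.n i e + P.degree) ∪ {0, 1})ᶜ : Set ℝ) :=
      ((((Set.finite_Iic _).image _).union (Set.toFinite _)).countable).dense_compl ℝ
    obtain ⟨r, hr, hball⟩ := Metric.eventually_nhds_iff.1 hev
    have hopen : IsOpen {t : ℝ | 0 < ε * (t - ξ e) ∧ |t - ξ e| < r} :=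
      (isOpen_lt continuous_const (by fun_prop : Continuous fun t : ℝ => ε * (t - ξ e))).inter
        (isOpen_lt (by fun_prop : Continuous fun t : ℝ => |t - ξ e|) continuous_const)
    have hne : {t : ℝ | 0 < ε * (t - ξ e) ∧ |t - ξ e| < r}.Nonempty := by
      rcases H.sign with h | h
      · exact ⟨ξ e + r / 2, by
          constructor
          · rw [h]; linarith
          · rw [add_sub_cancel_left, abs_of_pos (by linarith)]; linarith⟩
      · exact ⟨ξ e - r / 2, by
          constructor
          · rw [h]; linarith
          · rw [sub_sub_cancel_left, abs_neg, abs_of_pos (by linarith)]; linarith⟩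
    obtain ⟨t, ⟨h1, h2⟩, h3⟩ := hdense.inter_open_nonempty _ hopen hne
    obtain ⟨h4, h5⟩ := hball (show dist t (ξ e) < r from h2)
    simp only [upd_same] at h4 h5
    refine ⟨t, ?_, h1, h4 h1⟩
    have h6 := (h5 h1.le).1 e
    rw [upd_same] at h6
    simp only [mem_compl_iff, mem_union, mem_image, mem_Iic, mem_insert_iff, mem_singleton_iff,
      not_or, not_exists, not_and] at h3
    exact ⟨⟨lt_of_le_of_ne h6.1 (Ne.symm h3.2.1), lt_of_le_of_ne h6.2 h3.2.2⟩, h3.1⟩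
  obtain ⟨t, ht, -, hdet⟩ := hex
  have hgen : upd ξ e t ∈ P.genericCube i := fun f => by
    rw [upd_apply]
    split_ifs with hf
    · subst hf; exact ht
    · exact hξ f hf
  have := MultiPatch.orient_mul_det_pos hP hgen
  by_contra hcon
  nlinarith [mul_pos this hdet, mul_self_nonneg (fderiv ℝ (P.param i) (upd ξ e t)).det]

end MultiPatch
end

noncomputable section

/-! ### Traces of splines on sides, edges and vertices of a patch -/

/-- The value of a coordinate on a side of the cube. -/
def sideVal (s : Bool) : ℝ := if s then 1 else 0

theorem sideVal_mem (s : Bool) : sideVal s ∈ Icc (0 : ℝ) 1 := by cases s <;> simp [sideVal]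

theorem sideVal_xor (s b : Bool) :
    sideVal (xor s b) = if b then 1 - sideVal s else sideVal s := by
  cases s <;> cases b <;> simp [sideVal]

/-- The gluing of two patches, extended to the whole cube. -/
def Gluing.act (g : Gluing) (ξ : E3) : E3 := WithLp.toLp 2 fun f =>
  if g.flip (g.perm.symm f) then 1 - ξ (g.perm.symm f) else ξ (g.perm.symm f)

theorem Gluing.act_apply (g : Gluing) (ξ : E3) (e : Fin 3) :
    g.act ξ (g.perm e) = if g.flip e then 1 - ξ e else ξ e := by simp [Gluing.act]

theorem Gluing.act_upd (g : Gluing) (ξ : E3) (e : Fin 3) (t : ℝ) :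
    g.act (upd ξ e t) = upd (g.act ξ) (g.perm e) (if g.flip e then 1 - t else t) := by
  ext f
  obtain ⟨e', rfl⟩ := g.perm.surjective f
  rw [g.act_apply, upd_apply, upd_apply, g.act_apply]
  by_cases h : e' = e
  · subst h; simp
  · simp [h]

theorem Gluing.act_upd_side (g : Gluing) (ξ : E3) (e : Fin 3) (s : Bool) :
    g.act (upd ξ e (sideVal s)) = upd (g.act ξ) (g.perm e) (sideVal (xor s (g.flip e))) := by
  rw [g.act_upd, sideVal_xor]

theorem Gluing.continuous_act (g : Gluing) : Continuous g.act := by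
  refine (PiLp.continuous_toLp 2 _).comp (continuous_pi fun f => ?_)
  split_ifs <;> fun_prop

theorem Gluing.act_injective (g : Gluing) : Function.Injective g.act := by
  intro ξ η h
  ext e
  have := congrArg (fun v : E3 => v (g.perm e)) h
  simp only [g.act_apply] at this
  split_ifs at this <;> linarith

theorem Gluing.act_surjective (g : Gluing) : Function.Surjective g.act := by
  intro η
  refine ⟨WithLp.toLp 2 fun e => if g.flip e then 1 - η (g.perm e) else η (g.perm e), ?_⟩
  ext f
  obtain ⟨e, rfl⟩ := g.perm.surjective f
  rw [g.act_apply]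
  dsimp only
  split_ifs <;> ring

theorem Gluing.act_mem_closedCube (g : Gluing) {ξ : E3} : g.act ξ ∈ closedCube ↔ ξ ∈ closedCube := by
  have key : ∀ e, g.act ξ (g.perm e) ∈ Icc (0 : ℝ) 1 ↔ ξ e ∈ Icc (0 : ℝ) 1 := fun e => by
    rw [g.act_apply]
    split_ifs
    · exact ⟨fun h => ⟨by linarith [h.2], by linarith [h.1]⟩,
        fun h => ⟨by linarith [h.2], by linarith [h.1]⟩⟩
    · rfl
  exact ⟨fun h e => (key e).1 (h _), fun h f => by
    obtain ⟨e, rfl⟩ := g.perm.surjective f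
    exact (key e).2 (h e)⟩

/-- The whole-cube extension of a gluing preserves the volume. -/
theorem Gluing.integral_act (g : Gluing) (h : E3 → ℝ) :
    ∫ ξ in closedCube, h (g.act ξ) = ∫ ξ in closedCube, h ξ := by
  have h1 : MeasurePreserving (fun x : Fin 3 → ℝ => fun e => if g.flip e then 1 - x e else x e) :=
    volume_preserving_pi (f := fun e t => if g.flip e then 1 - t else t) fun e => by
      split_ifs
      · exact Measure.measurePreserving_sub_left volume 1
      · exact MeasurePreserving.id _
  have h2 := volume_measurePreserving_piCongrLeft (fun _ : Fin 3 => ℝ) g.perm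
  have h3 := (EuclideanSpace.volume_preserving_symm_measurableEquiv_toLp (Fin 3)).symm
  have h4 := EuclideanSpace.volume_preserving_symm_measurableEquiv_toLp (Fin 3)
  have hmp : MeasurePreserving g.act := by
    have := h3.comp (h2.comp (h1.comp h4))
    convert this using 1
    funext ξ
    ext f
    obtain ⟨e, rfl⟩ := g.perm.surjective f
    rw [g.act_apply]
    simp [MeasurableEquiv.piCongrLeft, Equiv.piCongrLeft]
  rw [← hmp.setIntegral_preimage_emb (g.continuous_act.measurableEmbedding g.act_injective) h closedCube]
  congr 2
  ext ξ
  exact g.act_mem_closedCube.symm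

/-- Linear independence of tensor products of univariate functions, for a single coefficient. -/
theorem sum_tens_eq_zero {N : Fin 3 → ℕ} (β : Fin 3 → ℕ → ℝ → ℝ) (G : Fin 3 → Set ℝ)
    (γ : (∀ f, Fin (N f)) → ℝ) (a₀ : ∀ f, Fin (N f))
    (hG : ∀ (e : Fin 3) (c : Fin (N e) → ℝ), (∀ t ∈ G e, ∑ k, c k * β e k t = 0) → c (a₀ e) = 0)
    (h : ∀ ξ : E3, (∀ e, ξ e ∈ G e) → ∑ a, γ a * tens β (fun f => a f) ξ = 0)
    (hne : ∀ e, (G e).Nonempty) : γ a₀ = 0 := by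
  -- one direction after the other, the splines are replaced by indicators of the index `a₀`
  have key : ∀ s : Finset (Fin 3), ∀ ξ : E3, (∀ e, ξ e ∈ G e) →
      ∑ a, γ a * tens (fun e => if e ∈ s then fun k _ => if k = (a₀ e : ℕ) then 1 else 0 else β e)
        (fun f => a f) ξ = 0 := by
    intro s
    induction s using Finset.induction_on with
    | empty => simpa using h
    | insert e s hes ih =>
      intro ξ hξ
      set βs : Fin 3 → ℕ → ℝ → ℝ :=
        fun e => if e ∈ s then fun k _ => if k = (a₀ e : ℕ) then 1 else 0 else β e with hβs
      have hup : (fun f => if f ∈ insert e s then fun k _ => if k = (a₀ f : ℕ) then 1 else 0 else β f)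
          = Function.update βs e (fun k _ => if k = (a₀ e : ℕ) then (1 : ℝ) else 0) := by
        funext f
        by_cases hf : f = e
        · subst hf; simp
        · simp [hf, hβs]
      rw [hup]
      simp only [tens_update]
      have h1 := hG e (fun k => ∑ a : ∀ f, Fin (N f), if a e = k then
        γ a * ∏ f ∈ Finset.univ.erase e, βs f (a f) (ξ f) else 0) fun t ht => by
          have h2 := ih (upd ξ e t) fun f => by
            rw [upd_apply]; split_ifs with hf
            · subst hf; exact ht
            · exact hξ f
          refine Eq.trans ?_ h2
          simp only [Finset.sum_mul, ite_mul, zero_mul]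
          rw [Finset.sum_comm]
          refine Finset.sum_congr rfl fun a _ => ?_
          rw [Finset.sum_ite_eq, if_pos (Finset.mem_univ _), tens_upd]
          simp only [hβs, if_neg hes]
          ring
      refine Eq.trans (Finset.sum_congr rfl fun a _ => ?_) h1
      by_cases h3 : a e = a₀ e
      · simp [h3]
      · have h4 : ((a e : ℕ) = a₀ e) ↔ False := ⟨fun h => h3 (Fin.ext h), False.elim⟩
        simp [h3, h4]
  choose t ht using hne
  have h1 := key Finset.univ (WithLp.toLp 2 t) ht
  rw [Finset.sum_eq_single a₀] at h1
  · simpa [tens] using h1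
  · intro a _ ha
    obtain ⟨e, he⟩ := Function.ne_iff.1 ha
    have : ((a e : ℕ) = a₀ e) ↔ False := ⟨fun h => he (Fin.ext h), False.elim⟩
    rw [tens, Finset.prod_eq_zero (Finset.mem_univ e), mul_zero]
    simp [this]
  · simp

namespace MultiPatch

variable {ι : Type*} {M : ControlGrid ι} {P : MultiPatch M} (hP : P.IsConforming)
include hP

theorem uni_side (i : ι) {D : Finset (Fin 3)} {e : Fin 3} (he : e ∉ D) (s : Bool) {k : ℕ}
    (hk : k < M.n i e) :
    P.uni i D e k (sideVal s) = if (if s then k + 1 = M.n i e else k = 0) then 1 else 0 := by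
  rw [uni, if_neg he]
  cases s
  · simp [sideVal, (hP.knots i e).bspline_zero hk]
  · simp [sideVal, (hP.knots i e).bspline_one hk]

omit hP in
theorem gen_nonempty (i : ι) (e : Fin 3) : (P.gen i e).Nonempty := by
  have : (1 : ℝ) ∈ closure (P.gen i e) :=
    IsOpenKnotVector.Icc_subset_closure_genericSet ⟨zero_le_one, le_rfl⟩
  exact closure_nonempty_iff.1 ⟨_, this⟩

/-- The splines that do not vanish on a given side, edge or vertex `φ` of the cube have linearly
independent restrictions to it. -/
theorem coeff_eq_zero (i : ι) {D : Finset (Fin 3)} (φ : Fin 3 → Option Bool)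
    (hφ : ∀ e s, φ e = some s → e ∉ D) (γ : M.Idx i D → ℝ)
    (h : ∀ ξ : E3, (∀ e s, φ e = some s → ξ e = sideVal s) → (∀ e, φ e = none → ξ e ∈ P.gen i e) →
      P.field i D γ ξ = 0) (a : M.Idx i D)
    (ha : ∀ e s, φ e = some s → ControlGrid.OnSide a e s) : γ a = 0 := by
  refine sum_tens_eq_zero (P.uni i D)
    (fun e => {t | (∀ s, φ e = some s → t = sideVal s) ∧ (φ e = none → t ∈ P.gen i e)}) γ a
    (fun e c hc => ?_) (fun ξ hξ => ?_) (fun e => ?_)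
  · cases hφe : φ e with
    | some s =>
      have h1 := hc (sideVal s) ⟨fun s' h' => by rw [hφe] at h'; cases h'; rfl,
        fun h' => by rw [hφe] at h'; cases h'⟩
      rw [Finset.sum_eq_single (a e), uni_side hP i (hφ e s hφe) s (idx_lt a e),
        if_pos (ha e s hφe).2, mul_one] at h1
      · exact h1
      · intro k _ hk
        have hkl : (k : ℕ) < M.n i e := k.isLt.trans_le (Nat.sub_le _ _)
        rw [uni_side hP i (hφ e s hφe) s hkl, if_neg, mul_zero]
        intro h2
        have h3 := (ha e s hφe).2
        apply hk
        apply Fin.ext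
        cases s <;> simp_all
        omega
      · simp
    | none =>
      have hc' : ∀ t ∈ P.gen i e, ∑ k : Fin (M.ext i D e), c k * P.uni i D e k t = 0 :=
        fun t ht => hc t ⟨fun s' h' => (by rw [hφe] at h'; cases h'), fun _ => ht⟩
      set c' : ℕ → ℝ := fun k => if hk : k < M.ext i D e then c ⟨k, hk⟩ else 0 with hcd
      have hck : ∀ k : Fin (M.ext i D e), c' k = c k := fun k => by simp [hcd]
      have hc2 : ∀ t ∈ P.gen i e, ∑ k ∈ Finset.range (M.ext i D e), c' k * P.uni i D e k t = 0 :=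
        fun t ht => by
          rw [← hc' t ht, ← Fin.sum_univ_eq_sum_range (fun k => c' k * P.uni i D e k t)]
          exact Finset.sum_congr rfl fun k _ => by rw [hck]
      rw [← hck]
      by_cases he : e ∈ D
      · simp only [uni, if_pos he, ControlGrid.ext] at hc2
        exact (hP.knots i e).curryBspline_linearIndep hP.degree_pos c' hc2 _ (by
          have := (a e).isLt; simpa only [ControlGrid.ext, if_pos he] using this)
      · simp only [uni, if_neg he, ControlGrid.ext] at hc2
        exact (hP.knots i e).bspline_linearIndep hP.degree_pos c' hc2 _ (idx_lt a e)
  · have h1 := h ξ (fun e => (hξ e).1) (fun e => (hξ e).2)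
    simpa only [field, basisFun_eq_tens] using h1
  · cases hφe : φ e with
    | some s => exact ⟨sideVal s, by simp⟩
    | none =>
      obtain ⟨t, ht⟩ := gen_nonempty (P := P) i e
      exact ⟨t, by simpa using ht⟩

/-- Matching knot vectors give matching splines, in the same or in the reversed order. -/
theorem uni_glue {i j : ι} {g : Gluing} (hg : M.glue i j = some g) {e : Fin 3}
    (he : g.face e = none) {D D' : Finset (Fin 3)} (hD : D' = D.image g.perm) {t : ℝ}
    (ht : t ∈ P.gen i e ∨ (t ∈ Icc (0 : ℝ) 1 ∧ e ∉ D)) {k l : ℕ} (hk : k < M.ext i D e)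
    (hkl : if g.flip e then k + l + 1 = M.ext i D e else l = k) :
    P.uni j D' (g.perm e) l (if g.flip e then 1 - t else t) = P.uni i D e k t := by
  obtain ⟨hn, hk'⟩ := hP.glue_knots i j g hg e he
  have hmem : g.perm e ∈ D' ↔ e ∈ D := by
    rw [hD]; simp
  have h2 := hP.two_le i e
  have hp := hP.degree_pos
  cases hf : g.flip e
  · simp only [hf, Bool.false_eq_true, if_false] at hk' hkl ⊢
    subst hkl
    rw [uni, uni]
    simp only [hmem]
    by_cases he' : e ∈ D
    · simp only [if_pos he', ControlGrid.ext] at hk ⊢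
      rw [curryBspline, curryBspline, hk' _ (by omega), hk' _ (by omega),
        bspline_congr (Ξ' := P.knot i e) _ _ _ fun m _ _ => hk' m (by omega)]
    · simp only [if_neg he', ControlGrid.ext] at hk ⊢
      exact bspline_congr _ _ _ fun m _ _ => hk' m (by omega)
  · simp only [hf, if_true] at hk' hkl ⊢
    rw [uni, uni]
    simp only [hmem]
    by_cases he' : e ∈ D
    · simp only [if_pos he', ControlGrid.ext] at hk hkl ⊢
      rcases ht with ht | ht
      · exact IsOpenKnotVector.curryBspline_reflect hP.degree_pos hk' ht k l (by omega)
      · exact absurd he' ht.2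
    · simp only [if_neg he', ControlGrid.ext] at hk hkl ⊢
      have hknot := hP.knots j (g.perm e)
      rw [hn] at hknot
      have ht' : t ∈ Icc (0 : ℝ) 1 := by
        rcases ht with ht | ht
        exacts [⟨ht.1.1.le, ht.1.2.le⟩, ht.1]
      exact (hP.knots i e).bspline_reflect_Icc hknot hk' ht' k l (by omega)

open Classical in
/-- On the common side, edge or vertex of two patches, each basis function of the second patch
coincides with the basis function of the entity of the first patch that it is glued to, and vanishes
if there is none. -/
theorem basisFun_act {i j : ι} {g : Gluing} (hg : M.glue i j = some g) {D D' : Finset (Fin 3)}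
    (hD : D' = D.image g.perm) (b : M.Idx j D') {ξ : E3}
    (hface : ∀ e s, g.face e = some s → ξ e = sideVal s ∧ e ∉ D)
    (hfree : ∀ e, g.face e = none → ξ e ∈ P.gen i e ∨ (ξ e ∈ Icc (0 : ℝ) 1 ∧ e ∉ D)) :
    P.basisFun j D' b (g.act ξ) =
      ∑ a : M.Idx i D, if ControlGrid.Matches g a b then P.basisFun i D a ξ else 0 := by
  set K : ∀ e, Fin (M.ext i D e) → Prop := fun e k => match g.face e with
    | none => if g.flip e then (k : ℕ) + (b (g.perm e) : ℕ) + 1 = M.ext i D e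
        else (b (g.perm e) : ℕ) = k
    | some s => (e ∉ D ∧ if s then (k : ℕ) + 1 = M.n i e else (k : ℕ) = 0) ∧
        ControlGrid.OnSide b (g.perm e) (xor s (g.flip e)) with hK
  have hM : ∀ a : M.Idx i D, ControlGrid.Matches g a b ↔ ∀ e, K e (a e) := fun a =>
    ⟨fun h => h.2, fun h => ⟨hD, h⟩⟩
  simp only [hM, basisFun_eq_tens]
  rw [sum_ite_tens K, tens, ← Equiv.prod_comp g.perm]
  refine Finset.prod_congr rfl fun e _ => ?_
  rw [g.act_apply]
  cases hfe : g.face e with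
  | none =>
    have hext : M.ext j D' (g.perm e) = M.ext i D e := by
      have : g.perm e ∈ D' ↔ e ∈ D := by rw [hD]; simp
      simp only [ControlGrid.ext, this, (hP.glue_knots i j g hg e hfe).1]
    have hb : (b (g.perm e) : ℕ) < M.ext i D e := hext ▸ (b (g.perm e)).isLt
    have hKe : ∀ k : Fin (M.ext i D e), K e k ↔
        if g.flip e then (k : ℕ) + (b (g.perm e) : ℕ) + 1 = M.ext i D e
          else (b (g.perm e) : ℕ) = k := fun k => by simp only [hK, hfe]
    obtain ⟨k₀, hk₀⟩ : ∃ k : Fin (M.ext i D e), K e k := by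
      cases hf : g.flip e
      · exact ⟨⟨b (g.perm e), hb⟩, (hKe _).2 (by rw [hf]; simp)⟩
      · exact ⟨⟨M.ext i D e - 1 - b (g.perm e), by omega⟩, (hKe _).2 (by rw [hf]; simp; omega)⟩
    rw [Finset.sum_eq_single k₀, if_pos hk₀,
      uni_glue hP hg hfe hD (hfree e hfe) k₀.isLt ((hKe k₀).1 hk₀)]
    · intro k _ hk
      rw [if_neg]
      intro h
      rw [hKe] at h hk₀
      apply hk
      apply Fin.ext
      split_ifs at h hk₀ <;> omega
    · simp
  | some s =>
    obtain ⟨hv, he⟩ := hface e s hfe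
    have he' : g.perm e ∉ D' := by rw [hD]; simpa using he
    have h2 := hP.two_le i e
    have hKe : ∀ k : Fin (M.ext i D e), K e k ↔
        (e ∉ D ∧ if s then (k : ℕ) + 1 = M.n i e else (k : ℕ) = 0) ∧
        ControlGrid.OnSide b (g.perm e) (xor s (g.flip e)) := fun k => by simp only [hK, hfe]
    rw [hv, ← sideVal_xor, uni_side hP j he' _ (idx_lt b _)]
    by_cases hb : ControlGrid.OnSide b (g.perm e) (xor s (g.flip e))
    · rw [if_pos hb.2]
      obtain ⟨k₀, hk₀⟩ : ∃ k : Fin (M.ext i D e), if s then (k : ℕ) + 1 = M.n i e else (k : ℕ) = 0 := by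
        cases s
        · exact ⟨⟨0, by simp [ControlGrid.ext, he]; omega⟩, by simp⟩
        · exact ⟨⟨M.n i e - 1, by simp [ControlGrid.ext, he]; omega⟩, by simp; omega⟩
      rw [Finset.sum_eq_single k₀, if_pos ((hKe k₀).2 ⟨⟨he, hk₀⟩, hb⟩), uni_side hP i he s
        (k₀.isLt.trans_le (Nat.sub_le _ _)), if_pos hk₀]
      · intro k _ hk
        rw [if_neg]
        intro h
        have h3 := ((hKe k).1 h).1.2
        apply hk
        apply Fin.ext
        cases s <;> simp at h3 hk₀ <;> omega
      · simp
    · rw [if_neg fun h => hb ⟨he', h⟩, Finset.sum_eq_zero]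
      intro k _
      rw [if_neg fun h => hb ((hKe k).1 h).2]

omit hP in
theorem matches_right_unique {i j : ι} {g : Gluing} {D D' : Finset (Fin 3)} {a : M.Idx i D}
    {b b' : M.Idx j D'} (h : ControlGrid.Matches g a b) (h' : ControlGrid.Matches g a b') :
    b = b' := by
  refine idx_ext fun f => ?_
  obtain ⟨e, rfl⟩ := g.perm.surjective f
  have h1 := h.2 e
  have h2 := h'.2 e
  cases hfe : g.face e with
  | none =>
    simp only [hfe] at h1 h2
    split_ifs at h1 h2 <;> omega
  | some s =>
    simp only [hfe] at h1 h2
    have h3 := h1.2.2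
    have h4 := h2.2.2
    split_ifs at h3 h4 <;> omega

/-- Each entity on the common side, edge or vertex of two patches is identified with one of the
other patch. -/
theorem exists_matches {i j : ι} {g : Gluing} (hg : M.glue i j = some g) {D D' : Finset (Fin 3)}
    (hD : D' = D.image g.perm) (a : M.Idx i D)
    (ha : ∀ e s, g.face e = some s → ControlGrid.OnSide a e s) :
    ∃ b : M.Idx j D', ControlGrid.Matches g a b := by
  have hmem : ∀ e, g.perm e ∈ D' ↔ e ∈ D := fun e => by rw [hD]; simp
  have hval : ∀ e, ∃ l, l < M.ext j D' (g.perm e) ∧ match g.face e with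
    | none => if g.flip e then (a e : ℕ) + l + 1 = M.ext i D e else l = a e
    | some s => if xor s (g.flip e) then l + 1 = M.n j (g.perm e) else l = 0 := by
    intro e
    have h2 := hP.two_le j (g.perm e)
    have hae := (a e).isLt
    cases hfe : g.face e with
    | none =>
      have hext : M.ext j D' (g.perm e) = M.ext i D e := by
        simp only [ControlGrid.ext, hmem, (hP.glue_knots i j g hg e hfe).1]
      rw [hext]
      cases hf : g.flip e
      · exact ⟨a e, hae, by simp⟩
      · exact ⟨M.ext i D e - 1 - a e, by omega, by simp; omega⟩
    | some s =>
      have he : g.perm e ∉ D' := fun h => (ha e s hfe).1 ((hmem e).1 h)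
      simp only [ControlGrid.ext, if_neg he]
      cases hx : xor s (g.flip e)
      · exact ⟨0, by omega, by simp⟩
      · exact ⟨M.n j (g.perm e) - 1, by omega, by simp; omega⟩
  choose l hl hl2 using hval
  have hls : ∀ e, l (g.perm.symm (g.perm e)) = l e := fun e => by rw [Equiv.symm_apply_apply]
  obtain ⟨b, hb⟩ := exists_idx_of_lt (M := M) j D' (fun f => l (g.perm.symm f)) fun f => by
    have := hl (g.perm.symm f)
    rwa [Equiv.apply_symm_apply] at this
  refine ⟨b, hD, fun e => ?_⟩
  have h1 := hl2 e
  have h3 : (b (g.perm e) : ℕ) = l e := (hb _).trans (hls e)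
  cases hfe : g.face e with
  | none => simpa only [hfe, h3] using h1
  | some s =>
    simp only [hfe] at h1
    refine ⟨ha e s hfe, fun h => (ha e s hfe).1 ((hmem e).1 h), ?_⟩
    rwa [h3]

omit hP in
theorem matches_onSide {i j : ι} {g : Gluing} {D D' : Finset (Fin 3)} {a : M.Idx i D}
    {b : M.Idx j D'} (h : ControlGrid.Matches g a b) :
    ∀ e s, g.face e = some s → ControlGrid.OnSide a e s := fun e s hs => by
  have := h.2 e
  simp only [hs] at this
  exact this.1

theorem basisFun_eq_zero {i : ι} {D : Finset (Fin 3)} {a : M.Idx i D} {e : Fin 3} {s : Bool}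
    (he : e ∉ D) (ha : ¬ ControlGrid.OnSide a e s) {ξ : E3} (hξ : ξ e = sideVal s) :
    P.basisFun i D a ξ = 0 := by
  rw [basisFun_eq_tens, tens, Finset.prod_eq_zero (Finset.mem_univ e)]
  rw [hξ, uni_side hP i he s (idx_lt a e), if_neg fun h => ha ⟨he, h⟩]

open Classical in
/-- Swapping the order of summation in `basisFun_act`. -/
theorem field_act_eq {i j : ι} {g : Gluing} (hg : M.glue i j = some g) {D D' : Finset (Fin 3)}
    (hD : D' = D.image g.perm) (c' : M.Idx j D' → ℝ) {ξ : E3}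
    (hface : ∀ e s, g.face e = some s → ξ e = sideVal s ∧ e ∉ D)
    (hfree : ∀ e, g.face e = none → ξ e ∈ P.gen i e ∨ (ξ e ∈ Icc (0 : ℝ) 1 ∧ e ∉ D)) :
    P.field j D' c' (g.act ξ) =
      P.field i D (fun a => ∑ b, if ControlGrid.Matches g a b then c' b else 0) ξ := by
  simp only [field, basisFun_act hP hg hD _ hface hfree, Finset.mul_sum, Finset.sum_mul]
  rw [Finset.sum_comm]
  refine Finset.sum_congr rfl fun a _ => Finset.sum_congr rfl fun b _ => ?_
  split_ifs <;> ring

/-- If matching coefficients agree up to the factor `r`, so do the traces. -/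
theorem field_act {i j : ι} {g : Gluing} (hg : M.glue i j = some g) {D D' : Finset (Fin 3)}
    (hD : D' = D.image g.perm) {c : M.Idx i D → ℝ} {c' : M.Idx j D' → ℝ} {r : ℝ}
    (hc : ∀ a b, ControlGrid.Matches g a b → c' b = r * c a) {ξ : E3}
    (hface : ∀ e s, g.face e = some s → ξ e = sideVal s ∧ e ∉ D)
    (hfree : ∀ e, g.face e = none → ξ e ∈ P.gen i e ∨ (ξ e ∈ Icc (0 : ℝ) 1 ∧ e ∉ D)) :
    P.field j D' c' (g.act ξ) = r * P.field i D c ξ := by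
  classical
  rw [field_act_eq hP hg hD c' hface hfree, field, field, Finset.mul_sum]
  refine Finset.sum_congr rfl fun a _ => ?_
  by_cases ha : ∀ e s, g.face e = some s → ControlGrid.OnSide a e s
  · obtain ⟨b, hb⟩ := exists_matches hP hg hD a ha
    rw [Finset.sum_eq_single b, if_pos hb, hc a b hb]
    · ring
    · intro b' _ hb'
      rw [if_neg fun h => hb' (matches_right_unique h hb)]
    · simp
  · push Not at ha
    obtain ⟨e, s, h1, h2⟩ := ha
    rw [basisFun_eq_zero hP (hface e s h1).2 h2 (hface e s h1).1]
    ring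

/-- If the traces agree up to the factor `r`, so do matching coefficients. -/
theorem coeff_of_field_act {i j : ι} {g : Gluing} (hg : M.glue i j = some g)
    {D D' : Finset (Fin 3)} (hD : D' = D.image g.perm) {c : M.Idx i D → ℝ} {c' : M.Idx j D' → ℝ}
    {r : ℝ} (hφ : ∀ e s, g.face e = some s → e ∉ D)
    (h : ∀ ξ : E3, (∀ e s, g.face e = some s → ξ e = sideVal s) →
      (∀ e, g.face e = none → ξ e ∈ P.gen i e) → P.field j D' c' (g.act ξ) = r * P.field i D c ξ)
    {a : M.Idx i D} {b : M.Idx j D'} (hab : ControlGrid.Matches g a b) : c' b = r * c a := by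
  classical
  have h0 := coeff_eq_zero hP i g.face hφ
    (fun a => (∑ b, if ControlGrid.Matches g a b then c' b else 0) - r * c a) (fun ξ h1 h2 => ?_) a
    (matches_onSide hab)
  · rw [Finset.sum_eq_single b, if_pos hab] at h0
    · linarith
    · intro b' _ hb'
      rw [if_neg fun h => hb' (matches_right_unique h hab)]
    · simp
  · have h3 := h ξ h1 h2
    rw [field_act_eq hP hg hD c' (fun e s hs => ⟨h1 e s hs, hφ e s hs⟩) fun e he => Or.inl (h2 e he)]
      at h3
    simp only [field, sub_mul, Finset.sum_sub_distrib] at h3 ⊢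
    rw [h3, Finset.mul_sum]
    simp only [mul_assoc, sub_self]

end MultiPatch
end

noncomputable section

/-! ### Sides of patches and interfaces -/

theorem mem_cubeFace_sideOf {e : Fin 3} {s : Bool} {ξ : E3} :
    ξ ∈ cubeFace (sideOf e s) ↔ ξ ∈ closedCube ∧ ξ e = sideVal s := by
  refine and_congr Iff.rfl ⟨fun h => h e s (by simp [sideOf]), fun h f t hf => ?_⟩
  rw [sideOf, Function.update_apply] at hf
  split_ifs at hf with hfe
  · cases hf; rw [hfe]; exact h

theorem sideOf_eq_none {e f : Fin 3} {s : Bool} : sideOf e s f = none ↔ f ≠ e := by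
  rw [sideOf, Function.update_apply]
  split_ifs with h <;> simp [h]

theorem sideOf_eq_some {e f : Fin 3} {s t : Bool} : sideOf e s f = some t ↔ f = e ∧ t = s := by
  rw [sideOf, Function.update_apply]
  split_ifs with h <;> simp [h, eq_comm]

/-- The direction, `1` or `-1`, in which the cube lies from one of its sides. -/
def inward (s : Bool) : ℝ := if s then -1 else 1

theorem inward_mul_self (s : Bool) : inward s * inward s = 1 := by cases s <;> simp [inward]

theorem cross3_smul (a b : ℝ) (u v : E3) : cross3 (a • u) (b • v) = (a * b) • cross3 u v := by
  ext k; fin_cases k <;> simp [cross3] <;> ring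

theorem cross3_swap (u v : E3) : cross3 v u = -cross3 u v := by
  ext k; fin_cases k <;> simp [cross3] <;> ring

/-- The sign with which a gluing acts on direction `e`. -/
def Gluing.dirSign (g : Gluing) (e : Fin 3) : ℝ := if g.flip e then -1 else 1

/-- The sign with which a gluing acts on the plane with normal direction `e`. -/
def Gluing.normSign (g : Gluing) (e : Fin 3) : ℝ :=
  g.dirSign (e + 1) * g.dirSign (e + 2) * if g.perm (e + 1) = g.perm e + 1 then 1 else -1

theorem Gluing.dirSign_mul_self (g : Gluing) (e : Fin 3) : g.dirSign e * g.dirSign e = 1 := by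
  rw [Gluing.dirSign]; split_ifs <;> norm_num

theorem Gluing.normSign_mul_self (g : Gluing) (e : Fin 3) : g.normSign e * g.normSign e = 1 := by
  rw [Gluing.normSign, Gluing.dirSign, Gluing.dirSign]; split_ifs <;> norm_num

theorem Gluing.perm_cases (g : Gluing) (e : Fin 3) :
    (g.perm (e + 1) = g.perm e + 1 ∧ g.perm (e + 2) = g.perm e + 2) ∨
      (g.perm (e + 1) = g.perm e + 2 ∧ g.perm (e + 2) = g.perm e + 1 ∧
        g.perm (e + 1) ≠ g.perm e + 1) := by
  have : ∀ e a b c : Fin 3, a ≠ b → a ≠ c → b ≠ c →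
      (b = a + 1 ∧ c = a + 2) ∨ (b = a + 2 ∧ c = a + 1 ∧ b ≠ a + 1) := by decide
  refine this e _ _ _ ?_ ?_ ?_ <;> rw [g.perm.injective.ne_iff]
  · exact (by decide : ∀ e : Fin 3, e ≠ e + 1) e
  · exact (by decide : ∀ e : Fin 3, e ≠ e + 2) e
  · exact (by decide : ∀ e : Fin 3, e + 1 ≠ e + 2) e

theorem fin3_cases {e f : Fin 3} (h : f ≠ e) : f = e + 1 ∨ f = e + 2 := by
  revert e f; decide

theorem fin3_add_one_ne (e : Fin 3) : e + 1 ≠ e := by revert e; decide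

theorem fin3_add_two_ne (e : Fin 3) : e + 2 ≠ e := by revert e; decide

/-- The gluing `g` identifies the side `b` with the side `b'`. -/
def ControlGrid.SidePair {ι : Type*} (M : ControlGrid ι) (g : Gluing) (b b' : ι × Fin 3 × Bool) :
    Prop :=
  M.glue b.1 b'.1 = some g ∧ g.face = sideOf b.2.1 b.2.2 ∧ b'.2.1 = g.perm b.2.1 ∧
    b'.2.2 = xor b.2.2 (g.flip b.2.1)

namespace MultiPatch

variable {ι : Type*} {M : ControlGrid ι} (P : MultiPatch M)

/-- The points of a side of the cube whose other coordinates are not knots. -/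
def sideGen (i : ι) (e : Fin 3) (s : Bool) : Set E3 :=
  {ξ | ξ e = sideVal s ∧ ∀ f, f ≠ e → ξ f ∈ P.gen i f}

/-- A closed side of a patch. -/
def side (b : ι × Fin 3 × Bool) : Set E3 := P.param b.1 '' cubeFace (sideOf b.2.1 b.2.2)

theorem sideGen_subset (i : ι) (e : Fin 3) (s : Bool) :
    P.sideGen i e s ⊆ cubeFace (sideOf e s) := fun ξ h => mem_cubeFace_sideOf.2 ⟨fun f => by
  by_cases hf : f = e
  · rw [hf, h.1]; exact sideVal_mem s
  · exact ⟨(h.2 f hf).1.1.le, (h.2 f hf).1.2.le⟩, h.1⟩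

/-- The normal field of the surfaces on which coordinate `e` is constant. -/
def normal (i : ι) (e : Fin 3) (ξ : E3) : E3 := cross3 (P.pd i (e + 1) ξ) (P.pd i (e + 2) ξ)

theorem exists_mem_sideGen (i : ι) (e : Fin 3) (s : Bool) : (P.sideGen i e s).Nonempty := by
  choose t ht using fun f => gen_nonempty (P := P) i f
  refine ⟨upd (WithLp.toLp 2 t) e (sideVal s), upd_same _ _ _, fun f hf => ?_⟩
  rw [upd_ne _ hf]
  exact ht f

variable {P}

theorem upd_mem_sideGen {i : ι} {e : Fin 3} (s : Bool) {ξ : E3} (hξ : ∀ f, f ≠ e → ξ f ∈ P.gen i f) :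
    upd ξ e (sideVal s) ∈ P.sideGen i e s :=
  ⟨upd_same _ _ _, fun f hf => by rw [upd_ne _ hf]; exact hξ f hf⟩

variable (hP : P.IsConforming)
include hP

omit hP in
theorem param_apply_field (i : ι) (ξ : E3) (b : Fin 3) :
    P.param i ξ b = (P.field i ∅ (fun a => P.weight i fun e => a e) ξ)⁻¹ *
      P.field i ∅ (fun a => P.weight i (fun e => a e) * P.ctrl i (fun e => a e) b) ξ := by
  simp only [param, field, PiLp.smul_apply, WithLp.ofLp_sum, WithLp.ofLp_smul,
    Finset.sum_apply, smul_eq_mul, Pi.smul_apply]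
  congr 1
  exact Finset.sum_congr rfl fun a _ => by ring

/-- On the common side, edge or vertex of two patches, the parametrisations correspond. -/
theorem param_act {i j : ι} {g : Gluing} (hg : M.glue i j = some g) {ξ : E3}
    (hξ : ξ ∈ cubeFace g.face) : P.param j (g.act ξ) = P.param i ξ := by
  obtain ⟨c, hc, hcc⟩ := hP.glue_control i j g hg
  have hD : (∅ : Finset (Fin 3)) = (∅ : Finset (Fin 3)).image g.perm := by simp
  have hface : ∀ e s, g.face e = some s → ξ e = sideVal s ∧ e ∉ (∅ : Finset (Fin 3)) :=
    fun e s h => ⟨hξ.2 e s h, Finset.notMem_empty e⟩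
  have hfree : ∀ e, g.face e = none →
      ξ e ∈ P.gen i e ∨ (ξ e ∈ Icc (0 : ℝ) 1 ∧ e ∉ (∅ : Finset (Fin 3))) :=
    fun e _ => Or.inr ⟨hξ.1 e, Finset.notMem_empty e⟩
  ext b
  rw [param_apply_field, param_apply_field,
    field_act hP hg hD (fun a b h => (hcc a b h).2) hface hfree,
    field_act hP hg hD (c := fun a => P.weight i (fun e => a e) * P.ctrl i (fun e => a e) b)
      (r := c) (fun a b h => by rw [(hcc a b h).1, (hcc a b h).2]; ring) hface hfree, mul_inv]
  field_simp

omit hP in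
theorem exists_oneSided_side (hP : P.IsConforming) {i : ι} {e : Fin 3} {s : Bool} {ξ : E3}
    (hξ : ξ ∈ P.sideGen i e s) : ∃ F A, P.OneSided i e (inward s) ξ F A := by
  refine exists_oneSided hP hξ.2 ?_ ?_
  · rw [hξ.1]; exact sideVal_mem s
  · rw [hξ.1]; cases s <;> simp [inward, sideVal]

omit hP in
theorem face_eq_sideOf {i : ι} {e : Fin 3} {s : Bool} {ξ : E3} (hξ : ξ ∈ P.sideGen i e s)
    {φ : Fin 3 → Option Bool} (hφ : ∃ e, φ e ≠ none) (h : ξ ∈ cubeFace φ) : φ = sideOf e s := by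
  have h1 : ∀ f, f ≠ e → φ f = none := fun f hf => by
    by_contra hne
    obtain ⟨t, ht⟩ := Option.ne_none_iff_exists'.1 hne
    have h2 : ξ f = sideVal t := h.2 f t ht
    have h3 := (hξ.2 f hf).1
    rw [h2] at h3
    cases t <;> simp [sideVal] at h3
  obtain ⟨f, hf⟩ := hφ
  have hfe : f = e := by
    by_contra hne
    exact hf (h1 f hne)
  subst hfe
  obtain ⟨t, ht⟩ := Option.ne_none_iff_exists'.1 hf
  have h2 : ξ f = sideVal t := h.2 f t ht
  rw [hξ.1] at h2
  have hst : t = s := by cases s <;> cases t <;> simp [sideVal] at h2 ⊢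
  funext k
  by_cases hk : k = f
  · subst hk; rw [ht, hst]; simp [sideOf]
  · rw [h1 k hk, sideOf_eq_none.2 hk]

/-- A generic point of a side lies in no other patch, except the one that is glued to this side. -/
theorem mem_patch_of_sideGen {i k : ι} {e : Fin 3} {s : Bool} {ξ : E3} (hξ : ξ ∈ P.sideGen i e s)
    (h : P.param i ξ ∈ P.patch k) : k = i ∨ ∃ g, M.glue i k = some g ∧ g.face = sideOf e s := by
  by_cases hik : i = k
  · exact Or.inl hik.symm
  have hmem := (P.sideGen_subset i e s hξ).1
  right
  cases hg : M.glue i k with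
  | none => exact absurd h (Set.disjoint_left.1 (hP.glue_none i k hik hg) ⟨ξ, hmem, rfl⟩)
  | some g =>
    refine ⟨g, rfl, ?_⟩
    have h1 : P.param i ξ ∈ P.param i '' cubeFace g.face := by
      rw [← hP.glue_inter i k g hg]; exact ⟨⟨ξ, hmem, rfl⟩, h⟩
    obtain ⟨η, hη, he⟩ := h1
    rw [injOn_param hP i hη.1 hmem he] at hη
    exact face_eq_sideOf hξ (hP.glue_proper i k g hg) hη

theorem SidePair.side_eq {g : Gluing} {b b' : ι × Fin 3 × Bool} (h : M.SidePair g b b') :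
    P.side b = P.side b' := by
  obtain ⟨i, e, s⟩ := b
  obtain ⟨j, e', s'⟩ := b'
  obtain ⟨h1, h2, h3, h4⟩ := h
  dsimp only at h1 h2 h3 h4
  subst h3 h4
  have key : ∀ ξ, g.act ξ ∈ cubeFace (sideOf (g.perm e) (xor s (g.flip e))) ↔
      ξ ∈ cubeFace (sideOf e s) := fun ξ => by
    rw [mem_cubeFace_sideOf, mem_cubeFace_sideOf, g.act_mem_closedCube, g.act_apply, sideVal_xor]
    refine and_congr Iff.rfl ?_
    split_ifs
    · exact ⟨fun h => by linarith, fun h => by rw [h]⟩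
    · rfl
  ext x
  constructor
  · rintro ⟨ξ, hξ, rfl⟩
    exact ⟨g.act ξ, (key ξ).2 hξ, param_act hP h1 (h2 ▸ hξ)⟩
  · rintro ⟨η, hη, rfl⟩
    obtain ⟨ξ, rfl⟩ := g.act_surjective η
    have hξ := (key ξ).1 hη
    exact ⟨ξ, hξ, (param_act hP h1 (h2 ▸ hξ)).symm⟩

theorem side_injective {i : ι} {e e' : Fin 3} {s s' : Bool}
    (h : P.side (i, e, s) ⊆ P.side (i, e', s')) : e = e' ∧ s = s' := by
  obtain ⟨ξ, hξ⟩ := P.exists_mem_sideGen i e s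
  have hξ' := P.sideGen_subset i e s hξ
  obtain ⟨η, hη, he⟩ := h ⟨ξ, hξ', rfl⟩
  rw [injOn_param hP i hη.1 hξ'.1 he] at hη
  have h1 := face_eq_sideOf hξ ⟨e', by simp [sideOf]⟩ hη
  have h2 : sideOf e s e' = some s' := by rw [← h1]; simp [sideOf]
  obtain ⟨h3, h4⟩ := sideOf_eq_some.1 h2
  exact ⟨h3.symm, h4.symm⟩

omit hP in
theorem SidePair.ne (hP : P.IsConforming) {g : Gluing} {b b' : ι × Fin 3 × Bool}
    (h : M.SidePair g b b') : b.1 ≠ b'.1 := fun he => by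
  have := h.1
  rw [he, hP.glue_self] at this
  cases this

theorem SidePair.symm {g : Gluing} {b b' : ι × Fin 3 × Bool} (h : M.SidePair g b b') :
    ∃ g', M.SidePair g' b' b := by
  have hs := SidePair.side_eq hP h
  obtain ⟨i, e, s⟩ := b
  obtain ⟨j, e', s'⟩ := b'
  obtain ⟨ξ, hξ⟩ := P.exists_mem_sideGen j e' s'
  have hξ' := P.sideGen_subset j e' s' hξ
  have hmem : P.param j ξ ∈ P.patch i := by
    have : P.param j ξ ∈ P.side (j, e', s') := ⟨ξ, hξ', rfl⟩
    rw [← hs] at this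
    obtain ⟨η, hη, he⟩ := this
    exact ⟨η, hη.1, he⟩
  rcases mem_patch_of_sideGen hP hξ hmem with h1 | ⟨g', hg', hf'⟩
  · exact absurd h1 (SidePair.ne hP h)
  · have h2 : M.SidePair g' (j, e', s') (i, g'.perm e', xor s' (g'.flip e')) := ⟨hg', hf', rfl, rfl⟩
    have h3 := SidePair.side_eq hP h2
    rw [← hs] at h3
    obtain ⟨h4, h5⟩ := side_injective hP h3.le
    exact ⟨g', hg', hf', h4, h5⟩

omit hP in
theorem act_mem_sideGen (hP : P.IsConforming) {i j : ι} {e : Fin 3} {s : Bool} {g : Gluing}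
    (hg : M.glue i j = some g) (hf : g.face = sideOf e s) {ξ : E3} (hξ : ξ ∈ P.sideGen i e s) :
    g.act ξ ∈ P.sideGen j (g.perm e) (xor s (g.flip e)) := by
  refine ⟨by rw [g.act_apply, hξ.1, sideVal_xor], fun f hfe => ?_⟩
  obtain ⟨f, rfl⟩ := g.perm.surjective f
  have hne : f ≠ e := fun h => hfe (by rw [h])
  obtain ⟨hn, hk⟩ := hP.glue_knots i j g hg f (by rw [hf, sideOf_eq_none]; exact hne)
  have h1 := hξ.2 f hne
  rw [g.act_apply]
  refine ⟨?_, fun m hm => ?_⟩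
  · split_ifs
    · exact ⟨by linarith [h1.1.2], by linarith [h1.1.1]⟩
    · exact h1.1
  · rw [hn] at hm
    rw [hk m hm]
    split_ifs
    · intro h2
      exact h1.2 (M.n i f + P.degree - m) (by omega) (by linarith)
    · exact h1.2 m hm

/-- The tangential derivatives on both sides of an interface agree up to sign. -/
theorem pd_act {i j : ι} {e : Fin 3} {s : Bool} {g : Gluing} (hg : M.glue i j = some g)
    (hf : g.face = sideOf e s) {ξ : E3} (hξ : ξ ∈ P.sideGen i e s) {f : Fin 3} (hfe : f ≠ e) :
    P.pd j (g.perm f) (g.act ξ) = g.dirSign f • P.pd i f ξ := by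
  have hmem := (P.sideGen_subset i e s hξ).1
  have hη := act_mem_sideGen hP hg hf hξ
  have hη' := (P.sideGen_subset _ _ _ hη).1
  have hne : g.perm f ≠ g.perm e := g.perm.injective.ne hfe
  have h1 := hasDerivAt_param hP hmem (hξ.2 f hfe)
  have h2 := hasDerivAt_param hP hη' (hη.2 _ hne)
  have hσ : HasDerivAt (fun t : ℝ => if g.flip f then 1 - t else t) (g.dirSign f) (ξ f) := by
    rw [Gluing.dirSign]
    split_ifs
    · simpa using (hasDerivAt_id (ξ f)).const_sub 1
    · exact hasDerivAt_id _
  rw [g.act_apply] at h2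
  have h3 := HasDerivAt.scomp_of_eq (ξ f) h2 hσ rfl
  have h4 : P.pd i f ξ = g.dirSign f • P.pd j (g.perm f) (g.act ξ) := by
    refine (h1.unique (h3.congr_of_eventuallyEq ?_))
    have hg01 := (hξ.2 f hfe).1
    filter_upwards [Icc_mem_nhds hg01.1 hg01.2] with t ht
    rw [Function.comp_apply, ← g.act_upd, param_act hP hg]
    rw [hf, mem_cubeFace_sideOf, upd_ne _ hfe.symm]
    exact ⟨upd_mem_closedCube hmem ht, hξ.1⟩
  rw [h4, smul_smul, g.dirSign_mul_self, one_smul]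

theorem normal_act {i j : ι} {e : Fin 3} {s : Bool} {g : Gluing} (hg : M.glue i j = some g)
    (hf : g.face = sideOf e s) {ξ : E3} (hξ : ξ ∈ P.sideGen i e s) :
    P.normal j (g.perm e) (g.act ξ) = g.normSign e • P.normal i e ξ := by
  have h1 := pd_act hP hg hf hξ (fin3_add_one_ne e)
  have h2 := pd_act hP hg hf hξ (fin3_add_two_ne e)
  rw [normal, normal, Gluing.normSign]
  rcases g.perm_cases e with ⟨h3, h4⟩ | ⟨h3, h4, h5⟩
  · rw [← h4, if_pos h3, ← h3, h1, h2, cross3_smul, mul_one]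
  · rw [if_neg h5, ← h4, ← h3, h1, h2, cross3_smul, cross3_swap, smul_neg, mul_neg_one, neg_smul,
      mul_comm]

omit hP in
/-- At a point of a side, the normal field tests the component of a direction across the side. -/
theorem OneSided.inner_normal (hP : P.IsConforming) {i : ι} {e : Fin 3} {ε : ℝ} {ξ : E3}
    {F : E3 → E3} {A : E3 →L[ℝ] E3} (H : P.OneSided i e ε ξ F A)
    (hξ : ∀ f, f ≠ e → ξ f ∈ P.gen i f) (w : E3) : ⟪P.normal i e ξ, A w⟫_ℝ = w e * A.det := by
  rw [← inner_cross3_apply A e w, H.apply_single hP (fin3_add_one_ne e) (hξ _ (fin3_add_one_ne e)),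
    H.apply_single hP (fin3_add_two_ne e) (hξ _ (fin3_add_two_ne e)), normal]

omit hP in
theorem normal_ne_zero (hP : P.IsConforming) {i : ι} {e : Fin 3} {s : Bool} {ξ : E3}
    (hξ : ξ ∈ P.sideGen i e s) : P.normal i e ξ ≠ 0 := fun h => by
  obtain ⟨F, A, H⟩ := exists_oneSided_side hP hξ
  have := H.inner_normal hP hξ.2 (EuclideanSpace.single e 1)
  rw [h, inner_zero_left] at this
  simp at this
  exact H.det_ne_zero hP this.symm

/-- Two half neighbourhoods of generic side points in different patches have disjoint images away
from the sides. -/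
theorem disjoint_half {i j : ι} {e e' : Fin 3} {s s' : Bool} {ξ ξ' : E3}
    (hξ : ξ ∈ P.sideGen i e s) (hij : i ≠ j)
    (hx : P.param i ξ = P.param j ξ') (hξ' : ξ' ∈ P.sideGen j e' s') :
    ∃ U ∈ nhds ξ, ∃ U' ∈ nhds ξ', ∀ η ∈ U, ∀ η' ∈ U', η ∈ closedCube → η' ∈ closedCube →
      0 < inward s * (η e - ξ e) → 0 < inward s' * (η' e' - ξ' e') →
        P.param i η ≠ P.param j η' := by
  refine ⟨univ, Filter.univ_mem, univ, Filter.univ_mem, fun η _ η' _ h1 h2 h3 _ h5 => ?_⟩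
  have hmem : P.param i ξ ∈ P.patch j := ⟨ξ', (P.sideGen_subset _ _ _ hξ').1, hx.symm⟩
  rcases mem_patch_of_sideGen hP hξ hmem with h | ⟨g, hg, hf⟩
  · exact hij h.symm
  · have h6 : P.param i η ∈ P.param i '' cubeFace g.face := by
      rw [← hP.glue_inter i j g hg]; exact ⟨⟨η, h1, rfl⟩, ⟨η', h2, h5.symm⟩⟩
    obtain ⟨ζ, hζ, he⟩ := h6
    rw [injOn_param hP i hζ.1 h1 he, hf, mem_cubeFace_sideOf] at hζ
    rw [hζ.2, hξ.1] at h3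
    simp at h3

/-- At an interface, the orientations of the patches, the inward directions and the sign of the
gluing are related. -/
theorem inward_mul_orient {i j : ι} {e : Fin 3} {s : Bool} {g : Gluing}
    (hg : M.glue i j = some g) (hf : g.face = sideOf e s) :
    inward (xor s (g.flip e)) * P.orient j = -(g.normSign e * (inward s * P.orient i)) := by
  have hij : i ≠ j := fun h => by rw [h, hP.glue_self] at hg; cases hg
  obtain ⟨ξ, hξ⟩ := P.exists_mem_sideGen i e s
  have hη := act_mem_sideGen hP hg hf hξ
  have hx : P.param i ξ = P.param j (g.act ξ) :=
    (param_act hP hg (hf ▸ P.sideGen_subset i e s hξ)).symm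
  obtain ⟨F, A, H⟩ := exists_oneSided_side hP hξ
  obtain ⟨F', A', H'⟩ := exists_oneSided_side hP hη
  obtain ⟨c, hc, hcw⟩ := H.opposite hP H' hx (disjoint_half hP hξ hij hx hη)
  obtain ⟨B', hB'⟩ := H'.exists_equiv hP
  obtain ⟨w', hw'⟩ := B'.surjective (A (EuclideanSpace.single e 1))
  have hw2 : A (EuclideanSpace.single e 1) = A' w' := by rw [← hw', ← hB']; rfl
  have h1 := hcw _ _ hw2
  have h2 := H.inner_normal hP hξ.2 (EuclideanSpace.single e 1)
  have h3 := H'.inner_normal hP hη.2 w'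
  rw [normal_act hP hg hf hξ, inner_smul_left, ← hw2, h2] at h3
  simp only [PiLp.single_apply, if_true, one_mul, mul_one, conj_trivial] at h1 h3
  have d1 := H.orient_mul_det_pos hP hξ.2
  have d2 := H'.orient_mul_det_pos hP hη.2
  have o1 := orient_mul_self (P := P) i
  have o2 := orient_mul_self (P := P) j
  have i1 := inward_mul_self s
  have i2 := inward_mul_self (xor s (g.flip e))
  have k1 := g.normSign_mul_self e
  set X := inward (xor s (g.flip e)) * P.orient j with hX
  set Y := g.normSign e * (inward s * P.orient i) with hY
  have hXX : X * X = 1 := by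
    rw [hX]; linear_combination P.orient j * P.orient j * i2 + o2
  have hYY : Y * Y = 1 := by
    rw [hY]; linear_combination
      inward s * inward s * P.orient i * P.orient i * k1 + P.orient i * P.orient i * i1 + o1
  have hXY : X * Y * (P.orient i * A.det) = -(c * (P.orient j * A'.det)) := by
    rw [hX, hY]
    linear_combination inward (xor s (g.flip e)) * P.orient j * g.normSign e * inward s * A.det * o1
      + inward (xor s (g.flip e)) * P.orient j * inward s * h3
      + P.orient j * inward s * A'.det * h1 - c * P.orient j * A'.det * i1
  have hneg : X * Y < 0 := by nlinarith [mul_pos hc d2]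
  have h4 : X * Y = -1 := by
    rcases mul_self_eq_one_iff.1 (show (X * Y) * (X * Y) = 1 by
      linear_combination Y * Y * hXX + hYY) with h | h
    · linarith
    · exact h
  linear_combination Y * h4 - X * hYY

/-- A side is shared with at most one other patch: the inward directions of two further patches
would both be opposite to that of the first, but they are also opposite to each other. -/
theorem SidePair.unique {g₁ g₂ : Gluing} {b b₁ b₂ : ι × Fin 3 × Bool} (h₁ : M.SidePair g₁ b b₁)
    (h₂ : M.SidePair g₂ b b₂) : b₁ = b₂ := by
  have n1 := SidePair.ne hP h₁
  have n2 := SidePair.ne hP h₂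
  obtain ⟨i, e, s⟩ := b
  obtain ⟨j₁, e₁, s₁⟩ := b₁
  obtain ⟨j₂, e₂, s₂⟩ := b₂
  obtain ⟨hg₁, hf₁, he₁, hs₁⟩ := h₁
  obtain ⟨hg₂, hf₂, he₂, hs₂⟩ := h₂
  dsimp only at hg₁ hf₁ he₁ hs₁ hg₂ hf₂ he₂ hs₂ n1 n2
  by_cases hj : j₁ = j₂
  · subst hj
    rw [hg₁] at hg₂
    cases hg₂
    rw [he₁, he₂, hs₁, hs₂]
  · exfalso
    obtain ⟨ξ, hξ⟩ := P.exists_mem_sideGen i e s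
    have hη₁ := act_mem_sideGen hP hg₁ hf₁ hξ
    have hη₂ := act_mem_sideGen hP hg₂ hf₂ hξ
    have hx₁ := (param_act hP hg₁ (hf₁ ▸ P.sideGen_subset i e s hξ)).symm
    have hx₂ := (param_act hP hg₂ (hf₂ ▸ P.sideGen_subset i e s hξ)).symm
    have hx₃ := hx₁.symm.trans hx₂
    obtain ⟨F, A, H⟩ := exists_oneSided_side hP hξ
    obtain ⟨F₁, A₁, H₁⟩ := exists_oneSided_side hP hη₁
    obtain ⟨F₂, A₂, H₂⟩ := exists_oneSided_side hP hη₂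
    obtain ⟨c₁, hc₁, k₁⟩ := H.opposite hP H₁ hx₁ (disjoint_half hP hξ n1 hx₁ hη₁)
    obtain ⟨c₂, hc₂, k₂⟩ := H.opposite hP H₂ hx₂ (disjoint_half hP hξ n2 hx₂ hη₂)
    obtain ⟨c₃, hc₃, k₃⟩ := H₁.opposite hP H₂ hx₃ (disjoint_half hP hη₁ hj hx₃ hη₂)
    obtain ⟨B₁, hB₁⟩ := H₁.exists_equiv hP
    obtain ⟨B₂, hB₂⟩ := H₂.exists_equiv hP
    obtain ⟨w₁, hw₁⟩ := B₁.surjective (A (EuclideanSpace.single e (inward s)))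
    obtain ⟨w₂, hw₂⟩ := B₂.surjective (A (EuclideanSpace.single e (inward s)))
    have q₁ : A (EuclideanSpace.single e (inward s)) = A₁ w₁ := by rw [← hw₁, ← hB₁]; rfl
    have q₂ : A (EuclideanSpace.single e (inward s)) = A₂ w₂ := by rw [← hw₂, ← hB₂]; rfl
    have r₁ := k₁ _ _ q₁
    have r₂ := k₂ _ _ q₂
    have r₃ := k₃ _ _ (q₁.symm.trans q₂)
    simp only [PiLp.single_apply, if_true, inward_mul_self, mul_one] at r₁ r₂
    rw [r₁, r₂] at r₃
    nlinarith [mul_pos hc₃ hc₁]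

end MultiPatch
end

noncomputable section

/-! ### The domain and its boundary near generic points of the sides -/

theorem inward_mul_nonneg {s : Bool} {t : ℝ} (ht : t ∈ Icc (0 : ℝ) 1) :
    0 ≤ inward s * (t - sideVal s) := by
  cases s
  · simpa [inward, sideVal] using ht.1
  · simpa [inward, sideVal] using ht.2

namespace MultiPatch

variable {ι : Type*} {M : ControlGrid ι} {P : MultiPatch M}

theorem isOpen_domain : IsOpen P.domain := isOpen_interior

theorem domain_subset : P.domain ⊆ ⋃ i, P.patch i := interior_subset

theorem mem_domain_of_strict {i : ι} {η : E3} {A : E3 →L[ℝ] E3}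
    (h : HasStrictFDerivAt (P.param i) A η) (hA : A.det ≠ 0) (hη : closedCube ∈ nhds η) :
    P.param i η ∈ P.domain := by
  have h1 : HasStrictFDerivAt (P.param i)
      ((A.toContinuousLinearEquivOfDetNeZero hA : E3 ≃L[ℝ] E3) : E3 →L[ℝ] E3) η := by
    simpa using h
  rw [domain, mem_interior_iff_mem_nhds, ← h1.map_nhds_eq_of_equiv]
  exact Filter.mem_of_superset (Filter.image_mem_map hη) (subset_iUnion_of_subset i subset_rfl)

variable (hP : P.IsConforming)
include hP

theorem OneSided.eventually_mem_domain {i : ι} {e : Fin 3} {ε : ℝ} {ξ : E3} {F : E3 → E3}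
    {A : E3 →L[ℝ] E3} (H : P.OneSided i e ε ξ F A) :
    ∀ᶠ η in nhds ξ, 0 < ε * (η e - ξ e) → P.param i η ∈ P.domain := by
  have hs : ∀ᶠ η in nhds ξ, ContDiffAt ℝ 1 F η :=
    (H.smooth.of_le (mod_cast le_top)).eventually (by simp)
  filter_upwards [H.eventually_det hP, H.agree.eventually_nhds, hs] with η h1 h2 h3 h4
  have hc : ∀ᶠ η' : E3 in nhds η, 0 < ε * (η' e - ξ e) :=
    (by fun_prop : Continuous fun η' : E3 => ε * (η' e - ξ e)).continuousAt.eventually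
      (lt_mem_nhds h4)
  have h5 : P.param i =ᶠ[nhds η] F := by
    filter_upwards [h2, hc] with η' h5 h6
    exact (h5 h6.le).2.symm
  have h6 : closedCube ∈ nhds η := by
    filter_upwards [h2, hc] with η' h5 h6
    exact (h5 h6.le).1
  have h7 : ContDiffAt ℝ 1 (P.param i) η := h3.congr_of_eventuallyEq h5
  refine mem_domain_of_strict (h7.hasStrictFDerivAt (by simp)) (fun h8 => ?_) h6
  have := h1 h4
  rw [h8, zero_mul] at this
  exact this.false

theorem param_mem_domain {i : ι} {ξ : E3} (hξ : ξ ∈ P.genericCube i) : P.param i ξ ∈ P.domain :=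
  mem_domain_of_strict ((contDiffAt_param hP hξ).hasStrictFDerivAt (by simp))
    (det_fderiv_ne_zero hP hξ)
    (Filter.mem_of_superset ((P.isOpen_genericCube i).mem_nhds hξ) (P.genericCube_subset i))

theorem isClosed_iUnion_patch [Finite ι] : IsClosed (⋃ i, P.patch i) :=
  isClosed_iUnion_of_finite fun i => (isCompact_patch hP i).isClosed

theorem closure_domain_subset [Finite ι] : closure P.domain ⊆ ⋃ i, P.patch i :=
  (isClosed_iUnion_patch hP).closure_subset_iff.2 domain_subset

theorem eventually_mem_patch [Finite ι] (x : E3) :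
    ∀ᶠ y in nhds x, ∀ k, y ∈ P.patch k → x ∈ P.patch k := by
  refine Filter.eventually_all.2 fun k => ?_
  by_cases h : x ∈ P.patch k
  · exact Filter.Eventually.of_forall fun _ _ => h
  · filter_upwards [(isCompact_patch hP k).isClosed.isOpen_compl.mem_nhds h] with y hy h'
    exact absurd h' hy

theorem patch_of_boundary {i k : ι} {e : Fin 3} {s : Bool} (hb : M.IsBoundarySide (i, e, s))
    {ξ : E3} (hξ : ξ ∈ P.sideGen i e s) (h : P.param i ξ ∈ P.patch k) : k = i := by
  rcases mem_patch_of_sideGen hP hξ h with h1 | ⟨g, h1, h2⟩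
  · exact h1
  · exact absurd h2 (hb k g h1)

/-- A generic point of a side lies on no other side, except on the one glued to it. -/
theorem side_of_mem {i : ι} {e : Fin 3} {s : Bool} {ξ : E3} (hξ : ξ ∈ P.sideGen i e s)
    {b : ι × Fin 3 × Bool} (h : P.param i ξ ∈ P.side b) :
    b = (i, e, s) ∨ ∃ g, M.SidePair g (i, e, s) b := by
  have key : ∀ {i : ι} {e : Fin 3} {s : Bool} {ξ : E3} (_ : ξ ∈ P.sideGen i e s) {e' : Fin 3}
      {s' : Bool}, P.param i ξ ∈ P.side (i, e', s') → e' = e ∧ s' = s := by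
    intro i e s ξ hξ e' s' ⟨η, hη, he⟩
    rw [injOn_param hP i hη.1 (P.sideGen_subset i e s hξ).1 he] at hη
    have h1 := face_eq_sideOf hξ ⟨e', by simp [sideOf]⟩ hη
    exact sideOf_eq_some.1 (by rw [← h1]; simp [sideOf])
  obtain ⟨k, e', s'⟩ := b
  have hmem : P.param i ξ ∈ P.patch k := by
    obtain ⟨η, hη, he⟩ := h
    exact ⟨η, hη.1, he⟩
  rcases mem_patch_of_sideGen hP hξ hmem with rfl | ⟨g, hg, hf⟩
  · left
    obtain ⟨h1, h2⟩ := key hξ h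
    rw [h1, h2]
  · right
    have h1 := act_mem_sideGen hP hg hf hξ
    rw [← param_act hP hg (hf ▸ P.sideGen_subset i e s hξ)] at h
    obtain ⟨h2, h3⟩ := key h1 h
    exact ⟨g, hg, hf, h2, h3⟩

/-- Generic points of an interface are interior points of the union of the patches: the two half
neighbourhoods, whose tangent half spaces are opposite, together cover a neighbourhood. -/
theorem interface_mem_domain {i j : ι} {e : Fin 3} {s : Bool} {g : Gluing}
    (hg : M.glue i j = some g) (hf : g.face = sideOf e s) {ξ : E3} (hξ : ξ ∈ P.sideGen i e s) :
    P.param i ξ ∈ P.domain := by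
  have hij : i ≠ j := fun h => by rw [h, hP.glue_self] at hg; cases hg
  have hη := act_mem_sideGen hP hg hf hξ
  have hx : P.param i ξ = P.param j (g.act ξ) :=
    (param_act hP hg (hf ▸ P.sideGen_subset i e s hξ)).symm
  obtain ⟨F, A, H⟩ := exists_oneSided_side hP hξ
  obtain ⟨F', A', H'⟩ := exists_oneSided_side hP hη
  obtain ⟨c, hc, hcw⟩ := H.opposite hP H' hx (disjoint_half hP hξ hij hx hη)
  obtain ⟨B, rfl⟩ := H.exists_equiv hP
  obtain ⟨B', rfl⟩ := H'.exists_equiv hP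
  set ε := inward s
  set ε' := inward (xor s (g.flip e))
  set G := H'.strict.localInverse F' B' (g.act ξ) with hG
  have hFx : F ξ = F' (g.act ξ) := by rw [H.eq_param, H'.eq_param, hx]
  have hGx : G (F' (g.act ξ)) = g.act ξ := H'.strict.localInverse_apply_image
  have hGs : HasStrictFDerivAt G (B'.symm : E3 →L[ℝ] E3) (F ξ) := by
    rw [hFx]; exact H'.strict.to_localInverse
  have hcomp : HasStrictFDerivAt (fun η => G (F η)) ((B'.symm : E3 →L[ℝ] E3).comp (B : E3 →L[ℝ] E3))
      ξ := hGs.comp ξ H.strict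
  -- the parameter normal to the second side, as a function of the parameters of the first patch
  have hh : HasStrictFDerivAt (fun η => ε' * G (F η) (g.perm e))
      (ε' • (EuclideanSpace.proj (g.perm e) : E3 →L[ℝ] ℝ).comp
        ((B'.symm : E3 →L[ℝ] E3).comp (B : E3 →L[ℝ] E3))) ξ :=
    (((EuclideanSpace.proj (g.perm e) : E3 →L[ℝ] ℝ).hasStrictFDerivAt).comp ξ hcomp).const_mul ε'
  have hhv : ∀ w : E3, ε' * (B'.symm (B w)) (g.perm e) = -c * (ε * w e) := fun w =>
    hcw w _ (B'.apply_symm_apply _).symm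
  have hF : Filter.Tendsto F (nhds ξ) (nhds (F ξ)) := H.smooth.continuousAt
  have hGt : Filter.Tendsto (fun η => G (F η)) (nhds ξ) (nhds (g.act ξ)) := by
    have := hcomp.continuousAt.tendsto
    rwa [hFx, hGx] at this
  have hupd : Filter.Tendsto (fun η => upd η e (sideVal s)) (nhds ξ) (nhds ξ) := by
    have := (continuous_upd_left e (sideVal s)).tendsto ξ
    rwa [← hξ.1, upd_eq_self, hξ.1] at this
  have hact : Filter.Tendsto g.act (nhds ξ) (nhds (g.act ξ)) := g.continuous_act.tendsto ξ
  have hact2 := hact.comp hupd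
  -- on the side itself the two parametrisations correspond
  have hside : ∀ᶠ η in nhds ξ, G (F (upd η e (sideVal s))) = g.act (upd η e (sideVal s)) := by
    filter_upwards [hupd.eventually H.agree, hact2.eventually H'.agree,
      hact2.eventually H'.strict.eventually_left_inverse] with η h1 h2 h3
    obtain ⟨h4, h5⟩ := h1 (by rw [upd_same, hξ.1]; simp)
    obtain ⟨h6, h7⟩ := h2 (by
      rw [Function.comp_apply, g.act_upd_side, upd_same, hη.1]; simp)
    rw [h5, ← param_act hP hg (by rw [hf, mem_cubeFace_sideOf]; exact ⟨h4, upd_same _ _ _⟩)]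
    rw [Function.comp_apply] at h7 h3
    rw [← h7]
    exact h3
  have hlip := hh.isLittleO.def (show (0 : ℝ) < c / 2 by positivity)
  have hpair : Filter.Tendsto (fun η => (η, upd η e (sideVal s))) (nhds ξ) (nhds (ξ, ξ)) :=
    Filter.tendsto_id.prodMk_nhds hupd
  have hev : ∀ᶠ η in nhds ξ, F η ∈ ⋃ i, P.patch i := by
    filter_upwards [H.agree, hGt.eventually H'.agree,
      (hF.eventually (hFx ▸ H'.strict.eventually_right_inverse)), hside, hpair.eventually hlip]
      with η h1 h2 h3 h4 h5
    by_cases hsgn : 0 ≤ ε * (η e - ξ e)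
    · obtain ⟨h6, h7⟩ := h1 hsgn
      exact mem_iUnion.2 ⟨i, η, h6, h7.symm⟩
    · have hd : η - upd η e (sideVal s) = (η e - ξ e) • EuclideanSpace.single e (1 : ℝ) := by
        rw [upd_eq_add, hξ.1, ← neg_sub (sideVal s) (η e), neg_smul]; abel
      rw [h4, g.act_upd_side, upd_same, hd] at h5
      have h8 : ε' * (B'.symm (B ((η e - ξ e) • EuclideanSpace.single e (1 : ℝ)))) (g.perm e) =
          -c * (ε * (η e - ξ e)) := by
        rw [hhv]; simp
      have h9 : |ε * (η e - ξ e)| = |η e - ξ e| := by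
        rw [abs_mul, show |ε| = 1 by rcases H.sign with h | h <;> rw [h] <;> simp, one_mul]
      have h14 : (ε' • (EuclideanSpace.proj (g.perm e) : E3 →L[ℝ] ℝ).comp
          ((B'.symm : E3 →L[ℝ] E3).comp (B : E3 →L[ℝ] E3)))
          ((η e - ξ e) • EuclideanSpace.single e (1 : ℝ)) = -c * (ε * (η e - ξ e)) := h8
      rw [h14, norm_smul, Real.norm_eq_abs, Real.norm_eq_abs, PiLp.norm_single, norm_one,
        mul_one] at h5
      rw [← h9, abs_of_neg (not_le.1 hsgn)] at h5
      have h10 := (abs_le.1 h5).1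
      have h11 : 0 ≤ ε' * (G (F η) (g.perm e) - g.act ξ (g.perm e)) := by
        rw [hη.1]
        push Not at hsgn
        nlinarith
      obtain ⟨h12, h13⟩ := h2 h11
      exact mem_iUnion.2 ⟨j, G (F η), h12, by rw [← h13]; exact h3⟩
  rw [domain, mem_interior_iff_mem_nhds, ← H.eq_param, ← H.strict.map_nhds_eq_of_equiv]
  exact hev

/-- Generic points of a side that is not an interface are boundary points of the domain. -/
theorem boundary_mem_frontier [Finite ι] {i : ι} {e : Fin 3} {s : Bool}
    (hb : M.IsBoundarySide (i, e, s)) {ξ : E3} (hξ : ξ ∈ P.sideGen i e s) :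
    P.param i ξ ∈ frontier P.domain := by
  obtain ⟨F, A, H⟩ := exists_oneSided_side hP hξ
  rw [frontier, isOpen_domain.interior_eq]
  have hlim : ∀ r : ℝ, Filter.Tendsto
      (fun t : ℝ => ξ + (r * t) • EuclideanSpace.single e (1 : ℝ)) (nhdsWithin 0 (Ioi 0))
      (nhds ξ) := fun r => by
    have : Continuous fun t : ℝ => ξ + (r * t) • EuclideanSpace.single e (1 : ℝ) := by fun_prop
    have h := this.tendsto 0
    simp only [mul_zero, zero_smul, add_zero] at h
    exact h.mono_left nhdsWithin_le_nhds
  have hε : inward s * inward s = 1 := inward_mul_self s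
  constructor
  · have h1 : Filter.Tendsto (fun t : ℝ => F (ξ + (inward s * t) • EuclideanSpace.single e (1 : ℝ)))
        (nhdsWithin 0 (Ioi 0)) (nhds (P.param i ξ)) := by
      rw [← H.eq_param]
      exact H.smooth.continuousAt.tendsto.comp (hlim _)
    refine mem_closure_of_tendsto h1 ?_
    filter_upwards [(hlim (inward s)).eventually (H.eventually_mem_domain hP),
      (hlim (inward s)).eventually H.agree, self_mem_nhdsWithin] with t h2 h3 ht
    have ht' : 0 < t := ht
    simp only [PiLp.add_apply, PiLp.smul_apply, PiLp.single_apply, if_true, smul_eq_mul, mul_one,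
      add_sub_cancel_left, ← mul_assoc, hε, one_mul] at h2 h3
    rw [(h3 ht'.le).2]
    exact h2 ht'
  · intro hdom
    -- otherwise the points just outside the cube would be mapped into the patch
    obtain ⟨B, rfl⟩ := H.exists_equiv hP
    have h0 : ∀ᶠ y in nhds (P.param i ξ), y ∈ P.patch i := by
      filter_upwards [isOpen_domain.mem_nhds hdom, eventually_mem_patch hP (P.param i ξ)]
        with y h1 h2
      obtain ⟨k, hk⟩ := mem_iUnion.1 (domain_subset h1)
      have := patch_of_boundary hP hb hξ (h2 k hk)
      exact this ▸ hk
    have hmem := (P.sideGen_subset i e s hξ).1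
    have hF0 : ∀ᶠ η in nhds ξ, F η ∈ P.patch i ∧ ∀ ζ ∈ closedCube, P.param i ζ = F η →
        ζ ∈ {ζ | (0 ≤ inward s * (ζ e - ξ e) → ζ ∈ closedCube ∧ F ζ = P.param i ζ) ∧
          H.strict.localInverse F B ξ (F ζ) = ζ} := by
      have hF : Filter.Tendsto F (nhds ξ) (nhds (P.param i ξ)) := by
        have := H.smooth.continuousAt.tendsto
        rwa [H.eq_param] at this
      exact hF.eventually (h0.and (eventually_param_near hP i hmem
        (H.agree.and H.strict.eventually_left_inverse)))
    obtain ⟨t, ⟨⟨η, hη, hηz⟩, h3⟩, h4, ht⟩ := (((hlim (-inward s)).eventually hF0).and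
      (((hlim (-inward s)).eventually H.strict.eventually_left_inverse).and
        self_mem_nhdsWithin)).exists
    have ht' : 0 < t := ht
    obtain ⟨h5, h6⟩ := h3 η hη hηz
    have h7 := inward_mul_nonneg (s := s) (hη e)
    rw [← hξ.1] at h7
    rw [(h5 h7).2, hηz, h4] at h6
    rw [← h6] at h7
    simp only [PiLp.add_apply, PiLp.smul_apply, PiLp.single_apply, if_true, smul_eq_mul, mul_one,
      add_sub_cancel_left] at h7
    nlinarith

theorem frontier_subset_side [Finite ι] {i : ι} {e : Fin 3} {s : Bool}
    (hb : M.IsBoundarySide (i, e, s)) {ξ : E3} (hξ : ξ ∈ P.sideGen i e s) :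
    ∀ᶠ y in nhds (P.param i ξ), y ∈ frontier P.domain → y ∈ P.side (i, e, s) := by
  obtain ⟨F, A, H⟩ := exists_oneSided_side hP hξ
  have hmem := (P.sideGen_subset i e s hξ).1
  filter_upwards [eventually_mem_patch hP (P.param i ξ),
    eventually_param_near hP i hmem (H.eventually_mem_domain hP)] with y h1 h2 hy
  obtain ⟨k, hk⟩ := mem_iUnion.1 (closure_domain_subset hP hy.1)
  have hki := patch_of_boundary hP hb hξ (h1 k hk)
  subst hki
  obtain ⟨η, hη, rfl⟩ := hk
  refine ⟨η, mem_cubeFace_sideOf.2 ⟨hη, ?_⟩, rfl⟩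
  by_contra hne
  have h3 := h2 η hη rfl
  rw [isOpen_domain.frontier_eq] at hy
  refine hy.2 (h3 ?_)
  rw [hξ.1]
  refine lt_of_le_of_ne (inward_mul_nonneg (hη e)) fun h4 => hne (sub_eq_zero.1 ?_)
  have := inward_mul_self s
  exact (mul_eq_zero.1 h4.symm).resolve_left fun h5 => by rw [h5] at this; simp at this

end MultiPatch
end

noncomputable section

/-! ### Fields on the domain and their pull-backs -/

theorem volume_image_eq_zero {K : NNReal} {f : E3 → E3} {s t : Set E3} (hf : LipschitzOnWith K f s)
    (hts : t ⊆ s) (ht : volume t = 0) : volume (f '' t) = 0 := by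
  have hH : (Measure.hausdorffMeasure (Module.finrank ℝ E3 : ℝ) : Measure E3).IsAddHaarMeasure :=
    isAddHaarMeasure_hausdorffMeasure
  have h1 : (volume : Measure E3) ≪ Measure.hausdorffMeasure (Module.finrank ℝ E3 : ℝ) :=
    Measure.absolutelyContinuous_isAddHaarMeasure _ _
  have h2 : (Measure.hausdorffMeasure (Module.finrank ℝ E3 : ℝ) : Measure E3) ≪ volume :=
    Measure.absolutelyContinuous_isAddHaarMeasure _ _
  refine h1 (le_antisymm (((hf.mono hts).hausdorffMeasure_image_le (by positivity)).trans ?_)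
    zero_le)
  rw [h2 ht, mul_zero]

namespace MultiPatch

variable {ι : Type*} {M : ControlGrid ι} {P : MultiPatch M}

theorem volume_coord_eq (e : Fin 3) (t : ℝ) : volume {ξ : E3 | ξ e = t} = 0 := by
  have h1 := (EuclideanSpace.volume_preserving_symm_measurableEquiv_toLp (Fin 3))
  have h2 : {ξ : E3 | ξ e = t} =
      (MeasurableEquiv.toLp 2 (Fin 3 → ℝ)).symm ⁻¹' {x : Fin 3 → ℝ | x e = t} := rfl
  rw [h2, h1.measure_preimage_equiv]
  have h3 : {x : Fin 3 → ℝ | x e = t} = Set.pi univ (Function.update (fun _ => (univ : Set ℝ)) e {t}) := by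
    ext x
    simp only [mem_ofPred_eq, mem_univ_pi]
    refine ⟨fun h f => ?_, fun h => by simpa using h e⟩
    by_cases hf : f = e
    · subst hf; simpa using h
    · simp [hf]
  rw [h3, volume_pi_pi]
  exact Finset.prod_eq_zero (Finset.mem_univ e) (by simp)

theorem volume_diff_genericCube (i : ι) : volume (closedCube \ P.genericCube i) = 0 := by
  have h1 : ∀ e, (Icc (0 : ℝ) 1 \ P.gen i e).Countable := fun e => by
    have h2 : (Ioo (0 : ℝ) 1 \ P.gen i e).Finite := IsOpenKnotVector.genericSet_compl_finite
    refine ((h2.union (Set.toFinite {0, 1})).subset fun t ht => ?_).countable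
    by_cases h0 : t = 0
    · right; simp [h0]
    by_cases h01 : t = 1
    · right; simp [h01]
    · exact Or.inl ⟨⟨lt_of_le_of_ne ht.1.1 (Ne.symm h0), lt_of_le_of_ne ht.1.2 h01⟩, ht.2⟩
  refine measure_mono_null (t := ⋃ e, ⋃ t ∈ Icc (0 : ℝ) 1 \ P.gen i e, {ξ : E3 | ξ e = t})
    (fun ξ hξ => ?_) ?_
  · have h2 : ¬ ∀ e, ξ e ∈ P.gen i e := hξ.2
    push Not at h2
    obtain ⟨e, he⟩ := h2
    exact mem_iUnion.2 ⟨e, mem_iUnion₂.2 ⟨ξ e, ⟨hξ.1 e, he⟩, rfl⟩⟩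
  · refine measure_iUnion_null fun e => (measure_biUnion_null_iff (h1 e)).2 fun t _ => ?_
    exact volume_coord_eq e t

theorem genericCube_ae_eq (i : ι) : P.genericCube i =ᵐ[volume] closedCube := by
  refine (ae_le_set.2 ?_).antisymm (ae_le_set.2 (volume_diff_genericCube i))
  rw [sdiff_eq_empty.2 (P.genericCube_subset i), measure_empty]

variable (hP : P.IsConforming)
include hP

theorem disjoint_image_genericCube {i j : ι} (hij : i ≠ j) :
    Disjoint (P.param i '' P.genericCube i) (P.patch j) := by
  rw [Set.disjoint_left]
  rintro _ ⟨ξ, hξ, rfl⟩ h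
  have hmem := P.genericCube_subset i hξ
  cases hg : M.glue i j with
  | none => exact Set.disjoint_left.1 (hP.glue_none i j hij hg) ⟨ξ, hmem, rfl⟩ h
  | some g =>
    have h1 : P.param i ξ ∈ P.param i '' cubeFace g.face := by
      rw [← hP.glue_inter i j g hg]; exact ⟨⟨ξ, hmem, rfl⟩, h⟩
    obtain ⟨η, hη, he⟩ := h1
    rw [injOn_param hP i hη.1 hmem he] at hη
    obtain ⟨e, he⟩ := hP.glue_proper i j g hg
    obtain ⟨s, hs⟩ := Option.ne_none_iff_exists'.1 he
    have h2 := hη.2 e s hs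
    have h3 := (hξ e).1
    rw [h2] at h3
    cases s <;> simp at h3

theorem eq_of_mem_genericCube {i j : ι} {ξ η : E3} (hξ : ξ ∈ P.genericCube i) (hη : η ∈ closedCube)
    (h : P.param i ξ = P.param j η) : i = j ∧ ξ = η := by
  have hij : i = j := by
    by_contra hij
    exact Set.disjoint_left.1 (disjoint_image_genericCube hP hij) ⟨ξ, hξ, rfl⟩ ⟨η, hη, h.symm⟩
  subst hij
  exact ⟨rfl, injOn_param hP i (P.genericCube_subset i hξ) hη h⟩

theorem image_genericCube_subset_domain (i : ι) : P.param i '' P.genericCube i ⊆ P.domain := by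
  rintro _ ⟨ξ, hξ, rfl⟩
  exact param_mem_domain hP hξ

theorem measurableSet_image_genericCube (i : ι) : MeasurableSet (P.param i '' P.genericCube i) := by
  have h := ContinuousOn.measurableEmbedding (P.isOpen_genericCube i).measurableSet
    ((continuousOn_param hP i).mono (P.genericCube_subset i))
    ((injOn_param hP i).mono (P.genericCube_subset i))
  have := h.measurableSet_range
  rwa [Set.range_domRestrict] at this

theorem volume_image_eq_zero_of_null (i : ι) {t : Set E3} (hts : t ⊆ closedCube)
    (ht : volume t = 0) : volume (P.param i '' t) = 0 :=
  let ⟨_, hK⟩ := exists_lipschitz_param hP i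
  volume_image_eq_zero hK hts ht

theorem volume_eq_zero_of_image_null (i : ι) {t : Set E3} (hts : t ⊆ closedCube)
    (ht : volume (P.param i '' t) = 0) : volume t = 0 := by
  obtain ⟨c, C, hc, hb⟩ := hP.biLipschitz i
  have hinj := (injOn_param hP i).leftInvOn_invFunOn
  have hL : LipschitzOnWith (Real.toNNReal c⁻¹) (Function.invFunOn (P.param i) closedCube)
      (P.param i '' closedCube) := by
    refine LipschitzOnWith.of_dist_le_mul ?_
    rintro _ ⟨ξ, hξ, rfl⟩ _ ⟨η, hη, rfl⟩
    rw [hinj hξ, hinj hη, Real.coe_toNNReal _ (inv_nonneg.2 hc.le), ← div_eq_inv_mul,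
      le_div_iff₀ hc, mul_comm]
    exact (hb ξ hξ η hη).1
  have h1 := volume_image_eq_zero hL (image_mono hts) ht
  have h2 : Function.invFunOn (P.param i) closedCube '' (P.param i '' t) = t := by
    rw [image_image]
    exact (image_congr fun ξ hξ => hinj (hts hξ)).trans (image_id' t)
  rwa [h2] at h1

/-- Almost every point of the domain has generic parameters. -/
theorem ae_generic [Finite ι] : ∀ᵐ x ∂(volume.restrict P.domain),
    (∃ i, ∃ ξ ∈ P.genericCube i, P.param i ξ = x) ∧
      ∀ i, ∀ ξ ∈ closedCube, P.param i ξ = x → ξ ∈ P.genericCube i := by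
  have h0 : volume (⋃ i, P.param i '' (closedCube \ P.genericCube i)) = 0 := by
    have : Countable ι := Finite.to_countable
    exact measure_iUnion_null fun i =>
      volume_image_eq_zero_of_null hP i sdiff_subset (volume_diff_genericCube i)
  have h1 : ∀ᵐ x ∂(volume.restrict P.domain),
      x ∉ ⋃ i, P.param i '' (closedCube \ P.genericCube i) :=
    ae_restrict_of_ae (measure_eq_zero_iff_ae_notMem.1 h0)
  filter_upwards [h1, ae_restrict_mem isOpen_domain.measurableSet] with x h2 h3
  have h4 : ∀ i, ∀ ξ ∈ closedCube, P.param i ξ = x → ξ ∈ P.genericCube i := fun i ξ hξ he => by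
    by_contra hne
    exact h2 (mem_iUnion.2 ⟨i, ξ, ⟨hξ, hne⟩, he⟩)
  obtain ⟨i, ξ, hξ, he⟩ := mem_iUnion.1 (domain_subset h3)
  exact ⟨⟨i, ξ, h4 i ξ hξ he, he⟩, h4⟩

theorem domain_ae_eq [Finite ι] : P.domain =ᵐ[volume] ⋃ i, P.param i '' P.genericCube i := by
  have h := (ae_restrict_iff' isOpen_domain.measurableSet).1 (ae_generic hP)
  filter_upwards [h] with x hx
  refine propext ⟨fun h1 => ?_, fun h1 => ?_⟩
  · obtain ⟨⟨i, ξ, hξ, he⟩, -⟩ := hx h1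
    exact mem_iUnion.2 ⟨i, ξ, hξ, he⟩
  · obtain ⟨i, hi⟩ := mem_iUnion.1 h1
    exact image_genericCube_subset_domain hP i hi

theorem volume_domain_lt_top [Finite ι] : volume P.domain < ⊤ := by
  have h1 : volume P.domain ≤ volume (⋃ i, P.patch i) := measure_mono domain_subset
  exact h1.trans_lt (isCompact_iUnion fun i => isCompact_patch hP i).measure_lt_top

/-- A property of almost every point of the domain holds at almost every parameter. -/
theorem ae_pullback {Q : E3 → Prop} (h : ∀ᵐ x ∂(volume.restrict P.domain), Q x) (i : ι) :
    ∀ᵐ ξ ∂(volume.restrict (P.genericCube i)), Q (P.param i ξ) := by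
  rw [ae_restrict_iff' (P.isOpen_genericCube i).measurableSet]
  rw [ae_restrict_iff' isOpen_domain.measurableSet] at h
  have h1 : volume (P.param i '' {ξ | ¬(ξ ∈ P.genericCube i → Q (P.param i ξ))}) = 0 := by
    refine measure_mono_null ?_ h
    rintro _ ⟨ξ, hξ, rfl⟩
    obtain ⟨h1, h2⟩ := Classical.not_imp.1 hξ
    exact fun h3 => h2 (h3 (param_mem_domain hP h1))
  refine volume_eq_zero_of_image_null hP i (fun ξ hξ => ?_) h1
  exact P.genericCube_subset i (Classical.not_imp.1 hξ).1

/-- Change of variables, patch by patch. -/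
theorem integral_domain [Fintype ι] {h : E3 → ℝ} {k : ι → E3 → ℝ}
    (hi : IntegrableOn h P.domain)
    (hk : ∀ᵐ x ∂(volume.restrict P.domain), ∀ i, ∀ ξ ∈ P.genericCube i, P.param i ξ = x →
      (fderiv ℝ (P.param i) ξ).det * h x = k i ξ) :
    ∫ x in P.domain, h x = ∑ i, P.orient i * ∫ ξ in closedCube, k i ξ := by
  have hfi : ∀ i, IntegrableOn h (P.param i '' P.genericCube i) := fun i =>
    hi.mono_set (image_genericCube_subset_domain hP i)
  rw [setIntegral_congr_set (domain_ae_eq hP), integral_iUnion_fintype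
    (fun i => measurableSet_image_genericCube hP i)
    (fun i j hij => (disjoint_image_genericCube hP hij).mono_right
      (image_mono (P.genericCube_subset j))) hfi]
  refine Finset.sum_congr rfl fun i _ => ?_
  rw [integral_image_eq_integral_abs_det_fderiv_smul volume (P.isOpen_genericCube i).measurableSet
    (fun ξ hξ => ((contDiffAt_param hP hξ).differentiableAt (by simp)).hasFDerivAt.hasFDerivWithinAt)
    ((injOn_param hP i).mono (P.genericCube_subset i)),
    ← integral_const_mul, ← setIntegral_congr_set (genericCube_ae_eq i)]
  refine setIntegral_congr_ae (P.isOpen_genericCube i).measurableSet ?_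
  have h1 := ae_pullback hP hk i
  rw [ae_restrict_iff' (P.isOpen_genericCube i).measurableSet] at h1
  filter_upwards [h1] with ξ h2 hξ
  rw [← h2 hξ i ξ hξ rfl, abs_det_eq hP hξ, smul_eq_mul, mul_assoc]

/-- Bounded measurable functions on the reference cubes define a square integrable field. -/
theorem exists_Lp [Fintype ι] {V : Type*} [NormedAddCommGroup V] [NormedSpace ℝ V]
    [MeasurableSpace V] [BorelSpace V] [SecondCountableTopology V] (h : ι → E3 → V)
    (hm : ∀ i, Measurable (h i)) (hb : ∀ i, ∃ C, ∀ ξ ∈ P.genericCube i, ‖h i ξ‖ ≤ C) :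
    ∃ u : Lp V 2 (volume.restrict P.domain), ∀ᵐ x ∂(volume.restrict P.domain), ∀ i,
      ∀ ξ ∈ closedCube, P.param i ξ = x → ξ ∈ P.genericCube i ∧ u x = h i ξ := by
  have hemb : ∀ i, MeasurableEmbedding ((P.genericCube i).domRestrict (P.param i)) := fun i =>
    ContinuousOn.measurableEmbedding (P.isOpen_genericCube i).measurableSet
      ((continuousOn_param hP i).mono (P.genericCube_subset i))
      ((injOn_param hP i).mono (P.genericCube_subset i))
  set v : ι → E3 → V := fun i => Function.extend ((P.genericCube i).domRestrict (P.param i))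
    (fun ξ => h i ξ) 0 with hv
  have hvm : ∀ i, Measurable (v i) := fun i =>
    (hemb i).measurable_extend ((hm i).comp measurable_subtype_coe) measurable_const
  have hv1 : ∀ i, ∀ ξ ∈ P.genericCube i, v i (P.param i ξ) = h i ξ := fun i ξ hξ =>
    (hemb i).injective.extend_apply (fun ξ : P.genericCube i => h i ξ) 0 ⟨ξ, hξ⟩
  have hv0 : ∀ i x, (¬ ∃ ξ ∈ P.genericCube i, P.param i ξ = x) → v i x = 0 := fun i x hx =>
    Function.extend_apply' _ _ _ fun ⟨ξ, hξ⟩ => hx ⟨ξ, ξ.2, hξ⟩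
  choose C hC using hb
  have hvC : ∀ i x, ‖v i x‖ ≤ |C i| := fun i x => by
    by_cases hx : ∃ ξ ∈ P.genericCube i, P.param i ξ = x
    · obtain ⟨ξ, hξ, rfl⟩ := hx
      rw [hv1 i ξ hξ]
      exact (hC i ξ hξ).trans (le_abs_self _)
    · rw [hv0 i x hx, norm_zero]; exact abs_nonneg _
  have hfin : IsFiniteMeasure (volume.restrict P.domain) :=
    ⟨by rw [Measure.restrict_apply_univ]; exact volume_domain_lt_top hP⟩
  have hmem : MemLp (fun x => ∑ i, v i x) 2 (volume.restrict P.domain) :=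
    MemLp.of_bound (Finset.measurable_fun_sum _ fun i _ => hvm i).aestronglyMeasurable
      (∑ i, |C i|) (Filter.Eventually.of_forall fun x =>
        (norm_sum_le _ _).trans (Finset.sum_le_sum fun i _ => hvC i x))
  refine ⟨hmem.toLp _, ?_⟩
  filter_upwards [hmem.coeFn_toLp, ae_generic hP] with x h1 h2 i ξ hξ hx
  have hξ' := h2.2 i ξ hξ hx
  refine ⟨hξ', ?_⟩
  rw [h1, Finset.sum_eq_single i, ← hx, hv1 i ξ hξ']
  · intro j _ hj
    refine hv0 j x ?_
    rintro ⟨η, hη, he⟩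
    exact hj (eq_of_mem_genericCube hP hη hξ (he.trans hx.symm)).1
  · simp

end MultiPatch
end

noncomputable section

/-! ### Green's formulas on the patches -/

theorem LineDiff.inner {G : Fin 3 → Set ℝ} {e : Fin 3} {H H' K K' : E3 → E3}
    (h : ∀ b, LineDiff G e (fun ξ => H ξ b) (fun ξ => H' ξ b))
    (k : ∀ b, LineDiff G e (fun ξ => K ξ b) (fun ξ => K' ξ b)) :
    LineDiff G e (fun ξ => ⟪H ξ, K ξ⟫_ℝ) (fun ξ => ⟪H' ξ, K ξ⟫_ℝ + ⟪H ξ, K' ξ⟫_ℝ) := by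
  simp only [inner_E3]
  refine ((((h 0).mul (k 0)).add ((h 1).mul (k 1))).add ((h 2).mul (k 2))).congr ?_
  funext ξ
  ring

theorem LineDiff.cross3 {G : Fin 3 → Set ℝ} {e : Fin 3} {H H' K K' : E3 → E3}
    (h : ∀ b, LineDiff G e (fun ξ => H ξ b) (fun ξ => H' ξ b))
    (k : ∀ b, LineDiff G e (fun ξ => K ξ b) (fun ξ => K' ξ b)) (b : Fin 3) :
    LineDiff G e (fun ξ => _root_.cross3 (H ξ) (K ξ) b)
      (fun ξ => (_root_.cross3 (H' ξ) (K ξ) + _root_.cross3 (H ξ) (K' ξ)) b) := by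
  fin_cases b
  · refine (((h 1).mul (k 2)).sub ((h 2).mul (k 1))).congr ?_
    funext ξ; simp [_root_.cross3]; ring
  · refine (((h 2).mul (k 0)).sub ((h 0).mul (k 2))).congr ?_
    funext ξ; simp [_root_.cross3]; ring
  · refine (((h 0).mul (k 1)).sub ((h 1).mul (k 0))).congr ?_
    funext ξ; simp [_root_.cross3]; ring

/-- The derivative of a field in a direction, in terms of the Jacobian matrix. -/
def jacMul (φ : E3 → E3) (x v : E3) : E3 := WithLp.toLp 2 fun b => ∑ m, jacobian φ x b m * v m

theorem fderiv_comp_eq {φ : E3 → E3} (hφ : ContDiff ℝ ∞ φ) (x v : E3) (b : Fin 3) :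
    fderiv ℝ (fun y => φ y b) x v = jacMul φ x v b := by
  have hd : HasFDerivAt φ (fderiv ℝ φ x) x :=
    (hφ.contDiffAt.differentiableAt (by simp)).hasFDerivAt
  have h1 : HasFDerivAt (fun y => φ y b)
      ((EuclideanSpace.proj b : E3 →L[ℝ] ℝ).comp (fderiv ℝ φ x)) x :=
    (EuclideanSpace.proj b : E3 →L[ℝ] ℝ).hasFDerivAt.comp x hd
  rw [h1.fderiv]
  change (fderiv ℝ φ x v) b = _
  rw [clm_apply_eq_sum]
  simp only [jacMul, jacobian, Matrix.of_apply, Fin.sum_univ_three, PiLp.add_apply, PiLp.smul_apply,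
    smul_eq_mul]
  ring

theorem IsTest.contDiff_apply {Γ : Set E3} {φ : E3 → E3} (h : IsTest Γ φ) (b : Fin 3) :
    ContDiff ℝ ∞ fun y => φ y b :=
  (EuclideanSpace.proj b : E3 →L[ℝ] ℝ).contDiff.comp h.smooth

theorem IsTest.hasCompactSupport_apply {Γ : Set E3} {φ : E3 → E3} (h : IsTest Γ φ) (b : Fin 3) :
    HasCompactSupport fun y => φ y b :=
  h.compact.comp_left (g := fun v : E3 => v b) rfl

/-! The algebraic identities behind the transformation of gradient, curl and divergence; the vectors
`p 0, p 1, p 2` are the columns of a Jacobian matrix. -/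

/-- Expansion of the inner product in a basis and its dual basis. -/
theorem det_mul_inner (p : Fin 3 → E3) (u v : E3) :
    ⟪p 0, cross3 (p 1) (p 2)⟫_ℝ * ⟪u, v⟫_ℝ =
      ∑ d, ⟪p d, u⟫_ℝ * ⟪cross3 (p (d + 1)) (p (d + 2)), v⟫_ℝ := by
  simp only [Fin.sum_univ_three, inner_E3, cross3, zero_add, show (1 : Fin 3) + 1 = 2 from rfl,
    show (1 : Fin 3) + 2 = 0 from rfl, show (2 : Fin 3) + 1 = 0 from rfl,
    show (2 : Fin 3) + 2 = 1 from rfl, Matrix.cons_val]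
  ring

theorem det_mul_divergence (p : Fin 3 → E3) (φ : E3 → E3) (x : E3) :
    ⟪p 0, cross3 (p 1) (p 2)⟫_ℝ * divergence φ x =
      ∑ d, ⟪cross3 (p (d + 1)) (p (d + 2)), jacMul φ x (p d)⟫_ℝ := by
  rw [divergence, Matrix.trace]
  simp only [Matrix.diag, Fin.sum_univ_three, inner_E3, cross3, jacMul, zero_add,
    show (1 : Fin 3) + 1 = 2 from rfl,
    show (1 : Fin 3) + 2 = 0 from rfl, show (2 : Fin 3) + 1 = 0 from rfl,
    show (2 : Fin 3) + 2 = 1 from rfl, Matrix.cons_val]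
  ring

theorem inner_cross3_curl (u v : E3) (φ : E3 → E3) (x : E3) :
    ⟪cross3 u v, curl φ x⟫_ℝ = ⟪v, jacMul φ x u⟫_ℝ - ⟪u, jacMul φ x v⟫_ℝ := by
  simp only [Fin.sum_univ_three, inner_E3, cross3, jacMul, curl, Matrix.cons_val]
  ring

theorem sum_cross3_symm (p : Fin 3 → E3) (q : Fin 3 → Fin 3 → E3) (hq : ∀ e f, q e f = q f e)
    (v : E3) : ∑ e, ⟪cross3 (q e (e + 1)) (p (e + 2)) + cross3 (p (e + 1)) (q e (e + 2)), v⟫_ℝ = 0 := by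
  simp only [Fin.sum_univ_three, zero_add, show (1 : Fin 3) + 1 = 2 from rfl,
    show (1 : Fin 3) + 2 = 0 from rfl, show (2 : Fin 3) + 1 = 0 from rfl,
    show (2 : Fin 3) + 2 = 1 from rfl]
  rw [hq 1 0, hq 2 0, hq 2 1]
  simp only [inner_E3, cross3, PiLp.add_apply, Matrix.cons_val]
  ring

namespace ControlGrid

variable {ι : Type*} {M : ControlGrid ι}

/-- The coboundary of a family of vertex values, before gluing. -/
def grad (c : M.LocalVertex → ℝ) : M.LocalEdge → ℝ := fun x => c (head x) - c (tail x)

/-- The facet with normal direction `d` of a cell, which contains the first vertex of the cell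
(`up = false`), or the opposite facet (`up = true`). -/
def cellFacet (q : M.LocalCell) (d : Fin 3) (up : Bool) : M.LocalFacet :=
  ⟨q.1, d, fun e => ⟨(q.2 e : ℕ) + (if e = d ∧ up = true then 1 else 0), by
    have h := (q.2 e).isLt
    generalize (q.2 e : ℕ) = k at h ⊢
    simp only [ext, Finset.mem_univ, if_true, Finset.mem_compl, Finset.mem_singleton] at h ⊢
    split_ifs <;> omega⟩⟩

/-- The flux of a family of facet values out of a cell. -/
def outflow (c : M.LocalFacet → ℝ) : M.LocalCell → ℝ := fun q =>
  ∑ d, (c (cellFacet q d true) - c (cellFacet q d false))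

end ControlGrid

namespace MultiPatch

variable {ι : Type*} {M : ControlGrid ι} {P : MultiPatch M}

variable (P) in
/-- The spline on patch `i` with the given vertex coefficients. -/
def hat0 (c : M.LocalVertex → ℝ) (i : ι) : E3 → ℝ := P.field i ∅ fun a => c ⟨i, a⟩

variable (P) in
/-- The components of the spline field on patch `i` with the given edge coefficients. -/
def hat1 (c : M.LocalEdge → ℝ) (i : ι) (d : Fin 3) : E3 → ℝ := P.field i {d} fun a => c ⟨i, d, a⟩

variable (P) in
/-- The components of the spline field on patch `i` with the given facet coefficients. -/
def hat2 (c : M.LocalFacet → ℝ) (i : ι) (d : Fin 3) : E3 → ℝ := P.field i {d}ᶜ fun a => c ⟨i, d, a⟩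

variable (P) in
/-- The spline on patch `i` with the given cell coefficients. -/
def hat3 (c : M.LocalCell → ℝ) (i : ι) : E3 → ℝ := P.field i Finset.univ fun a => c ⟨i, a⟩

variable (P) in
/-- The flux through the sides of all the patches. The integral over a side is written as an
integral over the cube. -/
def flux [Fintype ι] (T : ι → Fin 3 → E3 → ℝ) : ℝ :=
  ∑ i, ∑ e, ∑ s : Bool, -(inward s * P.orient i) *
    ∫ ξ in closedCube, T i e (upd ξ e (sideVal s))

variable (hP : P.IsConforming)
include hP

theorem det_param {i : ι} {ξ : E3} (hξ : ξ ∈ P.genericCube i) :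
    (fderiv ℝ (P.param i) ξ).det = ⟪P.pd i 0 ξ, cross3 (P.pd i 1 ξ) (P.pd i 2 ξ)⟫_ℝ := by
  have h := inner_cross3_apply (fderiv ℝ (P.param i) ξ) 0 (EuclideanSpace.single 0 1)
  simp only [zero_add, fderiv_param_single hP hξ, PiLp.single_apply, if_true, one_mul] at h
  rw [← h, real_inner_comm]

theorem lineDiff_test {Γ : Set E3} {φ : E3 → E3} (hφ : IsTest Γ φ) (i : ι) (e b : Fin 3) :
    LineDiff (P.gen i) e (fun ξ => φ (P.param i ξ) b)
      (fun ξ => jacMul φ (P.param i ξ) (P.pd i e ξ) b) := by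
  refine (LineDiff.comp_test (hφ.contDiff_apply b) (hφ.hasCompactSupport_apply b)
    (lineDiff_param hP i e)).congr ?_
  funext ξ
  exact fderiv_comp_eq hφ.smooth _ _ b

theorem lineDiff_normal (i : ι) (e b : Fin 3) :
    LineDiff (P.gen i) e (fun ξ => P.normal i e ξ b)
      (fun ξ => (cross3 (P.pd2 i e (e + 1) ξ) (P.pd i (e + 2) ξ) +
        cross3 (P.pd i (e + 1) ξ) (P.pd2 i e (e + 2) ξ)) b) :=
  LineDiff.cross3 (lineDiff_pd hP i (fin3_add_one_ne e).symm)
    (lineDiff_pd hP i (fin3_add_two_ne e).symm) b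

theorem lineDiff_hat0 (c : M.LocalVertex → ℝ) (i : ι) (e : Fin 3) :
    LineDiff (P.gen i) e (P.hat0 c i) (P.hat1 (ControlGrid.grad c) i e) :=
  lineDiff_field hP i (Finset.notMem_empty e) rfl _ _ fun a' a₁ a₀ h₁ h₀ => by
    have e1 : ControlGrid.head ⟨i, e, a'⟩ = (⟨i, a₁⟩ : M.LocalVertex) :=
      congrArg (Sigma.mk i) (idx_ext fun f => (h₁ f).symm)
    have e0 : ControlGrid.tail ⟨i, e, a'⟩ = (⟨i, a₀⟩ : M.LocalVertex) :=
      congrArg (Sigma.mk i) (idx_ext fun f => (h₀ f).symm)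
    rw [ControlGrid.grad, e1, e0]

/-- The difference of the values on the two edges in direction `f` of a facet. -/
theorem lineDiff_hat1 (c : M.LocalEdge → ℝ) (i : ι) {d e f : Fin 3} (hf : f ≠ d) (he : e ≠ f)
    (hd : d ≠ e) :
    LineDiff (P.gen i) e (P.hat1 c i f) (P.field i {d}ᶜ fun a =>
      c (ControlGrid.facetEdge ⟨i, d, a⟩ f hf true) -
        c (ControlGrid.facetEdge ⟨i, d, a⟩ f hf false)) :=
  lineDiff_field hP i (by simpa using he) (by revert d e f; decide) _ _ fun a' a₁ a₀ h₁ h₀ => by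
    have e1 : ControlGrid.facetEdge ⟨i, d, a'⟩ f hf true = (⟨i, f, a₁⟩ : M.LocalEdge) := by
      refine congrArg (fun a => (⟨i, f, a⟩ : M.LocalEdge)) (idx_ext fun k => ?_)
      rw [h₁ k]
      have hk : (k ≠ d ∧ k ≠ f) ↔ k = e := by omega
      simp only [and_true, hk]
    have e0 : ControlGrid.facetEdge ⟨i, d, a'⟩ f hf false = (⟨i, f, a₀⟩ : M.LocalEdge) := by
      refine congrArg (fun a => (⟨i, f, a⟩ : M.LocalEdge)) (idx_ext fun k => ?_)
      rw [h₀ k]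
      simp
    rw [e1, e0]

theorem lineDiff_hat2 (c : M.LocalFacet → ℝ) (i : ι) (e : Fin 3) :
    LineDiff (P.gen i) e (P.hat2 c i e) (P.field i Finset.univ fun a =>
      c (ControlGrid.cellFacet ⟨i, a⟩ e true) - c (ControlGrid.cellFacet ⟨i, a⟩ e false)) :=
  lineDiff_field hP i (by simp) (by revert e; decide) _ _ fun a' a₁ a₀ h₁ h₀ => by
    have e1 : ControlGrid.cellFacet ⟨i, a'⟩ e true = (⟨i, e, a₁⟩ : M.LocalFacet) :=
      congrArg (fun a => (⟨i, e, a⟩ : M.LocalFacet)) (idx_ext fun k => by rw [h₁ k]; simp)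
    have e0 : ControlGrid.cellFacet ⟨i, a'⟩ e false = (⟨i, e, a₀⟩ : M.LocalFacet) :=
      congrArg (fun a => (⟨i, e, a⟩ : M.LocalFacet)) (idx_ext fun k => by rw [h₀ k]; simp)
    rw [e1, e0]

/-- Gauss' theorem on all the patches. -/
theorem integral_eq_flux [Fintype ι] {h : E3 → ℝ} {T T' : ι → Fin 3 → E3 → ℝ}
    (hT : ∀ i e, LineDiff (P.gen i) e (T i e) (T' i e)) (hi : IntegrableOn h P.domain)
    (hk : ∀ᵐ x ∂(volume.restrict P.domain), ∀ i, ∀ ξ ∈ P.genericCube i, P.param i ξ = x →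
      ⟪P.pd i 0 ξ, cross3 (P.pd i 1 ξ) (P.pd i 2 ξ)⟫_ℝ * h x = ∑ e, T' i e ξ) :
    ∫ x in P.domain, h x = P.flux T := by
  rw [integral_domain hP (k := fun i ξ => ∑ e, T' i e ξ) hi (by
    filter_upwards [hk] with x hx i ξ hξ he
    rw [det_param hP hξ]
    exact hx i ξ hξ he), flux]
  refine Finset.sum_congr rfl fun i _ => ?_
  have hint : ∀ {e : Fin 3} {h : E3 → ℝ}, Measurable h → (∃ C, ∀ ξ ∈ closedCube, |h ξ| ≤ C) →
      IntegrableOn h closedCube := fun hm ⟨C, hC⟩ =>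
    integrableOn_closedCube_of_bounded hm.aestronglyMeasurable C hC
  rw [integral_finsetSum _ fun e _ => hint (e := e) (hT i e).meas' (hT i e).bdd', Finset.mul_sum]
  refine Finset.sum_congr rfl fun e _ => ?_
  have hs : ∀ t ∈ Icc (0 : ℝ) 1, IntegrableOn (fun ξ => T i e (upd ξ e t)) closedCube :=
    fun t ht => by
      obtain ⟨C, hC⟩ := (hT i e).bdd
      exact hint (e := e) ((hT i e).meas.comp (continuous_upd_left e t).measurable)
        ⟨C, fun ξ hξ => hC _ (upd_mem_closedCube hξ ht)⟩
  rw [(hT i e).integral_eq (IsOpenKnotVector.genericSet_compl_finite.countable),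
    integral_sub (hs 1 (by simp)) (hs 0 (by simp)), Fintype.sum_bool]
  simp only [inward, sideVal, if_true, Bool.false_eq_true, if_false]
  ring

omit hP in
variable (P) in
/-- The vector field whose flux is the boundary term for the gradient. -/
def trace0 (c : M.LocalVertex → ℝ) (i : ι) (e : Fin 3) (ξ : E3) : E3 :=
  P.hat0 c i ξ • P.normal i e ξ

omit hP in
variable (P) in
/-- The vector field whose flux is the boundary term for the curl. -/
def trace1 (c : M.LocalEdge → ℝ) (i : ι) (e : Fin 3) (ξ : E3) : E3 :=
  P.hat1 c i (e + 2) ξ • P.pd i (e + 1) ξ - P.hat1 c i (e + 1) ξ • P.pd i (e + 2) ξ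

theorem green_grad [Fintype ι] {Γ : Set E3} {φ : E3 → E3} (hφ : IsTest Γ φ)
    {u : L2Scalar P.domain} {g : L2Vector P.domain} {c : M.LocalVertex → ℝ}
    (hu : ∀ᵐ x ∂(volume.restrict P.domain), ∀ i, ∀ ξ ∈ P.genericCube i, P.param i ξ = x →
      u x = P.hat0 c i ξ)
    (hg : ∀ᵐ x ∂(volume.restrict P.domain), ∀ i, ∀ ξ ∈ P.genericCube i, P.param i ξ = x →
      ∀ d, ⟪P.pd i d ξ, g x⟫_ℝ = P.hat1 (ControlGrid.grad c) i d ξ) :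
    (∫ x in P.domain, u x * divergence φ x) + ∫ x in P.domain, ⟪g x, φ x⟫_ℝ =
      P.flux fun i e ξ => ⟪P.trace0 c i e ξ, φ (P.param i ξ)⟫_ℝ := by
  have i1 : Integrable (fun x => u x * divergence φ x) (volume.restrict P.domain) :=
    (Lp.memLp u).integrable_mul hφ.memLp_divergence
  have i2 := L2Vector.integrable g (hφ.memLp (Ω := P.domain))
  rw [← integral_add i1 i2]
  simp only [trace0, inner_smul_left, conj_trivial]
  refine integral_eq_flux hP (fun i e => (lineDiff_hat0 hP c i e).mul
    (LineDiff.inner (lineDiff_normal hP i e) (lineDiff_test hP hφ i e))) (i1.add i2) ?_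
  filter_upwards [hu, hg] with x h1 h2 i ξ hξ hx
  rw [mul_add, det_mul_inner (fun d => P.pd i d ξ), h1 i ξ hξ hx, mul_left_comm,
    det_mul_divergence (fun d => P.pd i d ξ)]
  have h3 := sum_cross3_symm (fun d => P.pd i d ξ) (fun e f => P.pd2 i e f ξ)
    (fun e f => P.pd2_symm i e f ξ) (φ x)
  simp only [h2 i ξ hξ hx, hx, mul_add, Finset.sum_add_distrib, normal, ← Finset.mul_sum, h3]
  ring

/-- The integrals over the patches reduce to boundary terms because mixed second derivatives of the
parametrisation are symmetric. -/
theorem green_curl [Fintype ι] {Γ : Set E3} {φ : E3 → E3} (hφ : IsTest Γ φ)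
    {u w : L2Vector P.domain} {c : M.LocalEdge → ℝ}
    (hu : ∀ᵐ x ∂(volume.restrict P.domain), ∀ i, ∀ ξ ∈ P.genericCube i, P.param i ξ = x →
      ∀ d, ⟪P.pd i d ξ, u x⟫_ℝ = P.hat1 c i d ξ)
    (hw : ∀ᵐ x ∂(volume.restrict P.domain), ∀ i, ∀ ξ ∈ P.genericCube i, P.param i ξ = x →
      ∀ d, ⟪P.normal i d ξ, w x⟫_ℝ = P.hat2 (M.circulation c) i d ξ) :
    (∫ x in P.domain, ⟪u x, curl φ x⟫_ℝ) - ∫ x in P.domain, ⟪w x, φ x⟫_ℝ =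
      P.flux fun i e ξ => ⟪P.trace1 c i e ξ, φ (P.param i ξ)⟫_ℝ := by
  have i1 := L2Vector.integrable u (hφ.memLp_curl (Ω := P.domain))
  have i2 := L2Vector.integrable w (hφ.memLp (Ω := P.domain))
  rw [← integral_sub i1 i2]
  simp only [trace1, inner_sub_left, inner_smul_left, conj_trivial]
  have n1 := fin3_add_one_ne
  have n2 := fin3_add_two_ne
  have n3 : ∀ e : Fin 3, e + 2 ≠ e + 1 := by decide
  refine integral_eq_flux hP (fun i e =>
    ((lineDiff_hat1 hP c i (d := e + 1) (n3 e) (n2 e).symm (n1 e)).mul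
      (LineDiff.inner (lineDiff_pd hP i (n1 e).symm) (lineDiff_test hP hφ i e))).sub
    ((lineDiff_hat1 hP c i (d := e + 2) (n3 e).symm (n1 e).symm (n2 e)).mul
      (LineDiff.inner (lineDiff_pd hP i (n2 e).symm) (lineDiff_test hP hφ i e)))) (i1.sub i2) ?_
  filter_upwards [hu, hw] with x h1 h2 i ξ hξ hx
  have h3 : ∀ d, P.hat2 (M.circulation c) i d ξ =
      P.field i {d}ᶜ (fun a => c (ControlGrid.facetEdge ⟨i, d, a⟩ (d + 2) (n2 d) true) -
        c (ControlGrid.facetEdge ⟨i, d, a⟩ (d + 2) (n2 d) false)) ξ -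
      P.field i {d}ᶜ (fun a => c (ControlGrid.facetEdge ⟨i, d, a⟩ (d + 1) (n1 d) true) -
        c (ControlGrid.facetEdge ⟨i, d, a⟩ (d + 1) (n1 d) false)) ξ := fun d => by
    simp only [hat2, field, ← Finset.sum_sub_distrib, ← sub_mul, ControlGrid.circulation]
    refine Finset.sum_congr rfl fun a _ => ?_
    ring
  -- the differences as a function without proof arguments, for the case split on the direction
  let q : Fin 3 → Fin 3 → ℝ := fun d f => if h : f ≠ d then P.field i {d}ᶜ (fun a =>
    c (ControlGrid.facetEdge ⟨i, d, a⟩ f h true) -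
      c (ControlGrid.facetEdge ⟨i, d, a⟩ f h false)) ξ else 0
  have hq : ∀ d f (h : f ≠ d), P.field i {d}ᶜ (fun a =>
    c (ControlGrid.facetEdge ⟨i, d, a⟩ f h true) -
      c (ControlGrid.facetEdge ⟨i, d, a⟩ f h false)) ξ = q d f := fun d f h => by
    simp only [q]
    rw [dif_pos h]
  have hdet := det_mul_inner (fun d => P.pd i d ξ)
  rw [mul_sub, hdet, real_inner_comm (φ x) (w x), hdet]
  simp only [inner_cross3_curl]
  simp only [← normal.eq_def]
  simp only [h1 i ξ hξ hx, h2 i ξ hξ hx, h3, hq, hx, Fin.sum_univ_three, zero_add,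
    show (1 : Fin 3) + 1 = 2 from rfl, show (1 : Fin 3) + 2 = 0 from rfl,
    show (2 : Fin 3) + 1 = 0 from rfl, show (2 : Fin 3) + 2 = 1 from rfl,
    P.pd2_symm i 1 0, P.pd2_symm i 2 0, P.pd2_symm i 2 1]
  ring

theorem green_div [Fintype ι] {Γ : Set E3} {φ : E3 → ℝ} (hφ : IsTest Γ φ)
    {u : L2Vector P.domain} {w : L2Scalar P.domain} {c : M.LocalFacet → ℝ}
    (hu : ∀ᵐ x ∂(volume.restrict P.domain), ∀ i, ∀ ξ ∈ P.genericCube i, P.param i ξ = x →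
      ∀ d, ⟪P.normal i d ξ, u x⟫_ℝ = P.hat2 c i d ξ)
    (hw : ∀ᵐ x ∂(volume.restrict P.domain), ∀ i, ∀ ξ ∈ P.genericCube i, P.param i ξ = x →
      (fderiv ℝ (P.param i) ξ).det * w x = P.hat3 (ControlGrid.outflow c) i ξ) :
    (∫ x in P.domain, ⟪u x, gradient φ x⟫_ℝ) + ∫ x in P.domain, w x * φ x =
      P.flux fun i e ξ => ⟪P.hat2 c i e ξ, φ (P.param i ξ)⟫_ℝ := by
  have i1 := L2Vector.integrable u (hφ.memLp_gradient (Ω := P.domain))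
  have i2 : Integrable (fun x => w x * φ x) (volume.restrict P.domain) :=
    (Lp.memLp w).integrable_mul hφ.memLp
  rw [← integral_add i1 i2]
  have hin : ∀ a b : ℝ, ⟪a, b⟫_ℝ = a * b := fun a b => by simp [mul_comm]
  simp only [hin]
  refine integral_eq_flux hP (fun i e => (lineDiff_hat2 hP c i e).mul
    (LineDiff.comp_test hφ.smooth hφ.compact (lineDiff_param hP i e))) (i1.add i2) ?_
  filter_upwards [hu, hw] with x h1 h2 i ξ hξ hx
  have h3 : P.hat3 (ControlGrid.outflow c) i ξ = ∑ d, P.field i Finset.univ (fun a =>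
      c (ControlGrid.cellFacet ⟨i, a⟩ d true) - c (ControlGrid.cellFacet ⟨i, a⟩ d false)) ξ := by
    simp only [hat3, field, ControlGrid.outflow, Finset.sum_mul]
    rw [Finset.sum_comm]
  have h4 : ∀ v, fderiv ℝ φ x v = ⟪v, gradient φ x⟫_ℝ := fun v => by
    rw [gradient, real_inner_comm, InnerProductSpace.toDual_symm_apply]
  have h5 := h2 i ξ hξ hx
  rw [det_param hP hξ, h3] at h5
  have hdet := det_mul_inner (fun d => P.pd i d ξ)
  rw [mul_add, real_inner_comm (gradient φ x) (u x), hdet, ← mul_assoc, h5, Finset.sum_mul, ← Finset.sum_add_distrib]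
  simp only [← normal.eq_def, h1 i ξ hξ hx, hx, h4]
  exact Finset.sum_congr rfl fun d _ => by ring

end MultiPatch
end

noncomputable section

/-! ### Continuity of traces, and fluxes through interfaces -/

theorem continuousOn_tens {β : Fin 3 → ℕ → ℝ → ℝ} {a : Fin 3 → ℕ} {X : Set E3}
    (h : ∀ e, (∀ ξ ∈ X, ContinuousAt (β e (a e)) (ξ e)) ∨ ∃ t, ∀ ξ ∈ X, ξ e = t) :
    ContinuousOn (tens β a) X := by
  refine continuousOn_finsetProd _ fun e _ => ?_
  rcases h e with h | ⟨t, h⟩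
  · intro ξ hξ
    exact (ContinuousAt.comp (f := fun η : E3 => η e) (h ξ hξ) (by fun_prop)).continuousWithinAt
  · exact continuousOn_const.congr fun ξ hξ => by rw [h ξ hξ]

namespace MultiPatch

variable {ι : Type*} {M : ControlGrid ι} {P : MultiPatch M}

variable (P) in
/-- A set of points of the cube on which each coordinate avoids the knots of patch `i` or is
constant. -/
structure Slice (i : ι) (X : Set E3) : Prop where
  subset : X ⊆ closedCube
  avoids : ∀ e, (∀ ξ ∈ X, ξ e ∈ P.gen i e) ∨ ∃ t, ∀ ξ ∈ X, ξ e = t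

theorem slice_genericCube (i : ι) : P.Slice i (P.genericCube i) :=
  ⟨P.genericCube_subset i, fun e => Or.inl fun _ h => h e⟩

theorem slice_sideGen (i : ι) (e : Fin 3) (s : Bool) : P.Slice i (P.sideGen i e s) :=
  ⟨fun _ h => (P.sideGen_subset i e s h).1, fun f => by
    by_cases hf : f = e
    · exact Or.inr ⟨sideVal s, fun ξ h => by rw [hf, h.1]⟩
    · exact Or.inl fun ξ h => h.2 f hf⟩

variable (hP : P.IsConforming)
include hP

theorem continuousOn_field {i : ι} {X : Set E3} (hX : P.Slice i X) (D : Finset (Fin 3))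
    (c : M.Idx i D → ℝ) : ContinuousOn (P.field i D c) X := by
  refine continuousOn_finsetSum _ fun a _ => continuousOn_const.mul ?_
  rw [show P.basisFun i D a = tens (P.uni i D) (fun e => a e) from funext (P.basisFun_eq_tens i D a)]
  refine continuousOn_tens fun e => (hX.avoids e).imp_left fun h ξ hξ => ?_
  have hk := (hP.knots i e)
  have ha := idx_lt a e
  rw [uni]
  split_ifs
  · exact hk.continuousAt_curryBspline hP.degree_pos (h ξ hξ) ha
  · exact (hk.contDiffAt_bspline (h ξ hξ) (by omega)).continuousAt

theorem continuousOn_sum_duni {i : ι} {X : Set E3} (hX : P.Slice i X) (S : Finset (Fin 3))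
    (γ : M.Idx i ∅ → ℝ) :
    ContinuousOn (fun ξ => ∑ a, γ a * tens (P.duni i S) (fun e => a e) ξ) X := by
  refine continuousOn_finsetSum _ fun a _ => continuousOn_const.mul ?_
  refine continuousOn_tens fun e => (hX.avoids e).imp_left fun h ξ hξ => ?_
  have hk := (hP.knots i e)
  have ha := idx_lt a e
  rw [duni]
  split_ifs
  · exact hk.continuousAt_bsplineDeriv hP.degree_pos (h ξ hξ) ha
  · exact (hk.contDiffAt_bspline (h ξ hξ) (by omega)).continuousAt

theorem continuousOn_pd {i : ι} {X : Set E3} (hX : P.Slice i X) (f : Fin 3) :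
    ContinuousOn (P.pd i f) X := by
  refine (PiLp.continuous_toLp 2 _).comp_continuousOn (continuousOn_pi.2 fun b => ?_)
  have hW := fun S => continuousOn_sum_duni hP hX S fun a => P.weight i (fun e => a e)
  have hN := fun S => continuousOn_sum_duni hP hX S fun a =>
    P.weight i (fun e => a e) * P.ctrl i (fun e => a e) b
  have hi : ContinuousOn (fun ξ => (P.weightSum i ∅ ξ)⁻¹) X :=
    (hW ∅).inv₀ fun ξ hξ => (weightSum_pos hP i (hX.subset hξ)).ne'
  exact (hi.mul (hN {f})).sub (((hW {f}).mul (hi.mul hi)).mul (hN ∅))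

theorem continuousOn_normal {i : ι} {X : Set E3} (hX : P.Slice i X) (e : Fin 3) :
    ContinuousOn (P.normal i e) X := by
  refine (PiLp.continuous_toLp 2 _).comp_continuousOn (continuousOn_pi.2 fun b => ?_)
  have h := fun f b => (EuclideanSpace.proj (𝕜 := ℝ) (b : Fin 3)).continuous.comp_continuousOn
    (continuousOn_pd hP hX f)
  fin_cases b
  all_goals exact ((h _ _).mul (h _ _)).sub ((h _ _).mul (h _ _))

theorem measurable_param (i : ι) : Measurable (P.param i) :=
  (PiLp.continuous_toLp 2 _).measurable.comp
    (measurable_pi_lambda _ fun b => (lineDiff_param hP i 0 b).meas)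

theorem isClosed_side (b : ι × Fin 3 × Bool) : IsClosed (P.side b) := by
  have h : cubeFace (sideOf b.2.1 b.2.2) = closedCube ∩ {ξ | ξ b.2.1 = sideVal b.2.2} :=
    Set.ext fun ξ => mem_cubeFace_sideOf
  refine IsCompact.isClosed (IsCompact.image_of_continuousOn ?_
    ((continuousOn_param hP b.1).mono fun ξ h => h.1))
  rw [h]
  exact isCompact_closedCube.inter_right (isClosed_eq (by fun_prop) continuous_const)

omit hP in
variable (P) in
/-- The flux through one side of a patch. -/
def sideFlux (T : ι → Fin 3 → E3 → ℝ) (b : ι × Fin 3 × Bool) : ℝ :=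
  -(inward b.2.2 * P.orient b.1) * ∫ ξ in closedCube, T b.1 b.2.1 (upd ξ b.2.1 (sideVal b.2.2))

omit hP in
theorem flux_eq_sum [Fintype ι] (T : ι → Fin 3 → E3 → ℝ) :
    P.flux T = ∑ b, P.sideFlux T b := by
  simp only [flux, sideFlux, Fintype.sum_prod_type]

omit hP in
/-- Almost every point of a side is generic. -/
theorem ae_upd_mem_sideGen (i : ι) (e : Fin 3) (s : Bool) :
    ∀ᵐ ξ ∂(volume.restrict closedCube), upd ξ e (sideVal s) ∈ P.sideGen i e s := by
  rw [ae_restrict_iff' measurableSet_closedCube]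
  filter_upwards [P.genericCube_ae_eq i] with ξ h hξ
  exact P.upd_mem_sideGen s fun f _ => h.mpr hξ f

theorem sideFlux_glue {i j : ι} {e : Fin 3} {s : Bool} {g : Gluing} (hg : M.glue i j = some g)
    (hf : g.face = sideOf e s) (T : ι → Fin 3 → E3 → ℝ) :
    P.sideFlux T (j, g.perm e, xor s (g.flip e)) = (inward s * P.orient i) *
      ∫ ξ in closedCube, g.normSign e * T j (g.perm e) (g.act (upd ξ e (sideVal s))) := by
  rw [sideFlux, inward_mul_orient hP hg hf, integral_const_mul]
  simp only [g.act_upd_side]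
  rw [g.integral_act fun ξ => T j (g.perm e) (upd ξ (g.perm e) (sideVal (xor s (g.flip e))))]
  ring

omit hP in
theorem exists_sidePair {b : ι × Fin 3 × Bool} (h : ¬ M.IsBoundarySide b) :
    ∃ b' g, M.SidePair g b b' := by
  simp only [ControlGrid.IsBoundarySide, not_forall, not_not] at h
  obtain ⟨j, g, h1, h2⟩ := h
  exact ⟨(j, g.perm b.2.1, xor b.2.2 (g.flip b.2.1)), g, h1, h2, rfl, rfl⟩

/-- The fluxes of a field with matching traces cancel at the interfaces. -/
theorem flux_eq_zero [Fintype ι] {T : ι → Fin 3 → E3 → ℝ}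
    (h : ∀ i e s j g, M.glue i j = some g → g.face = sideOf e s → ∀ ξ ∈ P.sideGen i e s,
      T j (g.perm e) (g.act ξ) = g.normSign e * T i e ξ)
    (hb : ∀ i e s, M.IsBoundarySide (i, e, s) → ∀ ξ ∈ P.sideGen i e s, T i e ξ = 0) :
    P.flux T = 0 := by
  classical
  have h0 : ∀ b, M.IsBoundarySide b → P.sideFlux T b = 0 := fun ⟨i, e, s⟩ hbs => by
    rw [sideFlux, integral_eq_zero_of_ae, mul_zero]
    filter_upwards [P.ae_upd_mem_sideGen i e s] with ξ hξ
    exact hb i e s hbs _ hξ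
  have h1 : ∀ {g b b'}, M.SidePair g b b' → P.sideFlux T b + P.sideFlux T b' = 0 := by
    rintro g ⟨i, e, s⟩ ⟨j, e', s'⟩ ⟨hg, hf, he, hs⟩
    dsimp only at hg hf he hs
    subst he hs
    rw [sideFlux_glue hP hg hf, sideFlux, integral_congr_ae (f := fun ξ => g.normSign e *
      T j (g.perm e) (g.act (upd ξ e (sideVal s)))) (g := fun ξ => T i e (upd ξ e (sideVal s)))]
    · ring
    · filter_upwards [P.ae_upd_mem_sideGen i e s] with ξ hξ
      rw [h i e s j g hg hf _ hξ, ← mul_assoc, g.normSign_mul_self, one_mul]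
  rw [flux_eq_sum]
  let σ : ι × Fin 3 × Bool → ι × Fin 3 × Bool := fun b =>
    if h : ∃ b' g, M.SidePair g b b' then h.choose else b
  have hσ : ∀ {g b b'}, M.SidePair g b b' → σ b = b' := fun {g b b'} hp => by
    have hex : ∃ b' g, M.SidePair g b b' := ⟨b', g, hp⟩
    simp only [σ, dif_pos hex]
    obtain ⟨g', hg'⟩ := hex.choose_spec
    exact SidePair.unique hP hg' hp
  refine Finset.sum_involution (fun b _ => σ b) (fun b _ => ?_) (fun b _ hne => ?_)
    (fun _ _ => Finset.mem_univ _) (fun b _ => ?_)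
  · by_cases hbs : M.IsBoundarySide b
    · have : σ b = b := dif_neg fun ⟨b', g, hp⟩ => hbs _ _ hp.1 hp.2.1
      rw [this, h0 b hbs, add_zero]
    · obtain ⟨b', g, hp⟩ := exists_sidePair hbs
      rw [hσ hp, h1 hp]
  · have hbs : ¬ M.IsBoundarySide b := fun hbs => hne (h0 b hbs)
    obtain ⟨b', g, hp⟩ := exists_sidePair hbs
    rw [hσ hp]
    exact fun hh => SidePair.ne hP hp (by rw [hh])
  · by_cases hbs : M.IsBoundarySide b
    · have : σ b = b := dif_neg fun ⟨b', g, hp⟩ => hbs _ _ hp.1 hp.2.1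
      rw [this, this]
    · obtain ⟨b', g, hp⟩ := exists_sidePair hbs
      obtain ⟨g', hp'⟩ := SidePair.symm hP hp
      rw [hσ hp, hσ hp']

/-! ### Traces of fields with weak derivatives -/

omit hP in
/-- The integral over a side of a nonnegative function that is positive near some point. -/
theorem side_integral_pos {i : ι} {e : Fin 3} {s : Bool} {k : E3 → ℝ} {ξ : E3}
    (hk : IntegrableOn (fun ξ => k (upd ξ e (sideVal s))) closedCube)
    (h0 : ∀ η ∈ P.sideGen i e s, 0 ≤ k η) (hξ : ξ ∈ P.sideGen i e s)
    (hpos : ∀ᶠ η in nhds ξ, η ∈ P.sideGen i e s → 0 < k η) :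
    0 < ∫ ξ in closedCube, k (upd ξ e (sideVal s)) := by
  rw [integral_pos_iff_support_of_nonneg_ae ?_ hk]
  · -- the fibre over a neighbourhood of the point contains an open set
    have hmem : upd ξ e (1 / 2) ∈ {η | (∀ f, f ≠ e → η f ∈ P.gen i f) ∧ η e ∈ Ioo (0 : ℝ) 1} :=
      ⟨fun f hf => by rw [upd_ne _ hf]; exact hξ.2 f hf, by rw [upd_same]; norm_num⟩
    have hopen : IsOpen {η : E3 | (∀ f, f ≠ e → η f ∈ P.gen i f) ∧ η e ∈ Ioo (0 : ℝ) 1} := by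
      have : {η : E3 | (∀ f, f ≠ e → η f ∈ P.gen i f) ∧ η e ∈ Ioo (0 : ℝ) 1} =
          (⋂ f, ⋂ _ : f ≠ e, (fun η : E3 => η f) ⁻¹' P.gen i f) ∩
            (fun η : E3 => η e) ⁻¹' Ioo 0 1 := by
        ext η; simp
      rw [this]
      refine IsOpen.inter (isOpen_iInter_of_finite fun f => isOpen_iInter_of_finite fun _ =>
        IsOpen.preimage (by fun_prop) IsOpenKnotVector.genericSet_isOpen)
        (isOpen_Ioo.preimage (by fun_prop))
    have hlim : Filter.Tendsto (fun η => upd η e (sideVal s)) (nhds (upd ξ e (1 / 2))) (nhds ξ) := by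
      have h := (continuous_upd_left e (sideVal s)).tendsto (upd ξ e (1 / 2))
      rw [upd_upd, ← hξ.1, upd_eq_self] at h
      rw [← hξ.1]
      exact h
    have hnb := Filter.inter_mem (hlim.eventually hpos) (hopen.mem_nhds hmem)
    refine (Measure.measure_pos_of_mem_nhds volume hnb).trans_le ?_
    rw [Measure.restrict_apply' measurableSet_closedCube]
    refine measure_mono ?_
    rintro η ⟨h1, h2, h3⟩
    refine ⟨(h1 (P.upd_mem_sideGen s h2)).ne', fun f => ?_⟩
    by_cases hf : f = e
    · rw [hf]; exact ⟨h3.1.le, h3.2.le⟩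
    · exact ⟨(h2 f hf).1.1.le, (h2 f hf).1.2.le⟩
  · filter_upwards [P.ae_upd_mem_sideGen i e s] with η hη
    exact h0 _ hη

section

variable {V : Type*} [NormedAddCommGroup V] [InnerProductSpace ℝ V] [MeasurableSpace V]
  [BorelSpace V] [SecondCountableTopology V]

omit hP in
variable (P V) in
/-- A family of vector fields on the patches whose fluxes are the boundary terms of Green's
formulas. -/
structure TraceField (W : ι → Fin 3 → E3 → V) : Prop where
  meas : ∀ i e, Measurable (W i e)
  bdd : ∀ i e, ∃ C, ∀ ξ ∈ closedCube, ‖W i e ξ‖ ≤ C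
  cont : ∀ i e s, ContinuousOn (W i e) (P.sideGen i e s)

/-- A continuous field on a side vanishes if its moments with all localized test functions do. -/
theorem eq_zero_of_moments [Finite ι] {i : ι} {e : Fin 3} {s : Bool} {Y : E3 → V} {ξ : E3}
    (hξ : ξ ∈ P.sideGen i e s) (hm : Measurable Y) (hbd : ∃ C, ∀ ξ ∈ closedCube, ‖Y ξ‖ ≤ C)
    (hc : ContinuousOn Y (P.sideGen i e s)) {Γ : Set E3}
    (hΓ : ∀ᶠ y in nhds (P.param i ξ), y ∉ Γ) {B : Set (ι × Fin 3 × Bool)}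
    (hB : ∀ b, P.param i ξ ∈ P.side b → b ∈ B)
    (h : ∀ (χ : E3 → ℝ) (v : V), IsTest Γ (fun x => χ x • v) → (∀ b ∉ B, ∀ x ∈ P.side b, χ x = 0) →
      ∫ ξ in closedCube, χ (P.param i (upd ξ e (sideVal s))) * ⟪Y (upd ξ e (sideVal s)), v⟫_ℝ = 0) :
    Y ξ = 0 := by
  by_contra hne
  have hmem := (P.sideGen_subset i e s hξ).1
  have hpos : ∀ᶠ η in nhdsWithin ξ (P.sideGen i e s), 0 < ⟪Y η, Y ξ⟫_ℝ := by
    have h1 : ContinuousWithinAt (fun η => ⟪Y η, Y ξ⟫_ℝ) (P.sideGen i e s) ξ :=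
      (hc ξ hξ).inner continuousWithinAt_const
    exact h1.eventually_const_lt (real_inner_self_pos.2 hne)
  rw [eventually_nhdsWithin_iff] at hpos
  have hside : ∀ᶠ y in nhds (P.param i ξ), ∀ b ∉ B, y ∉ P.side b := by
    refine Filter.eventually_all.2 fun b => ?_
    by_cases hb : b ∈ B
    · exact Filter.Eventually.of_forall fun y h => absurd hb h
    · filter_upwards [(isClosed_side hP b).isOpen_compl.mem_nhds fun hx => hb (hB b hx)] with y hy _
      exact hy
  obtain ⟨χ, hχ1, hχ2, hχ3, hχ4, hχ5⟩ := exists_contDiff_tsupport_subset (n := ⊤)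
    (hΓ.and ((eventually_param_near hP i hmem hpos).and hside))
  have hχ0 : ∀ x, χ x ≠ 0 → _ := fun x hx => hχ1 (subset_tsupport _ hx)
  have hint : ∀ v : V, IntegrableOn (fun ξ => χ (P.param i (upd ξ e (sideVal s))) *
      ⟪Y (upd ξ e (sideVal s)), v⟫_ℝ) closedCube := fun v => by
    obtain ⟨C, hC⟩ := hbd
    have hu := (continuous_upd_left e (sideVal s)).measurable
    refine integrableOn_closedCube_of_bounded (((hχ3.continuous.measurable.comp
      (measurable_param hP i)).comp hu).mul ((hm.comp hu).inner_const)).aestronglyMeasurable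
      (C * ‖v‖) fun η hη => ?_
    have h1 : χ (P.param i (upd η e (sideVal s))) ∈ Icc (0 : ℝ) 1 := hχ4 ⟨_, rfl⟩
    have h2 := hC _ (upd_mem_closedCube hη (e := e) (sideVal_mem s))
    have h3 := abs_real_inner_le_norm (Y (upd η e (sideVal s))) v
    have h4 := mul_le_mul_of_nonneg_right h2 (norm_nonneg v)
    rw [Real.norm_eq_abs, abs_mul, abs_of_nonneg h1.1]
    calc _ ≤ 1 * |⟪Y (upd η e (sideVal s)), v⟫_ℝ| :=
          mul_le_mul_of_nonneg_right h1.2 (abs_nonneg _)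
      _ ≤ _ := by linarith
  have key := side_integral_pos (P := P) (i := i) (e := e) (s := s)
    (k := fun η => χ (P.param i η) * ⟪Y η, Y ξ⟫_ℝ) (hint (Y ξ)) (fun η hη => ?_) hξ ?_
  · refine key.ne' (h χ (Y ξ) ⟨?_, ?_, ?_⟩ fun b hb x hx => ?_)
    · exact (hχ3.smul contDiff_const)
    · exact hχ2.smul_right
    · refine Set.disjoint_left.2 fun x hx => (hχ1 (tsupport_smul_subset_left _ _ hx)).1
    · by_contra hx'
      exact (hχ0 x hx').2.2 b hb hx
  · have h1 : χ (P.param i η) ∈ Icc (0 : ℝ) 1 := hχ4 ⟨_, rfl⟩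
    by_cases h2 : χ (P.param i η) = 0
    · simp [h2]
    · exact mul_nonneg h1.1
        ((hχ0 _ h2).2.1 η (P.sideGen_subset i e s hη).1 rfl hη).le
  · have h1 : ContinuousWithinAt (fun η => χ (P.param i η)) closedCube ξ :=
      hχ3.continuous.continuousAt.comp_continuousWithinAt (continuousOn_param hP i ξ hmem)
    have h2 : ∀ᶠ η in nhdsWithin ξ closedCube, 0 < χ (P.param i η) :=
      h1.eventually_const_lt (show 0 < χ (P.param i ξ) by rw [hχ5]; exact one_pos)
    filter_upwards [hpos, eventually_nhdsWithin_iff.1 h2] with η h3 h4 hη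
    exact mul_pos (h4 (P.sideGen_subset i e s hη).1) (h3 hη)

omit hP [MeasurableSpace V] [BorelSpace V] [SecondCountableTopology V] in
theorem integrable_inner {Ω Γ : Set E3} (w : Lp V 2 (volume.restrict Ω)) {φ : E3 → V}
    (hφ : IsTest Γ φ) : Integrable (fun x => ⟪w x, φ x⟫_ℝ) (volume.restrict Ω) := by
  refine (L2.integrable_inner (𝕜 := ℝ) w (hφ.memLp.toLp φ)).congr ?_
  filter_upwards [hφ.memLp.coeFn_toLp] with x hx
  rw [hx]

omit [MeasurableSpace V] [BorelSpace V] [SecondCountableTopology V] in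
/-- A flux that is given by a square-integrable field vanishes: the test functions can be cut off
outside of small neighbourhoods of the sides. -/
theorem flux_eq_zero_of_integral [Fintype ι] {Γ : Set E3} {W : ι → Fin 3 → E3 → V}
    {w : Lp V 2 (volume.restrict P.domain)}
    (h : ∀ φ : E3 → V, IsTest Γ φ → P.flux (fun i e ξ => ⟪W i e ξ, φ (P.param i ξ)⟫_ℝ) =
      ∫ x in P.domain, ⟪w x, φ x⟫_ℝ) {φ : E3 → V} (hφ : IsTest Γ φ) :
    P.flux (fun i e ξ => ⟪W i e ξ, φ (P.param i ξ)⟫_ℝ) = 0 := by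
  obtain ⟨f, hf1, hf2, hf3⟩ := (isClosed_iUnion_of_finite (isClosed_side hP)).isOpen_compl.exists_contDiff_support_eq
    (n := ⊤)
  have hf4 : ∀ x, f x ∈ Icc (0 : ℝ) 1 := fun x => hf3 ⟨x, rfl⟩
  have hψ : ∀ n : ℕ, IsTest Γ fun x => (1 - f x) ^ n • φ x := fun n =>
    ⟨((contDiff_const.sub hf2).pow n).smul hφ.smooth, hφ.compact.smul_left,
      hφ.avoids.mono_left (tsupport_smul_subset_right _ _)⟩
  have h1 : ∀ n : ℕ, ∫ x in P.domain, ⟪w x, (1 - f x) ^ n • φ x⟫_ℝ =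
      P.flux (fun i e ξ => ⟪W i e ξ, φ (P.param i ξ)⟫_ℝ) := fun n => by
    rw [← h _ (hψ n), flux_eq_sum, flux_eq_sum]
    refine Finset.sum_congr rfl fun b _ => ?_
    rw [sideFlux, sideFlux]
    congr 1
    refine setIntegral_congr_fun measurableSet_closedCube fun ξ hξ => ?_
    have hx : P.param b.1 (upd ξ b.2.1 (sideVal b.2.2)) ∉ f.support := by
      rw [hf1, mem_compl_iff, not_not]
      exact mem_iUnion.2 ⟨b, _, mem_cubeFace_sideOf.2
        ⟨upd_mem_closedCube hξ (sideVal_mem _), upd_same _ _ _⟩, rfl⟩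
    rw [Function.mem_support, not_not] at hx
    simp only [hx, sub_zero, one_pow, one_smul]
  have h2 : Filter.Tendsto (fun n : ℕ => ∫ x in P.domain, ⟪w x, (1 - f x) ^ n • φ x⟫_ℝ)
      Filter.atTop (nhds (∫ x in P.domain, (0 : ℝ))) := by
    refine tendsto_integral_of_dominated_convergence (fun x => ‖⟪w x, φ x⟫_ℝ‖)
      (fun n => (integrable_inner w (hψ n)).aestronglyMeasurable)
      (integrable_inner w hφ).norm (fun n => Filter.Eventually.of_forall fun x => ?_) ?_
    · have h3 := hf4 x
      rw [inner_smul_right, norm_mul, norm_pow, Real.norm_eq_abs (1 - f x),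
        abs_of_nonneg (by linarith [h3.2])]
      exact mul_le_of_le_one_left (norm_nonneg _)
        (pow_le_one₀ (by linarith [h3.2]) (by linarith [h3.1]))
    · filter_upwards [ae_generic hP] with x hx
      have hx' : x ∈ f.support := by
        rw [hf1, mem_compl_iff, mem_iUnion]
        rintro ⟨⟨i, e, s⟩, ξ, hξ, hxξ⟩
        have h3 := (hx.2 i ξ hξ.1 hxξ e).1
        rw [(mem_cubeFace_sideOf.1 hξ).2] at h3
        cases s <;> simp [sideVal] at h3
      have h3 : 0 < f x := (hf4 x).1.lt_of_ne' hx'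
      have h4 := (tendsto_pow_atTop_nhds_zero_of_lt_one (r := 1 - f x)
        (by linarith [(hf4 x).2]) (by linarith)).mul_const ⟪w x, φ x⟫_ℝ
      simpa only [inner_smul_right, zero_mul] using h4
  rw [integral_zero] at h2
  exact tendsto_nhds_unique (tendsto_const_nhds.congr fun n => (h1 n).symm) h2

end

end MultiPatch
end

noncomputable section

namespace MultiPatch

variable {ι : Type*} {M : ControlGrid ι} {P : MultiPatch M} (hP : P.IsConforming)

section

variable {V : Type*} [NormedAddCommGroup V] [InnerProductSpace ℝ V] [MeasurableSpace V]
  [BorelSpace V] [SecondCountableTopology V] [Fintype ι] {W : ι → Fin 3 → E3 → V}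
  (hW : P.TraceField V W) (S : Set (ι × Fin 3 × Bool))

variable (P) in
/-- The traces of a field agree at the interfaces and vanish on the sides in `S`. -/
def TracesMatch (S : Set (ι × Fin 3 × Bool)) (W : ι → Fin 3 → E3 → V) : Prop :=
  (∀ i e s j g, M.glue i j = some g → g.face = sideOf e s → ∀ ξ ∈ P.sideGen i e s,
    W j (g.perm e) (g.act ξ) = g.normSign e • W i e ξ) ∧
  ∀ i e s, (i, e, s) ∈ S → ∀ ξ ∈ P.sideGen i e s, W i e ξ = 0

include hP

omit [MeasurableSpace V] [BorelSpace V] [SecondCountableTopology V] in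
theorem TracesMatch.flux_eq_zero {S} (h : P.TracesMatch S W) {φ : E3 → V}
    (hφ : IsTest (frontier P.domain \ P.dirichletPart S) φ) :
    P.flux (fun i e ξ => ⟪W i e ξ, φ (P.param i ξ)⟫_ℝ) = 0 := by
  refine MultiPatch.flux_eq_zero hP (fun i e s j g hg hf ξ hξ => ?_) fun i e s hb ξ hξ => ?_
  · rw [h.1 i e s j g hg hf ξ hξ, param_act hP hg (hf ▸ P.sideGen_subset i e s hξ),
      real_inner_smul_left]
  · by_cases hs : (i, e, s) ∈ S
    · rw [h.2 i e s hs ξ hξ, inner_zero_left]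
    · by_cases hD : P.param i ξ ∈ P.dirichletPart S
      · -- a generic point of a boundary side lies in no other side
        obtain ⟨b, hb', hx⟩ := mem_iUnion₂.1 hD
        rcases side_of_mem hP hξ (b := b) hx with rfl | ⟨g, hg⟩
        · exact absurd hb' hs
        · exact absurd hg.2.1 (hb _ _ hg.1)
      · rw [image_eq_zero_of_notMem_tsupport fun hx => Set.disjoint_left.1 hφ.avoids hx
          ⟨boundary_mem_frontier hP hb hξ, hD⟩, inner_zero_right]

include hW

omit [Fintype ι] in
theorem TraceField.integrableOn {χ : E3 → ℝ} {v : V} (hχ : ContDiff ℝ ∞ fun x => χ x • v)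
    (hc : HasCompactSupport fun x => χ x • v) (j : ι) (e' : Fin 3) (a : E3 → E3)
    (ha : Measurable a) (ha' : ∀ ξ ∈ closedCube, a ξ ∈ closedCube) (k : E3 → ℝ)
    (hk : ∀ ξ ∈ closedCube, k ξ = ⟪W j e' (a ξ), χ (P.param j (a ξ)) • v⟫_ℝ) :
    IntegrableOn k closedCube := by
  obtain ⟨C, hC⟩ := hW.bdd j e'
  obtain ⟨C', hC'⟩ := hχ.continuous.norm.bddAbove_range_of_hasCompactSupport hc.norm
  refine IntegrableOn.congr_fun (f := fun ξ => ⟪W j e' (a ξ), χ (P.param j (a ξ)) • v⟫_ℝ) ?_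
    (fun ξ hξ => (hk ξ hξ).symm) measurableSet_closedCube
  refine integrableOn_closedCube_of_bounded (((hW.meas j e').comp ha).inner
    (hχ.continuous.measurable.comp ((measurable_param hP j).comp ha))).aestronglyMeasurable
    (C * C') fun ξ hξ => ?_
  rw [Real.norm_eq_abs]
  have h1 := hC _ (ha' ξ hξ)
  exact (abs_real_inner_le_norm _ _).trans (mul_le_mul h1 (hC' ⟨_, rfl⟩) (norm_nonneg _)
    ((norm_nonneg _).trans h1))

/-- If the boundary terms of Green's formula vanish for all test functions, the traces match. -/
theorem tracesMatch_of_flux (hS : ∀ b ∈ S, M.IsBoundarySide b)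
    (h : ∀ φ : E3 → V, IsTest (frontier P.domain \ P.dirichletPart S) φ →
      P.flux (fun i e ξ => ⟪W i e ξ, φ (P.param i ξ)⟫_ℝ) = 0) : P.TracesMatch S W := by
  classical
  have hzero : ∀ {χ : E3 → ℝ} {v : V} {b}, (∀ x ∈ P.side b, χ x = 0) →
      P.sideFlux (fun i e ξ => ⟪W i e ξ, χ (P.param i ξ) • v⟫_ℝ) b = 0 := fun {χ v b} hχ => by
    rw [sideFlux, setIntegral_eq_zero_of_forall_eq_zero, mul_zero]
    intro ξ hξ
    rw [hχ _ ⟨_, mem_cubeFace_sideOf.2 ⟨upd_mem_closedCube hξ (sideVal_mem _), upd_same _ _ _⟩,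
      rfl⟩, zero_smul, inner_zero_right]
  have hc : ∀ i s, inward s * P.orient i ≠ 0 := fun i s h0 => by
    have h1 := P.orient_mul_self i
    have h2 := inward_mul_self s
    have : (inward s * inward s) * (P.orient i * P.orient i) = 0 := by
      linear_combination (inward s * P.orient i) * h0
    rw [h1, h2] at this
    norm_num at this
  refine ⟨fun i e s j g hg hf ξ hξ => ?_, fun i e s hs ξ hξ => ?_⟩
  · have hx : P.param i ξ ∈ P.domain := interface_mem_domain hP hg hf hξ
    have hact := fun η hη => act_mem_sideGen hP hg hf (ξ := η) hη
    have hpair : M.SidePair g (i, e, s) (j, g.perm e, xor s (g.flip e)) := ⟨hg, hf, rfl, rfl⟩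
    suffices h0 : g.normSign e • W j (g.perm e) (g.act ξ) - W i e ξ = 0 by
      rw [← sub_eq_zero.1 h0, smul_smul, g.normSign_mul_self, one_smul]
    refine eq_zero_of_moments hP (s := s) (Γ := frontier P.domain \ P.dirichletPart S)
      (Y := fun ξ => g.normSign e • W j (g.perm e) (g.act ξ) - W i e ξ)
      (B := {(i, e, s), (j, g.perm e, xor s (g.flip e))}) hξ
      ((((hW.meas j _).comp g.continuous_act.measurable).const_smul _).sub (hW.meas i e)) ?_ ?_ ?_
      (fun b hb => ?_) fun χ v hχ hB => ?_
    · obtain ⟨C, hC⟩ := hW.bdd i e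
      obtain ⟨C', hC'⟩ := hW.bdd j (g.perm e)
      refine ⟨‖g.normSign e‖ * C' + C, fun η hη => (norm_sub_le _ _).trans
        (add_le_add ?_ (hC η hη))⟩
      rw [norm_smul]
      exact mul_le_mul_of_nonneg_left (hC' _ (g.act_mem_closedCube.2 hη)) (norm_nonneg _)
    · exact (((hW.cont j _ _).comp g.continuous_act.continuousOn hact).const_smul _).sub
        (hW.cont i e s)
    · filter_upwards [isOpen_domain.mem_nhds hx] with y hy hyΓ
      exact (isOpen_domain.frontier_eq ▸ hyΓ.1).2 hy
    · rcases side_of_mem hP hξ hb with rfl | ⟨g', hg'⟩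
      · exact Or.inl rfl
      · exact Or.inr (SidePair.unique hP hg' hpair)
    · have h1 := h _ hχ
      rw [flux_eq_sum, ← Finset.sum_subset (Finset.subset_univ
        {(i, e, s), (j, g.perm e, xor s (g.flip e))}) fun b _ hb => hzero (hB b fun hb' => hb (by
          simpa using hb')), Finset.sum_pair (fun h => SidePair.ne hP hpair (by rw [h]; )),
        sideFlux_glue hP hg hf, sideFlux, neg_mul, neg_add_eq_sub, ← mul_sub,
        ← integral_sub] at h1
      · rw [← (mul_eq_zero.1 h1).resolve_left (hc i s)]
        refine setIntegral_congr_fun measurableSet_closedCube fun η hη => ?_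
        have hη' : upd η e (sideVal s) ∈ cubeFace g.face := hf ▸ mem_cubeFace_sideOf.2
          ⟨upd_mem_closedCube hη (sideVal_mem s), upd_same _ _ _⟩
        simp only [param_act hP hg hη', inner_sub_left, real_inner_smul_left,
          real_inner_smul_right]
        ring
      · refine Integrable.const_mul ?_ _
        exact hW.integrableOn hP hχ.smooth hχ.compact j (g.perm e)
          (fun ξ => g.act (upd ξ e (sideVal s)))
          (g.continuous_act.comp (continuous_upd_left e _)).measurable (fun η hη =>
            g.act_mem_closedCube.2 (upd_mem_closedCube hη (sideVal_mem s))) _ fun _ _ => rfl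
      · exact hW.integrableOn hP hχ.smooth hχ.compact i e
          (fun ξ => upd ξ e (sideVal s)) (continuous_upd_left e _).measurable (fun η hη =>
            upd_mem_closedCube hη (sideVal_mem s)) _ fun _ _ => rfl
  · have hb := hS _ hs
    have hB : ∀ b, P.param i ξ ∈ P.side b → b = (i, e, s) := fun b hb' => by
      rcases side_of_mem hP hξ hb' with rfl | ⟨g', hg'⟩
      · rfl
      · exact absurd hg'.2.1 (hb _ _ hg'.1)
    refine eq_zero_of_moments hP (s := s) (Γ := frontier P.domain \ P.dirichletPart S)
      (Y := W i e) (B := {(i, e, s)}) hξ (hW.meas i e) (hW.bdd i e) (hW.cont i e s) ?_ hB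
      fun χ v hχ hB => ?_
    · filter_upwards [frontier_subset_side hP hb hξ] with y hy hyΓ
      exact hyΓ.2 (mem_iUnion₂.2 ⟨_, hs, hy hyΓ.1⟩)
    · have h1 := h _ hχ
      rw [flux_eq_sum, Finset.sum_eq_single (i, e, s) (fun b _ hb' => hzero (hB b hb'))
        (fun h => absurd (Finset.mem_univ _) h), sideFlux, neg_mul, neg_eq_zero] at h1
      rw [← (mul_eq_zero.1 h1).resolve_left (hc i s)]
      simp only [real_inner_smul_right]

end

/-! ### Matching of traces and matching of coefficients -/

include hP

theorem field_act_iff {i j : ι} {g : Gluing} (hg : M.glue i j = some g) {e : Fin 3} {s : Bool}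
    (hf : g.face = sideOf e s) {D D' : Finset (Fin 3)} (he : e ∉ D) (hD : D' = D.image g.perm)
    {c : M.Idx i D → ℝ} {c' : M.Idx j D' → ℝ} {r : ℝ} :
    (∀ ξ ∈ P.sideGen i e s, P.field j D' c' (g.act ξ) = r * P.field i D c ξ) ↔
      ∀ a b, ControlGrid.Matches g a b → c' b = r * c a := by
  constructor
  · intro h a b hab
    refine coeff_of_field_act hP hg hD (fun f t hft => ?_) (fun ξ h1 h2 => h ξ ⟨?_, ?_⟩) hab
    · rw [hf, sideOf_eq_some] at hft
      rwa [hft.1]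
    · exact h1 e s (by rw [hf, sideOf_eq_some]; exact ⟨rfl, rfl⟩)
    · exact fun f hfe => h2 f (by rw [hf, sideOf_eq_none]; exact hfe)
  · intro h ξ hξ
    refine field_act hP hg hD h (fun f t hft => ?_) fun f hft => Or.inl (hξ.2 f ?_)
    · rw [hf, sideOf_eq_some] at hft
      rw [hft.1, hft.2]
      exact ⟨hξ.1, he⟩
    · rwa [hf, sideOf_eq_none] at hft

/-- A spline vanishes on a side if and only if its coefficients there vanish. -/
theorem field_eq_zero_iff {i : ι} {e : Fin 3} {s : Bool} {D : Finset (Fin 3)} (he : e ∉ D)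
    {c : M.Idx i D → ℝ} :
    (∀ ξ ∈ P.sideGen i e s, P.field i D c ξ = 0) ↔ ∀ a, ControlGrid.OnSide a e s → c a = 0 := by
  constructor
  · intro h a ha
    refine coeff_eq_zero hP i (sideOf e s) (fun f t hft => ?_) c (fun ξ h1 h2 => h ξ ⟨?_, ?_⟩) a
      fun f t hft => ?_
    · rw [sideOf_eq_some] at hft
      rwa [hft.1]
    · exact h1 e s (by rw [sideOf_eq_some]; exact ⟨rfl, rfl⟩)
    · exact fun f hfe => h2 f (by rw [sideOf_eq_none]; exact hfe)
    · rw [sideOf_eq_some] at hft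
      rwa [hft.1, hft.2]
  · intro h ξ hξ
    refine Finset.sum_eq_zero fun a _ => ?_
    by_cases ha : ControlGrid.OnSide a e s
    · rw [h a ha, zero_mul]
    · rw [basisFun_eq_zero hP he ha hξ.1, mul_zero]

end MultiPatch
end

noncomputable section

/-! ### Bounded measurable fields on the cube -/

section

variable {V : Type*} [NormedAddCommGroup V] [NormedSpace ℝ V] [MeasurableSpace V]

/-- `F` is measurable, and bounded on `X`. -/
structure BddMeas (X : Set E3) (F : E3 → V) : Prop where
  meas : Measurable F
  bdd : ∃ C, ∀ ξ ∈ X, ‖F ξ‖ ≤ C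

variable [BorelSpace V] [SecondCountableTopology V] {X : Set E3} {F G : E3 → V} {h : E3 → ℝ}

omit [NormedSpace ℝ V] [BorelSpace V] [SecondCountableTopology V] in
theorem BddMeas.mono (H : BddMeas X F) {Y : Set E3} (hY : Y ⊆ X) : BddMeas Y F :=
  ⟨H.meas, let ⟨C, hC⟩ := H.bdd; ⟨C, fun ξ hξ => hC ξ (hY hξ)⟩⟩

omit [SecondCountableTopology V] in
theorem BddMeas.smul (H : BddMeas X h) (K : BddMeas X F) : BddMeas X fun ξ => h ξ • F ξ := by
  obtain ⟨C, hC⟩ := H.bdd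
  obtain ⟨C', hC'⟩ := K.bdd
  refine ⟨H.meas.smul K.meas, C * C', fun ξ hξ => ?_⟩
  rw [norm_smul]
  exact mul_le_mul (hC ξ hξ) (hC' ξ hξ) (norm_nonneg _) ((norm_nonneg _).trans (hC ξ hξ))

omit [NormedSpace ℝ V] in
theorem BddMeas.sub (H : BddMeas X F) (K : BddMeas X G) : BddMeas X fun ξ => F ξ - G ξ := by
  obtain ⟨C, hC⟩ := H.bdd
  obtain ⟨C', hC'⟩ := K.bdd
  exact ⟨H.meas.sub K.meas, C + C', fun ξ hξ => (norm_sub_le _ _).trans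
    (add_le_add (hC ξ hξ) (hC' ξ hξ))⟩

omit [NormedSpace ℝ V] in
theorem BddMeas.sum {α : Type*} (s : Finset α) {F : α → E3 → V} (H : ∀ a ∈ s, BddMeas X (F a)) :
    BddMeas X fun ξ => ∑ a ∈ s, F a ξ := by
  refine ⟨Finset.measurable_fun_sum _ fun a ha => (H a ha).meas, ?_⟩
  choose! C hC using fun a ha => (H a ha).bdd
  exact ⟨∑ a ∈ s, C a, fun ξ hξ => (norm_sum_le _ _).trans
    (Finset.sum_le_sum fun a ha => hC a ha ξ hξ)⟩

theorem BddMeas.of_apply {F : E3 → E3} (H : ∀ b, BddMeas X fun ξ => F ξ b) : BddMeas X F := by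
  have h : F = fun ξ => ∑ b, F ξ b • EuclideanSpace.single b (1 : ℝ) := by
    funext ξ
    ext k
    fin_cases k <;> simp [Fin.sum_univ_three]
  rw [h]
  exact BddMeas.sum _ fun b _ => (H b).smul ⟨measurable_const, ‖EuclideanSpace.single b (1 : ℝ)‖,
    fun _ _ => le_rfl⟩

end

theorem LineDiff.bddMeas {G : Fin 3 → Set ℝ} {e : Fin 3} {h h' : E3 → ℝ} (H : LineDiff G e h h') :
    BddMeas closedCube h := ⟨H.meas, H.bdd⟩

theorem LineDiff.bddMeas' {G : Fin 3 → Set ℝ} {e : Fin 3} {h h' : E3 → ℝ} (H : LineDiff G e h h') :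
    BddMeas closedCube h' := ⟨H.meas', H.bdd'⟩

namespace MultiPatch

variable {ι : Type*} {M : ControlGrid ι} {P : MultiPatch M}

theorem bddMeas_field (i : ι) (D : Finset (Fin 3)) (c : M.Idx i D → ℝ) :
    BddMeas closedCube (P.field i D c) := by
  unfold field
  refine BddMeas.sum _ fun a _ => BddMeas.smul (V := ℝ)
    ⟨measurable_const, ‖c a‖, fun _ _ => le_rfl⟩ ?_
  rw [show P.basisFun i D a = tens (P.uni i D) (fun e => a e) from funext (P.basisFun_eq_tens i D a)]
  exact ⟨measurable_tens fun f => P.measurable_uni _ _ _ _,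
    tens_bounded fun f => P.uni_bounded _ _ _ _⟩

variable (hP : P.IsConforming)
include hP

theorem bddMeas_pd (i : ι) (f : Fin 3) : BddMeas closedCube (P.pd i f) :=
  BddMeas.of_apply fun b => (lineDiff_param hP i f b).bddMeas'

theorem bddMeas_normal (i : ι) (e : Fin 3) : BddMeas closedCube (P.normal i e) :=
  BddMeas.of_apply fun b => (lineDiff_normal hP i e b).bddMeas

theorem traceField_trace0 (c : M.LocalVertex → ℝ) : P.TraceField E3 (P.trace0 c) where
  meas i e := ((bddMeas_field i ∅ _).smul (bddMeas_normal hP i e)).meas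
  bdd i e := ((bddMeas_field i ∅ _).smul (bddMeas_normal hP i e)).bdd
  cont i e s := (continuousOn_field hP (slice_sideGen i e s) _ _).smul
    (continuousOn_normal hP (slice_sideGen i e s) e)

theorem traceField_trace1 (c : M.LocalEdge → ℝ) : P.TraceField E3 (P.trace1 c) where
  meas i _ := (((bddMeas_field i _ _).smul (bddMeas_pd hP i _)).sub
    ((bddMeas_field i _ _).smul (bddMeas_pd hP i _))).meas
  bdd i _ := (((bddMeas_field i _ _).smul (bddMeas_pd hP i _)).sub
    ((bddMeas_field i _ _).smul (bddMeas_pd hP i _))).bdd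
  cont i e s := ((continuousOn_field hP (slice_sideGen i e s) _ _).smul
    (continuousOn_pd hP (slice_sideGen i e s) _)).sub
    ((continuousOn_field hP (slice_sideGen i e s) _ _).smul
    (continuousOn_pd hP (slice_sideGen i e s) _))

theorem traceField_hat2 (c : M.LocalFacet → ℝ) : P.TraceField ℝ (P.hat2 c) where
  meas i _ := (bddMeas_field i _ _).meas
  bdd i _ := (bddMeas_field i _ _).bdd
  cont i e s := continuousOn_field hP (slice_sideGen i e s) _ _

/-! ### Fields with given coefficients -/

omit hP in
variable (P) in
/-- The determinant of the derivative of the parametrisation. -/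
def jac (i : ι) (ξ : E3) : ℝ := ⟪P.pd i 0 ξ, P.normal i 0 ξ⟫_ℝ

theorem jac_eq {i : ι} {ξ : E3} (hξ : ξ ∈ P.genericCube i) :
    (fderiv ℝ (P.param i) ξ).det = P.jac i ξ := det_param hP hξ

theorem jac_ne_zero {i : ι} {ξ : E3} (hξ : ξ ∈ P.genericCube i) : P.jac i ξ ≠ 0 :=
  jac_eq hP hξ ▸ det_fderiv_ne_zero hP hξ

omit hP in
theorem inner_pd_normal (i : ι) (ξ : E3) (d f : Fin 3) :
    ⟪P.pd i d ξ, P.normal i f ξ⟫_ℝ = if d = f then P.jac i ξ else 0 := by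
  fin_cases d <;> fin_cases f <;> simp [jac, normal, inner_E3, cross3] <;> ring

omit hP in
theorem jac_mul_inner (i : ι) (ξ u v : E3) :
    P.jac i ξ * ⟪u, v⟫_ℝ = ∑ d, ⟪P.pd i d ξ, u⟫_ℝ * ⟪P.normal i d ξ, v⟫_ℝ :=
  det_mul_inner (fun d => P.pd i d ξ) u v

theorem eq_of_inner_pd {i : ι} {ξ : E3} (hξ : ξ ∈ P.genericCube i) {u v : E3}
    (h : ∀ d, ⟪P.pd i d ξ, u⟫_ℝ = ⟪P.pd i d ξ, v⟫_ℝ) : u = v := by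
  have h1 := P.jac_mul_inner i ξ (u - v) (u - v)
  simp only [inner_sub_right (P.pd i _ ξ), h, sub_self, zero_mul, Finset.sum_const_zero] at h1
  exact sub_eq_zero.1 (inner_self_eq_zero.1 ((mul_eq_zero.1 h1).resolve_left (jac_ne_zero hP hξ)))

theorem eq_of_inner_normal {i : ι} {ξ : E3} (hξ : ξ ∈ P.genericCube i) {u v : E3}
    (h : ∀ d, ⟪P.normal i d ξ, u⟫_ℝ = ⟪P.normal i d ξ, v⟫_ℝ) : u = v := by
  have h1 := P.jac_mul_inner i ξ (u - v) (u - v)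
  simp only [inner_sub_right (P.normal i _ ξ), h, sub_self, mul_zero, Finset.sum_const_zero] at h1
  exact sub_eq_zero.1 (inner_self_eq_zero.1 ((mul_eq_zero.1 h1).resolve_left (jac_ne_zero hP hξ)))

/-- The determinant is bounded below, since the derivative of a bi-Lipschitz map enlarges a ball to
a set that contains a ball of comparable radius. -/
theorem exists_le_abs_jac (i : ι) : ∃ δ, 0 < δ ∧ ∀ ξ ∈ P.genericCube i, δ ≤ |P.jac i ξ| := by
  obtain ⟨c, C, hc, hb⟩ := hP.biLipschitz i
  refine ⟨c ^ 3, by positivity, fun ξ hξ => ?_⟩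
  have H := oneSided_of_generic hP hξ 0
  have hA := fun v => (H.bounds hb v).1
  rw [← jac_eq hP hξ]
  obtain ⟨B, hB⟩ := H.exists_equiv hP
  rw [← hB] at hA ⊢
  have h1 : Metric.closedBall (0 : E3) c ⊆ (B : E3 →L[ℝ] E3) '' Metric.closedBall 0 1 := by
    intro y hy
    refine ⟨B.symm y, ?_, by simp⟩
    have h2 := hA (B.symm y)
    simp only [ContinuousLinearEquiv.coe_coe, ContinuousLinearEquiv.apply_symm_apply,
      mem_closedBall_zero_iff] at h2 hy ⊢
    exact le_of_mul_le_mul_left (by linarith) hc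
  have h2 := measure_mono (μ := volume) h1
  rw [Measure.addHaar_image_continuousLinearMap, Measure.addHaar_closedBall' _ _ hc.le,
    ENNReal.mul_le_mul_iff_left (Metric.measure_closedBall_pos volume _ one_pos).ne'
      measure_closedBall_lt_top.ne, ENNReal.ofReal_le_ofReal_iff (abs_nonneg _)] at h2
  rw [finrank_euclideanSpace_fin] at h2
  exact h2

theorem bddMeas_jac_inv (i : ι) : BddMeas (P.genericCube i) fun ξ => (P.jac i ξ)⁻¹ := by
  obtain ⟨δ, h1, h2⟩ := exists_le_abs_jac hP i
  refine ⟨((bddMeas_pd hP i 0).meas.inner (bddMeas_normal hP i 0).meas).inv, δ⁻¹, fun ξ hξ => ?_⟩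
  rw [norm_inv]
  exact inv_anti₀ h1 (h2 ξ hξ)

theorem hasCoeffs0_iff [Finite ι] {u : L2Scalar P.domain} {c : M.LocalVertex → ℝ} :
    P.HasCoeffs0 u c ↔ ∀ᵐ x ∂(volume.restrict P.domain), ∀ i, ∀ ξ ∈ P.genericCube i,
      P.param i ξ = x → u x = P.hat0 c i ξ := by
  constructor <;> intro h <;> filter_upwards [h, ae_generic hP] with x h1 h2 i ξ hξ hx
  · exact h1 i ξ (P.genericCube_subset_openCube i hξ) hx
  · exact h1 i ξ (h2.2 i ξ (openCube_subset_closedCube hξ) hx) hx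

theorem hasCoeffs1_iff [Finite ι] {u : L2Vector P.domain} {c : M.LocalEdge → ℝ} :
    P.HasCoeffs1 u c ↔ ∀ᵐ x ∂(volume.restrict P.domain), ∀ i, ∀ ξ ∈ P.genericCube i,
      P.param i ξ = x → ∀ d, ⟪P.pd i d ξ, u x⟫_ℝ = P.hat1 c i d ξ := by
  have key : ∀ i, ∀ ξ ∈ P.genericCube i, ∀ (v : E3) d,
      ((jacobian (P.param i) ξ).transpose.mulVec v) d = ⟪P.pd i d ξ, v⟫_ℝ := fun i ξ hξ v d => by
    simp only [Matrix.mulVec, dotProduct, Matrix.transpose_apply, jacobian_param hP hξ,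
      Fin.sum_univ_three, inner_E3]
  constructor <;> intro h <;> filter_upwards [h, ae_generic hP] with x h1 h2 i ξ hξ hx d
  · rw [← key i ξ hξ]
    exact h1 i ξ (P.genericCube_subset_openCube i hξ) hx d
  · have hξ' := h2.2 i ξ (openCube_subset_closedCube hξ) hx
    rw [key i ξ hξ']
    exact h1 i ξ hξ' hx d

theorem hasCoeffs2_iff [Finite ι] {u : L2Vector P.domain} {c : M.LocalFacet → ℝ} :
    P.HasCoeffs2 u c ↔ ∀ᵐ x ∂(volume.restrict P.domain), ∀ i, ∀ ξ ∈ P.genericCube i,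
      P.param i ξ = x → ∀ d, ⟪P.normal i d ξ, u x⟫_ℝ = P.hat2 c i d ξ := by
  have key : ∀ i, ∀ ξ ∈ P.genericCube i, ∀ (v : E3) d,
      ((jacobian (P.param i) ξ).adjugate.mulVec v) d = ⟪P.normal i d ξ, v⟫_ℝ := fun i ξ hξ v d => by
    rw [Matrix.adjugate_fin_three]
    simp only [Matrix.mulVec, dotProduct, jacobian_param hP hξ, Fin.sum_univ_three, inner_E3,
      normal, cross3]
    fin_cases d <;> simp <;> ring
  constructor <;> intro h <;> filter_upwards [h, ae_generic hP] with x h1 h2 i ξ hξ hx d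
  · rw [← key i ξ hξ]
    exact h1 i ξ (P.genericCube_subset_openCube i hξ) hx d
  · have hξ' := h2.2 i ξ (openCube_subset_closedCube hξ) hx
    rw [key i ξ hξ']
    exact h1 i ξ hξ' hx d

theorem hasCoeffs3_iff [Finite ι] {u : L2Scalar P.domain} {c : M.LocalCell → ℝ} :
    P.HasCoeffs3 u c ↔ ∀ᵐ x ∂(volume.restrict P.domain), ∀ i, ∀ ξ ∈ P.genericCube i,
      P.param i ξ = x → P.jac i ξ * u x = P.hat3 c i ξ := by
  have key : ∀ i, ∀ ξ ∈ P.genericCube i, (jacobian (P.param i) ξ).det = P.jac i ξ :=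
    fun i ξ hξ => by
      simp only [Matrix.det_fin_three, jacobian_param hP hξ, jac, normal, cross3, inner_E3]
      simp
      ring
  constructor <;> intro h <;> filter_upwards [h, ae_generic hP] with x h1 h2 i ξ hξ hx
  · rw [← key i ξ hξ]
    exact h1 i ξ (P.genericCube_subset_openCube i hξ) hx
  · have hξ' := h2.2 i ξ (openCube_subset_closedCube hξ) hx
    rw [key i ξ hξ']
    exact h1 i ξ hξ' hx

section

variable [Fintype ι]

theorem exists_hasCoeffs0 (c : M.LocalVertex → ℝ) : ∃ u : L2Scalar P.domain, P.HasCoeffs0 u c := by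
  have hb := fun i => (bddMeas_field (P := P) i ∅ fun a => c ⟨i, a⟩).mono (P.genericCube_subset i)
  obtain ⟨u, hu⟩ := exists_Lp hP _ (fun i => (hb i).meas) fun i => (hb i).bdd
  refine ⟨u, (hasCoeffs0_iff hP).2 ?_⟩
  filter_upwards [hu] with x hx i ξ hξ h
  exact (hx i ξ (P.genericCube_subset i hξ) h).2

theorem exists_hasCoeffs1 (c : M.LocalEdge → ℝ) : ∃ u : L2Vector P.domain, P.HasCoeffs1 u c := by
  have hb := fun i => BddMeas.sum (X := P.genericCube i) Finset.univ fun d _ =>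
    ((bddMeas_field (P := P) i {d} fun a => c ⟨i, d, a⟩).mono (P.genericCube_subset i)).smul
      ((bddMeas_jac_inv hP i).smul ((bddMeas_normal hP i d).mono (P.genericCube_subset i)))
  obtain ⟨u, hu⟩ := exists_Lp hP _ (fun i => (hb i).meas) fun i => (hb i).bdd
  refine ⟨u, (hasCoeffs1_iff hP).2 ?_⟩
  filter_upwards [hu] with x hx i ξ hξ h d
  rw [(hx i ξ (P.genericCube_subset i hξ) h).2, inner_sum, Finset.sum_eq_single d]
  · rw [real_inner_smul_right, real_inner_smul_right, inner_pd_normal, if_pos rfl,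
      inv_mul_cancel₀ (jac_ne_zero hP hξ), mul_one, hat1]
  · intro f _ hf
    rw [real_inner_smul_right, real_inner_smul_right, inner_pd_normal, if_neg hf.symm, mul_zero,
      mul_zero]
  · simp

theorem exists_hasCoeffs2 (c : M.LocalFacet → ℝ) : ∃ u : L2Vector P.domain, P.HasCoeffs2 u c := by
  have hb := fun i => BddMeas.sum (X := P.genericCube i) Finset.univ fun d _ =>
    ((bddMeas_field (P := P) i {d}ᶜ fun a => c ⟨i, d, a⟩).mono (P.genericCube_subset i)).smul
      ((bddMeas_jac_inv hP i).smul ((bddMeas_pd hP i d).mono (P.genericCube_subset i)))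
  obtain ⟨u, hu⟩ := exists_Lp hP _ (fun i => (hb i).meas) fun i => (hb i).bdd
  refine ⟨u, (hasCoeffs2_iff hP).2 ?_⟩
  filter_upwards [hu] with x hx i ξ hξ h d
  rw [(hx i ξ (P.genericCube_subset i hξ) h).2, inner_sum, Finset.sum_eq_single d]
  · rw [real_inner_smul_right, real_inner_smul_right, real_inner_comm, inner_pd_normal, if_pos rfl,
      inv_mul_cancel₀ (jac_ne_zero hP hξ), mul_one, hat2]
  · intro f _ hf
    rw [real_inner_smul_right, real_inner_smul_right, real_inner_comm, inner_pd_normal, if_neg hf,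
      mul_zero, mul_zero]
  · simp

theorem exists_hasCoeffs3 (c : M.LocalCell → ℝ) : ∃ u : L2Scalar P.domain, P.HasCoeffs3 u c := by
  have hb := fun i => (bddMeas_jac_inv hP i).smul
    ((bddMeas_field (P := P) i Finset.univ fun a => c ⟨i, a⟩).mono (P.genericCube_subset i))
  obtain ⟨u, hu⟩ := exists_Lp hP _ (fun i => (hb i).meas) fun i => (hb i).bdd
  refine ⟨u, (hasCoeffs3_iff hP).2 ?_⟩
  filter_upwards [hu] with x hx i ξ hξ h
  rw [(hx i ξ (P.genericCube_subset i hξ) h).2, smul_eq_mul, ← mul_assoc,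
    mul_inv_cancel₀ (jac_ne_zero hP hξ), one_mul, hat3]

end

theorem HasCoeffs0.unique [Finite ι] {u v : L2Scalar P.domain} {c : M.LocalVertex → ℝ}
    (hu : P.HasCoeffs0 u c) (hv : P.HasCoeffs0 v c) : u = v := by
  refine Lp.ext ?_
  filter_upwards [(hasCoeffs0_iff hP).1 hu, (hasCoeffs0_iff hP).1 hv, ae_generic hP]
    with x h1 h2 ⟨⟨i, ξ, hξ, hx⟩, _⟩
  rw [h1 i ξ hξ hx, h2 i ξ hξ hx]

theorem HasCoeffs1.unique [Finite ι] {u v : L2Vector P.domain} {c : M.LocalEdge → ℝ}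
    (hu : P.HasCoeffs1 u c) (hv : P.HasCoeffs1 v c) : u = v := by
  refine Lp.ext ?_
  filter_upwards [(hasCoeffs1_iff hP).1 hu, (hasCoeffs1_iff hP).1 hv, ae_generic hP]
    with x h1 h2 ⟨⟨i, ξ, hξ, hx⟩, _⟩
  exact eq_of_inner_pd hP hξ fun d => by rw [h1 i ξ hξ hx, h2 i ξ hξ hx]

theorem HasCoeffs2.unique [Finite ι] {u v : L2Vector P.domain} {c : M.LocalFacet → ℝ}
    (hu : P.HasCoeffs2 u c) (hv : P.HasCoeffs2 v c) : u = v := by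
  refine Lp.ext ?_
  filter_upwards [(hasCoeffs2_iff hP).1 hu, (hasCoeffs2_iff hP).1 hv, ae_generic hP]
    with x h1 h2 ⟨⟨i, ξ, hξ, hx⟩, _⟩
  exact eq_of_inner_normal hP hξ fun d => by rw [h1 i ξ hξ hx, h2 i ξ hξ hx]

theorem HasCoeffs3.unique [Finite ι] {u v : L2Scalar P.domain} {c : M.LocalCell → ℝ}
    (hu : P.HasCoeffs3 u c) (hv : P.HasCoeffs3 v c) : u = v := by
  refine Lp.ext ?_
  filter_upwards [(hasCoeffs3_iff hP).1 hu, (hasCoeffs3_iff hP).1 hv, ae_generic hP]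
    with x h1 h2 ⟨⟨i, ξ, hξ, hx⟩, _⟩
  exact mul_left_cancel₀ (jac_ne_zero hP hξ) (by rw [h1 i ξ hξ hx, h2 i ξ hξ hx])

/-- Splines of a patch are determined by their values almost everywhere. -/
theorem coeff_eq_of_ae {i : ι} {D : Finset (Fin 3)} {c c' : M.Idx i D → ℝ}
    (h : ∀ᵐ ξ ∂(volume.restrict (P.genericCube i)), P.field i D c ξ = P.field i D c' ξ) :
    c = c' := by
  have h1 := Measure.eqOn_open_of_ae_eq h (P.isOpen_genericCube i)
    (continuousOn_field hP (slice_genericCube i) D c)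
    (continuousOn_field hP (slice_genericCube i) D c')
  funext a
  refine sub_eq_zero.1 (coeff_eq_zero hP i (fun _ => none) (fun _ _ h => by cases h)
    (fun a => c a - c' a) (fun ξ _ h2 => ?_) a fun _ _ h => by cases h)
  have h3 := h1 fun e => h2 e rfl
  simp only [field, sub_mul, Finset.sum_sub_distrib] at h3 ⊢
  rw [h3, sub_self]

theorem HasCoeffs0.unique_coeffs [Finite ι] {u : L2Scalar P.domain} {c c' : M.LocalVertex → ℝ}
    (h : P.HasCoeffs0 u c) (h' : P.HasCoeffs0 u c') : c = c' := by
  funext ⟨i, a⟩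
  refine congrFun (coeff_eq_of_ae hP (c := fun a => c ⟨i, a⟩) (c' := fun a => c' ⟨i, a⟩) ?_) a
  filter_upwards [ae_pullback hP ((hasCoeffs0_iff hP).1 h) i,
    ae_pullback hP ((hasCoeffs0_iff hP).1 h') i,
    ae_restrict_mem (P.isOpen_genericCube i).measurableSet] with ξ h1 h2 hξ
  exact (h1 i ξ hξ rfl).symm.trans (h2 i ξ hξ rfl)

theorem HasCoeffs1.unique_coeffs [Finite ι] {u : L2Vector P.domain} {c c' : M.LocalEdge → ℝ}
    (h : P.HasCoeffs1 u c) (h' : P.HasCoeffs1 u c') : c = c' := by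
  funext ⟨i, d, a⟩
  refine congrFun (coeff_eq_of_ae hP (c := fun a => c ⟨i, d, a⟩) (c' := fun a => c' ⟨i, d, a⟩) ?_) a
  filter_upwards [ae_pullback hP ((hasCoeffs1_iff hP).1 h) i,
    ae_pullback hP ((hasCoeffs1_iff hP).1 h') i,
    ae_restrict_mem (P.isOpen_genericCube i).measurableSet] with ξ h1 h2 hξ
  exact (h1 i ξ hξ rfl d).symm.trans (h2 i ξ hξ rfl d)

theorem HasCoeffs2.unique_coeffs [Finite ι] {u : L2Vector P.domain} {c c' : M.LocalFacet → ℝ}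
    (h : P.HasCoeffs2 u c) (h' : P.HasCoeffs2 u c') : c = c' := by
  funext ⟨i, d, a⟩
  refine congrFun (coeff_eq_of_ae hP (c := fun a => c ⟨i, d, a⟩) (c' := fun a => c' ⟨i, d, a⟩) ?_) a
  filter_upwards [ae_pullback hP ((hasCoeffs2_iff hP).1 h) i,
    ae_pullback hP ((hasCoeffs2_iff hP).1 h') i,
    ae_restrict_mem (P.isOpen_genericCube i).measurableSet] with ξ h1 h2 hξ
  exact (h1 i ξ hξ rfl d).symm.trans (h2 i ξ hξ rfl d)

theorem HasCoeffs3.unique_coeffs [Finite ι] {u : L2Scalar P.domain} {c c' : M.LocalCell → ℝ}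
    (h : P.HasCoeffs3 u c) (h' : P.HasCoeffs3 u c') : c = c' := by
  funext ⟨i, a⟩
  refine congrFun (coeff_eq_of_ae hP (c := fun a => c ⟨i, a⟩) (c' := fun a => c' ⟨i, a⟩) ?_) a
  filter_upwards [ae_pullback hP ((hasCoeffs3_iff hP).1 h) i,
    ae_pullback hP ((hasCoeffs3_iff hP).1 h') i,
    ae_restrict_mem (P.isOpen_genericCube i).measurableSet] with ξ h1 h2 hξ
  exact (h1 i ξ hξ rfl).symm.trans (h2 i ξ hξ rfl)

end MultiPatch
end

noncomputable section

/-! ### Coefficients that match at the interfaces -/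

namespace ControlGrid

variable {ι : Type*} (M : ControlGrid ι) (S : Set (ι × Fin 3 × Bool))

/-- Vertex coefficients that agree across the sides shared by two patches and vanish on the sides
in `S`. -/
def sideCochains0 : Set (M.LocalVertex → ℝ) :=
  {c | (∀ x y g e s, M.glue x.1 y.1 = some g → g.face = sideOf e s → Matches g x.2 y.2 →
    c y = c x) ∧ ∀ x : M.LocalVertex, M.OnDirichlet S x.2 → c x = 0}

/-- Edge coefficients that agree up to orientation across the sides shared by two patches and vanish
on the sides in `S`. -/
def sideCochains1 : Set (M.LocalEdge → ℝ) :=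
  {c | (∀ x y g e s, M.glue x.1 y.1 = some g → g.face = sideOf e s → Matches g x.2.2 y.2.2 →
    c y = g.dirSign x.2.1 * c x) ∧ ∀ x : M.LocalEdge, M.OnDirichlet S x.2.2 → c x = 0}

/-- Facet coefficients that agree up to orientation across the sides shared by two patches and
vanish on the sides in `S`. -/
def sideCochains2 : Set (M.LocalFacet → ℝ) :=
  {c | (∀ x y g e s, M.glue x.1 y.1 = some g → g.face = sideOf e s → Matches g x.2.2 y.2.2 →
    c y = g.normSign x.2.1 * c x) ∧ ∀ x : M.LocalFacet, M.OnDirichlet S x.2.2 → c x = 0}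

variable {M} in
theorem Matches.dir_eq {g : Gluing} {i j : ι} {d d' : Fin 3} {a : M.Idx i {d}} {b : M.Idx j {d'}}
    (h : Matches g a b) : d' = g.perm d := by
  have h1 := h.1
  rw [Finset.image_singleton] at h1
  exact Finset.singleton_injective h1

variable {M} in
theorem image_compl_singleton (g : Gluing) (d : Fin 3) :
    ({g.perm d}ᶜ : Finset (Fin 3)) = ({d}ᶜ : Finset (Fin 3)).image g.perm := by
  ext f
  obtain ⟨f, rfl⟩ := g.perm.surjective f
  simp

variable {M} in
theorem Matches.normal_eq {g : Gluing} {i j : ι} {d d' : Fin 3} {a : M.Idx i {d}ᶜ}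
    {b : M.Idx j {d'}ᶜ} (h : Matches g a b) : d' = g.perm d := by
  have h1 := h.1
  rw [← image_compl_singleton] at h1
  exact Finset.singleton_injective (compl_injective h1)

end ControlGrid

namespace MultiPatch

variable {ι : Type*} {M : ControlGrid ι} {P : MultiPatch M}

/-- The partial derivatives along a side are linearly independent. -/
theorem tangential_inj (hP : P.IsConforming) {i : ι} {e : Fin 3} {s : Bool} {ξ : E3}
    (hξ : ξ ∈ P.sideGen i e s) {a b : ℝ}
    (h : a • P.pd i (e + 1) ξ + b • P.pd i (e + 2) ξ = 0) : a = 0 ∧ b = 0 := by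
  have hn := normal_ne_zero hP hξ
  have h1 : a • P.normal i e ξ = 0 := by
    have : a • P.normal i e ξ = cross3 (a • P.pd i (e + 1) ξ + b • P.pd i (e + 2) ξ)
        (P.pd i (e + 2) ξ) := by
      ext k; fin_cases k <;> simp [normal, cross3] <;> ring
    rw [this, h]
    ext k; fin_cases k <;> simp [cross3]
  have h2 : b • P.normal i e ξ = 0 := by
    have : b • P.normal i e ξ = cross3 (P.pd i (e + 1) ξ)
        (a • P.pd i (e + 1) ξ + b • P.pd i (e + 2) ξ) := by
      ext k; fin_cases k <;> simp [normal, cross3] <;> ring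
    rw [this, h]
    ext k; fin_cases k <;> simp [cross3]
  exact ⟨(smul_eq_zero.1 h1).resolve_right hn, (smul_eq_zero.1 h2).resolve_right hn⟩

variable (hP : P.IsConforming) (S : Set (ι × Fin 3 × Bool))
include hP

theorem tracesMatch_trace0 {c : M.LocalVertex → ℝ} :
    P.TracesMatch S (P.trace0 c) ↔ c ∈ M.sideCochains0 S := by
  refine and_congr ⟨fun h ⟨i, a⟩ ⟨j, b⟩ g e s hg hf hab => ?_, fun h i e s j g hg hf => ?_⟩
    ⟨fun h ⟨i, a⟩ ⟨e, s, hs, ha⟩ => ?_, fun h i e s hs ξ hξ => ?_⟩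
  · rw [← one_mul (c ⟨i, a⟩)]
    refine (field_act_iff hP hg hf (Finset.notMem_empty e) (by simp)
      (c := fun a => c ⟨i, a⟩) (c' := fun a => c ⟨j, a⟩)).1 (fun ξ hξ => ?_) a b hab
    have h1 := h i e s j g hg hf ξ hξ
    rw [trace0, trace0, normal_act hP hg hf hξ, smul_smul, smul_smul] at h1
    have h2 := smul_left_injective ℝ (normal_ne_zero hP hξ) h1
    rw [mul_comm] at h2
    rw [one_mul]
    exact mul_left_cancel₀ (left_ne_zero_of_mul_eq_one (g.normSign_mul_self e)) h2
  · intro ξ hξ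
    have h1 := (field_act_iff hP hg hf (Finset.notMem_empty e) (by simp) (r := 1)
      (c := fun a => c ⟨i, a⟩) (c' := fun a => c ⟨j, a⟩)).2
      (fun a b hab => (h ⟨i, a⟩ ⟨j, b⟩ g e s hg hf hab).trans (one_mul _).symm) ξ hξ
    rw [trace0, trace0, normal_act hP hg hf hξ, hat0, h1, hat0, one_mul, smul_smul, smul_smul,
      mul_comm]
  · exact (field_eq_zero_iff hP (Finset.notMem_empty e) (c := fun a => c ⟨i, a⟩)).1
      (fun ξ hξ => (smul_eq_zero.1 (h i e s hs ξ hξ)).resolve_right (normal_ne_zero hP hξ)) a ha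
  · rw [trace0, hat0, (field_eq_zero_iff hP (Finset.notMem_empty e)).2
      (fun a ha => h ⟨i, a⟩ ⟨e, s, hs, ha⟩) ξ hξ, zero_smul]

/-- The traces of the components of a field on the two patches at a side have equal tangential parts
if and only if the tangential components agree up to orientation. -/
theorem trace1_act_iff (c : M.LocalEdge → ℝ) {i j : ι} {e : Fin 3} {s : Bool} {g : Gluing}
    (hg : M.glue i j = some g) (hf : g.face = sideOf e s) {ξ : E3} (hξ : ξ ∈ P.sideGen i e s) :
    P.trace1 c j (g.perm e) (g.act ξ) = g.normSign e • P.trace1 c i e ξ ↔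
      ∀ f, f ≠ e → P.hat1 c j (g.perm f) (g.act ξ) = g.dirSign f * P.hat1 c i f ξ := by
  have h1 := pd_act hP hg hf hξ (fin3_add_one_ne e)
  have h2 := pd_act hP hg hf hξ (fin3_add_two_ne e)
  have d1 := g.dirSign_mul_self (e + 1)
  have d2 := g.dirSign_mul_self (e + 2)
  have hfe : (∀ f, f ≠ e → P.hat1 c j (g.perm f) (g.act ξ) = g.dirSign f * P.hat1 c i f ξ) ↔
      P.hat1 c j (g.perm (e + 1)) (g.act ξ) = g.dirSign (e + 1) * P.hat1 c i (e + 1) ξ ∧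
      P.hat1 c j (g.perm (e + 2)) (g.act ξ) = g.dirSign (e + 2) * P.hat1 c i (e + 2) ξ :=
    ⟨fun h => ⟨h _ (fin3_add_one_ne e), h _ (fin3_add_two_ne e)⟩, fun h f hf => by
      rcases fin3_cases hf with rfl | rfl
      exacts [h.1, h.2]⟩
  rw [hfe, ← sub_eq_zero, trace1, trace1, Gluing.normSign]
  generalize P.hat1 c i (e + 1) ξ = u1 at *
  generalize P.hat1 c i (e + 2) ξ = u2 at *
  have hinj := fun a b => tangential_inj hP hξ (a := a) (b := b)
  rcases g.perm_cases e with ⟨h3, h4⟩ | ⟨h3, h4, h5⟩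
  · rw [← h4, if_pos h3, ← h3, h1, h2]
    generalize P.hat1 c j (g.perm (e + 1)) (g.act ξ) = v1 at *
    generalize P.hat1 c j (g.perm (e + 2)) (g.act ξ) = v2 at *
    generalize P.pd i (e + 1) ξ = p1 at *
    generalize P.pd i (e + 2) ξ = p2 at *
    generalize g.dirSign (e + 1) = s1 at *
    generalize g.dirSign (e + 2) = s2 at *
    constructor
    · intro h
      obtain ⟨ha, hb⟩ := hinj (v2 * s1 - s1 * s2 * u2) (s1 * s2 * u1 - v1 * s2) (by
        rw [← h]; module)
      constructor
      · linear_combination -s2 * hb + (s1 * u1 - v1) * d2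
      · linear_combination s1 * ha + (s2 * u2 - v2) * d1
    · rintro ⟨rfl, rfl⟩
      module
  · rw [if_neg h5, ← h3, ← h4, h1, h2]
    generalize P.hat1 c j (g.perm (e + 1)) (g.act ξ) = v1 at *
    generalize P.hat1 c j (g.perm (e + 2)) (g.act ξ) = v2 at *
    generalize P.pd i (e + 1) ξ = p1 at *
    generalize P.pd i (e + 2) ξ = p2 at *
    generalize g.dirSign (e + 1) = s1 at *
    generalize g.dirSign (e + 2) = s2 at *
    constructor
    · intro h
      obtain ⟨ha, hb⟩ := hinj (s1 * s2 * u2 - v2 * s1) (v1 * s2 - s1 * s2 * u1) (by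
        rw [← h]; module)
      constructor
      · linear_combination s2 * hb + (s1 * u1 - v1) * d2
      · linear_combination -s1 * ha + (s2 * u2 - v2) * d1
    · rintro ⟨rfl, rfl⟩
      module

theorem tracesMatch_trace1 {c : M.LocalEdge → ℝ} :
    P.TracesMatch S (P.trace1 c) ↔ c ∈ M.sideCochains1 S := by
  refine and_congr ⟨fun h ⟨i, d, a⟩ ⟨j, d', b⟩ g e s hg hf hab => ?_, fun h i e s j g hg hf ξ hξ => ?_⟩
    ⟨fun h ⟨i, d, a⟩ ⟨e, s, hs, he, ha⟩ => ?_, fun h i e s hs ξ hξ => ?_⟩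
  · obtain rfl := ControlGrid.Matches.dir_eq hab
    have hed : e ∉ ({d} : Finset (Fin 3)) := by
      exact (matches_onSide hab e s (by rw [hf, sideOf_eq_some]; exact ⟨rfl, rfl⟩)).1
    refine (field_act_iff hP hg hf hed (by simp)
      (c := fun a => c ⟨i, d, a⟩) (c' := fun a => c ⟨j, g.perm d, a⟩)).1 (fun ξ hξ => ?_) a b hab
    exact (trace1_act_iff hP c hg hf hξ).1 (h i e s j g hg hf ξ hξ) d
      fun hh => hed (Finset.mem_singleton.2 hh.symm)
  · refine (trace1_act_iff hP c hg hf hξ).2 fun f hfe => ?_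
    exact (field_act_iff hP hg hf (D := {f}) (by simpa using hfe.symm) (by simp)
      (c := fun a => c ⟨i, f, a⟩) (c' := fun a => c ⟨j, g.perm f, a⟩)).2
      (fun a b hab => h ⟨i, f, a⟩ ⟨j, _, b⟩ g e s hg hf hab) ξ hξ
  · refine (field_eq_zero_iff hP he (c := fun a => c ⟨i, d, a⟩)).1 (fun ξ hξ => ?_) a ⟨he, ha⟩
    have h1 := h i e s hs ξ hξ
    rw [trace1, sub_eq_add_neg, ← neg_smul] at h1
    obtain ⟨h2, h3⟩ := tangential_inj hP hξ h1
    rcases fin3_cases (e := e) (f := d) (fun hh => he (Finset.mem_singleton.2 hh.symm)) with rfl | rfl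
    · exact neg_eq_zero.1 h3
    · exact h2
  · have h1 : ∀ f, f ≠ e → P.hat1 c i f ξ = 0 := fun f hf =>
      (field_eq_zero_iff hP (by simpa using hf.symm)).2
        (fun a ha => h ⟨i, f, a⟩ ⟨e, s, hs, ha⟩) ξ hξ
    rw [trace1, h1 _ (fin3_add_one_ne e), h1 _ (fin3_add_two_ne e), zero_smul, zero_smul, sub_zero]

theorem tracesMatch_hat2 {c : M.LocalFacet → ℝ} :
    P.TracesMatch S (P.hat2 c) ↔ c ∈ M.sideCochains2 S := by
  have hne : ∀ {d e : Fin 3}, e ∉ ({d}ᶜ : Finset (Fin 3)) ↔ e = d := by simp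
  refine and_congr ⟨fun h ⟨i, d, a⟩ ⟨j, d', b⟩ g e s hg hf hab => ?_, fun h i e s j g hg hf ξ hξ => ?_⟩
    ⟨fun h ⟨i, d, a⟩ ⟨e, s, hs, he, ha⟩ => ?_, fun h i e s hs ξ hξ => ?_⟩
  · obtain rfl := ControlGrid.Matches.normal_eq hab
    obtain rfl := hne.1 (matches_onSide hab e s (by rw [hf, sideOf_eq_some]; exact ⟨rfl, rfl⟩)).1
    exact (field_act_iff hP hg hf (D := {e}ᶜ) (by simp) (ControlGrid.image_compl_singleton g e)
      (c := fun a => c ⟨i, e, a⟩) (c' := fun a => c ⟨j, g.perm e, a⟩)).1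
      (fun ξ hξ => h i e s j g hg hf ξ hξ) a b hab
  · exact (field_act_iff hP hg hf (D := {e}ᶜ) (by simp) (ControlGrid.image_compl_singleton g e)
      (c := fun a => c ⟨i, e, a⟩) (c' := fun a => c ⟨j, g.perm e, a⟩)).2
      (fun a b hab => h ⟨i, e, a⟩ ⟨j, _, b⟩ g e s hg hf hab) ξ hξ
  · obtain rfl := hne.1 he
    exact (field_eq_zero_iff hP he (c := fun a => c ⟨i, e, a⟩)).1 (h i e s hs) a ⟨he, ha⟩
  · exact (field_eq_zero_iff hP (D := {e}ᶜ) (by simp)).2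
      (fun a ha => h ⟨i, e, a⟩ ⟨e, s, hs, ha⟩) ξ hξ

end MultiPatch
end

noncomputable section

/-! ### The complex of test functions -/

theorem jacobian_apply {F : E3 → E3} {x : E3} (hF : DifferentiableAt ℝ F x) (m e : Fin 3) :
    jacobian F x m e = fderiv ℝ (fun y => F y m) x (EuclideanSpace.single e 1) := by
  have h := ((EuclideanSpace.proj (𝕜 := ℝ) m).hasFDerivAt.comp x hF.hasFDerivAt).fderiv
  rw [jacobian, Matrix.of_apply]
  exact (congrArg (fun L : E3 →L[ℝ] ℝ => L (EuclideanSpace.single e 1)) h).symm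

theorem gradient_apply (φ : E3 → ℝ) (x : E3) (m : Fin 3) :
    gradient φ x m = fderiv ℝ φ x (EuclideanSpace.single m 1) := by
  have h : ⟪gradient φ x, EuclideanSpace.single m 1⟫_ℝ = _ :=
    InnerProductSpace.toDual_symm_apply
  rw [← h, EuclideanSpace.inner_single_right]
  simp

/-- Second partial derivatives commute. -/
theorem fderiv_fderiv_symm {φ : E3 → ℝ} (hφ : ContDiff ℝ ∞ φ) (x v w : E3) :
    fderiv ℝ (fun y => fderiv ℝ φ y v) x w = fderiv ℝ (fun y => fderiv ℝ φ y w) x v := by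
  have h1 : DifferentiableAt ℝ (fderiv ℝ φ) x :=
    ((hφ.fderiv_right (m := ∞) (by simp)).differentiable (by simp)).differentiableAt
  have h2 : ∀ v w : E3, fderiv ℝ (fun y => fderiv ℝ φ y v) x w = fderiv ℝ (fderiv ℝ φ) x w v :=
    fun v w => by
      rw [fderiv_clm_apply h1 (differentiableAt_const v)]
      simp
  rw [h2, h2]
  refine (hφ.contDiffAt.isSymmSndFDerivAt ?_).eq w v
  rw [minSmoothness_of_isRCLikeNormedField]
  exact WithTop.coe_le_coe.2 (le_top : (2 : ℕ∞) ≤ ⊤)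

variable {Γ : Set E3}

theorem IsTest.gradient {φ : E3 → ℝ} (hφ : IsTest Γ φ) : IsTest Γ (gradient φ) := by
  have hs : tsupport (_root_.gradient φ) ⊆ tsupport φ := by
    refine closure_minimal (fun x hx => ?_) (isClosed_tsupport φ)
    by_contra h
    refine hx ?_
    have h0 : fderiv ℝ φ x = 0 := by
      by_contra h'
      exact h (support_fderiv_subset ℝ h')
    simp [_root_.gradient, h0]
  refine ⟨?_, hφ.compact.of_isClosed_subset (isClosed_tsupport _) hs, hφ.avoids.mono_left hs⟩
  exact (InnerProductSpace.toDual ℝ E3).symm.toContinuousLinearEquiv.contDiff.comp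
    (hφ.smooth.fderiv_right (by simp))

theorem contDiff_jacobian {φ : E3 → E3} (hφ : ContDiff ℝ ∞ φ) (m e : Fin 3) :
    ContDiff ℝ ∞ fun x => jacobian φ x m e :=
  (EuclideanSpace.proj (𝕜 := ℝ) m).contDiff.comp
    ((hφ.fderiv_right (m := ∞) (by simp)).clm_apply contDiff_const)

theorem IsTest.curl {φ : E3 → E3} (hφ : IsTest Γ φ) : IsTest Γ (curl φ) := by
  have hs : tsupport (_root_.curl φ) ⊆ tsupport φ := by
    refine closure_minimal (fun x hx => ?_) (isClosed_tsupport φ)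
    by_contra h
    refine hx ?_
    ext k
    fin_cases k <;> simp [_root_.curl, IsTest.jacobian_eq_zero h]
  refine ⟨?_, hφ.compact.of_isClosed_subset (isClosed_tsupport _) hs, hφ.avoids.mono_left hs⟩
  have hj := contDiff_jacobian hφ.smooth
  refine contDiff_euclidean.2 fun k => ?_
  fin_cases k
  · exact (hj 2 1).sub (hj 1 2)
  · exact (hj 0 2).sub (hj 2 0)
  · exact (hj 1 0).sub (hj 0 1)

theorem curl_gradient {φ : E3 → ℝ} (hφ : IsTest Γ φ) (x : E3) : curl (gradient φ) x = 0 := by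
  have h : ∀ m e, jacobian (gradient φ) x m e = jacobian (gradient φ) x e m := fun m e => by
    have hd := (hφ.gradient.smooth.differentiable (by simp)).differentiableAt (x := x)
    rw [jacobian_apply hd, jacobian_apply hd]
    simp only [gradient_apply]
    exact fderiv_fderiv_symm hφ.smooth _ _ _
  ext k
  fin_cases k <;> simp [curl, h 1 0, h 2 0, h 2 1]

theorem divergence_curl {φ : E3 → E3} (hφ : IsTest Γ φ) (x : E3) : divergence (curl φ) x = 0 := by
  have hd := (hφ.curl.smooth.differentiable (by simp)).differentiableAt (x := x)
  have hφd := fun y => (hφ.smooth.differentiable (by simp)).differentiableAt (x := y)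
  have hj := fun m e => ((contDiff_jacobian hφ.smooth m e).differentiable
    (by simp)).differentiableAt (x := x)
  have hsymm : ∀ m e l, fderiv ℝ (fun y => jacobian φ y m e) x (EuclideanSpace.single l 1) =
      fderiv ℝ (fun y => jacobian φ y m l) x (EuclideanSpace.single e 1) := fun m e l => by
    simp only [jacobian_apply (hφd _)]
    exact fderiv_fderiv_symm (hφ.contDiff_apply m) _ _ _
  have hsub : ∀ m e m' e' (v : E3), fderiv ℝ (fun y => jacobian φ y m e - jacobian φ y m' e') x v =
      fderiv ℝ (fun y => jacobian φ y m e) x v - fderiv ℝ (fun y => jacobian φ y m' e') x v :=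
    fun m e m' e' v => by
      rw [fderiv_fun_sub (hj m e) (hj m' e')]
      rfl
  rw [divergence, Matrix.trace, Fin.sum_univ_three]
  simp only [Matrix.diag, jacobian_apply hd]
  simp only [curl, Matrix.cons_val]
  rw [hsub, hsub, hsub, hsymm 2 1 0, hsymm 1 2 0, hsymm 0 2 1]
  ring

/-- Weak derivatives are unique. -/
theorem eq_zero_of_integral_test {Ω : Set E3} (hΩ : IsOpen Ω) {w : L2Vector Ω}
    (h : ∀ φ : E3 → E3, IsTest (frontier Ω) φ → ∫ x in Ω, ⟪w x, φ x⟫_ℝ = 0) : w = 0 := by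
  have hb : ∀ b, ∀ᵐ x ∂(volume.restrict Ω), x ∈ Ω → w x b = 0 := fun b => by
    refine hΩ.ae_eq_zero_of_integral_contDiff_smul_eq_zero ?_ fun χ h1 h2 h3 => ?_
    · have h0 : MemLp (fun x => w x b) 2 (volume.restrict Ω) :=
        (EuclideanSpace.proj (𝕜 := ℝ) b).comp_memLp' (Lp.memLp w)
      exact (h0.locallyIntegrable (by norm_num)).locallyIntegrableOn _
    · have hχ : IsTest (frontier Ω) fun x => χ x • EuclideanSpace.single b (1 : ℝ) :=
        ⟨h1.smul contDiff_const, h2.smul_right, Set.disjoint_left.2 fun x hx hx' =>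
          (hΩ.frontier_eq ▸ hx').2 (h3 (tsupport_smul_subset_left _ _ hx))⟩
      rw [← h _ hχ]
      refine integral_congr_ae (Filter.Eventually.of_forall fun x => ?_)
      simp [inner_smul_right, EuclideanSpace.inner_single_right]
  refine Lp.ext ?_
  filter_upwards [ae_all_iff.2 hb, ae_restrict_mem hΩ.measurableSet,
    Lp.coeFn_zero E3 2 (volume.restrict Ω)] with x h1 h2 h3
  rw [h3]
  ext b
  exact h1 b h2

theorem IsTest.mono {V : Type*} [NormedAddCommGroup V] [NormedSpace ℝ V] {Γ' : Set E3} {φ : E3 → V}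
    (hφ : IsTest Γ φ) (h : Γ' ⊆ Γ) : IsTest Γ' φ :=
  ⟨hφ.smooth, hφ.compact, hφ.avoids.mono_right h⟩

/-! ### The spline complex in terms of coefficients -/

namespace MultiPatch

variable {ι : Type*} [Fintype ι] {M : ControlGrid ι} {P : MultiPatch M} (hP : P.IsConforming)
  {S : Set (ι × Fin 3 × Bool)}
include hP

theorem weakGrad_of_coeffs {c : M.LocalVertex → ℝ} (hc : c ∈ M.sideCochains0 S)
    {u : L2Scalar P.domain} {g : L2Vector P.domain} (hu : P.HasCoeffs0 u c)
    (hg : P.HasCoeffs1 g (ControlGrid.grad c)) :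
    WeakGrad P.domain (frontier P.domain \ P.dirichletPart S) u g := fun φ hφ => by
  have h := green_grad hP hφ ((hasCoeffs0_iff hP).1 hu) ((hasCoeffs1_iff hP).1 hg)
  rw [((tracesMatch_trace0 hP S).2 hc).flux_eq_zero hP hφ] at h
  linarith

theorem weakCurl_of_coeffs {c : M.LocalEdge → ℝ} (hc : c ∈ M.sideCochains1 S)
    {u w : L2Vector P.domain} (hu : P.HasCoeffs1 u c)
    (hw : P.HasCoeffs2 w (M.circulation c)) :
    WeakCurl P.domain (frontier P.domain \ P.dirichletPart S) u w := fun φ hφ => by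
  have h := green_curl hP hφ ((hasCoeffs1_iff hP).1 hu) ((hasCoeffs2_iff hP).1 hw)
  rw [((tracesMatch_trace1 hP S).2 hc).flux_eq_zero hP hφ] at h
  linarith

theorem green_div_coeffs {Γ : Set E3} {φ : E3 → ℝ} (hφ : IsTest Γ φ) {c : M.LocalFacet → ℝ}
    {u : L2Vector P.domain} {w : L2Scalar P.domain}
    (hu : P.HasCoeffs2 u c) (hw : P.HasCoeffs3 w (ControlGrid.outflow c)) :
    (∫ x in P.domain, ⟪u x, gradient φ x⟫_ℝ) + ∫ x in P.domain, w x * φ x =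
      P.flux fun i e ξ => ⟪P.hat2 c i e ξ, φ (P.param i ξ)⟫_ℝ := by
  refine green_div hP hφ ((hasCoeffs2_iff hP).1 hu) ?_
  filter_upwards [(hasCoeffs3_iff hP).1 hw] with x hx i ξ hξ h
  rw [jac_eq hP hξ]
  exact hx i ξ hξ h

theorem weakDiv_of_coeffs {c : M.LocalFacet → ℝ} (hc : c ∈ M.sideCochains2 S)
    {u : L2Vector P.domain} {w : L2Scalar P.domain} (hu : P.HasCoeffs2 u c)
    (hw : P.HasCoeffs3 w (ControlGrid.outflow c)) :
    WeakDiv P.domain (frontier P.domain \ P.dirichletPart S) u w := fun φ hφ => by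
  have h := green_div_coeffs hP hφ hu hw
  rw [((tracesMatch_hat2 hP S).2 hc).flux_eq_zero hP hφ] at h
  linarith

omit hP [Fintype ι] in
theorem integral_sub_inner {Ω Γ : Set E3} (v w : L2Vector Ω) {φ : E3 → E3} (hφ : IsTest Γ φ) :
    ∫ x in Ω, ⟪(v - w) x, φ x⟫_ℝ = (∫ x in Ω, ⟪v x, φ x⟫_ℝ) - ∫ x in Ω, ⟪w x, φ x⟫_ℝ := by
  rw [← integral_sub (integrable_inner v hφ) (integrable_inner w hφ)]
  refine integral_congr_ae ?_
  filter_upwards [Lp.coeFn_sub v w] with x hx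
  rw [hx, Pi.sub_apply, inner_sub_left]

theorem mem_sideCochains0 (hS : ∀ b ∈ S, M.IsBoundarySide b) {c : M.LocalVertex → ℝ}
    {u : L2Scalar P.domain} {g : L2Vector P.domain} (hu : P.HasCoeffs0 u c)
    (hg : WeakGrad P.domain (frontier P.domain \ P.dirichletPart S) u g) :
    c ∈ M.sideCochains0 S := by
  obtain ⟨g', hg'⟩ := exists_hasCoeffs1 hP (ControlGrid.grad c)
  refine (tracesMatch_trace0 hP S).1 (tracesMatch_of_flux hP (traceField_trace0 hP c) S hS
    fun φ hφ => flux_eq_zero_of_integral hP (w := g' - g) (fun φ hφ => ?_) hφ)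
  rw [← green_grad hP hφ ((hasCoeffs0_iff hP).1 hu) ((hasCoeffs1_iff hP).1 hg'), hg φ hφ,
    integral_sub_inner g' g hφ]
  ring

theorem mem_sideCochains1 (hS : ∀ b ∈ S, M.IsBoundarySide b) {c : M.LocalEdge → ℝ}
    {u w : L2Vector P.domain} (hu : P.HasCoeffs1 u c)
    (hw : WeakCurl P.domain (frontier P.domain \ P.dirichletPart S) u w) :
    c ∈ M.sideCochains1 S := by
  obtain ⟨w', hw'⟩ := exists_hasCoeffs2 hP (M.circulation c)
  refine (tracesMatch_trace1 hP S).1 (tracesMatch_of_flux hP (traceField_trace1 hP c) S hS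
    fun φ hφ => flux_eq_zero_of_integral hP (w := w - w') (fun φ hφ => ?_) hφ)
  rw [← green_curl hP hφ ((hasCoeffs1_iff hP).1 hu) ((hasCoeffs2_iff hP).1 hw'), hw φ hφ,
    integral_sub_inner w w' hφ]

theorem mem_sideCochains2 (hS : ∀ b ∈ S, M.IsBoundarySide b) {c : M.LocalFacet → ℝ}
    {u : L2Vector P.domain} {w : L2Scalar P.domain} (hu : P.HasCoeffs2 u c)
    (hw : WeakDiv P.domain (frontier P.domain \ P.dirichletPart S) u w) :
    c ∈ M.sideCochains2 S := by
  obtain ⟨w', hw'⟩ := exists_hasCoeffs3 hP (ControlGrid.outflow c)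
  refine (tracesMatch_hat2 hP S).1 (tracesMatch_of_flux hP (traceField_hat2 hP c) S hS
    fun φ hφ => flux_eq_zero_of_integral hP (w := w' - w) (fun φ hφ => ?_) hφ)
  have hsub : ∫ x in P.domain, ⟪(w' - w) x, φ x⟫_ℝ =
      (∫ x in P.domain, w' x * φ x) - ∫ x in P.domain, w x * φ x := by
    have hi : ∀ v : L2Scalar P.domain, Integrable (fun x => v x * φ x)
        (volume.restrict P.domain) := fun v => (Lp.memLp v).integrable_mul hφ.memLp
    rw [← integral_sub (hi w') (hi w)]
    refine integral_congr_ae ?_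
    filter_upwards [Lp.coeFn_sub w' w] with x hx
    rw [hx, Pi.sub_apply, ← sub_mul]
    simp [mul_comm]
  rw [← green_div_coeffs hP hφ hu hw', hw φ hφ, hsub]
  ring

/-- A scalar spline has weak derivatives and zero trace on the Dirichlet sides if and only if its
coefficients match at the interfaces and vanish on these sides; the two lemmas below are the
analogues for the tangential and the normal trace. -/
theorem mem_S0_iff (hS : ∀ b ∈ S, M.IsBoundarySide b) {u : L2Scalar P.domain}
    {c : M.LocalVertex → ℝ} (hu : P.HasCoeffs0 u c) : u ∈ P.S0 S ↔ c ∈ M.sideCochains0 S :=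
  ⟨fun ⟨_, _, hg⟩ => mem_sideCochains0 hP hS hu hg, fun hc =>
    let ⟨g, hg⟩ := exists_hasCoeffs1 hP (ControlGrid.grad c)
    ⟨⟨c, hu⟩, g, weakGrad_of_coeffs hP hc hu hg⟩⟩

theorem mem_S1_iff (hS : ∀ b ∈ S, M.IsBoundarySide b) {u : L2Vector P.domain}
    {c : M.LocalEdge → ℝ} (hu : P.HasCoeffs1 u c) : u ∈ P.S1 S ↔ c ∈ M.sideCochains1 S :=
  ⟨fun ⟨_, _, hw⟩ => mem_sideCochains1 hP hS hu hw, fun hc =>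
    let ⟨w, hw⟩ := exists_hasCoeffs2 hP (M.circulation c)
    ⟨⟨c, hu⟩, w, weakCurl_of_coeffs hP hc hu hw⟩⟩

theorem mem_S2_iff (hS : ∀ b ∈ S, M.IsBoundarySide b) {u : L2Vector P.domain}
    {c : M.LocalFacet → ℝ} (hu : P.HasCoeffs2 u c) : u ∈ P.S2 S ↔ c ∈ M.sideCochains2 S :=
  ⟨fun ⟨_, _, hw⟩ => mem_sideCochains2 hP hS hu hw, fun hc =>
    let ⟨w, hw⟩ := exists_hasCoeffs3 hP (ControlGrid.outflow c)
    ⟨⟨c, hu⟩, w, weakDiv_of_coeffs hP hc hu hw⟩⟩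

/-- Gradients have vanishing weak curl, hence their coefficients match. -/
theorem grad_mem_sideCochains1 (hS : ∀ b ∈ S, M.IsBoundarySide b) {c : M.LocalVertex → ℝ}
    (hc : c ∈ M.sideCochains0 S) : ControlGrid.grad c ∈ M.sideCochains1 S := by
  obtain ⟨u, hu⟩ := exists_hasCoeffs0 hP c
  obtain ⟨g, hg⟩ := exists_hasCoeffs1 hP (ControlGrid.grad c)
  refine mem_sideCochains1 hP hS hg (w := 0) fun φ hφ => ?_
  have h1 := weakGrad_of_coeffs hP hc hu hg _ hφ.curl
  have h2 := L2Vector.integral_smul (Ω := P.domain) 0 0 φ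
  simp only [divergence_curl hφ, mul_zero, integral_zero] at h1
  rw [zero_smul, zero_mul] at h2
  rw [h2]
  linarith

/-- Curls have vanishing weak divergence, hence their coefficients match. -/
theorem circulation_mem_sideCochains2 (hS : ∀ b ∈ S, M.IsBoundarySide b) {c : M.LocalEdge → ℝ}
    (hc : c ∈ M.sideCochains1 S) : M.circulation c ∈ M.sideCochains2 S := by
  obtain ⟨u, hu⟩ := exists_hasCoeffs1 hP c
  obtain ⟨w, hw⟩ := exists_hasCoeffs2 hP (M.circulation c)
  refine mem_sideCochains2 hP hS hw (w := 0) fun φ hφ => ?_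
  have h1 := weakCurl_of_coeffs hP hc hu hw _ hφ.gradient
  have h2 := L2Scalar.integral_smul (Ω := P.domain) 0 0 φ
  simp only [curl_gradient hφ, inner_zero_right, integral_zero] at h1
  rw [zero_smul, zero_mul] at h2
  rw [h2, ← h1, neg_zero]

/-- Weak derivatives are unique, so that the coefficients of the gradient are those of the patchwise
gradient. -/
theorem isGrad_iff {c : M.LocalVertex → ℝ} (hc : c ∈ M.sideCochains0 S)
    {u : L2Scalar P.domain} {g : L2Vector P.domain} (hu : P.HasCoeffs0 u c) :
    P.IsGrad u g ↔ P.HasCoeffs1 g (ControlGrid.grad c) := by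
  have key : ∀ {g : L2Vector P.domain}, P.HasCoeffs1 g (ControlGrid.grad c) → P.IsGrad u g :=
    fun hg φ hφ => weakGrad_of_coeffs hP hc hu hg φ (hφ.mono sdiff_subset)
  refine ⟨fun h => ?_, key⟩
  obtain ⟨g', hg'⟩ := exists_hasCoeffs1 hP (ControlGrid.grad c)
  have h0 : g - g' = 0 := eq_zero_of_integral_test isOpen_domain fun φ hφ => by
    rw [integral_sub_inner g g' hφ]
    linarith [h φ hφ, key hg' φ hφ]
  rw [sub_eq_zero.1 h0]
  exact hg'

theorem isCurl_iff {c : M.LocalEdge → ℝ} (hc : c ∈ M.sideCochains1 S)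
    {u w : L2Vector P.domain} (hu : P.HasCoeffs1 u c) :
    P.IsCurl u w ↔ P.HasCoeffs2 w (M.circulation c) := by
  have key : ∀ {w : L2Vector P.domain}, P.HasCoeffs2 w (M.circulation c) → P.IsCurl u w :=
    fun hw φ hφ => weakCurl_of_coeffs hP hc hu hw φ (hφ.mono sdiff_subset)
  refine ⟨fun h => ?_, key⟩
  obtain ⟨w', hw'⟩ := exists_hasCoeffs2 hP (M.circulation c)
  have h0 : w - w' = 0 := eq_zero_of_integral_test isOpen_domain fun φ hφ => by
    rw [integral_sub_inner w w' hφ]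
    linarith [h φ hφ, key hw' φ hφ]
  rw [sub_eq_zero.1 h0]
  exact hw'

theorem mem_curlKernel_iff (hS : ∀ b ∈ S, M.IsBoundarySide b) {c : M.LocalEdge → ℝ}
    {u : L2Vector P.domain} (hu : P.HasCoeffs1 u c) :
    u ∈ P.curlKernel S ↔ c ∈ M.sideCochains1 S ∧ ∀ q, M.circulation c q = 0 := by
  refine (and_congr_left' (mem_S1_iff hP hS hu)).trans (and_congr_right fun hc => ?_)
  refine (isCurl_iff hP hc hu).trans ⟨fun h q => ?_, fun h => ?_⟩
  · rw [HasCoeffs2.unique_coeffs hP h HasCoeffs2.zero]; rfl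
  · rw [show M.circulation c = 0 from funext h]; exact HasCoeffs2.zero

/-- A spline field is a gradient of a spline with zero boundary values if and only if its
coefficients are differences of vertex coefficients. -/
theorem mem_gradients_iff (hS : ∀ b ∈ S, M.IsBoundarySide b) {c : M.LocalEdge → ℝ}
    {g : L2Vector P.domain} (hg : P.HasCoeffs1 g c) :
    g ∈ P.gradients S ↔ ∃ b ∈ M.sideCochains0 S, ControlGrid.grad b = c := by
  constructor
  · rintro ⟨u, hu, hug⟩
    obtain ⟨b, hb⟩ := hu.1
    have hb' := (mem_S0_iff hP hS hb).1 hu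
    exact ⟨b, hb', HasCoeffs1.unique_coeffs hP ((isGrad_iff hP hb' hb).1 hug) hg⟩
  · rintro ⟨b, hb, rfl⟩
    obtain ⟨u, hu⟩ := exists_hasCoeffs0 hP b
    exact ⟨u, (mem_S0_iff hP hS hu).2 hb, (isGrad_iff hP hb hu).2 hg⟩

end MultiPatch
end

noncomputable section

/-! ### Mesh entities as points of the domain -/

namespace ControlGrid

variable {ι : Type*} {M : ControlGrid ι}

/-- The centre of a mesh entity in the reference cube, for the uniform grid. -/
def pos {i : ι} {D : Finset (Fin 3)} (a : M.Idx i D) : E3 := WithLp.toLp 2 fun e =>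
  ((2 * (a e : ℕ) + if e ∈ D then 1 else 0 : ℕ) : ℝ) / ((2 * (M.n i e - 1) : ℕ) : ℝ)

theorem idx_bound {i : ι} {D : Finset (Fin 3)} (a : M.Idx i D) (e : Fin 3) :
    (a e : ℕ) + (if e ∈ D then 1 else 0) < M.n i e := by
  have := (a e).isLt
  unfold ext at this
  omega

variable (h2 : ∀ i e, 2 ≤ M.n i e)
include h2

theorem pos_injective {i : ι} {D D' : Finset (Fin 3)} {a : M.Idx i D} {b : M.Idx i D'}
    (h : pos a = pos b) : D = D' ∧ ∀ e, (a e : ℕ) = b e := by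
  have key : ∀ e, 2 * (a e : ℕ) + (if e ∈ D then 1 else 0) =
      2 * (b e : ℕ) + if e ∈ D' then 1 else 0 := fun e => by
    have h1 : pos a e = pos b e := by rw [h]
    have h3 := h2 i e
    have h4 : ((2 * (M.n i e - 1) : ℕ) : ℝ) ≠ 0 := Nat.cast_ne_zero.2 (by omega)
    exact Nat.cast_injective ((div_left_inj' h4).1 h1)
  have hD : ∀ e, e ∈ D ↔ e ∈ D' := fun e => by
    have := key e
    split_ifs at this with h1 h3 h3
    · exact ⟨fun _ => h3, fun _ => h1⟩
    · omega
    · omega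
    · exact ⟨fun h => absurd h h1, fun h => absurd h h3⟩
  refine ⟨Finset.ext hD, fun e => ?_⟩
  have := key e
  simp only [hD e] at this
  omega

theorem pos_eq_sideVal_iff {i : ι} {D : Finset (Fin 3)} {a : M.Idx i D} {e : Fin 3} {s : Bool} :
    pos a e = sideVal s ↔ OnSide a e s := by
  have h3 := h2 i e
  have h4 : ((2 * (M.n i e - 1) : ℕ) : ℝ) ≠ 0 := Nat.cast_ne_zero.2 (by omega)
  have h5 : pos a e = ((2 * (a e : ℕ) + if e ∈ D then 1 else 0 : ℕ) : ℝ) /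
    ((2 * (M.n i e - 1) : ℕ) : ℝ) := rfl
  have h6 := idx_bound a e
  rw [h5, OnSide]
  cases s
  · simp only [sideVal, Bool.false_eq_true, if_false]
    rw [div_eq_zero_iff, or_iff_left h4, Nat.cast_eq_zero]
    split_ifs with h <;> simp [h]
  · simp only [sideVal, if_true]
    rw [div_eq_one_iff_eq h4, Nat.cast_inj]
    split_ifs at h6 ⊢ with h
    · simp only [h, not_true_eq_false, false_and, iff_false]
      omega
    · simp only [h, not_false_eq_true, true_and]
      omega

theorem pos_mem_closedCube {i : ι} {D : Finset (Fin 3)} (a : M.Idx i D) : pos a ∈ closedCube :=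
  fun e => by
    have h3 := h2 i e
    have h4 : (0 : ℝ) < ((2 * (M.n i e - 1) : ℕ) : ℝ) := Nat.cast_pos.2 (by omega)
    have h6 := idx_bound a e
    refine ⟨div_nonneg (Nat.cast_nonneg _) (Nat.cast_nonneg _), (div_le_one h4).2 ?_⟩
    exact Nat.cast_le.2 (by split_ifs at h6 ⊢ <;> omega)

theorem pos_mem_cubeFace_iff {i : ι} {D : Finset (Fin 3)} {a : M.Idx i D}
    {φ : Fin 3 → Option Bool} :
    pos a ∈ cubeFace φ ↔ ∀ e s, φ e = some s → OnSide a e s :=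
  ⟨fun h e s he => (pos_eq_sideVal_iff h2).1 (h.2 e s he),
    fun h => ⟨pos_mem_closedCube h2 a, fun e s he => (pos_eq_sideVal_iff h2).2 (h e s he)⟩⟩

theorem act_pos {i j : ι} {g : Gluing} (hn : ∀ e, g.face e = none → M.n j (g.perm e) = M.n i e)
    {D D' : Finset (Fin 3)} {a : M.Idx i D} {b : M.Idx j D'} (h : Matches g a b) :
    g.act (pos a) = pos b := by
  ext f
  obtain ⟨e, rfl⟩ := g.perm.surjective f
  have h1 := h.2 e
  rw [g.act_apply]
  cases hf : g.face e with
  | some s =>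
    simp only [hf] at h1
    rw [(pos_eq_sideVal_iff h2).2 h1.1, (pos_eq_sideVal_iff h2).2 h1.2, sideVal_xor]
  | none =>
    simp only [hf] at h1
    have h3 := h2 i e
    have h4 : ((2 * (M.n i e - 1) : ℕ) : ℝ) ≠ 0 := Nat.cast_ne_zero.2 (by omega)
    have hD : g.perm e ∈ D' ↔ e ∈ D := by rw [h.1]; simp
    have h6 := idx_bound a e
    simp only [pos, hn e hf, hD]
    split_ifs at h1 ⊢ with h7 h8 h8
    · rw [eq_div_iff h4, sub_mul, div_mul_cancel₀ _ h4, one_mul, sub_eq_iff_eq_add, ← Nat.cast_add]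
      simp only [ext, h8, if_true] at h1
      exact congrArg Nat.cast (by omega)
    · rw [eq_div_iff h4, sub_mul, div_mul_cancel₀ _ h4, one_mul, sub_eq_iff_eq_add, ← Nat.cast_add]
      simp only [ext, h8, if_false] at h1
      exact congrArg Nat.cast (by omega)
    · rw [h1]
    · rw [h1]

omit h2 in
/-- The end points of identified edges are identified, in the order given by the orientations. -/
theorem matches_endpoints {g : Gluing} {x y : M.LocalEdge} (h : Matches g x.2.2 y.2.2) :
    (g.flip x.2.1 = false ∧ Matches g (tail x).2 (tail y).2 ∧ Matches g (head x).2 (head y).2) ∨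
    (g.flip x.2.1 = true ∧ Matches g (tail x).2 (head y).2 ∧ Matches g (head x).2 (tail y).2) := by
  obtain ⟨i, d, a⟩ := x
  obtain ⟨j, d', b⟩ := y
  obtain rfl := Matches.dir_eq h
  have hD : (∅ : Finset (Fin 3)) = (∅ : Finset (Fin 3)).image g.perm := by simp
  have hne : ∀ e s, g.face e = some s → e ≠ d := fun e s he hed => by
    have := h.2 e
    simp only [he] at this
    exact this.1.1 (by simp [hed])
  have hs : ∀ {k : ι} {f f' : Fin 3} {s : Bool} (c : M.Idx k {f}), f' ≠ f →
      (OnSide c f' s → OnSide (tail ⟨k, f, c⟩).2 f' s ∧ OnSide (head ⟨k, f, c⟩).2 f' s) := by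
    intro k f f' s c hf hc
    refine ⟨⟨Finset.notMem_empty _, hc.2⟩, Finset.notMem_empty _, ?_⟩
    have := hc.2
    simpa only [head, if_neg hf, add_zero] using this
  cases hflip : g.flip d with
  | false =>
    refine Or.inl ⟨rfl, ⟨hD, fun e => ?_⟩, ⟨hD, fun e => ?_⟩⟩
    all_goals
      have h1 := h.2 e
      cases hf : g.face e with
      | some s =>
        simp only [hf] at h1 ⊢
        have hed := hne e s hf
        have h3 := hs a hed h1.1
        have h4 := hs b (g.perm.injective.ne hed) h1.2
        first | exact ⟨h3.1, h4.1⟩ | exact ⟨h3.2, h4.2⟩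
      | none =>
        simp only [hf] at h1 ⊢
        by_cases hed : e = d
        · subst hed
          simp only [hflip, Bool.false_eq_true, if_false] at h1 ⊢
          simp [tail, head, h1]
        · have hed' : g.perm e ≠ g.perm d := g.perm.injective.ne hed
          simp only [ext, Finset.mem_singleton, hed, if_false, Finset.notMem_empty] at h1 ⊢
          simpa [tail, head, hed] using h1
  | true =>
    refine Or.inr ⟨rfl, ⟨hD, fun e => ?_⟩, ⟨hD, fun e => ?_⟩⟩
    all_goals
      have h1 := h.2 e
      cases hf : g.face e with
      | some s =>
        simp only [hf] at h1 ⊢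
        have hed := hne e s hf
        have h3 := hs a hed h1.1
        have h4 := hs b (g.perm.injective.ne hed) h1.2
        first | exact ⟨h3.1, h4.2⟩ | exact ⟨h3.2, h4.1⟩
      | none =>
        simp only [hf] at h1 ⊢
        by_cases hed : e = d
        · subst hed
          have hb := idx_bound a e
          simp only [hflip, if_true, ext, Finset.mem_singleton, Finset.notMem_empty, if_false]
            at h1 hb ⊢
          simp only [tail, head, if_true]
          omega
        · have hed' : g.perm e ≠ g.perm d := g.perm.injective.ne hed
          simp only [ext, Finset.mem_singleton, hed, if_false, Finset.notMem_empty] at h1 ⊢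
          simpa [tail, head, hed] using h1

end ControlGrid

namespace MultiPatch

variable {ι : Type*} {M : ControlGrid ι} {P : MultiPatch M} (hP : P.IsConforming)
include hP

theorem param_pos {i j : ι} {g : Gluing} (hg : M.glue i j = some g) {D D' : Finset (Fin 3)}
    {a : M.Idx i D} {b : M.Idx j D'} (h : ControlGrid.Matches g a b) :
    P.param j (ControlGrid.pos b) = P.param i (ControlGrid.pos a) := by
  rw [← ControlGrid.act_pos hP.two_le (fun e he => (hP.glue_knots i j g hg e he).1) h]
  exact param_act hP hg ((ControlGrid.pos_mem_cubeFace_iff hP.two_le).2 (matches_onSide h))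

/-- A property of mesh entities that passes from a patch to a neighbour across a full side passes to
all identified entities, since patches through a point are linked by full sides. -/
theorem of_matches_of_side {Q : ∀ k D, M.Idx k D → Prop}
    (hQ : ∀ k l g e s, M.glue k l = some g → g.face = sideOf e s → ∀ D D' (a : M.Idx k D)
      (b : M.Idx l D'), ControlGrid.Matches g a b → Q k D a → Q l D' b)
    {i j : ι} {g : Gluing} (hg : M.glue i j = some g) {D D' : Finset (Fin 3)} {a : M.Idx i D}
    {b : M.Idx j D'} (h : ControlGrid.Matches g a b) (ha : Q i D a) : Q j D' b := by
  have hcube := fun {k : ι} {D : Finset (Fin 3)} (a : M.Idx k D) =>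
    ControlGrid.pos_mem_closedCube hP.two_le a
  have key : ∀ {k}, Relation.ReflTransGen (fun k l => P.param i (ControlGrid.pos a) ∈ P.patch k ∧
      P.param i (ControlGrid.pos a) ∈ P.patch l ∧ ∃ g e s, M.glue k l = some g ∧
        g.face = sideOf e s) i k →
      ∃ D'' b', Q k D'' b' ∧ P.param k (ControlGrid.pos b') = P.param i (ControlGrid.pos a) := by
    intro k hk
    induction hk with
    | refl => exact ⟨D, a, ha, rfl⟩
    | tail _ hstep ih =>
      obtain ⟨hk, hl, g', e, s, hg', hf⟩ := hstep
      obtain ⟨D'', b', hb', hx⟩ := ih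
      have hmem := hP.glue_inter _ _ _ hg' ▸ mem_inter hk hl
      obtain ⟨η, hη, hηx⟩ := hmem
      rw [← hx] at hηx
      rw [injOn_param hP _ hη.1 (hcube b') hηx] at hη
      obtain ⟨b'', hb''⟩ := exists_matches hP hg' rfl b'
        ((ControlGrid.pos_mem_cubeFace_iff hP.two_le).1 hη)
      exact ⟨_, b'', hQ _ _ _ _ _ hg' hf _ _ _ _ hb'' hb', (param_pos hP hg' hb'').trans hx⟩
  have hx := param_pos hP hg h
  obtain ⟨D'', b', hb', hx'⟩ := key (hP.sideLinked (P.param i (ControlGrid.pos a)) i j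
    ⟨_, hcube a, rfl⟩ ⟨_, hcube b, hx⟩)
  obtain ⟨rfl, h1⟩ := ControlGrid.pos_injective hP.two_le
    (injOn_param hP j (hcube b') (hcube b) (hx'.trans hx.symm))
  rwa [← idx_ext h1]

theorem sideCochains0_matches {S : Set (ι × Fin 3 × Bool)} {c : M.LocalVertex → ℝ}
    (hc : c ∈ M.sideCochains0 S) {x y : M.LocalVertex} {g : Gluing}
    (hg : M.glue x.1 y.1 = some g) (h : ControlGrid.Matches g x.2 y.2) : c y = c x := by
  refine of_matches_of_side hP (Q := fun k D a => ∀ a' : M.Idx k ∅, D = ∅ →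
    (∀ e, (a' e : ℕ) = a e) → c ⟨k, a'⟩ = c x) (fun k l g e s hg hf D D' a b hab hQ b' hD' hb => ?_)
    hg h (fun a' _ ha => ?_) y.2 rfl fun _ => rfl
  · subst hD'
    have hD : D = ∅ := Finset.image_eq_empty.1 hab.1.symm
    subst hD
    rw [idx_ext hb, ← hQ a rfl fun _ => rfl]
    exact hc.1 ⟨k, a⟩ ⟨l, b⟩ g e s hg hf hab
  · rw [idx_ext ha]

/-- The orientation of an edge is read off from its end points in the physical space, so that the
signs collected along a chain of patches agree with the sign of the direct identification. -/
theorem sideCochains1_matches {S : Set (ι × Fin 3 × Bool)} {c : M.LocalEdge → ℝ}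
    (hc : c ∈ M.sideCochains1 S) {x y : M.LocalEdge} {g : Gluing}
    (hg : M.glue x.1 y.1 = some g) (h : ControlGrid.Matches g x.2.2 y.2.2) :
    c y = g.dirSign x.2.1 * c x := by
  let pt : M.LocalVertex → E3 := fun v => P.param v.1 (ControlGrid.pos v.2)
  have hpt : ∀ {z w : M.LocalEdge} {g : Gluing}, M.glue z.1 w.1 = some g →
      ControlGrid.Matches g z.2.2 w.2.2 →
      (g.dirSign z.2.1 = 1 ∧ pt (ControlGrid.tail w) = pt (ControlGrid.tail z) ∧
        pt (ControlGrid.head w) = pt (ControlGrid.head z)) ∨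
      (g.dirSign z.2.1 = -1 ∧ pt (ControlGrid.head w) = pt (ControlGrid.tail z) ∧
        pt (ControlGrid.tail w) = pt (ControlGrid.head z)) := fun {z w g} hg h => by
    rcases ControlGrid.matches_endpoints h with ⟨h1, h2, h3⟩ | ⟨h1, h2, h3⟩
    · exact Or.inl ⟨by simp [Gluing.dirSign, h1], param_pos hP hg h2, param_pos hP hg h3⟩
    · exact Or.inr ⟨by simp [Gluing.dirSign, h1], param_pos hP hg h2, param_pos hP hg h3⟩
  have hne : pt (ControlGrid.tail x) ≠ pt (ControlGrid.head x) := fun h => by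
    have h1 := (ControlGrid.pos_injective hP.two_le (injOn_param hP x.1
      (ControlGrid.pos_mem_closedCube hP.two_le _) (ControlGrid.pos_mem_closedCube hP.two_le _)
      h)).2 x.2.1
    simp [ControlGrid.tail, ControlGrid.head] at h1
  have key : (c y = c x ∧ pt (ControlGrid.tail y) = pt (ControlGrid.tail x)) ∨
      (c y = -c x ∧ pt (ControlGrid.tail y) = pt (ControlGrid.head x)) := by
    have := of_matches_of_side hP (Q := fun k D a => ∀ d, ∀ a' : M.Idx k {d}, D = {d} →
      (∀ e, (a' e : ℕ) = a e) →
      (c ⟨k, d, a'⟩ = c x ∧ pt (ControlGrid.tail ⟨k, d, a'⟩) = pt (ControlGrid.tail x) ∧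
        pt (ControlGrid.head ⟨k, d, a'⟩) = pt (ControlGrid.head x)) ∨
      (c ⟨k, d, a'⟩ = -c x ∧ pt (ControlGrid.tail ⟨k, d, a'⟩) = pt (ControlGrid.head x) ∧
        pt (ControlGrid.head ⟨k, d, a'⟩) = pt (ControlGrid.tail x)))
      (fun k l g e s hg hf D D' a b hab hQ d' b' hD' hb => ?_)
      hg h (fun d a' hd ha => ?_) y.2.1 y.2.2 rfl fun _ => rfl
    · exact this.imp (fun h => ⟨h.1, h.2.1⟩) fun h => ⟨h.1, h.2.1⟩
    · subst hD'
      obtain ⟨d, rfl⟩ := g.perm.surjective d'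
      have hD : D = {d} := by
        have h1 := hab.1
        rw [← Finset.image_singleton] at h1
        exact (Finset.image_injective g.perm.injective h1).symm
      subst hD
      rw [idx_ext hb]
      have h1 := hc.1 ⟨k, d, a⟩ ⟨l, g.perm d, b⟩ g e s hg hf hab
      rcases hpt (z := ⟨k, d, a⟩) (w := ⟨l, g.perm d, b⟩) hg hab with ⟨h2, h3, h4⟩ | ⟨h2, h3, h4⟩ <;>
      rcases hQ d a rfl fun _ => rfl with ⟨h5, h6, h7⟩ | ⟨h5, h6, h7⟩
      · exact Or.inl ⟨by rw [h1, h2, h5, one_mul], h3.trans h6, h4.trans h7⟩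
      · exact Or.inr ⟨by rw [h1, h2, h5, one_mul], h3.trans h6, h4.trans h7⟩
      · exact Or.inr ⟨by rw [h1, h2, h5, neg_one_mul], h4.trans h7, h3.trans h6⟩
      · exact Or.inl ⟨by rw [h1, h2, h5, neg_one_mul, neg_neg], h4.trans h7, h3.trans h6⟩
    · obtain ⟨i, d₀, a₀⟩ := x
      obtain rfl := Finset.singleton_injective hd
      exact Or.inl ⟨by rw [idx_ext ha], by rw [idx_ext ha], by rw [idx_ext ha]⟩
  rcases hpt hg h with ⟨h1, h2, h3⟩ | ⟨h1, h2, h3⟩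
  · rw [h1, one_mul]
    exact key.elim (fun h => h.1) fun h => absurd (h2.symm.trans h.2) hne
  · rw [h1, neg_one_mul]
    exact key.elim (fun h => absurd (h.2.symm.trans h3) hne) fun h => h.1

theorem mem_cochains1_iff {S : Set (ι × Fin 3 × Bool)} {c : M.LocalEdge → ℝ} :
    c ∈ M.cochains1 S ↔ c ∈ M.sideCochains1 S :=
  ⟨fun h => ⟨fun x y g _ _ hg _ hm => h.1 x y g hg hm, h.2⟩,
    fun h => ⟨fun _ _ _ hg hm => sideCochains1_matches hP h hg hm, h.2⟩⟩

/-- Matching vertex coefficients are functions on the vertices of the glued mesh. -/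
theorem mem_sideCochains0_iff {S : Set (ι × Fin 3 × Bool)} {c : M.LocalVertex → ℝ} :
    c ∈ M.sideCochains0 S ↔ ∃ f ∈ M.cochains0 S, c = fun x => f (ControlGrid.toVertex x) := by
  constructor
  · intro hc
    refine ⟨Quot.lift c fun x y ⟨g, hg, hm⟩ => (sideCochains0_matches hP hc hg hm).symm, ?_, rfl⟩
    rintro _ ⟨x, rfl, hx⟩
    exact hc.2 x hx
  · rintro ⟨f, hf, rfl⟩
    refine ⟨fun x y g _ _ hg _ hm => congrArg f (Quot.sound ⟨g, hg, hm⟩).symm, fun x hx => ?_⟩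
    exact hf _ ⟨x, rfl, hx⟩

end MultiPatch
end

noncomputable section

/-! ### Paths and forests in the control-mesh graph -/

namespace ControlGrid

variable {ι : Type*} {M : ControlGrid ι}

instance [Finite ι] : Finite M.Edge :=
  Finite.of_surjective (toEdge : M.LocalEdge → M.Edge) Quot.mk_surjective

/-- Two local edges that represent the same edge of the glued mesh have the same end points and
carry the same cochain values, up to their orientations. -/
theorem endpoints_of_toEdge_eq {x y : M.LocalEdge} (h : toEdge x = toEdge y) :
    (toVertex (tail x) = toVertex (tail y) ∧ toVertex (head x) = toVertex (head y) ∧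
      ∀ S, ∀ c ∈ M.cochains1 S, c y = c x) ∨
    (toVertex (tail x) = toVertex (head y) ∧ toVertex (head x) = toVertex (tail y) ∧
      ∀ S, ∀ c ∈ M.cochains1 S, c y = -c x) := by
  have h' := Quot.eqvGen_exact h
  clear h
  induction h' with
  | rel x y hxy =>
    obtain ⟨g, hg, hm⟩ := hxy
    rcases matches_endpoints hm with ⟨h1, h2, h3⟩ | ⟨h1, h2, h3⟩
    · exact Or.inl ⟨Quot.sound ⟨g, hg, h2⟩, Quot.sound ⟨g, hg, h3⟩, fun S c hc => by
        simpa [h1] using hc.1 x y g hg hm⟩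
    · exact Or.inr ⟨Quot.sound ⟨g, hg, h2⟩, Quot.sound ⟨g, hg, h3⟩, fun S c hc => by
        simpa [h1] using hc.1 x y g hg hm⟩
  | refl x => exact Or.inl ⟨rfl, rfl, fun _ _ _ => rfl⟩
  | symm x y h ih =>
    rcases ih with ⟨h1, h2, h3⟩ | ⟨h1, h2, h3⟩
    · exact Or.inl ⟨h1.symm, h2.symm, fun S c hc => (h3 S c hc).symm⟩
    · exact Or.inr ⟨h2.symm, h1.symm, fun S c hc => by rw [h3 S c hc, neg_neg]⟩
  | trans x y z h h' ih ih' =>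
    rcases ih with ⟨h1, h2, h3⟩ | ⟨h1, h2, h3⟩ <;>
    rcases ih' with ⟨h4, h5, h6⟩ | ⟨h4, h5, h6⟩
    · exact Or.inl ⟨h1.trans h4, h2.trans h5, fun S c hc => (h6 S c hc).trans (h3 S c hc)⟩
    · exact Or.inr ⟨h1.trans h4, h2.trans h5, fun S c hc => by rw [h6 S c hc, h3 S c hc]⟩
    · exact Or.inr ⟨h1.trans h5, h2.trans h4, fun S c hc => by rw [h6 S c hc, h3 S c hc]⟩
    · exact Or.inl ⟨h1.trans h5, h2.trans h4, fun S c hc => by rw [h6 S c hc, h3 S c hc, neg_neg]⟩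

variable {A B : Set M.Edge} {u v w : M.Vertex}

theorem cochain_eq_zero_of_toEdge_eq {S : Set (ι × Fin 3 × Bool)} {c : M.LocalEdge → ℝ}
    (hc : c ∈ M.cochains1 S) {x y : M.LocalEdge} (h : toEdge x = toEdge y) (hx : c x = 0) :
    c y = 0 := by
  rcases endpoints_of_toEdge_eq h with ⟨-, -, h3⟩ | ⟨-, -, h3⟩ <;> simp [h3 S c hc, hx]

theorem joined_refl (v : M.Vertex) : M.Joined A v v := Relation.EqvGen.refl v

theorem Joined.symm (h : M.Joined A v w) : M.Joined A w v := Relation.EqvGen.symm _ _ h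

theorem Joined.trans (h : M.Joined A u v) (h' : M.Joined A v w) : M.Joined A u w :=
  Relation.EqvGen.trans _ _ _ h h'

theorem joined_of_mem {x : M.LocalEdge} (hx : toEdge x ∈ A) :
    M.Joined A (toVertex (tail x)) (toVertex (head x)) :=
  Relation.EqvGen.rel _ _ ⟨x, hx, rfl, rfl⟩

/-- A function of the vertices that does not change along the edges in `A` does not change along the
paths in `A`. -/
theorem Joined.map_eq {α : Type*} {f : M.Vertex → α} (h : M.Joined A v w)
    (hf : ∀ x : M.LocalEdge, toEdge x ∈ A → f (toVertex (tail x)) = f (toVertex (head x))) :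
    f v = f w := by
  induction h with
  | rel _ _ h =>
    obtain ⟨x, hx, rfl, rfl⟩ := h
    exact hf x hx
  | refl _ => rfl
  | symm _ _ _ ih => exact ih.symm
  | trans _ _ _ _ _ ih ih' => exact ih.trans ih'

theorem Joined.mono (hAB : A ⊆ B) (h : M.Joined A v w) : M.Joined B v w :=
  Relation.EqvGen.mono (fun _ _ ⟨x, hx, hv⟩ => ⟨x, hAB hx, hv⟩) _ _ h

theorem joined_congr (h : M.Joined A v w) : M.Joined A u v = M.Joined A u w :=
  propext ⟨fun h' => h'.trans h, fun h' => h'.trans h.symm⟩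

theorem joined_insert {x : M.LocalEdge} (h : M.Joined (insert (toEdge x) A) v w) :
    M.Joined A v w ∨
    (M.Joined A v (toVertex (tail x)) ∧ M.Joined A (toVertex (head x)) w) ∨
    (M.Joined A v (toVertex (head x)) ∧ M.Joined A (toVertex (tail x)) w) := by
  classical
  -- the component of `v` in `A`, with the component of the tail replaced by that of the head
  let f : M.Vertex → Set M.Vertex := fun v =>
    if M.Joined A (toVertex (tail x)) v then {u | M.Joined A u (toVertex (head x))}
    else {u | M.Joined A u v}
  have hA : ∀ {v w}, M.Joined A v w → f v = f w := fun {v w} hvw => by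
    simp only [f, joined_congr hvw]
  have hx : f (toVertex (tail x)) = f (toVertex (head x)) := by
    simp only [f, joined_refl, if_true]
    split_ifs <;> rfl
  have key : f v = f w := h.map_eq fun y hy => by
    rcases hy with hy | hy
    · rcases endpoints_of_toEdge_eq hy with ⟨h1, h2, -⟩ | ⟨h1, h2, -⟩
      · rw [h1, h2, hx]
      · rw [h1, h2, hx]
    · exact hA (joined_of_mem hy)
  simp only [f] at key
  split_ifs at key with h1 h2 h2
  · exact Or.inl (h1.symm.trans h2)
  · exact Or.inr (Or.inl ⟨h1.symm, (Set.ext_iff.1 key w).2 (joined_refl w) |>.symm⟩)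
  · exact Or.inr (Or.inr ⟨(Set.ext_iff.1 key v).1 (joined_refl v), h2⟩)
  · exact Or.inl ((Set.ext_iff.1 key v).1 (joined_refl v))

/-- A set of edges without cycles: no edge joins vertices that are joined by the other edges. -/
def Acyclic (A : Set M.Edge) : Prop :=
  ∀ x : M.LocalEdge, toEdge x ∈ A →
    ¬ M.Joined (A \ {toEdge x}) (toVertex (tail x)) (toVertex (head x))

theorem Acyclic.mono (hB : Acyclic B) (hAB : A ⊆ B) : Acyclic A := fun x hx h =>
  hB x (hAB hx) (h.mono (sdiff_subset_sdiff_left hAB))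

theorem Acyclic.insert (hA : Acyclic A) {x : M.LocalEdge}
    (hx : ¬ M.Joined A (toVertex (tail x)) (toVertex (head x))) :
    Acyclic (insert (toEdge x) A) := by
  intro y hy h
  by_cases hyx : toEdge y = toEdge x
  · have h' : M.Joined A (toVertex (tail y)) (toVertex (head y)) :=
      h.mono fun E hE => hE.1.resolve_left fun h3 => hE.2 (h3.trans hyx.symm)
    rcases endpoints_of_toEdge_eq hyx with ⟨h1, h2, -⟩ | ⟨h1, h2, -⟩
    · exact hx (h1 ▸ h2 ▸ h')
    · exact hx (h1 ▸ h2 ▸ h').symm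
  · have hyA : toEdge y ∈ A := hy.resolve_left hyx
    have h' : M.Joined (Insert.insert (toEdge x) (A \ {toEdge y})) (toVertex (tail y))
        (toVertex (head y)) :=
      h.mono fun E hE => hE.1.imp id fun h3 => ⟨h3, hE.2⟩
    have hyj := joined_of_mem hyA
    have hsub : A \ {toEdge y} ⊆ A := sdiff_subset
    rcases joined_insert h' with h1 | ⟨h1, h2⟩ | ⟨h1, h2⟩
    · exact hA y hyA h1
    · exact hx (((h1.mono hsub).symm.trans hyj).trans (h2.mono hsub).symm)
    · exact hx (((h2.mono hsub).trans hyj.symm).trans (h1.mono hsub))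

/-- On a forest each cochain is the coboundary of a potential. When an edge is added to a forest,
the potential is adapted by a constant off the tree that contains the tail of the edge. -/
theorem Acyclic.exists_potential {S : Set (ι × Fin 3 × Bool)} {c : M.LocalEdge → ℝ}
    (hc : c ∈ M.cochains1 S) (hfin : A.Finite) (hA : Acyclic A) :
    ∃ f, ∀ x : M.LocalEdge, toEdge x ∈ A → M.coboundary f x = c x := by
  classical
  induction A, hfin using Set.Finite.induction_on with
  | empty => exact ⟨0, fun x hx => hx.elim⟩
  | @insert E A hE _ ih =>
    obtain ⟨f, hf⟩ := ih (hA.mono (subset_insert E A))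
    obtain ⟨x, rfl⟩ := Quot.exists_rep E
    change toEdge x ∉ A at hE
    have hx : ¬ M.Joined A (toVertex (tail x)) (toVertex (head x)) := fun h =>
      hA x (mem_insert _ _) (h.mono fun E' hE' => ⟨mem_insert_of_mem _ hE', fun h => hE (h ▸ hE')⟩)
    let k : M.Vertex → ℝ := fun v =>
      if M.Joined A (toVertex (tail x)) v then 0 else c x - M.coboundary f x
    refine ⟨f + k, fun y hy => ?_⟩
    rw [map_add, Pi.add_apply]
    have hk : M.coboundary k x = c x - M.coboundary f x := by
      simp [coboundary, k, hx, joined_refl]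
    rcases hy with hy | hy
    · change toEdge y = toEdge x at hy
      rcases endpoints_of_toEdge_eq hy.symm with ⟨h1, h2, h3⟩ | ⟨h1, h2, h3⟩
      all_goals
        rw [h3 S c hc]
        simp only [coboundary, LinearMap.coe_mk, AddHom.coe_mk] at hk ⊢
        rw [← h1, ← h2]
        linarith
    · have : M.coboundary k y = 0 := by
        simp [coboundary, k, joined_congr (joined_of_mem hy)]
      rw [this, hf y hy, add_zero]

end ControlGrid
end

noncomputable section

/-! ### Gauge trees and relative cochains -/

namespace ControlGrid

variable {ι : Type*} {M : ControlGrid ι} {S : Set (ι × Fin 3 × Bool)} {T : Set M.Edge}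

theorem onDirichlet_endpoints {x : M.LocalEdge} (hx : M.OnDirichlet S x.2.2) :
    toVertex (tail x) ∈ M.dirichletVertices S ∧ toVertex (head x) ∈ M.dirichletVertices S := by
  obtain ⟨e, s, he, hs⟩ := hx
  refine ⟨⟨_, rfl, e, s, he, Finset.notMem_empty _, hs.2⟩,
    ⟨_, rfl, e, s, he, Finset.notMem_empty _, ?_⟩⟩
  have hne : e ≠ x.2.1 := fun h => hs.1 (Finset.mem_singleton.2 h)
  simpa [head, hne] using hs.2

theorem coboundary_mem_cochains1 {f : M.Vertex → ℝ} (hf : f ∈ M.cochains0 S) :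
    M.coboundary f ∈ M.cochains1 S := by
  refine ⟨fun x y g hg hm => ?_, fun x hx => ?_⟩
  · rcases matches_endpoints hm with ⟨h1, h2, h3⟩ | ⟨h1, h2, h3⟩
    all_goals
      have h4 := congrArg f (Quot.sound ⟨g, hg, h2⟩)
      have h5 := congrArg f (Quot.sound ⟨g, hg, h3⟩)
      change f (toVertex _) = f (toVertex _) at h4 h5
      simp [coboundary, h1, h4, h5]
  · have h := onDirichlet_endpoints hx
    simp [coboundary, hf _ h.1, hf _ h.2]

theorem circulation_coboundary (f : M.Vertex → ℝ) (q : M.LocalFacet) :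
    M.circulation (M.coboundary f) q = 0 := by
  obtain ⟨i, d, a⟩ := q
  have h : ∀ x y : M.LocalVertex, x = y → f (toVertex x) = f (toVertex y) := fun x y h => by rw [h]
  have h1 : d + 1 ≠ d := (by decide : ∀ d : Fin 3, d + 1 ≠ d) d
  have h2 : d + 2 ≠ d := (by decide : ∀ d : Fin 3, d + 2 ≠ d) d
  have h3 : d + 2 ≠ d + 1 := (by decide : ∀ d : Fin 3, d + 2 ≠ d + 1) d
  have hcases := (by decide : ∀ d e : Fin 3, e = d ∨ e = d + 1 ∨ e = d + 2) d
  have e1 := h (head (facetEdge ⟨i, d, a⟩ (d + 1) h1 false))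
    (tail (facetEdge ⟨i, d, a⟩ (d + 2) h2 true)) (by
      refine congrArg (Sigma.mk i) (funext fun e => Fin.ext ?_)
      rcases hcases e with rfl | rfl | rfl <;>
        simp [facetEdge, h1, h2, h3, h1.symm, h2.symm, h3.symm])
  have e2 := h (head (facetEdge ⟨i, d, a⟩ (d + 2) h2 false))
    (tail (facetEdge ⟨i, d, a⟩ (d + 1) h1 true)) (by
      refine congrArg (Sigma.mk i) (funext fun e => Fin.ext ?_)
      rcases hcases e with rfl | rfl | rfl <;>
        simp [facetEdge, h1, h2, h3, h1.symm, h2.symm, h3.symm])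
  have e3 := h (head (facetEdge ⟨i, d, a⟩ (d + 2) h2 true))
    (head (facetEdge ⟨i, d, a⟩ (d + 1) h1 true)) (by
      refine congrArg (Sigma.mk i) (funext fun e => Fin.ext ?_)
      rcases hcases e with rfl | rfl | rfl <;>
        simp [facetEdge, h1, h2, h3, h1.symm, h2.symm, h3.symm])
  have e4 := h (tail (facetEdge ⟨i, d, a⟩ (d + 2) h2 false))
    (tail (facetEdge ⟨i, d, a⟩ (d + 1) h1 false)) (by
      refine congrArg (Sigma.mk i) (funext fun e => Fin.ext ?_)
      simp [facetEdge])
  simp only [circulation, coboundary, LinearMap.coe_mk, AddHom.coe_mk]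
  linarith

theorem coboundaries1_le : M.coboundaries1 S ≤ M.cocycles1 S := by
  rintro _ ⟨f, hf, rfl⟩
  exact ⟨coboundary_mem_cochains1 hf, circulation_coboundary f⟩

theorem cocycles1_le : M.cocycles1 S ≤ M.cochains1 S := fun _ h => h.1

variable (S T) in
/-- The relative `1`-cochains that vanish on the edges in `T`. -/
def gaugedCochains : Submodule ℝ (M.LocalEdge → ℝ) where
  carrier := {c | c ∈ M.cochains1 S ∧ ∀ x : M.LocalEdge, toEdge x ∈ T → c x = 0}
  zero_mem' := ⟨zero_mem _, fun _ _ => rfl⟩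
  add_mem' := fun h h' => ⟨add_mem h.1 h'.1, fun x hx => by simp [h.2 x hx, h'.2 x hx]⟩
  smul_mem' := fun r _ h => ⟨Submodule.smul_mem _ r h.1, fun x hx => by simp [h.2 x hx]⟩

theorem eq_zero_of_mem_dirichletEdges {c : M.LocalEdge → ℝ} (hc : c ∈ M.cochains1 S)
    {x : M.LocalEdge} (hx : toEdge x ∈ M.dirichletEdges S) : c x = 0 := by
  obtain ⟨y, hy, hD⟩ := hx
  exact cochain_eq_zero_of_toEdge_eq hc hy (hc.2 y hD)

namespace IsGaugeTree

/-- A potential that is constant along the tree vanishes up to the constant of a spanning tree: the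
tree reaches each vertex from the Dirichlet vertices, if there are any. -/
theorem gauged_inf_coboundaries (hT : M.IsGaugeTree S T) :
    gaugedCochains S T ⊓ M.coboundaries1 S = ⊥ := by
  refine (Submodule.eq_bot_iff _).2 ?_
  rintro _ ⟨⟨-, h0⟩, f, hf, rfl⟩
  have hj : ∀ {v w}, M.Joined T v w → f v = f w := fun h =>
    h.map_eq fun x hx => by
      have := h0 x hx
      simp only [coboundary, LinearMap.coe_mk, AddHom.coe_mk] at this
      linarith
  rcases (M.dirichletVertices S).eq_empty_or_nonempty with hD | hD
  · funext x
    exact sub_eq_zero.2 (hj (hT.spans hD _ _))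
  · have : f = 0 := funext fun v => by
      obtain ⟨w, hw, hwv⟩ := hT.reaches hD v
      rw [← hj hwv, hf w hw, Pi.zero_apply]
    rw [this, map_zero]

/-- Each relative cochain agrees on a gauge tree with the coboundary of a potential that vanishes on
the Dirichlet vertices: a potential on the forest is constant on each component of the Dirichlet
subgraph, and each tree meets at most one of them, so that this constant can be subtracted. -/
theorem gauged_sup_coboundaries [Finite ι] (hT : M.IsGaugeTree S T) :
    gaugedCochains S T ⊔ M.coboundaries1 S = M.cochains1 S := by
  classical
  refine le_antisymm (sup_le (fun c h => h.1) (coboundaries1_le.trans cocycles1_le)) fun c hc => ?_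
  obtain ⟨f, hf⟩ := Acyclic.exists_potential hc T.toFinite hT.acyclic
  have hD : ∀ {v w}, M.Joined (M.dirichletEdges S) v w → f v = f w := fun h =>
    h.map_eq fun x hx => (hT.dirichlet x hx).map_eq fun y hy => by
      have h1 := hf y hy.1
      rw [eq_zero_of_mem_dirichletEdges hc hy.2] at h1
      exact (sub_eq_zero.1 h1).symm
  let K : (M.Vertex → Prop) → ℝ := fun q => if h : ∃ w, q w then f h.choose else 0
  let k : M.Vertex → ℝ := fun v => K fun w => w ∈ M.dirichletVertices S ∧ M.Joined T w v
  have hk0 : f - k ∈ M.cochains0 S := fun v hv => by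
    have h : ∃ w, w ∈ M.dirichletVertices S ∧ M.Joined T w v := ⟨v, hv, joined_refl v⟩
    have h1 : k v = f h.choose := dif_pos h
    rw [Pi.sub_apply, h1, hD (hT.separates _ h.choose_spec.1 v hv h.choose_spec.2), sub_self]
  have hk : ∀ x : M.LocalEdge, toEdge x ∈ T → M.coboundary k x = 0 := fun x hx => by
    refine sub_eq_zero.2 (congrArg K (funext fun w => ?_))
    rw [joined_congr (joined_of_mem hx)]
  refine Submodule.mem_sup.2 ⟨c - M.coboundary (f - k), ⟨sub_mem hc (coboundary_mem_cochains1 hk0),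
    fun x hx => ?_⟩, _, ⟨f - k, hk0, rfl⟩, sub_add_cancel _ _⟩
  rw [Pi.sub_apply, map_sub, Pi.sub_apply, hk x hx, hf x hx, sub_zero, sub_self]

end IsGaugeTree

/-- A forest that is maximal among the forests that contain a spanning forest of the Dirichlet
subgraph and do not connect different components of it is a gauge tree: otherwise some edge leaves
the set of the vertices reached so far, and it can be added. -/
theorem exists_isGaugeTree [Finite ι] (hconn : ∀ v w, M.Joined univ v w) :
    ∃ T, M.IsGaugeTree S T := by
  obtain ⟨F, hF⟩ := (Set.toFinite {A : Set M.Edge | Acyclic A ∧ A ⊆ M.dirichletEdges S}).exists_maximal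
    ⟨∅, fun x hx => hx.elim, empty_subset _⟩
  have hFD : ∀ x : M.LocalEdge, toEdge x ∈ M.dirichletEdges S →
      M.Joined F (toVertex (tail x)) (toVertex (head x)) := fun x hx => by
    by_contra h
    exact h (joined_of_mem (hF.2 ⟨hF.1.1.insert h, insert_subset hx hF.1.2⟩ (subset_insert _ _)
      (mem_insert _ _)))
  obtain ⟨T, hT⟩ := (Set.toFinite {A : Set M.Edge | Acyclic A ∧ F ⊆ A ∧
    ∀ v ∈ M.dirichletVertices S, ∀ w ∈ M.dirichletVertices S,
      M.Joined A v w → M.Joined (M.dirichletEdges S) v w}).exists_maximal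
    ⟨F, hF.1.1, subset_rfl, fun _ _ _ _ h => h.mono hF.1.2⟩
  obtain ⟨⟨hac, hFT, hsep⟩, hmax⟩ := hT
  have key : ∀ R : Set M.Vertex, R.Nonempty → M.dirichletVertices S ⊆ R →
      (∀ v w, M.Joined T v w → v ∈ R → w ∈ R) → ∀ w, w ∈ R := by
    rintro R ⟨v, hv⟩ hDR hR w
    by_contra hw
    obtain ⟨x, hx⟩ : ∃ x : M.LocalEdge, ¬ ((toVertex (tail x) ∈ R) = (toVertex (head x) ∈ R)) := by
      by_contra! h
      have h1 : (v ∈ R) = (w ∈ R) := (hconn v w).map_eq fun x _ => h x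
      exact hw (h1 ▸ hv)
    have hxT : ¬ M.Joined T (toVertex (tail x)) (toVertex (head x)) := fun h =>
      hx (propext ⟨hR _ _ h, hR _ _ h.symm⟩)
    refine hxT (joined_of_mem (hmax ⟨hac.insert hxT, hFT.trans (subset_insert _ _), ?_⟩
      (subset_insert _ _) (mem_insert (toEdge x) T)))
    intro v hv w hw h
    rcases joined_insert h with h | ⟨h1, h2⟩ | ⟨h1, h2⟩
    · exact hsep v hv w hw h
    · exact absurd (propext (iff_of_true (hR _ _ h1 (hDR hv)) (hR _ _ h2.symm (hDR hw)))) hx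
    · exact absurd (propext (iff_of_true (hR _ _ h2.symm (hDR hw)) (hR _ _ h1 (hDR hv)))) hx
  refine ⟨T, hac, fun x hx => (hFD x hx).mono (subset_inter hFT hF.1.2), fun hD v => ?_, ?_, hsep⟩
  · exact key {w | M.Joined T v w} ⟨v, joined_refl v⟩ (hD ▸ empty_subset _)
      fun _ _ h h' => Joined.trans h' h
  · exact fun ⟨d, hd⟩ => key {v | ∃ w ∈ M.dirichletVertices S, M.Joined T w v}
      ⟨d, d, hd, joined_refl d⟩ (fun v hv => ⟨v, hv, joined_refl v⟩)
      fun _ _ h ⟨w, hw, h'⟩ => ⟨w, hw, h'.trans h⟩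

/-! ### Harmonic edges -/

/-- A space of functions on a finite set is parametrised by the values at as many points as its
dimension: the points of a minimal set on which no nonzero function of the space vanishes. -/
theorem exists_interpolation_set {X : Type*} [Finite X] (W : Submodule ℝ (X → ℝ)) :
    ∃ s : Set X, s.ncard = Module.finrank ℝ W ∧ (∀ w ∈ W, (∀ x ∈ s, w x = 0) → w = 0) ∧
      ∀ b : X → ℝ, ∃ w ∈ W, ∀ x ∈ s, w x = b x := by
  classical
  have := Fintype.ofFinite X
  obtain ⟨s, hs⟩ := (Set.toFinite {s : Set X | ∀ w ∈ W, (∀ x ∈ s, w x = 0) → w = 0}).exists_minimal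
    ⟨univ, fun w _ h => funext fun x => h x (mem_univ x)⟩
  have h1 : ∀ x : s, ∃ w ∈ W, ∀ y ∈ s, w y = if y = x.1 then 1 else 0 := by
    rintro ⟨x, hx⟩
    have h2 : ¬ ∀ w ∈ W, (∀ y ∈ s \ {x}, w y = 0) → w = 0 := fun h =>
      (hs.2 h sdiff_subset hx).2 rfl
    push Not at h2
    obtain ⟨w, hw, h3, h4⟩ := h2
    have h5 : w x ≠ 0 := fun h5 => h4 (hs.1 w hw fun y hy => by
      by_cases hyx : y = x
      · rw [hyx, h5]
      · exact h3 y ⟨hy, hyx⟩)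
    refine ⟨(w x)⁻¹ • w, Submodule.smul_mem _ _ hw, fun y hy => ?_⟩
    split_ifs with hyx
    · simp [hyx, h5]
    · simp [h3 y ⟨hy, hyx⟩]
  choose e he h2 using h1
  have h3 : ∀ b : X → ℝ, ∃ w ∈ W, ∀ x ∈ s, w x = b x := fun b => by
    refine ⟨∑ x : s, b x • e x, Submodule.sum_mem _ fun x _ => Submodule.smul_mem _ _ (he x),
      fun y hy => ?_⟩
    rw [Finset.sum_apply, Finset.sum_eq_single ⟨y, hy⟩]
    · simp [h2 _ y hy]
    · intro x _ hx
      have : y ≠ x := fun h => hx (Subtype.ext h.symm)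
      simp [h2 _ y hy, this]
    · simp
  refine ⟨s, ?_, hs.1, h3⟩
  let r : W →ₗ[ℝ] (s → ℝ) := (LinearMap.funLeft ℝ ℝ Subtype.val).comp W.subtype
  have hr : Function.Bijective r := by
    refine ⟨(injective_iff_map_eq_zero r).2 fun w hw => ?_, fun b => ?_⟩
    · exact Subtype.ext (hs.1 w.1 w.2 fun x hx => congrFun hw ⟨x, hx⟩)
    · obtain ⟨w, hw, h⟩ := h3 fun x => if hx : x ∈ s then b ⟨x, hx⟩ else 0
      exact ⟨⟨w, hw⟩, funext fun x => (h x x.2).trans (dif_pos x.2)⟩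
  rw [(LinearEquiv.ofBijective r hr).finrank_eq, Module.finrank_fintype_fun_eq_card,
    Set.ncard_eq_toFinset_card', Set.toFinset_card]

namespace IsGaugeTree

variable [Finite ι]

/-- The cocycles that vanish on a gauge tree represent the cohomology classes. -/
theorem finrank_gauged_inf_cocycles (hT : M.IsGaugeTree S T) :
    Module.finrank ℝ ↥(gaugedCochains S T ⊓ M.cocycles1 S) = M.relativeBetti1 S := by
  have hc : IsCompl ((M.coboundaries1 S).submoduleOf (M.cocycles1 S))
      ((gaugedCochains S T ⊓ M.cocycles1 S).submoduleOf (M.cocycles1 S)) := by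
    refine ⟨Submodule.disjoint_def.2 fun z hz hz' => Subtype.ext ?_,
      codisjoint_iff.2 (eq_top_iff.2 fun z _ => ?_)⟩
    · have : z.1 ∈ gaugedCochains S T ⊓ M.coboundaries1 S := ⟨hz'.1, hz⟩
      rw [hT.gauged_inf_coboundaries] at this
      exact this
    · have hz : z.1 ∈ gaugedCochains S T ⊔ M.coboundaries1 S := by
        rw [hT.gauged_sup_coboundaries]
        exact z.2.1
      obtain ⟨n, hn, b, hb, hnb⟩ := Submodule.mem_sup.1 hz
      have hb' := coboundaries1_le hb
      have hn' : n ∈ M.cocycles1 S := by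
        rw [← add_sub_cancel_right n b, hnb]
        exact sub_mem z.2 hb'
      exact Submodule.mem_sup.2 ⟨⟨b, hb'⟩, hb, ⟨n, hn'⟩, ⟨hn, hn'⟩,
        Subtype.ext ((add_comm _ _).trans hnb)⟩
  rw [relativeBetti1, (Submodule.quotientEquivOfIsCompl _ _ hc).finrank_eq,
    (Submodule.submoduleOfEquivOfLe inf_le_right).finrank_eq]

theorem gauged_inf_cocycles_iff (hT : M.IsGaugeTree S T) :
    (gaugedCochains S T ⊓ M.cocycles1 S = ⊥ ∧ gaugedCochains S T ⊔ M.cocycles1 S = M.cochains1 S) ↔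
      M.relativeBetti1 S = 0 := by
  rw [← hT.finrank_gauged_inf_cocycles, Submodule.finrank_eq_zero]
  refine and_iff_left (le_antisymm (sup_le (fun c h => h.1) cocycles1_le) ?_)
  rw [← hT.gauged_sup_coboundaries]
  exact sup_le_sup_left coboundaries1_le _

/-- The cocycles that vanish on the tree are parametrised by their values on a set of edges. None of
these edges lies in the tree or on the Dirichlet boundary, where such cocycles vanish, and different
local edges of a minimal set are not identified with each other. -/
theorem exists_harmonic_edges (hT : M.IsGaugeTree S T) :
    ∃ H : Set M.Edge, H ⊆ (T ∪ M.dirichletEdges S)ᶜ ∧ H.ncard = M.relativeBetti1 S ∧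
      gaugedCochains S (T ∪ H) ⊓ M.cocycles1 S = ⊥ ∧
      gaugedCochains S (T ∪ H) ⊔ M.cocycles1 S = M.cochains1 S := by
  classical
  obtain ⟨s, hs, hinj, hsurj⟩ := exists_interpolation_set (gaugedCochains S T ⊓ M.cocycles1 S)
  have hone : ∀ x ∈ s, ∃ w ∈ gaugedCochains S T ⊓ M.cocycles1 S,
      ∀ y ∈ s, w y = if y = x then 1 else 0 := fun x _ => hsurj fun y => if y = x then 1 else 0
  refine ⟨toEdge '' s, ?_, ?_, ?_, le_antisymm (sup_le (fun c h => h.1) cocycles1_le) ?_⟩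
  · rintro _ ⟨x, hx, rfl⟩ hxT
    obtain ⟨w, hw, h⟩ := hone x hx
    have h1 : w x = 1 := by simp [h x hx]
    have h2 : w x = 0 := hxT.elim (hw.1.2 x) (eq_zero_of_mem_dirichletEdges hw.1.1)
    exact one_ne_zero (h1.symm.trans h2)
  · rw [Set.InjOn.ncard_image, hs, hT.finrank_gauged_inf_cocycles]
    intro x hx y hy hxy
    by_contra hne
    obtain ⟨w, hw, h⟩ := hone x hx
    have h1 : w x = 0 := cochain_eq_zero_of_toEdge_eq hw.1.1 hxy.symm (by simp [h y hy, Ne.symm hne])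
    simp [h x hx] at h1
  · refine (Submodule.eq_bot_iff _).2 fun c ⟨hc, hz⟩ => hinj c
      ⟨⟨hc.1, fun x hx => hc.2 x (Or.inl hx)⟩, hz⟩ fun x hx => hc.2 x (Or.inr ⟨x, hx, rfl⟩)
  · rw [← hT.gauged_sup_coboundaries]
    refine sup_le (fun n hn => ?_) (coboundaries1_le.trans le_sup_right)
    obtain ⟨w, hw, h⟩ := hsurj n
    refine Submodule.mem_sup.2 ⟨n - w, ⟨sub_mem hn.1 hw.1.1, fun x hx => ?_⟩, w, hw.2,
      sub_add_cancel n w⟩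
    rcases hx with hx | ⟨y, hy, hyx⟩
    · rw [Pi.sub_apply, hn.2 x hx, hw.1.2 x hx, sub_zero]
    · exact cochain_eq_zero_of_toEdge_eq (sub_mem hn.1 hw.1.1) hyx
        (by rw [Pi.sub_apply, h y hy, sub_self])

end IsGaugeTree

end ControlGrid
end

noncomputable section

/-! ### Connectivity of the control-mesh graph -/

namespace ControlGrid

variable {ι : Type*} {M : ControlGrid ι}

/-- The vertices of one patch are joined to its first vertex, by decreasing one index at a time. -/
theorem joined_corner {i : ι} {z : M.Idx i ∅} (hz : ∀ e, (z e : ℕ) = 0) (a : M.Idx i ∅) :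
    M.Joined univ (toVertex ⟨i, z⟩) (toVertex ⟨i, a⟩) := by
  induction hN : ∑ e, (a e : ℕ) generalizing a with
  | zero =>
    have : a = z := funext fun e => Fin.ext (by
      rw [hz e]
      exact Finset.sum_eq_zero_iff.1 hN e (Finset.mem_univ e))
    rw [this]
    exact joined_refl _
  | succ N ih =>
    obtain ⟨d, -, hd⟩ : ∃ d ∈ Finset.univ, (a d : ℕ) ≠ 0 := by
      by_contra! h
      rw [Finset.sum_eq_zero h] at hN
      omega
    have hlt : ∀ e, (a e : ℕ) < M.n i e := fun e => by
      have := (a e).isLt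
      simpa [ext] using this
    let x : M.LocalEdge := ⟨i, d, fun e => ⟨(a e : ℕ) - (if e = d then 1 else 0), by
      have := hlt e
      simp only [ext, Finset.mem_singleton]
      by_cases h : e = d
      · subst h
        simp only [if_true]
        omega
      · simpa only [h, if_false, Nat.sub_zero] using this⟩⟩
    have hhead : head x = ⟨i, a⟩ := by
      refine congrArg (Sigma.mk i) (funext fun e => Fin.ext ?_)
      change (a e : ℕ) - (if e = d then 1 else 0) + (if e = d then 1 else 0) = a e
      split_ifs with h
      · subst h
        omega
      · rfl
    have hsum : ∑ e, ((tail x).2 e : ℕ) = N := by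
      have h1 : ∑ e, (a e : ℕ) = ∑ e, (((tail x).2 e : ℕ) + if e = d then 1 else 0) :=
        Finset.sum_congr rfl fun e _ => by
          change (a e : ℕ) = (a e : ℕ) - (if e = d then 1 else 0) + if e = d then 1 else 0
          split_ifs with h
          · subst h
            omega
          · rfl
      rw [Finset.sum_add_distrib, Finset.sum_ite_eq' Finset.univ d] at h1
      simp only [Finset.mem_univ, if_true] at h1
      omega
    rw [← hhead]
    exact (ih (tail x).2 hsum).trans (joined_of_mem (mem_univ (toEdge x)))

end ControlGrid

namespace MultiPatch

variable {ι : Type*} {M : ControlGrid ι} {P : MultiPatch M} (hP : P.IsConforming)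
include hP

omit hP in
theorem joined_patch {i : ι} (a b : M.Idx i ∅) :
    M.Joined univ (ControlGrid.toVertex ⟨i, a⟩) (ControlGrid.toVertex ⟨i, b⟩) := by
  have hz := ControlGrid.joined_corner (M := M) (i := i)
    (z := fun e => ⟨0, Nat.lt_of_le_of_lt (Nat.zero_le _) (a e).isLt⟩) fun _ => rfl
  exact (hz a).symm.trans (hz b)

/-- Patches that meet share a corner of their common side, edge or vertex. -/
theorem exists_common_vertex {i j : ι} (h : (P.patch i ∩ P.patch j).Nonempty) :
    ∃ (a : M.Idx i ∅) (b : M.Idx j ∅),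
      ControlGrid.toVertex (⟨i, a⟩ : M.LocalVertex) = ControlGrid.toVertex ⟨j, b⟩ := by
  have h2 := hP.two_le
  have hcorner : ∀ (k : ι) (σ : Fin 3 → Bool), ∃ a : M.Idx k ∅, ∀ e, ControlGrid.OnSide a e (σ e) :=
    fun k σ => ⟨fun e => ⟨if σ e then M.n k e - 1 else 0, by
      have := h2 k e
      simp only [ControlGrid.ext, Finset.notMem_empty, if_false]
      split_ifs <;> omega⟩, fun e => ⟨Finset.notMem_empty _, by
        have := h2 k e
        cases h : σ e <;> simp only [h, if_true, Bool.false_eq_true, if_false]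
        omega⟩⟩
  by_cases hij : i = j
  · subst hij
    obtain ⟨a, -⟩ := hcorner i fun _ => false
    exact ⟨a, a, rfl⟩
  cases hg : M.glue i j with
  | none => exact absurd h (not_nonempty_iff_eq_empty.2 (hP.glue_none i j hij hg).inter_eq)
  | some g =>
    obtain ⟨a, ha⟩ := hcorner i fun e => g.face e = some true
    obtain ⟨b, hb⟩ := exists_matches hP hg (D := ∅) (D' := ∅) (by simp) a fun e s hs => by
      have := ha e
      simp only [hs, Option.some.injEq] at this
      cases s <;> simpa using this
    exact ⟨a, b, Quot.sound ⟨g, hg, hb⟩⟩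

/-- The patches whose vertices are joined to a given one, and the other patches, have disjoint
closed unions that cover the domain. -/
theorem joined_of_isConnected [Finite ι] (h : IsConnected P.domain) (v w : M.Vertex) :
    M.Joined univ v w := by
  obtain ⟨⟨i, a⟩, rfl⟩ := Quot.exists_rep v
  obtain ⟨⟨j, b⟩, rfl⟩ := Quot.exists_rep w
  by_contra hn
  let A : Set ι := {k | ∃ c : M.Idx k ∅,
    M.Joined univ (ControlGrid.toVertex ⟨i, a⟩) (ControlGrid.toVertex ⟨k, c⟩)}
  have hclosed : ∀ B : Set ι, IsClosed (⋃ k ∈ B, P.patch k) := fun B =>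
    B.toFinite.isClosed_biUnion fun k _ => (isCompact_patch hP k).isClosed
  have hne : ∀ k (B : Set ι), k ∈ B → (P.domain ∩ ⋃ k ∈ B, P.patch k).Nonempty := fun k B hk => by
    choose t ht using fun f => gen_nonempty (P := P) k f
    have hξ : WithLp.toLp 2 t ∈ P.genericCube k := ht
    exact ⟨_, param_mem_domain hP hξ, mem_biUnion hk ⟨_, P.genericCube_subset k hξ, rfl⟩⟩
  obtain ⟨x, -, hx, hx'⟩ := isPreconnected_closed_iff.1 h.isPreconnected _ _ (hclosed A) (hclosed Aᶜ)
    (fun x hx => by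
      obtain ⟨k, hk⟩ := mem_iUnion.1 (domain_subset hx)
      by_cases hkA : k ∈ A
      · exact Or.inl (mem_biUnion hkA hk)
      · exact Or.inr (mem_biUnion hkA hk))
    (hne i A ⟨a, ControlGrid.joined_refl _⟩)
    (hne j Aᶜ fun ⟨c, hc⟩ => hn (hc.trans (joined_patch c b)))
  obtain ⟨k, ⟨c, hc⟩, hxk⟩ := mem_iUnion₂.1 hx
  obtain ⟨l, hl, hxl⟩ := mem_iUnion₂.1 hx'
  obtain ⟨a', b', hab⟩ := exists_common_vertex hP ⟨x, hxk, hxl⟩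
  refine hl ⟨b', ?_⟩
  rw [← hab]
  exact hc.trans (joined_patch c a')

end MultiPatch

/-! ### Fields and their coefficients -/

/-- A linear relation that assigns to each coefficient vector exactly one field, and to each field
at most one coefficient vector, is the graph of an injective linear map. -/
theorem exists_linearMap_of_relation {X V : Type*} [AddCommGroup X] [Module ℝ X] [AddCommGroup V]
    [Module ℝ V] {R : V → X → Prop} (hadd : ∀ {u v c b}, R u c → R v b → R (u + v) (c + b))
    (hsmul : ∀ (r : ℝ) {u c}, R u c → R (r • u) (r • c)) (hex : ∀ c, ∃ u, R u c)
    (huniq : ∀ {u v c}, R u c → R v c → u = v) (hinj : ∀ {u c b}, R u c → R u b → c = b) :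
    ∃ Φ : X →ₗ[ℝ] V, Function.Injective Φ ∧ ∀ u c, R u c ↔ Φ c = u := by
  choose Φ hΦ using hex
  refine ⟨⟨⟨Φ, fun c b => huniq (hΦ _) (hadd (hΦ c) (hΦ b))⟩,
    fun r c => huniq (hΦ _) (hsmul r (hΦ c))⟩, fun c b h => ?_, fun u c => ⟨fun h => ?_, ?_⟩⟩
  · refine hinj (hΦ c) ?_
    have : Φ c = Φ b := h
    rw [this]
    exact hΦ b
  · exact huniq (hΦ c) h
  · rintro rfl
    exact hΦ c

/-- Subspaces that consist of the fields with the same coefficient vectors, for two ways to assign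
fields to coefficients, are isomorphic. -/
theorem exists_linearEquiv_of_linearMaps {X V W : Type*} [AddCommGroup X] [Module ℝ X]
    [AddCommGroup V] [Module ℝ V] [AddCommGroup W] [Module ℝ W] {Φ : X →ₗ[ℝ] V} {Ψ : X →ₗ[ℝ] W}
    (hΦ : Function.Injective Φ) (hΨ : Function.Injective Ψ) {U : Submodule ℝ V} {U' : Submodule ℝ W}
    (hU : ∀ u ∈ U, ∃ c, Φ c = u) (hU' : ∀ u ∈ U', ∃ c, Ψ c = u) (h : ∀ c, Φ c ∈ U ↔ Ψ c ∈ U') :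
    ∃ I : U ≃ₗ[ℝ] U', ∀ (u : U) (c : X), Φ c = u.1 → Ψ c = (I u).1 := by
  have h1 : (U.comap Φ).map Φ = U := Submodule.map_comap_eq_self fun u hu => hU u hu
  have h2 : (U.comap Φ).map Ψ = U' := by
    rw [show U.comap Φ = U'.comap Ψ from Submodule.ext h]
    exact Submodule.map_comap_eq_self fun u hu => hU' u hu
  let E1 := (Submodule.equivMapOfInjective Φ hΦ (U.comap Φ)).trans (LinearEquiv.ofEq _ _ h1)
  let E2 := (Submodule.equivMapOfInjective Ψ hΨ (U.comap Φ)).trans (LinearEquiv.ofEq _ _ h2)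
  refine ⟨E1.symm.trans E2, fun u c hc => ?_⟩
  have hcU : c ∈ U.comap Φ := by
    rw [Submodule.mem_comap, hc]
    exact u.2
  have : u = E1 ⟨c, hcU⟩ := Subtype.ext hc.symm
  rw [this, LinearEquiv.trans_apply, LinearEquiv.symm_apply_apply]
  rfl

namespace MultiPatch

variable {ι : Type*} [Fintype ι] {M : ControlGrid ι} {P : MultiPatch M} (hP : P.IsConforming)
include hP

theorem exists_field0 : ∃ Φ : (M.LocalVertex → ℝ) →ₗ[ℝ] L2Scalar P.domain, Function.Injective Φ ∧
    ∀ u c, P.HasCoeffs0 u c ↔ Φ c = u :=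
  exists_linearMap_of_relation HasCoeffs0.add HasCoeffs0.smul (exists_hasCoeffs0 hP)
    (HasCoeffs0.unique hP) (HasCoeffs0.unique_coeffs hP)

theorem exists_field1 : ∃ Φ : (M.LocalEdge → ℝ) →ₗ[ℝ] L2Vector P.domain, Function.Injective Φ ∧
    ∀ u c, P.HasCoeffs1 u c ↔ Φ c = u :=
  exists_linearMap_of_relation HasCoeffs1.add HasCoeffs1.smul (exists_hasCoeffs1 hP)
    (HasCoeffs1.unique hP) (HasCoeffs1.unique_coeffs hP)

theorem exists_field2 : ∃ Φ : (M.LocalFacet → ℝ) →ₗ[ℝ] L2Vector P.domain, Function.Injective Φ ∧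
    ∀ u c, P.HasCoeffs2 u c ↔ Φ c = u :=
  exists_linearMap_of_relation HasCoeffs2.add HasCoeffs2.smul (exists_hasCoeffs2 hP)
    (HasCoeffs2.unique hP) (HasCoeffs2.unique_coeffs hP)

theorem exists_field3 : ∃ Φ : (M.LocalCell → ℝ) →ₗ[ℝ] L2Scalar P.domain, Function.Injective Φ ∧
    ∀ u c, P.HasCoeffs3 u c ↔ Φ c = u :=
  exists_linearMap_of_relation HasCoeffs3.add HasCoeffs3.smul (exists_hasCoeffs3 hP)
    (HasCoeffs3.unique hP) (HasCoeffs3.unique_coeffs hP)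

variable {S : Set (ι × Fin 3 × Bool)} (hS : ∀ b ∈ S, M.IsBoundarySide b)
include hS

theorem mem_S1_iff_cochains1 {u : L2Vector P.domain} {c : M.LocalEdge → ℝ}
    (hu : P.HasCoeffs1 u c) : u ∈ P.S1 S ↔ c ∈ M.cochains1 S :=
  (mem_S1_iff hP hS hu).trans (mem_cochains1_iff hP).symm

theorem mem_curlKernel_iff_cocycles1 {u : L2Vector P.domain} {c : M.LocalEdge → ℝ}
    (hu : P.HasCoeffs1 u c) : u ∈ P.curlKernel S ↔ c ∈ M.cocycles1 S :=
  (mem_curlKernel_iff hP hS hu).trans (and_congr_left' (mem_cochains1_iff hP).symm)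

theorem mem_gradients_iff_coboundaries1 {u : L2Vector P.domain} {c : M.LocalEdge → ℝ}
    (hu : P.HasCoeffs1 u c) : u ∈ P.gradients S ↔ c ∈ M.coboundaries1 S := by
  rw [mem_gradients_iff hP hS hu]
  constructor
  · rintro ⟨b, hb, rfl⟩
    obtain ⟨f, hf, rfl⟩ := (mem_sideCochains0_iff hP).1 hb
    exact ⟨f, hf, rfl⟩
  · rintro ⟨f, hf, rfl⟩
    exact ⟨_, (mem_sideCochains0_iff hP).2 ⟨f, hf, rfl⟩, rfl⟩

/-- Whether a set of edges removes exactly a subspace can be decided on the coefficients. -/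
theorem removesExactly_iff {T : Set M.Edge} {K : Submodule ℝ (L2Vector P.domain)}
    {C : Submodule ℝ (M.LocalEdge → ℝ)} (hK : K ≤ P.S1 S)
    (h : ∀ {u c}, P.HasCoeffs1 u c → (u ∈ K ↔ c ∈ C)) :
    P.RemovesExactly S T K ↔ ControlGrid.gaugedCochains S T ⊓ C = ⊥ ∧
      ControlGrid.gaugedCochains S T ⊔ C = M.cochains1 S := by
  obtain ⟨Φ, hΦ, hR⟩ := exists_field1 hP
  have hmap : ∀ {U : Submodule ℝ (L2Vector P.domain)} {B : Submodule ℝ (M.LocalEdge → ℝ)},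
      U ≤ P.S1 S → (∀ {u c}, P.HasCoeffs1 u c → (u ∈ U ↔ c ∈ B)) → U = B.map Φ := by
    intro U B hU hB
    refine Submodule.ext fun u => ⟨fun hu => ?_, ?_⟩
    · obtain ⟨c, hc⟩ := (hU hu).1
      exact ⟨c, (hB hc).1 hu, (hR u c).1 hc⟩
    · rintro ⟨c, hc, rfl⟩
      exact (hB ((hR _ c).2 rfl)).2 hc
  have hgauged : P.gauged S T = (ControlGrid.gaugedCochains S T).map Φ :=
    hmap (fun u hu => hu.1) fun {u c} hu => and_congr (mem_S1_iff_cochains1 hP hS hu)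
      ⟨fun ⟨b, hb, hT⟩ => HasCoeffs1.unique_coeffs hP hb hu ▸ hT, fun hT => ⟨c, hu, hT⟩⟩
  rw [RemovesExactly, hgauged, hmap hK h, hmap le_rfl (mem_S1_iff_cochains1 hP hS),
    ← Submodule.map_inf _ hΦ, ← Submodule.map_sup,
    (Submodule.map_injective_of_injective hΦ).eq_iff,
    (Submodule.map_injective_of_injective hΦ).eq_iff' (Submodule.map_bot Φ)]

theorem removesExactly_curlKernel_iff {T : Set M.Edge} :
    P.RemovesExactly S T (P.curlKernel S) ↔
      ControlGrid.gaugedCochains S T ⊓ M.cocycles1 S = ⊥ ∧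
      ControlGrid.gaugedCochains S T ⊔ M.cocycles1 S = M.cochains1 S :=
  removesExactly_iff hP hS (fun _ h => h.1) (mem_curlKernel_iff_cocycles1 hP hS)

theorem removesExactly_gradients_iff {T : Set M.Edge} :
    P.RemovesExactly S T (P.gradients S) ↔
      ControlGrid.gaugedCochains S T ⊓ M.coboundaries1 S = ⊥ ∧
      ControlGrid.gaugedCochains S T ⊔ M.coboundaries1 S = M.cochains1 S := by
  refine removesExactly_iff hP hS ?_ (mem_gradients_iff_coboundaries1 hP hS)
  rintro g ⟨u, hu, hg⟩
  obtain ⟨c, hc⟩ := hu.1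
  have hc' := (mem_S0_iff hP hS hc).1 hu
  exact (mem_S1_iff hP hS ((isGrad_iff hP hc' hc).1 hg)).2 (grad_mem_sideCochains1 hP hS hc')

/-- The four isomorphisms identify fields with the same coefficients; since the membership in the
spaces and the differential operators are expressed by the coefficients alone, they commute with
the operators. -/
theorem exists_isomorphisms {Q : MultiPatch M} (hQ : Q.IsConforming) :
    ∃ (I0 : P.S0 S ≃ₗ[ℝ] Q.S0 S) (I1 : P.S1 S ≃ₗ[ℝ] Q.S1 S) (I2 : P.S2 S ≃ₗ[ℝ] Q.S2 S)
      (I3 : P.S3 ≃ₗ[ℝ] Q.S3),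
      (∀ u c, P.HasCoeffs0 u.1 c → Q.HasCoeffs0 (I0 u).1 c) ∧
      (∀ u c, P.HasCoeffs1 u.1 c → Q.HasCoeffs1 (I1 u).1 c) ∧
      (∀ u c, P.HasCoeffs2 u.1 c → Q.HasCoeffs2 (I2 u).1 c) ∧
      (∀ u c, P.HasCoeffs3 u.1 c → Q.HasCoeffs3 (I3 u).1 c) ∧
      (∀ u : P.S0 S, ∃ g : P.S1 S, P.IsGrad u.1 g.1 ∧ Q.IsGrad (I0 u).1 (I1 g).1) ∧
      (∀ u : P.S1 S, ∃ w : P.S2 S, P.IsCurl u.1 w.1 ∧ Q.IsCurl (I1 u).1 (I2 w).1) ∧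
      (∀ u : P.S2 S, ∃ w : P.S3, P.IsDiv u.1 w.1 ∧ Q.IsDiv (I2 u).1 (I3 w).1) ∧
      (∀ u : P.S1 S, u.1 ∈ P.curlKernel S ↔ (I1 u).1 ∈ Q.curlKernel S) := by
  obtain ⟨Φ0, hΦ0, hR0⟩ := exists_field0 hP
  obtain ⟨Φ1, hΦ1, hR1⟩ := exists_field1 hP
  obtain ⟨Φ2, hΦ2, hR2⟩ := exists_field2 hP
  obtain ⟨Φ3, hΦ3, hR3⟩ := exists_field3 hP
  obtain ⟨Ψ0, hΨ0, hQ0⟩ := exists_field0 hQ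
  obtain ⟨Ψ1, hΨ1, hQ1⟩ := exists_field1 hQ
  obtain ⟨Ψ2, hΨ2, hQ2⟩ := exists_field2 hQ
  obtain ⟨Ψ3, hΨ3, hQ3⟩ := exists_field3 hQ
  obtain ⟨I0, hI0⟩ := exists_linearEquiv_of_linearMaps (U := P.S0 S) (U' := Q.S0 S) hΦ0 hΨ0
    (fun u hu => hu.1.imp fun c => (hR0 u c).1) (fun u hu => hu.1.imp fun c => (hQ0 u c).1)
    fun c => (mem_S0_iff hP hS ((hR0 _ c).2 rfl)).trans (mem_S0_iff hQ hS ((hQ0 _ c).2 rfl)).symm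
  obtain ⟨I1, hI1⟩ := exists_linearEquiv_of_linearMaps (U := P.S1 S) (U' := Q.S1 S) hΦ1 hΨ1
    (fun u hu => hu.1.imp fun c => (hR1 u c).1) (fun u hu => hu.1.imp fun c => (hQ1 u c).1)
    fun c => (mem_S1_iff hP hS ((hR1 _ c).2 rfl)).trans (mem_S1_iff hQ hS ((hQ1 _ c).2 rfl)).symm
  obtain ⟨I2, hI2⟩ := exists_linearEquiv_of_linearMaps (U := P.S2 S) (U' := Q.S2 S) hΦ2 hΨ2
    (fun u hu => hu.1.imp fun c => (hR2 u c).1) (fun u hu => hu.1.imp fun c => (hQ2 u c).1)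
    fun c => (mem_S2_iff hP hS ((hR2 _ c).2 rfl)).trans (mem_S2_iff hQ hS ((hQ2 _ c).2 rfl)).symm
  obtain ⟨I3, hI3⟩ := exists_linearEquiv_of_linearMaps (U := P.S3) (U' := Q.S3) hΦ3 hΨ3
    (fun u hu => hu.imp fun c => (hR3 u c).1) (fun u hu => hu.imp fun c => (hQ3 u c).1)
    fun c => ⟨fun _ => ⟨c, (hQ3 _ c).2 rfl⟩, fun _ => ⟨c, (hR3 _ c).2 rfl⟩⟩
  have h0 : ∀ u c, P.HasCoeffs0 u.1 c → Q.HasCoeffs0 (I0 u).1 c := fun u c h =>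
    (hQ0 _ c).2 (hI0 u c ((hR0 _ c).1 h))
  have h1 : ∀ u c, P.HasCoeffs1 u.1 c → Q.HasCoeffs1 (I1 u).1 c := fun u c h =>
    (hQ1 _ c).2 (hI1 u c ((hR1 _ c).1 h))
  have h2 : ∀ u c, P.HasCoeffs2 u.1 c → Q.HasCoeffs2 (I2 u).1 c := fun u c h =>
    (hQ2 _ c).2 (hI2 u c ((hR2 _ c).1 h))
  have h3 : ∀ u c, P.HasCoeffs3 u.1 c → Q.HasCoeffs3 (I3 u).1 c := fun u c h =>
    (hQ3 _ c).2 (hI3 u c ((hR3 _ c).1 h))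
  refine ⟨I0, I1, I2, I3, h0, h1, h2, h3, fun u => ?_, fun u => ?_, fun u => ?_, fun u => ?_⟩
  · obtain ⟨c, hc⟩ := u.2.1
    have hc' := (mem_S0_iff hP hS hc).1 u.2
    obtain ⟨g, hg⟩ := exists_hasCoeffs1 hP (ControlGrid.grad c)
    refine ⟨⟨g, (mem_S1_iff hP hS hg).2 (grad_mem_sideCochains1 hP hS hc')⟩,
      (isGrad_iff hP hc' hc).2 hg, (isGrad_iff hQ hc' (h0 u c hc)).2 (h1 _ _ hg)⟩
  · obtain ⟨c, hc⟩ := u.2.1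
    have hc' := (mem_S1_iff hP hS hc).1 u.2
    obtain ⟨w, hw⟩ := exists_hasCoeffs2 hP (M.circulation c)
    refine ⟨⟨w, (mem_S2_iff hP hS hw).2 (circulation_mem_sideCochains2 hP hS hc')⟩,
      (isCurl_iff hP hc' hc).2 hw, (isCurl_iff hQ hc' (h1 u c hc)).2 (h2 _ _ hw)⟩
  · obtain ⟨c, hc⟩ := u.2.1
    have hc' := (mem_S2_iff hP hS hc).1 u.2
    obtain ⟨w, hw⟩ := exists_hasCoeffs3 hP (ControlGrid.outflow c)
    exact ⟨⟨w, _, hw⟩, fun φ hφ => weakDiv_of_coeffs hP hc' hc hw φ (hφ.mono sdiff_subset),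
      fun φ hφ => weakDiv_of_coeffs hQ hc' (h2 u c hc) (h3 ⟨w, _, hw⟩ _ hw) φ
        (hφ.mono sdiff_subset)⟩
  · obtain ⟨c, hc⟩ := u.2.1
    exact (mem_curlKernel_iff hP hS hc).trans (mem_curlKernel_iff hQ hS (h1 u c hc)).symm

end MultiPatch

end

theorem mainTheorem2 {ι : Type*} [Fintype ι] (M : ControlGrid ι) (P : MultiPatch M)
    (hP : P.IsConforming) (S : Set (ι × Fin 3 × Bool)) (hS : ∀ b ∈ S, M.IsBoundarySide b) :
    -- isomorphisms onto the lowest-order spaces on the control mesh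
    (P.controlMesh.IsConforming →
      ∃ (I0 : P.S0 S ≃ₗ[ℝ] P.controlMesh.S0 S) (I1 : P.S1 S ≃ₗ[ℝ] P.controlMesh.S1 S)
        (I2 : P.S2 S ≃ₗ[ℝ] P.controlMesh.S2 S) (I3 : P.S3 ≃ₗ[ℝ] P.controlMesh.S3),
        -- basis functions are mapped to the basis functions of the same mesh entities
        (∀ u c, P.HasCoeffs0 u.1 c → P.controlMesh.HasCoeffs0 (I0 u).1 c) ∧
        (∀ u c, P.HasCoeffs1 u.1 c → P.controlMesh.HasCoeffs1 (I1 u).1 c) ∧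
        (∀ u c, P.HasCoeffs2 u.1 c → P.controlMesh.HasCoeffs2 (I2 u).1 c) ∧
        (∀ u c, P.HasCoeffs3 u.1 c → P.controlMesh.HasCoeffs3 (I3 u).1 c) ∧
        -- the isomorphisms commute with grad, curl and div
        (∀ u : P.S0 S, ∃ g : P.S1 S,
          P.IsGrad u.1 g.1 ∧ P.controlMesh.IsGrad (I0 u).1 (I1 g).1) ∧
        (∀ u : P.S1 S, ∃ w : P.S2 S,
          P.IsCurl u.1 w.1 ∧ P.controlMesh.IsCurl (I1 u).1 (I2 w).1) ∧
        (∀ u : P.S2 S, ∃ w : P.S3,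
          P.IsDiv u.1 w.1 ∧ P.controlMesh.IsDiv (I2 u).1 (I3 w).1) ∧
        -- discrete kernels correspond to each other
        (∀ u : P.S1 S, u.1 ∈ P.curlKernel S ↔ (I1 u).1 ∈ P.controlMesh.curlKernel S) ∧
        -- gauging splines is equivalent to gauging the lowest-order space
        (∀ T : Set M.Edge, P.RemovesExactly S T (P.curlKernel S) ↔
          P.controlMesh.RemovesExactly S T (P.controlMesh.curlKernel S))) ∧
    -- the degrees of freedom of the spline fields are the relative 1-cochains of the control mesh, and
    -- those of the curl-free spline fields are its relative 1-cocycles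
    (∀ c, c ∈ M.cochains1 S ↔ ∃ u ∈ P.S1 S, P.HasCoeffs1 u c) ∧
    (∀ u ∈ P.S1 S, ∀ c, P.HasCoeffs1 u c → (u ∈ P.curlKernel S ↔ c ∈ M.cocycles1 S)) ∧
    -- tree–cotree gauging of the splines on the control-mesh graph
    (IsConnected P.domain →
      (∃ T, M.IsGaugeTree S T) ∧
      ∀ T, M.IsGaugeTree S T →
        P.RemovesExactly S T (P.gradients S) ∧
        (P.RemovesExactly S T (P.curlKernel S) ↔ M.relativeBetti1 S = 0) ∧
        ∃ H : Set M.Edge, H ⊆ (T ∪ M.dirichletEdges S)ᶜ ∧ H.ncard = M.relativeBetti1 S ∧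
          P.RemovesExactly S (T ∪ H) (P.curlKernel S)) := by
  refine ⟨fun hQ => ?_, fun c => ?_, fun u _ c hc => ?_, fun hconn => ⟨?_, fun T hT => ?_⟩⟩
  · obtain ⟨I0, I1, I2, I3, h0, h1, h2, h3, hgrad, hcurl, hdiv, hker⟩ :=
      MultiPatch.exists_isomorphisms hP hS hQ
    exact ⟨I0, I1, I2, I3, h0, h1, h2, h3, hgrad, hcurl, hdiv, hker, fun T =>
      (MultiPatch.removesExactly_curlKernel_iff hP hS).trans
        (MultiPatch.removesExactly_curlKernel_iff hQ hS).symm⟩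
  · refine ⟨fun hc => ?_, fun ⟨u, hu, hc⟩ => (MultiPatch.mem_S1_iff_cochains1 hP hS hc).1 hu⟩
    obtain ⟨u, hu⟩ := MultiPatch.exists_hasCoeffs1 hP c
    exact ⟨u, (MultiPatch.mem_S1_iff_cochains1 hP hS hu).2 hc, hu⟩
  · exact MultiPatch.mem_curlKernel_iff_cocycles1 hP hS hc
  · exact ControlGrid.exists_isGaugeTree (MultiPatch.joined_of_isConnected hP hconn)
  · refine ⟨(MultiPatch.removesExactly_gradients_iff hP hS).2
      ⟨hT.gauged_inf_coboundaries, hT.gauged_sup_coboundaries⟩,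
      (MultiPatch.removesExactly_curlKernel_iff hP hS).trans hT.gauged_inf_cocycles_iff, ?_⟩
    obtain ⟨H, h1, h2, h3⟩ := hT.exists_harmonic_edges
    exact ⟨H, h1, h2, (MultiPatch.removesExactly_curlKernel_iff hP hS).2 h3⟩
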